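/- **Theorem.** The first Schönhage–Strassen algorithm SS-C can be carried out on the log-RAM with Depth-Cost so that it multiplies integers correctly in time $O(n\log\log n)$, where $n$ is the length of the input. *The machine.* A log-RAM has a finite program, registers $R_0,R_1,R_2,\dots$ holding nonnegative integers, an input register holding an $n$-bit string, and an output string. Initially $R_0=n$ and all other registers are $0$. Arguments $A,A',A''$ are nonnegative integer constants, $R_j$, or $R_{R_j}$. The instructions are: $R_i=A\ \mathrm{op}\ A'$ with $\mathrm{op}\in\{\lor,\land,\oplus,+,-,*,\div\}$ (Boolean operations act bitwise, $\div$ is integer division); $R_i=\lnot A$ (bitwise); $R_i=R_j$ with its $A'$ rightmost bits cyclically shifted by $A$ positions to the left or right; input to $R_i$ of the bits at positions $A,\dots,A'$ of the input register; appending the $A$ rightmost bits of $R_j$ to the right of the output; a jump if $A=A'$; and the vector copy of $R_A,\dots,R_{A+A''-1}$ to $R_{A'},\dots,R_{A'+A''-1}$. All values assigned to registers must be nonnegative integers of $O(\log n)$ bits, division by $0$ is not allowed, and shift amounts and the numbers of bits shifted, read, or output by one instruction must be $O(\log n)$; here the $O(\log n)$ bound is a constant, depending only on the machine, times the binary length of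 $n$. *The cost.* A vector copy costs $\max\{1,\lceil\log_2 A\rceil,\lceil\log_2 A'\rceil,A''\}$. Any other instruction costs the sum of $\max\{1,\lceil\log_2 i\rceil\}$ over the accesses to registers $R_i$ that it makes, plus the cost of the operation itself, which is $1$ for Boolean operations and $\max\{1,\lceil\log_2\lceil\log_2 n\rceil\rceil\}$ for arithmetic operations, shifts, input, output and jumps. (In these formulas $\lceil\log_2 0\rceil$ is read as $0$.) *The algorithm SS-C.* To multiply two integers $x,y$ of $m$ bits (so $n=2m$), cut them into $d=\lceil m/\ell\rceil$ pieces of length $\ell=\Theta(\log n)$, the coefficients of two polynomials, and let $N$ be the power of two with $2d\le N<4d$. Complex numbers are represented in fixed-point form with $p$ fractional bits, and each operation on them, as well as each root of unity used, is accurate up to an error of at most $2^{-q}$, where $\log n\le q\le p=O(\log n)$. Evaluate both polynomials at all powers of $e^{2\pi i/N}$ by a radix-2 FFT: in level $h=N/2,N/4,\dots,1$, within each block of $2h$ consecutive entries, replace the entries $u,v$ at positions $j$ and $j+h$ ($0\le j<h$) by $u+v$ and $(u-v)\zeta$, where $\zeta\approx e^{2\pi i j/(2h)}$. Multiply corresponding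 values. Apply the inverse FFT: in level $h=1,2,\dots,N/2$ replace $u,v$ at positions $j,j+h$ by $u+\zeta v$ and $u-\zeta v$, where $\zeta\approx e^{-2\pi i j/(2h)}$. Divide by $N$ and round the real parts to integers $z_0,\dots,z_{N-1}$. The output is the $2m$-bit binary representation of $\sum_i z_i2^{\ell i}$. *The claim.* There are a log-RAM $M$ and constants $c, C$ such that for every $m\ge1$ there are parameters $\ell,N,p,q$ as above (with all implied constants bounded by means of $c$) for which, for all integers $0\le x,y<2^m$, the following holds. Started on the $2m$-bit input made up of $x$ and $y$, the machine $M$ executes only allowed instructions and halts; its computation carries out SS-C on $x,y$, i.e. the vectors after each level of the two FFTs, the vector of products, the vectors after each level of the inverse FFT, and the vector of rounded coefficients of an execution of SS-C appear in the registers in this order (the two forward FFTs may be interleaved; complex entries take four consecutive registers, real and imaginary parts being differences of two registers in units of $2^{-p}$); its output is the $2m$-bit binary representation of $xy$; and, if $m\ge2$, the total cost of the computation is at most $C\,n\log\log n$ with $n=2m$. -/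

import Mathlib

namespace DepthCostRAM

/-! ### The machine model: the log-RAM with Depth-Cost -/

/-- Arguments of instructions: a constant, `R_j`, or `R_{R_j}`. -/
inductive Arg where
  | const (v : ℕ)
  | reg (j : ℕ)
  | ind (j : ℕ)

/-- Binary operations. Boolean ones act on binary representations bit by bit. -/
inductive BinOp where
  | or | and | xor | add | sub | mul | div

/-- Instructions. -/
inductive Instr where
  /-- `R_i = A op A'` -/
  | bin (i : ℕ) (op : BinOp) (A A' : Arg)
  /-- `R_i = ¬ A` (bitwise) -/
  | neg (i : ℕ) (A : Arg)
  /-- `R_i = R_j` with its `A'` rightmost bits cyclically shifted to the left by `A` positions -/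
  | shiftLeft (i j : ℕ) (A A' : Arg)
  /-- `R_i = R_j` with its `A'` rightmost bits cyclically shifted to the right by `A` positions -/
  | shiftRight (i j : ℕ) (A A' : Arg)
  /-- read into `R_i` the bits from position `A` to position `A'` of the input register -/
  | input (i : ℕ) (A A' : Arg)
  /-- append the `A` rightmost bits of `R_j` to the right of the output -/
  | output (j : ℕ) (A : Arg)
  /-- jump to the given program line if `A = A'` -/
  | jump (A A' : Arg) (target : ℕ)
  /-- vector copy: `R_A, …, R_{A+A''-1}` is copied to `R_{A'}, …, R_{A'+A''-1}` -/
  | copy (A A' A'' : Arg)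

/-- A configuration: program counter, registers, and the output written so far. -/
structure Config where
  pc : ℕ
  mem : ℕ → ℕ
  out : List Bool

/-- The value of an argument. -/
def Arg.eval (mem : ℕ → ℕ) : Arg → ℕ
  | .const v => v
  | .reg j => mem j
  | .ind j => mem (mem j)

/-- The result of a binary operation. Registers hold nonnegative integers only, so a negative
difference and a division by zero are illegal (`none`). -/
def BinOp.eval : BinOp → ℕ → ℕ → Option ℕ
  | .or, a, b => some (a ||| b)
  | .and, a, b => some (a &&& b)
  | .xor, a, b => some (a ^^^ b)
  | .add, a, b => some (a + b)
  | .sub, a, b => if b ≤ a then some (a - b) else none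
  | .mul, a, b => some (a * b)
  | .div, a, b => if b = 0 then none else some (a / b)

/-- Cyclic left shift by `s` positions of the `len` rightmost bits of `v`. -/
def rotLeft (v s len : ℕ) : ℕ :=
  v / 2 ^ len * 2 ^ len +
    (v % 2 ^ len * 2 ^ (s % len) % 2 ^ len + v % 2 ^ len / 2 ^ (len - s % len))

/-- Cyclic right shift by `s` positions of the `len` rightmost bits of `v`. -/
def rotRight (v s len : ℕ) : ℕ := rotLeft v (len - s % len) len

/-- The `len` rightmost bits of `v`, the most significant one first. -/
def bits (len v : ℕ) : List Bool := (List.range len).map fun i => v.testBit (len - 1 - i)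

/-- `R_i = v`, followed by passing to the next program line; only values of at most `w` bits may be
assigned to a register. -/
def assign (w : ℕ) (s : Config) (i v : ℕ) : Option Config :=
  if v < 2 ^ w then some { s with pc := s.pc + 1, mem := Function.update s.mem i v } else none

/-- Effect of one instruction on a machine of word length `w` whose input register holds the
`n`-bit number `inp` (position `i` of the input register is the bit of weight `2 ^ i`).
`none` means that the instruction is illegal. -/
def exec (w n inp : ℕ) (s : Config) : Instr → Option Config
  | .bin i op A A' => (op.eval (A.eval s.mem) (A'.eval s.mem)).bind (assign w s i)
  | .neg i A => assign w s i (2 ^ w - 1 - A.eval s.mem % 2 ^ w)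
  | .shiftLeft i j A A' =>
      if A.eval s.mem ≤ w ∧ A'.eval s.mem ≤ w then
        assign w s i (rotLeft (s.mem j) (A.eval s.mem) (A'.eval s.mem)) else none
  | .shiftRight i j A A' =>
      if A.eval s.mem ≤ w ∧ A'.eval s.mem ≤ w then
        assign w s i (rotRight (s.mem j) (A.eval s.mem) (A'.eval s.mem)) else none
  | .input i A A' =>
      if A.eval s.mem ≤ A'.eval s.mem ∧ A'.eval s.mem < n ∧
          A'.eval s.mem + 1 - A.eval s.mem ≤ w then
        assign w s i (inp / 2 ^ A.eval s.mem % 2 ^ (A'.eval s.mem + 1 - A.eval s.mem)) else none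
  | .output j A =>
      if A.eval s.mem ≤ w then
        some { s with pc := s.pc + 1, out := s.out ++ bits (A.eval s.mem) (s.mem j) } else none
  | .jump A A' target =>
      some { s with pc := if A.eval s.mem = A'.eval s.mem then target else s.pc + 1 }
  | .copy A A' A'' =>
      some { s with
        pc := s.pc + 1
        mem := fun r =>
          if A'.eval s.mem ≤ r ∧ r < A'.eval s.mem + A''.eval s.mem then
            s.mem (A.eval s.mem + (r - A'.eval s.mem)) else s.mem r }

/-- The cost `max {1, log i}` of accessing `R_i`. -/
def accessCost (i : ℕ) : ℕ := max 1 (Nat.clog 2 i)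

/-- The cost of the register accesses made in evaluating an argument. -/
def Arg.cost (mem : ℕ → ℕ) : Arg → ℕ
  | .const _ => 0
  | .reg j => accessCost j
  | .ind j => accessCost j + accessCost (mem j)

/-- The cost, of order `log log n`, of arithmetic operations, shifts, comparisons, input and
output of words of length `O(log n)`. -/
def wordCost (n : ℕ) : ℕ := max 1 (Nat.clog 2 (Nat.clog 2 n))

/-- The cost of a binary operation itself. -/
def BinOp.cost (n : ℕ) : BinOp → ℕ
  | .or | .and | .xor => 1
  | .add | .sub | .mul | .div => wordCost n

/-- The depth-cost of an instruction: register accesses plus the operation itself. -/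
def Instr.cost (n : ℕ) (mem : ℕ → ℕ) : Instr → ℕ
  | .bin i op A A' => accessCost i + A.cost mem + A'.cost mem + op.cost n
  | .neg i A => accessCost i + A.cost mem + 1
  | .shiftLeft i j A A' => accessCost i + accessCost j + A.cost mem + A'.cost mem + wordCost n
  | .shiftRight i j A A' => accessCost i + accessCost j + A.cost mem + A'.cost mem + wordCost n
  | .input i A A' => accessCost i + A.cost mem + A'.cost mem + wordCost n
  | .output j A => accessCost j + A.cost mem + wordCost n
  | .jump A A' _ => A.cost mem + A'.cost mem + wordCost n
  | .copy A A' A'' =>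
      max 1 (max (max (Nat.clog 2 (A.eval mem)) (Nat.clog 2 (A'.eval mem))) (A''.eval mem))

/-- A log-RAM: a finite program together with the constant of the `O(log n)` bound on the length
of its registers. -/
structure Machine where
  prog : List Instr
  wordConst : ℕ

namespace Machine

variable (M : Machine)

/-- The number of bits of a register for inputs of length `n`; `Nat.size n` is the length of the
binary representation of `n`. -/
def wordLen (n : ℕ) : ℕ := M.wordConst * Nat.size n

/-- The configuration after `t` steps on the `n`-bit input `inp`; `none` if an illegal instruction
was met or the machine stopped earlier. At the start `R_0` holds `n`, all other registers `0`. -/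
def configAt (n inp : ℕ) : ℕ → Option Config
  | 0 => some { pc := 0, mem := Function.update (fun _ => 0) 0 n, out := [] }
  | t + 1 => (configAt n inp t).bind fun s => (M.prog[s.pc]?).bind (exec (M.wordLen n) n inp s)

/-- The cost of step number `t`. -/
def stepCost (n inp t : ℕ) : ℕ :=
  match M.configAt n inp t with
  | none => 0
  | some s =>
    match M.prog[s.pc]? with
    | none => 0
    | some I => I.cost n s.mem

/-- The depth-cost of the first `T` steps. -/
def cost (n inp T : ℕ) : ℕ := ∑ t ∈ Finset.range T, M.stepCost n inp t

/-- After `T` legal steps the machine stops, by having left the program, with output `o`. -/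
def HaltsWith (n inp T : ℕ) (o : List Bool) : Prop :=
  ∃ s, M.configAt n inp T = some s ∧ M.prog.length ≤ s.pc ∧ s.out = o

end Machine

/-! ### The algorithm SS-C -/

/-- Parameters of SS-C: the factors are cut into pieces of `pieceLen` bits, the Fourier transforms
have `2 ^ levels` points, complex numbers are stored in fixed-point form with `fracBits` fractional
bits, and every operation on them is accurate up to `2 ^ (-accBits)`. -/
structure Params where
  pieceLen : ℕ
  levels : ℕ
  fracBits : ℕ
  accBits : ℕ

namespace Params

variable (P : Params)

/-- The number of points of the Fourier transforms. -/
def points : ℕ := 2 ^ P.levels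

/-- The admissible error of a single operation. -/
noncomputable def err : ℝ := (1 / 2) ^ P.accBits

/-- The requirements on the parameters for factors of `m` bits (input length `2 * m`): piece length
and precision are of order `log n`, and the number of points is the least power of two that is at
least twice the number of pieces. -/
structure Admissible (c m : ℕ) : Prop where
  piece_lower : Nat.size (2 * m) ≤ c * P.pieceLen
  piece_upper : P.pieceLen ≤ c * Nat.size (2 * m)
  points_lower : 2 * (m ⌈/⌉ P.pieceLen) ≤ P.points
  points_upper : P.points < 4 * (m ⌈/⌉ P.pieceLen)
  acc_lower : Nat.size (2 * m) ≤ P.accBits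
  acc_upper : P.accBits ≤ P.fracBits
  frac_upper : P.fracBits ≤ c * Nat.size (2 * m)

/-- `ζ` is a fixed-point approximation of the root of unity `exp (2 π i j / B)`. -/
def ApproxRoot (ζ : ℂ) (j : ℤ) (B : ℕ) : Prop :=
  (∃ a b : ℤ, ζ = ⟨(a : ℝ) / 2 ^ P.fracBits, (b : ℝ) / 2 ^ P.fracBits⟩) ∧
    ‖ζ - Complex.exp (2 * Real.pi * Complex.I * ((j : ℂ) / (B : ℂ)))‖ ≤ P.err

/-- `a'` arises from `a` by one level of the FFT: in every block of `2 * h` consecutive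
entries, `(u, v)` at distance `h` is replaced by `(u + v, (u - v) ζ)`. Performing this
for `h = 2 ^ (levels - 1), …, 2, 1` evaluates the polynomial with coefficients `a` at all powers of
the root of unity `exp (2 π i / points)` (in bit-reversed order). -/
def ForwardLevel (h : ℕ) (a a' : ℕ → ℂ) : Prop :=
  ∀ b j : ℕ, 2 * h * (b + 1) ≤ P.points → j < h →
    ∃ ζ : ℂ, P.ApproxRoot ζ j (2 * h) ∧
      ‖a' (2 * h * b + j) - (a (2 * h * b + j) + a (2 * h * b + h + j))‖ ≤ P.err ∧
      ‖a' (2 * h * b + h + j) - (a (2 * h * b + j) - a (2 * h * b + h + j)) * ζ‖ ≤ P.err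

/-- `a'` arises from `a` by one level of the inverse FFT: in every block of `2 * h` consecutive
entries, `(u, v)` at distance `h` is replaced by `(u + ζ v, u - ζ v)`. Performing
this for `h = 1, 2, …, 2 ^ (levels - 1)` inverts the forward transform up to the factor `points`. -/
def InverseLevel (h : ℕ) (a a' : ℕ → ℂ) : Prop :=
  ∀ b j : ℕ, 2 * h * (b + 1) ≤ P.points → j < h →
    ∃ ζ : ℂ, P.ApproxRoot ζ (-(j : ℤ)) (2 * h) ∧
      ‖a' (2 * h * b + j) - (a (2 * h * b + j) + ζ * a (2 * h * b + h + j))‖ ≤ P.err ∧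
      ‖a' (2 * h * b + h + j) - (a (2 * h * b + j) - ζ * a (2 * h * b + h + j))‖ ≤ P.err

end Params

/-- The data produced by SS-C: the vectors after each level of the FFTs of the two factors, the
vectors after each level of the inverse FFT, and the coefficients of the product polynomial. -/
structure SSCData where
  F : ℕ → ℕ → ℂ
  G : ℕ → ℕ → ℂ
  H : ℕ → ℕ → ℂ
  z : ℕ → ℕ

/-- `D` is the data of an execution of SS-C with parameters `P` on the factors `x` and `y`: the
pieces of the factors are transformed level by level, corresponding values are multiplied, the
products are transformed back, divided by the number of points, and rounded to integers. -/
structure IsSSC (P : Params) (x y : ℕ) (D : SSCData) : Prop where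
  pieces_x : ∀ i < P.points, D.F 0 i = ((x / 2 ^ (P.pieceLen * i) % 2 ^ P.pieceLen : ℕ) : ℂ)
  pieces_y : ∀ i < P.points, D.G 0 i = ((y / 2 ^ (P.pieceLen * i) % 2 ^ P.pieceLen : ℕ) : ℂ)
  fft_x : ∀ s < P.levels, P.ForwardLevel (2 ^ (P.levels - 1 - s)) (D.F s) (D.F (s + 1))
  fft_y : ∀ s < P.levels, P.ForwardLevel (2 ^ (P.levels - 1 - s)) (D.G s) (D.G (s + 1))
  mul_values : ∀ i < P.points, ‖D.H 0 i - D.F P.levels i * D.G P.levels i‖ ≤ P.err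
  inverse_fft : ∀ s < P.levels, P.InverseLevel (2 ^ s) (D.H s) (D.H (s + 1))
  rounding : ∀ i < P.points, |(D.z i : ℝ) - (D.H P.levels i).re / P.points| ≤ 1 / 2

/-- Somewhere in memory the vector `v 0, …, v (points - 1)` of complex numbers is stored,
four consecutive registers per entry: real and imaginary part are given, in units of
`2 ^ (-fracBits)`, as differences of two registers each. -/
def StoresComplex (P : Params) (mem : ℕ → ℕ) (v : ℕ → ℂ) : Prop :=
  ∃ base : ℕ, ∀ i < P.points,
    v i = ⟨((mem (base + 4 * i) : ℝ) - (mem (base + 4 * i + 1) : ℝ)) / 2 ^ P.fracBits,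
      ((mem (base + 4 * i + 2) : ℝ) - (mem (base + 4 * i + 3) : ℝ)) / 2 ^ P.fracBits⟩

/-- Somewhere in memory the vector `v 0, …, v (points - 1)` of natural numbers is stored. -/
def StoresNat (P : Params) (mem : ℕ → ℕ) (v : ℕ → ℕ) : Prop :=
  ∃ base : ℕ, ∀ i < P.points, v i = mem (base + i)

/-- The input for the multiplication of the `m`-bit numbers `x` and `y`: the `2 * m`-bit string in
which `x` occupies the positions below `m` and `y` the remaining ones. -/
def inputOf (m x y : ℕ) : ℕ := x + 2 ^ m * y

/-- The first `T` steps of the machine on the factors `x`, `y` of `m` bits carry out SS-C with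
parameters `P`: there is an execution of SS-C on `x`, `y` whose successive vectors all appear in
memory, in the order prescribed by the algorithm, and at time `T` the output is the `2 * m`-bit
number obtained from the rounded coefficients by evaluation at `2 ^ pieceLen`. -/
def Machine.CarriesOutSSC (M : Machine) (P : Params) (m x y T : ℕ) : Prop :=
  ∃ D : SSCData, IsSSC P x y D ∧
    ∃ (tF tG tH : ℕ → ℕ) (tz : ℕ),
      Monotone tF ∧ Monotone tG ∧ Monotone tH ∧
      tF P.levels ≤ tH 0 ∧ tG P.levels ≤ tH 0 ∧ tH P.levels ≤ tz ∧ tz ≤ T ∧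
      (∀ s ≤ P.levels, ∃ σ, M.configAt (2 * m) (inputOf m x y) (tF s) = some σ ∧
        StoresComplex P σ.mem (D.F s)) ∧
      (∀ s ≤ P.levels, ∃ σ, M.configAt (2 * m) (inputOf m x y) (tG s) = some σ ∧
        StoresComplex P σ.mem (D.G s)) ∧
      (∀ s ≤ P.levels, ∃ σ, M.configAt (2 * m) (inputOf m x y) (tH s) = some σ ∧
        StoresComplex P σ.mem (D.H s)) ∧
      (∃ σ, M.configAt (2 * m) (inputOf m x y) tz = some σ ∧ StoresNat P σ.mem D.z) ∧
      M.HaltsWith (2 * m) (inputOf m x y) T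
        (bits (2 * m) (∑ i ∈ Finset.range P.points, D.z i * 2 ^ (P.pieceLen * i)))

end DepthCostRAM

/-! Let S be the binary length of n. Pieces have S bits, so N·S = O(n). There are fewer than S
levels, hence O(n) butterflies altogether, and the bound O(n log log n) leaves O(log log n) for
each. Moving a single entry of the data vector already costs of order log n, because its address has
that length. The vector copy resolves this: its address cost and its length cost enter as a maximum,
so a vector of about log n registers is moved for the price of one long address.

The chunk size B is the least power of two that is at least S, or N/2 if that is smaller. B
consecutive butterflies of a level touch exactly two vectors of B entries each
(`place_upper_and_lower`, `bfly_place`, `exists_place`). These are copied to the registers from 128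
on, processed there, and copied back. Since the near area has O(log n) registers, its addresses have
O(log log n) bits, and a butterfly costs O(log log n) (`bflyCmd_runs`, `chunkCmd_runs`,
`levelCmd_runs`). Work outside the levels handles each of O(N) entries once at cost O(S), or
computes parameters at cost O(S² log log n); both are within the bound.
`Setting.Computed.totalCost_le` adds this up.

No table of roots is stored. One root of order 2N is computed by the half-angle formula with integer
square roots. The root of a level arises from it by repeated squaring, and the twiddle factors are
its successive powers. With V = 2^S the fixed-point unit is V^(-16) and the admitted error is
V^(-9). Squaring multiplies the error by at most 4, so S squarings cost a factor V², and powering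
costs another factor N ≤ V (`zsq_spec`, `zpow_spec`, `Setting.power_close`).

For correctness, a forward level is read as reduction of each block polynomial modulo X^h - 1 and
X^h + 1, and an inverse level undoes this up to a factor 2. Hence after all levels the inverse
transform of the products has, at every N-th root of unity, N times the value of the product
polynomial (`blockEval_exactInvs`), and interpolation identifies the coefficients
(`exactInvs_eq_coeff`). This treats all blocks at once and never mentions bit reversal. The
accumulated error is at most N·17/64 (`norm_sub_prodCoeff_le`), so division by N and rounding give
the exact coefficients, and the carries then give the bits of xy.

The program is structured code compiled to jumps. Registers below 64 are variables, 64 to 127 are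
scratch for expressions, and everything above is reached by vector copies only. Word lengths are
verified by a static check in units of S (`Block.chk`) that `decide` evaluates. `multiplier_run`
describes the machine in terms of natural numbers alone, the analysis supplies its hypotheses, and
`Setting.multiplier_spec` joins the two. -/

namespace DepthCostRAM

/-! ### Runs of a machine -/

/-- Memory and output of a configuration. -/
structure St where
  mem : ℕ → ℕ
  out : List Bool

/-- The configuration with the given program counter. -/
def St.withPc (s : St) (pc : ℕ) : Config := ⟨pc, s.mem, s.out⟩

namespace Machine

/-- `Reach M n inp σ σ' t k`: from `σ` the machine gets to `σ'` in `t` steps of total cost `k`. -/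
inductive Reach (M : Machine) (n inp : ℕ) : Config → Config → ℕ → ℕ → Prop
  | refl (σ : Config) : Reach M n inp σ σ 0 0
  | head {σ σ' σ'' : Config} {I : Instr} {t k : ℕ} (hI : M.prog[σ.pc]? = some I)
      (hs : exec (M.wordLen n) n inp σ I = some σ') (hr : Reach M n inp σ' σ'' t k) :
      Reach M n inp σ σ'' (t + 1) (I.cost n σ.mem + k)

variable {M : Machine} {n inp : ℕ}

theorem Reach.trans {a b c : Config} {t k t' k' : ℕ} (h : M.Reach n inp a b t k)
    (h' : M.Reach n inp b c t' k') : M.Reach n inp a c (t + t') (k + k') := by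
  induction h with
  | refl σ => simpa using h'
  | head hI hs _ ih =>
    have := Reach.head hI hs (ih h')
    convert this using 1 <;> ring

theorem Reach.single {σ σ' : Config} {I : Instr} (hI : M.prog[σ.pc]? = some I)
    (hs : exec (M.wordLen n) n inp σ I = some σ') :
    M.Reach n inp σ σ' 1 (I.cost n σ.mem) := by
  simpa using Reach.head hI hs (Reach.refl σ')

/-- Bridge from the relational description to the step-indexed run and its cost. The start time is
universally quantified because the induction peels off the first step. -/
theorem Reach.configAt {a b : Config} {t k : ℕ} (h : M.Reach n inp a b t k) :
    ∀ t₀ : ℕ, M.configAt n inp t₀ = some a →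
      M.configAt n inp (t₀ + t) = some b ∧ M.cost n inp (t₀ + t) = M.cost n inp t₀ + k := by
  induction h with
  | refl σ => intro t₀ h; exact ⟨h, rfl⟩
  | @head σ σ' σ'' I t k hI hs _ ih =>
    intro t₀ h0
    have h1 : M.configAt n inp (t₀ + 1) = some σ' := by
      simp [Machine.configAt, h0, hI, hs]
    have hc : M.cost n inp (t₀ + 1) = M.cost n inp t₀ + I.cost n σ.mem := by
      simp [Machine.cost, Finset.sum_range_succ, Machine.stepCost, h0, hI]
    obtain ⟨h2, h3⟩ := ih (t₀ + 1) h1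
    refine ⟨by rw [← h2]; congr 1; ring, ?_⟩
    rw [show t₀ + (t + 1) = t₀ + 1 + t by ring, h3, hc]
    ring

end Machine

/-! ### Structured programs -/

/-- Structured programs: straight-line code, composition, and the loop that runs as long as the
two arguments differ. -/
inductive Cmd where
  | blk (l : List Instr)
  | seq (c c' : Cmd)
  | loop (A A' : Arg) (c : Cmd)

namespace Cmd

/-- The number of instructions of the compiled program. -/
def len : Cmd → ℕ
  | blk l => l.length
  | seq c c' => c.len + c'.len
  | loop _ _ c => c.len + 2

/-- Compilation to code that starts at line `pc`. -/
def compile : Cmd → ℕ → List Instr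
  | blk l, _ => l
  | seq c c', pc => c.compile pc ++ c'.compile (pc + c.len)
  | loop A A' c, pc =>
      .jump A A' (pc + c.len + 2) :: (c.compile (pc + 1) ++ [.jump (.const 0) (.const 0) pc])

theorem length_compile (c : Cmd) (pc : ℕ) : (c.compile pc).length = c.len := by
  induction c generalizing pc <;> simp [compile, len, *]

/-- The code of `c` stands at line `pc` of the program of `M`. -/
def Placed (M : Machine) (c : Cmd) (pc : ℕ) : Prop :=
  ∃ pre suf, M.prog = pre ++ (c.compile pc ++ suf) ∧ pre.length = pc

variable {M : Machine} {c c' : Cmd} {pc : ℕ}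

theorem Placed.seq_left (h : Placed M (seq c c') pc) : Placed M c pc := by
  obtain ⟨pre, suf, h, hl⟩ := h
  exact ⟨pre, c'.compile (pc + c.len) ++ suf, by simp [h, compile], hl⟩

theorem Placed.seq_right (h : Placed M (seq c c') pc) : Placed M c' (pc + c.len) := by
  obtain ⟨pre, suf, h, hl⟩ := h
  exact ⟨pre ++ c.compile pc, suf, by simp [h, compile], by simp [hl, length_compile]⟩

theorem Placed.loop_body {A A' : Arg} (h : Placed M (loop A A' c) pc) :
    Placed M c (pc + 1) := by
  obtain ⟨pre, suf, h, hl⟩ := h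
  exact ⟨pre ++ [.jump A A' (pc + c.len + 2)], .jump (.const 0) (.const 0) pc :: suf,
    by simp [h, compile], by simp [hl]⟩

theorem Placed.loop_head {A A' : Arg} (h : Placed M (loop A A' c) pc) :
    M.prog[pc]? = some (.jump A A' (pc + c.len + 2)) := by
  obtain ⟨pre, suf, h, hl⟩ := h
  simp [h, compile, ← hl]

theorem Placed.loop_back {A A' : Arg} (h : Placed M (loop A A' c) pc) :
    M.prog[pc + 1 + c.len]? = some (.jump (.const 0) (.const 0) pc) := by
  obtain ⟨pre, suf, h, hl⟩ := h
  have : M.prog = (pre ++ .jump A A' (pc + c.len + 2) :: c.compile (pc + 1)) ++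
      .jump (.const 0) (.const 0) pc :: suf := by simp [h, compile]
  rw [this, List.getElem?_append_right (by simp [length_compile, hl]; omega)]
  simp [length_compile, hl, Nat.add_assoc, Nat.add_comm]

end Cmd

/-- From state `s`, the code of `c` gets to state `s'` at cost at most `K`, on every machine of
word length `w` and input length `n`, and wherever the code stands in the program. -/
def Raw (w n inp : ℕ) (c : Cmd) (s s' : St) (K : ℕ) : Prop :=
  ∀ (M : Machine) (pc : ℕ), M.wordLen n = w → c.Placed M pc →
    ∃ t k, k ≤ K ∧ M.Reach n inp (s.withPc pc) (s'.withPc (pc + c.len)) t k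

variable {w n inp : ℕ}

theorem Raw.mono {c : Cmd} {s s' : St} {K K' : ℕ} (h : Raw w n inp c s s' K) (hK : K ≤ K') :
    Raw w n inp c s s' K' := fun M pc hw hp =>
  let ⟨t, k, hk, hr⟩ := h M pc hw hp
  ⟨t, k, hk.trans hK, hr⟩

theorem Raw.seq {c c' : Cmd} {s s' s'' : St} {K K' : ℕ} (h : Raw w n inp c s s' K)
    (h' : Raw w n inp c' s' s'' K') : Raw w n inp (c.seq c') s s'' (K + K') := by
  intro M pc hw hp
  obtain ⟨t, k, hk, hr⟩ := h M pc hw hp.seq_left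
  obtain ⟨t', k', hk', hr'⟩ := h' M _ hw hp.seq_right
  refine ⟨t + t', k + k', by omega, ?_⟩
  have := hr.trans hr'
  rwa [show pc + c.len + c'.len = pc + (c.seq c').len by simp [Cmd.len, Nat.add_assoc]] at this

/-- The composition of two straight-line blocks compiles to the code of the concatenated block, so
both are placed by the same hypothesis, up to definitional unfolding. -/
theorem Raw.append {l l' : List Instr} {s s' s'' : St} {K K' : ℕ}
    (h : Raw w n inp (.blk l) s s' K) (h' : Raw w n inp (.blk l') s' s'' K') :
    Raw w n inp (.blk (l ++ l')) s s'' (K + K') := by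
  intro M pc hw hp
  have hp' : (Cmd.seq (.blk l) (.blk l')).Placed M pc := hp
  simpa [Cmd.len] using (h.seq h') M pc hw hp'

theorem Raw.nil (s : St) : Raw w n inp (.blk []) s s 0 :=
  fun _ _ _ _ => ⟨0, 0, le_rfl, .refl _⟩

theorem Raw.instr {I : Instr} {s s' : St} {K : ℕ}
    (h : ∀ pc, exec w n inp (s.withPc pc) I = some (s'.withPc (pc + 1)))
    (hK : I.cost n s.mem ≤ K) : Raw w n inp (.blk [I]) s s' K := by
  rintro M pc hw ⟨pre, suf, hM, hl⟩
  refine ⟨1, _, hK, Machine.Reach.single (I := I) ?_ ?_⟩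
  · simp [hM, Cmd.compile, St.withPc, ← hl]
  · rw [hw, h]; simp [Cmd.len]

theorem Raw.loop_exit {A A' : Arg} {c : Cmd} {s : St} (h : A.eval s.mem = A'.eval s.mem) :
    Raw w n inp (.loop A A' c) s s (A.cost s.mem + A'.cost s.mem + wordCost n) := by
  intro M pc hw hp
  refine ⟨1, _, le_rfl, Machine.Reach.single (I := .jump A A' (pc + c.len + 2)) ?_ ?_⟩
  · exact hp.loop_head
  · simp [exec, St.withPc, h, Cmd.len, Nat.add_assoc]

/-- One full iteration that returns to the loop head. It is kept apart from `Raw.loop_step` because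
the statement on vectors after each level needs the configurations at the head of a running loop,
not only the final one. -/
theorem Machine.Reach.loop_step {M : Machine} {A A' : Arg} {c : Cmd} {s s' : St} {pc K : ℕ}
    (hw : M.wordLen n = w) (hp : (Cmd.loop A A' c).Placed M pc)
    (h : A.eval s.mem ≠ A'.eval s.mem) (hc : Raw w n inp c s s' K) :
    ∃ t k, k ≤ A.cost s.mem + A'.cost s.mem + 2 * wordCost n + K ∧
      M.Reach n inp (s.withPc pc) (s'.withPc pc) t k := by
  obtain ⟨t, k, hk, hr⟩ := hc M (pc + 1) hw hp.loop_body
  have h1 : M.Reach n inp (s.withPc pc) (s.withPc (pc + 1)) 1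
      (A.cost s.mem + A'.cost s.mem + wordCost n) :=
    Machine.Reach.single (I := .jump A A' (pc + c.len + 2)) hp.loop_head
      (by simp [exec, St.withPc, h])
  have h2 : M.Reach n inp (s'.withPc (pc + 1 + c.len)) (s'.withPc pc) 1 (0 + 0 + wordCost n) :=
    Machine.Reach.single (I := .jump (.const 0) (.const 0) pc) hp.loop_back
      (by simp [exec, St.withPc, Arg.eval])
  exact ⟨_, _, by omega, (h1.trans hr).trans h2⟩

theorem Raw.loop_step {A A' : Arg} {c : Cmd} {s s' s'' : St} {K K' : ℕ}
    (h : A.eval s.mem ≠ A'.eval s.mem) (hc : Raw w n inp c s s' K)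
    (hl : Raw w n inp (.loop A A' c) s' s'' K') :
    Raw w n inp (.loop A A' c) s s''
      (A.cost s.mem + A'.cost s.mem + 2 * wordCost n + K + K') := by
  intro M pc hw hp
  obtain ⟨t, k, hk, hr⟩ := Machine.Reach.loop_step hw hp h hc
  obtain ⟨t', k', hk', hr'⟩ := hl M pc hw hp
  exact ⟨_, _, by omega, hr.trans hr'⟩

/-! ### Runs up to scratch registers -/

/-- Agreement of two memories outside the scratch registers `R_64, …, R_127`. -/
def Sim (m m' : ℕ → ℕ) : Prop := ∀ i, i < 64 ∨ 128 ≤ i → m i = m' i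

theorem Sim.refl (m : ℕ → ℕ) : Sim m m := fun _ _ => rfl

/-- As `Raw`, but up to the contents of the scratch registers. -/
def Runs (w n inp : ℕ) (c : Cmd) (s s' : St) (K : ℕ) : Prop :=
  ∀ m, Sim m s.mem → ∃ m', Sim m' s'.mem ∧ Raw w n inp c ⟨m, s.out⟩ ⟨m', s'.out⟩ K

theorem Runs.mono {c : Cmd} {s s' : St} {K K' : ℕ} (h : Runs w n inp c s s' K) (hK : K ≤ K') :
    Runs w n inp c s s' K' := fun m hm =>
  let ⟨m', hm', hr⟩ := h m hm
  ⟨m', hm', hr.mono hK⟩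

theorem Runs.seq {c c' : Cmd} {s s' s'' : St} {K K' : ℕ} (h : Runs w n inp c s s' K)
    (h' : Runs w n inp c' s' s'' K') : Runs w n inp (c.seq c') s s'' (K + K') := by
  intro m hm
  obtain ⟨m', hm', hr⟩ := h m hm
  obtain ⟨m'', hm'', hr'⟩ := h' m' hm'
  exact ⟨m'', hm'', hr.seq hr'⟩

/-- Arguments that refer directly to registers below 64. -/
def Arg.Low : Arg → Prop
  | .const _ => True
  | .reg j => j < 64
  | .ind _ => False

theorem Arg.Low.eval_eq {A : Arg} (hA : A.Low) {m m' : ℕ → ℕ} (h : Sim m m') :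
    A.eval m = A.eval m' := by
  cases A with
  | const v => rfl
  | reg j => exact h j (Or.inl hA)
  | ind j => exact hA.elim

theorem accessCost_low {i : ℕ} (h : i < 128) : accessCost i ≤ 7 := by
  unfold accessCost
  have : Nat.clog 2 i ≤ 7 := Nat.clog_le_of_le_pow (by norm_num; omega)
  omega

theorem Arg.Low.cost_le {A : Arg} (hA : A.Low) (m : ℕ → ℕ) : A.cost m ≤ 7 := by
  cases A with
  | const v => simp [Arg.cost]
  | reg j => exact accessCost_low (lt_trans hA (by norm_num))
  | ind j => exact hA.elim

theorem wordCost_pos (n : ℕ) : 1 ≤ wordCost n := le_max_left _ _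

/-- Per iteration two jumps and the evaluation of two direct arguments, each of cost at most 7, are
charged: 2 + 14 units of `wordCost n`, as `wordCost n ≥ 1`. The last test uses a single jump, hence
15. -/
theorem Runs.loop {A A' : Arg} (hA : A.Low) (hA' : A'.Low) {c : Cmd} (Inv : ℕ → St → Prop)
    {T K : ℕ}
    (hbody : ∀ i < T, ∀ s, Inv i s → A.eval s.mem ≠ A'.eval s.mem ∧
      ∃ s', Inv (i + 1) s' ∧ Runs w n inp c s s' K)
    (hend : ∀ s, Inv T s → A.eval s.mem = A'.eval s.mem) {s : St} (h0 : Inv 0 s) :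
    ∃ s', Inv T s' ∧
      Runs w n inp (.loop A A' c) s s' (T * (K + 16 * wordCost n) + 15 * wordCost n) := by
  have hW := wordCost_pos n
  -- Here j counts the iterations still to come, so the induction runs backwards from the exit of
  -- the loop.
  have key : ∀ j ≤ T, ∀ s, Inv (T - j) s → ∃ s', Inv T s' ∧
      Runs w n inp (.loop A A' c) s s' (j * (K + 16 * wordCost n) + 15 * wordCost n) := by
    intro j
    induction j with
    | zero =>
      intro _ s hs
      refine ⟨s, hs, fun m hm => ⟨m, hm, Raw.mono (Raw.loop_exit ?_) ?_⟩⟩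
      · simpa [hA.eval_eq hm, hA'.eval_eq hm] using hend s hs
      · have := hA.cost_le m
        have := hA'.cost_le m
        simp only
        omega
    | succ j ih =>
      intro hj s hs
      obtain ⟨hne, s1, hs1, hr1⟩ := hbody (T - (j + 1)) (by omega) s hs
      rw [show T - (j + 1) + 1 = T - j by omega] at hs1
      obtain ⟨s2, hs2, hr2⟩ := ih (by omega) s1 hs1
      refine ⟨s2, hs2, fun m hm => ?_⟩
      obtain ⟨m1, hm1, h1⟩ := hr1 m hm
      obtain ⟨m2, hm2, h2⟩ := hr2 m1 hm1
      refine ⟨m2, hm2, Raw.mono (Raw.loop_step ?_ h1 h2) ?_⟩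
      · simpa [hA.eval_eq hm, hA'.eval_eq hm] using hne
      · have := hA.cost_le m
        have := hA'.cost_le m
        have e : (j + 1) * (K + 16 * wordCost n) =
          j * (K + 16 * wordCost n) + (K + 16 * wordCost n) := by ring
        simp only [e]
        omega
  have := key T le_rfl s (by simpa using h0)
  simpa using this

theorem Runs.loop_mem {A A' : Arg} (hA : A.Low) (hA' : A'.Low) {c : Cmd} {o : List Bool}
    (Inv : ℕ → (ℕ → ℕ) → Prop) {T K : ℕ}
    (hbody : ∀ i < T, ∀ m, Inv i m → A.eval m ≠ A'.eval m ∧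
      ∃ m', Inv (i + 1) m' ∧ Runs w n inp c ⟨m, o⟩ ⟨m', o⟩ K)
    (hend : ∀ m, Inv T m → A.eval m = A'.eval m) {m : ℕ → ℕ} (h0 : Inv 0 m) :
    ∃ m', Inv T m' ∧ Runs w n inp (.loop A A' c) ⟨m, o⟩ ⟨m', o⟩
      (T * (K + 16 * wordCost n) + 15 * wordCost n) := by
  obtain ⟨s', ⟨h1, h2⟩, h3⟩ := Runs.loop (w := w) (n := n) (inp := inp) hA hA' (c := c)
    (fun i s => s.out = o ∧ Inv i s.mem) (T := T) (K := K)
    (fun i hi s hs => by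
      obtain ⟨h1, m', h2, h3⟩ := hbody i hi s.mem hs.2
      refine ⟨h1, ⟨m', o⟩, ⟨rfl, h2⟩, ?_⟩
      obtain ⟨mem, out⟩ := s
      obtain rfl : out = o := hs.1
      exact h3)
    (fun s hs => hend s.mem hs.2) (s := ⟨m, o⟩) ⟨rfl, h0⟩
  obtain ⟨m', o'⟩ := s'
  obtain rfl : o' = o := h1
  exact ⟨m', h2, h3⟩

/-- At time `t` the machine is at line `pc` in state `s`, up to scratch registers, and has spent at
most `k`. -/
def Machine.IsAt (M : Machine) (n inp t pc : ℕ) (s : St) (k : ℕ) : Prop :=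
  ∃ m, Sim m s.mem ∧ M.configAt n inp t = some ⟨pc, m, s.out⟩ ∧ M.cost n inp t ≤ k

theorem Machine.IsAt.run {M : Machine} {t pc k K : ℕ} {s s' : St} {c : Cmd}
    (h : M.IsAt n inp t pc s k) (hr : Runs (M.wordLen n) n inp c s s' K) (hp : c.Placed M pc) :
    ∃ t', t ≤ t' ∧ M.IsAt n inp t' (pc + c.len) s' (k + K) := by
  obtain ⟨m, hm, hc, hk⟩ := h
  obtain ⟨m', hm', hr'⟩ := hr m hm
  obtain ⟨t', k', hk', hreach⟩ := hr' M pc rfl hp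
  obtain ⟨h1, h2⟩ := hreach.configAt t hc
  exact ⟨t + t', by omega, m', hm', h1, by omega⟩

/-- In contrast to `Runs.loop` this records the time of every arrival at the loop head. The
transforms are loops of this kind, and these times witness that the vectors appear in memory in the
prescribed order. -/
theorem Machine.IsAt.loop {M : Machine} {t pc k K T : ℕ} {A A' : Arg} (hA : A.Low)
    (hA' : A'.Low) {c : Cmd} (Inv : ℕ → St → Prop)
    (hbody : ∀ i < T, ∀ s, Inv i s → A.eval s.mem ≠ A'.eval s.mem ∧
      ∃ s', Inv (i + 1) s' ∧ Runs (M.wordLen n) n inp c s s' K)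
    {s : St} (h0 : Inv 0 s) (h : M.IsAt n inp t pc s k)
    (hp : (Cmd.loop A A' c).Placed M pc) :
    ∃ τ : ℕ → ℕ, Monotone τ ∧ t ≤ τ 0 ∧
      ∀ i ≤ T, ∃ s', Inv i s' ∧ M.IsAt n inp (τ i) pc s' (k + i * (K + 16 * wordCost n)) := by
  have hW := wordCost_pos n
  -- The sequence of times is built one arrival at a time: it is constant from i on, and the
  -- extension adds the duration of one more iteration.
  have key : ∀ i : ℕ, ∃ τ : ℕ → ℕ, Monotone τ ∧ t ≤ τ 0 ∧ (∀ j ≥ i, τ j = τ i) ∧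
      (i ≤ T → ∀ j ≤ i, ∃ s', Inv j s' ∧
        M.IsAt n inp (τ j) pc s' (k + j * (K + 16 * wordCost n))) := by
    intro i
    induction i with
    | zero =>
      refine ⟨fun _ => t, monotone_const, le_rfl, fun _ _ => rfl, fun _ j hj => ?_⟩
      obtain rfl : j = 0 := by omega
      exact ⟨s, h0, by simpa using h⟩
    | succ i ih =>
      obtain ⟨τ, hmono, ht, hconst, hτ⟩ := ih
      by_cases hi : i + 1 ≤ T
      · obtain ⟨s1, hs1, m, hm, hc, hk⟩ := hτ (by omega) i le_rfl
        obtain ⟨hne, s2, hs2, hr⟩ := hbody i (by omega) s1 hs1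
        obtain ⟨m', hm', hraw⟩ := hr m hm
        obtain ⟨t', k', hk', hreach⟩ := Machine.Reach.loop_step (s := ⟨m, s1.out⟩) rfl hp
          (by simpa [hA.eval_eq hm, hA'.eval_eq hm] using hne) hraw
        obtain ⟨h1, h2⟩ := hreach.configAt (τ i) hc
        refine ⟨fun j => if j ≤ i then τ j else τ i + t', ?_, by simpa using ht, ?_, ?_⟩
        · intro a b hab
          by_cases ha : a ≤ i <;> by_cases hb : b ≤ i <;> simp only [ha, hb, if_true, if_false]
          · exact hmono hab
          · exact (hmono ha).trans (by omega)
          · omega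
          · exact le_rfl
        · intro j hj
          have h1 : ¬ j ≤ i := by omega
          have h2 : ¬ i + 1 ≤ i := by omega
          simp only [h1, h2, if_false]
        · intro _ j hj
          rcases Nat.lt_or_ge i j with hij | hij
          · obtain rfl : j = i + 1 := by omega
            refine ⟨s2, hs2, m', hm', ?_, ?_⟩
            · simpa [St.withPc] using h1
            · have := hA.cost_le m
              have := hA'.cost_le m
              have e : (i + 1) * (K + 16 * wordCost n) =
                i * (K + 16 * wordCost n) + (K + 16 * wordCost n) := by ring
              have h3 : (if i + 1 ≤ i then τ (i + 1) else τ i + t') = τ i + t' := by simp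
              simp only [h3] at hk' ⊢
              rw [e, h2]
              omega
          · simpa only [hij, if_true] using hτ (by omega) j hij
      · exact ⟨τ, hmono, ht, fun j hj => (hconst j (by omega)).trans (hconst _ (by omega)).symm,
          fun h => absurd h hi⟩
  obtain ⟨τ, h1, h2, -, h3⟩ := key T
  exact ⟨τ, h1, h2, h3 le_rfl⟩

/-- `Machine.IsAt.loop` ends at the loop head; this adds the final jump behind the loop. -/
theorem Machine.IsAt.loop_exit {M : Machine} {t pc k : ℕ} {A A' : Arg} (hA : A.Low)
    (hA' : A'.Low) {c : Cmd} {s : St} (hs : A.eval s.mem = A'.eval s.mem)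
    (h : M.IsAt n inp t pc s k) (hp : (Cmd.loop A A' c).Placed M pc) :
    ∃ t', t ≤ t' ∧ M.IsAt n inp t' (pc + (Cmd.loop A A' c).len) s (k + 15 * wordCost n) := by
  refine h.run (fun m hm => ⟨m, hm, Raw.mono (Raw.loop_exit ?_) ?_⟩) hp
  · simpa [hA.eval_eq hm, hA'.eval_eq hm] using hs
  · have := hA.cost_le m
    have := hA'.cost_le m
    have := wordCost_pos n
    simp only
    omega

/-! ### Arithmetic expressions -/

/-- Arithmetic expressions in constants and registers. -/
inductive Expr where
  | lit (v : ℕ)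
  | var (j : ℕ)
  | add (a b : Expr)
  | sub (a b : Expr)
  | mul (a b : Expr)
  | div (a b : Expr)

namespace Expr

instance : Add Expr := ⟨add⟩
instance : Sub Expr := ⟨sub⟩
instance : Mul Expr := ⟨mul⟩
instance : Div Expr := ⟨div⟩

/-- The value, with the operations of `ℕ`. -/
def eval (m : ℕ → ℕ) : Expr → ℕ
  | lit v => v
  | var j => m j
  | add a b => a.eval m + b.eval m
  | sub a b => a.eval m - b.eval m
  | mul a b => a.eval m * b.eval m
  | div a b => a.eval m / b.eval m

/-- No negative difference and no division by zero occurs in the evaluation. -/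
def Legal (m : ℕ → ℕ) : Expr → Prop
  | lit _ => True
  | var _ => True
  | add a b => a.Legal m ∧ b.Legal m
  | sub a b => a.Legal m ∧ b.Legal m ∧ b.eval m ≤ a.eval m
  | mul a b => a.Legal m ∧ b.Legal m
  | div a b => a.Legal m ∧ b.Legal m ∧ b.eval m ≠ 0

/-- All subexpressions have values of at most `w` bits. -/
def Fits (w : ℕ) (m : ℕ → ℕ) : Expr → Prop
  | lit v => v < 2 ^ w
  | var j => m j < 2 ^ w
  | add a b => a.Fits w m ∧ b.Fits w m ∧ a.eval m + b.eval m < 2 ^ w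
  | sub a b => a.Fits w m ∧ b.Fits w m
  | mul a b => a.Fits w m ∧ b.Fits w m ∧ a.eval m * b.eval m < 2 ^ w
  | div a b => a.Fits w m ∧ b.Fits w m

/-- All registers that occur are below 64. -/
def low : Expr → Bool
  | lit _ => true
  | var j => decide (j < 64)
  | add a b | sub a b | mul a b | div a b => a.low && b.low

/-- The number of scratch registers used. -/
def depth : Expr → ℕ
  | lit _ | var _ => 1
  | add a b | sub a b | mul a b | div a b => max a.depth (b.depth + 1)

/-- The number of instructions of the code. -/
def nodes : Expr → ℕ
  | lit _ | var _ => 1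
  | add a b | sub a b | mul a b | div a b => a.nodes + b.nodes + 1

/-- A bound for the length of the value, in units of some `S ≥ 1`, from such bounds for the
registers. -/
def bnd (env : ℕ → ℕ) : Expr → ℕ
  | lit v => v.size
  | var j => env j
  | add a b => max (a.bnd env) (b.bnd env) + 1
  | sub a _ => a.bnd env
  | mul a b => a.bnd env + b.bnd env
  | div a _ => a.bnd env

/-- A bound for the lengths of the values of all subexpressions. -/
def top (env : ℕ → ℕ) : Expr → ℕ
  | lit v => v.size
  | var j => env j
  | add a b => max (max (a.top env) (b.top env)) (max (a.bnd env) (b.bnd env) + 1)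
  | sub a b => max (a.top env) (b.top env)
  | mul a b => max (max (a.top env) (b.top env)) (a.bnd env + b.bnd env)
  | div a b => max (a.top env) (b.top env)

/-- Code that leaves the value in the scratch register `R_t`. -/
def code : Expr → ℕ → List Instr
  | lit v, t => [.bin t .add (.const v) (.const 0)]
  | var j, t => [.bin t .add (.reg j) (.const 0)]
  | add a b, t => a.code t ++ (b.code (t + 1) ++ [.bin t .add (.reg t) (.reg (t + 1))])
  | sub a b, t => a.code t ++ (b.code (t + 1) ++ [.bin t .sub (.reg t) (.reg (t + 1))])
  | mul a b, t => a.code t ++ (b.code (t + 1) ++ [.bin t .mul (.reg t) (.reg (t + 1))])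
  | div a b, t => a.code t ++ (b.code (t + 1) ++ [.bin t .div (.reg t) (.reg (t + 1))])

@[simp] theorem eval_add (m : ℕ → ℕ) (a b : Expr) : (a + b).eval m = a.eval m + b.eval m := rfl
@[simp] theorem eval_sub (m : ℕ → ℕ) (a b : Expr) : (a - b).eval m = a.eval m - b.eval m := rfl
@[simp] theorem eval_mul (m : ℕ → ℕ) (a b : Expr) : (a * b).eval m = a.eval m * b.eval m := rfl
@[simp] theorem eval_div (m : ℕ → ℕ) (a b : Expr) : (a / b).eval m = a.eval m / b.eval m := rfl
@[simp] theorem eval_var (m : ℕ → ℕ) (j : ℕ) : (var j).eval m = m j := rfl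
@[simp] theorem eval_lit (m : ℕ → ℕ) (v : ℕ) : (lit v).eval m = v := rfl
@[simp] theorem legal_add (m : ℕ → ℕ) (a b : Expr) :
    (a + b).Legal m ↔ a.Legal m ∧ b.Legal m := Iff.rfl
@[simp] theorem legal_sub (m : ℕ → ℕ) (a b : Expr) :
    (a - b).Legal m ↔ a.Legal m ∧ b.Legal m ∧ b.eval m ≤ a.eval m := Iff.rfl
@[simp] theorem legal_mul (m : ℕ → ℕ) (a b : Expr) :
    (a * b).Legal m ↔ a.Legal m ∧ b.Legal m := Iff.rfl
@[simp] theorem legal_div (m : ℕ → ℕ) (a b : Expr) :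
    (a / b).Legal m ↔ a.Legal m ∧ b.Legal m ∧ b.eval m ≠ 0 := Iff.rfl
@[simp] theorem legal_var (m : ℕ → ℕ) (j : ℕ) : (var j).Legal m := trivial
@[simp] theorem legal_lit (m : ℕ → ℕ) (v : ℕ) : (lit v).Legal m := trivial

theorem one_le_depth (e : Expr) : 1 ≤ e.depth := by
  induction e <;> simp [depth, *]

variable {w n inp : ℕ}

theorem eval_lt_of_fits {e : Expr} {m : ℕ → ℕ} (h : e.Fits w m) : e.eval m < 2 ^ w := by
  induction e with
  | lit v => exact h
  | var j => exact h
  | add a b => exact h.2.2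
  | sub a b iha _ => exact (Nat.sub_le _ _).trans_lt (iha h.1)
  | mul a b => exact h.2.2
  | div a b iha _ => exact (Nat.div_le_self _ _).trans_lt (iha h.1)

theorem raw_leaf {A : Arg} (hA : A.Low) {t : ℕ} (ht : t < 128) {m : ℕ → ℕ} {o : List Bool}
    (hv : A.eval m < 2 ^ w) :
    Raw w n inp (.blk [.bin t .add A (.const 0)]) ⟨m, o⟩ ⟨Function.update m t (A.eval m), o⟩
      (22 * wordCost n) := by
  refine Raw.instr (fun pc => ?_) ?_
  · have h0 : Arg.eval m (.const 0) = 0 := rfl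
    simp [exec, St.withPc, BinOp.eval, h0, assign, hv]
  · have := hA.cost_le m
    have := accessCost_low ht
    have := wordCost_pos n
    have h0 : Arg.cost m (.const 0) = 0 := rfl
    simp only [Instr.cost, h0, BinOp.cost]
    omega

/-- The factor 22 is three accesses to registers below 128, at cost at most 7 each, plus the
operation itself. The same constant is used for every elementary instruction. -/
theorem raw_op {op : BinOp} {t : ℕ} (ht : t + 1 < 128) {m : ℕ → ℕ} {o : List Bool} {v : ℕ}
    (hop : op.eval (m t) (m (t + 1)) = some v) (hv : v < 2 ^ w) :
    Raw w n inp (.blk [.bin t op (.reg t) (.reg (t + 1))]) ⟨m, o⟩ ⟨Function.update m t v, o⟩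
      (22 * wordCost n) := by
  refine Raw.instr (fun pc => ?_) ?_
  · simp [exec, St.withPc, Arg.eval, assign, hv, hop]
  · have := accessCost_low ht
    have := accessCost_low (show t < 128 by omega)
    have := wordCost_pos n
    have : op.cost n ≤ wordCost n := by cases op <;> simp [BinOp.cost] <;> omega
    simp only [Instr.cost, Arg.cost]
    omega

/-- The right operand is evaluated after the left one has changed scratch registers, so its
hypothesis has to hold for every memory that agrees with the original one below t. -/
theorem raw_node {op : BinOp} {t : ℕ} {ca cb : List Instr} {m : ℕ → ℕ} {o : List Bool}
    {va vb v Ka Kb : ℕ} (ht : t + 1 < 128)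
    (ha : ∃ m', m' t = va ∧ (∀ i, i < t ∨ 128 ≤ i → m' i = m i) ∧
      Raw w n inp (.blk ca) ⟨m, o⟩ ⟨m', o⟩ Ka)
    (hb : ∀ m1 : ℕ → ℕ, (∀ i, i < t → m1 i = m i) →
      ∃ m', m' (t + 1) = vb ∧ (∀ i, i < t + 1 ∨ 128 ≤ i → m' i = m1 i) ∧
      Raw w n inp (.blk cb) ⟨m1, o⟩ ⟨m', o⟩ Kb)
    (hop : op.eval va vb = some v) (hv : v < 2 ^ w) :
    ∃ m', m' t = v ∧ (∀ i, i < t ∨ 128 ≤ i → m' i = m i) ∧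
      Raw w n inp (.blk (ca ++ (cb ++ [.bin t op (.reg t) (.reg (t + 1))]))) ⟨m, o⟩ ⟨m', o⟩
        (Ka + Kb + 22 * wordCost n) := by
  obtain ⟨m1, h1, h1', hr1⟩ := ha
  obtain ⟨m2, h2, h2', hr2⟩ := hb m1 (fun i hi => h1' i (Or.inl hi))
  have e1 : m2 t = va := by rw [h2' t (by omega), h1]
  refine ⟨Function.update m2 t v, by simp, ?_, ?_⟩
  · intro i hi
    rw [Function.update_of_ne (by omega), h2' i (by omega), h1' i hi]
  · rw [Nat.add_assoc]
    exact hr1.append (hr2.append (raw_op ht (by rw [e1, h2]; exact hop) hv))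

/-- Stack discipline: the left operand is left in t, the right one in t + 1, and nothing below t is
touched. The values refer to a reference memory `m₀`, with which the actual memory needs to agree on
the registers below 64 only. -/
theorem raw_code (e : Expr) {m₀ : ℕ → ℕ} (hlow : e.low = true) (hl : e.Legal m₀)
    (hf : e.Fits w m₀) (o : List Bool) :
    ∀ (t : ℕ) (m : ℕ → ℕ), 64 ≤ t → t + e.depth ≤ 128 → (∀ i < 64, m i = m₀ i) →
      ∃ m', m' t = e.eval m₀ ∧ (∀ i, i < t ∨ 128 ≤ i → m' i = m i) ∧
        Raw w n inp (.blk (e.code t)) ⟨m, o⟩ ⟨m', o⟩ (e.nodes * (22 * wordCost n)) := by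
  induction e with
  | lit v =>
    intro t m ht htd hm
    refine ⟨Function.update m t v, by simp [eval], fun i hi => ?_, ?_⟩
    · rw [Function.update_of_ne]; simp [depth] at htd; omega
    · simp only [nodes, one_mul]
      exact raw_leaf (A := .const v) trivial (by simp [depth] at htd; omega) hf
  | var j =>
    intro t m ht htd hm
    have hj : j < 64 := by simpa [low] using hlow
    refine ⟨Function.update m t (m j), by simp [eval, hm j hj], fun i hi => ?_, ?_⟩
    · rw [Function.update_of_ne]; simp [depth] at htd; omega
    · simp only [nodes, one_mul]
      exact raw_leaf (A := .reg j) hj (by simp [depth] at htd; omega)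
        (by simpa [Arg.eval, hm j hj, Fits] using hf)
  | add a b iha ihb =>
    intro t m ht htd hm
    simp only [low, Bool.and_eq_true] at hlow
    simp only [depth] at htd
    have := one_le_depth b
    obtain ⟨m', h1, h2, h3⟩ := raw_node (n := n) (inp := inp) (op := .add) (by omega)
      (iha hlow.1 hl.1 hf.1 t m ht (by omega) hm)
      (fun m1 h1 => ihb hlow.2 hl.2 hf.2.1 (t + 1) m1 (by omega) (by omega)
        fun i hi => (h1 i (by omega)).trans (hm i hi)) rfl hf.2.2
    exact ⟨m', h1, h2, h3.mono (by simp only [nodes]; apply le_of_eq; ring)⟩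
  | mul a b iha ihb =>
    intro t m ht htd hm
    simp only [low, Bool.and_eq_true] at hlow
    simp only [depth] at htd
    have := one_le_depth b
    obtain ⟨m', h1, h2, h3⟩ := raw_node (n := n) (inp := inp) (op := .mul) (by omega)
      (iha hlow.1 hl.1 hf.1 t m ht (by omega) hm)
      (fun m1 h1 => ihb hlow.2 hl.2 hf.2.1 (t + 1) m1 (by omega) (by omega)
        fun i hi => (h1 i (by omega)).trans (hm i hi)) rfl hf.2.2
    exact ⟨m', h1, h2, h3.mono (by simp only [nodes]; apply le_of_eq; ring)⟩
  | sub a b iha ihb =>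
    intro t m ht htd hm
    simp only [low, Bool.and_eq_true] at hlow
    simp only [depth] at htd
    have := one_le_depth b
    obtain ⟨m', h1, h2, h3⟩ := raw_node (n := n) (inp := inp) (op := .sub) (by omega)
      (iha hlow.1 hl.1 hf.1 t m ht (by omega) hm)
      (fun m1 h1 => ihb hlow.2 hl.2.1 hf.2 (t + 1) m1 (by omega) (by omega)
        fun i hi => (h1 i (by omega)).trans (hm i hi)) (if_pos hl.2.2)
      ((Nat.sub_le _ _).trans_lt (eval_lt_of_fits hf.1))
    exact ⟨m', h1, h2, h3.mono (by simp only [nodes]; apply le_of_eq; ring)⟩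
  | div a b iha ihb =>
    intro t m ht htd hm
    simp only [low, Bool.and_eq_true] at hlow
    simp only [depth] at htd
    have := one_le_depth b
    obtain ⟨m', h1, h2, h3⟩ := raw_node (n := n) (inp := inp) (op := .div) (by omega)
      (iha hlow.1 hl.1 hf.1 t m ht (by omega) hm)
      (fun m1 h1 => ihb hlow.2 hl.2.1 hf.2 (t + 1) m1 (by omega) (by omega)
        fun i hi => (h1 i (by omega)).trans (hm i hi)) (if_neg hl.2.2)
      ((Nat.div_le_self _ _).trans_lt (eval_lt_of_fits hf.1))
    exact ⟨m', h1, h2, h3.mono (by simp only [nodes]; apply le_of_eq; ring)⟩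

end Expr

/-! ### Static bounds for the lengths of values -/

/-- The registers below 64 hold numbers of length at most `env j * S`. -/
def Bd (env : ℕ → ℕ) (S : ℕ) (m : ℕ → ℕ) : Prop := ∀ j < 64, m j < 2 ^ (env j * S)

/-- A sum may need one more bit; since S ≥ 1, one more unit of S bits is enough. In this way all
bounds stay integer multiples of S and can be computed without knowing S. -/
theorem add_lt_two_pow {a b k l S : ℕ} (hS : 1 ≤ S) (ha : a < 2 ^ (k * S))
    (hb : b < 2 ^ (l * S)) : a + b < 2 ^ ((max k l + 1) * S) := by
  have h1 : 2 ^ (k * S) ≤ 2 ^ (max k l * S) :=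
    Nat.pow_le_pow_right (by norm_num) (Nat.mul_le_mul_right _ (le_max_left _ _))
  have h2 : 2 ^ (l * S) ≤ 2 ^ (max k l * S) :=
    Nat.pow_le_pow_right (by norm_num) (Nat.mul_le_mul_right _ (le_max_right _ _))
  have h3 : 2 ^ (max k l * S + 1) ≤ 2 ^ ((max k l + 1) * S) :=
    Nat.pow_le_pow_right (by norm_num) (by rw [add_mul]; omega)
  rw [pow_succ] at h3
  omega

theorem mul_lt_two_pow {a b k l S : ℕ} (ha : a < 2 ^ (k * S)) (hb : b < 2 ^ (l * S)) :
    a * b < 2 ^ ((k + l) * S) := by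
  rw [add_mul, pow_add]
  exact Nat.mul_lt_mul'' ha hb

theorem lt_two_pow_size_mul {S : ℕ} (hS : 1 ≤ S) (v : ℕ) : v < 2 ^ (v.size * S) :=
  (Nat.lt_size_self v).trans_le
    (Nat.pow_le_pow_right (by norm_num) (Nat.le_mul_of_pos_right _ (by omega)))

namespace Expr

variable {env : ℕ → ℕ} {S : ℕ} {m : ℕ → ℕ}

theorem eval_lt_bnd (hS : 1 ≤ S) (hm : Bd env S m) :
    ∀ e : Expr, e.low = true → e.eval m < 2 ^ (e.bnd env * S)
  | lit v, _ => lt_two_pow_size_mul hS v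
  | var j, h => hm j (by simpa [low] using h)
  | add a b, h => by
    simp only [low, Bool.and_eq_true] at h
    exact add_lt_two_pow hS (eval_lt_bnd hS hm a h.1) (eval_lt_bnd hS hm b h.2)
  | sub a b, h => by
    simp only [low, Bool.and_eq_true] at h
    exact (Nat.sub_le _ _).trans_lt (eval_lt_bnd hS hm a h.1)
  | mul a b, h => by
    simp only [low, Bool.and_eq_true] at h
    exact mul_lt_two_pow (eval_lt_bnd hS hm a h.1) (eval_lt_bnd hS hm b h.2)
  | div a b, h => by
    simp only [low, Bool.and_eq_true] at h
    exact (Nat.div_le_self _ _).trans_lt (eval_lt_bnd hS hm a h.1)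

/-- This replaces the semantic word-length condition by a comparison of concrete numerals, uniform
in the input length, which `decide` settles for every block of the program. -/
theorem fits_of_top (hS : 1 ≤ S) (hm : Bd env S m) {wc : ℕ} :
    ∀ e : Expr, e.low = true → e.top env ≤ wc → e.Fits (wc * S) m
  | lit v, _, h => (lt_two_pow_size_mul hS v).trans_le
      (Nat.pow_le_pow_right (by norm_num) (Nat.mul_le_mul_right _ h))
  | var j, h, h' => (hm j (by simpa [low] using h)).trans_le
      (Nat.pow_le_pow_right (by norm_num) (Nat.mul_le_mul_right _ h'))
  | add a b, h, h' => by
    simp only [low, Bool.and_eq_true] at h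
    simp only [top, max_le_iff] at h'
    refine ⟨fits_of_top hS hm a h.1 h'.1.1, fits_of_top hS hm b h.2 h'.1.2, ?_⟩
    exact (add_lt_two_pow hS (eval_lt_bnd hS hm a h.1) (eval_lt_bnd hS hm b h.2)).trans_le
      (Nat.pow_le_pow_right (by norm_num) (Nat.mul_le_mul_right _ h'.2))
  | mul a b, h, h' => by
    simp only [low, Bool.and_eq_true] at h
    simp only [top, max_le_iff] at h'
    refine ⟨fits_of_top hS hm a h.1 h'.1.1, fits_of_top hS hm b h.2 h'.1.2, ?_⟩
    exact (mul_lt_two_pow (eval_lt_bnd hS hm a h.1) (eval_lt_bnd hS hm b h.2)).trans_le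
      (Nat.pow_le_pow_right (by norm_num) (Nat.mul_le_mul_right _ h'.2))
  | sub a b, h, h' => by
    simp only [low, Bool.and_eq_true] at h
    simp only [top, max_le_iff] at h'
    exact ⟨fits_of_top hS hm a h.1 h'.1, fits_of_top hS hm b h.2 h'.2⟩
  | div a b, h, h' => by
    simp only [low, Bool.and_eq_true] at h
    simp only [top, max_le_iff] at h'
    exact ⟨fits_of_top hS hm a h.1 h'.1, fits_of_top hS hm b h.2 h'.2⟩

end Expr

/-! ### Blocks of assignments -/

/-- A sequence of assignments of values of expressions to registers. -/
abbrev Block := List (ℕ × Expr)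

namespace Block

/-- The effect on the memory. -/
def den : Block → (ℕ → ℕ) → ℕ → ℕ
  | [], m => m
  | a :: l, m => den l (Function.update m a.1 (a.2.eval m))

/-- No negative difference and no division by zero occurs. -/
def Legal : Block → (ℕ → ℕ) → Prop
  | [], _ => True
  | a :: l, m => a.2.Legal m ∧ Legal l (Function.update m a.1 (a.2.eval m))

/-- Static check, from bounds for the registers, that all values have length at most `wc * S`. -/
def chk (wc : ℕ) : (ℕ → ℕ) → Block → Bool
  | _, [] => true
  | env, a :: l => a.2.low && decide (a.2.depth ≤ 64) && decide (a.1 < 64) &&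
      decide (a.2.top env ≤ wc) && chk wc (Function.update env a.1 (a.2.bnd env)) l

/-- Bounds for the registers after the block. -/
def envAfter : (ℕ → ℕ) → Block → ℕ → ℕ
  | env, [] => env
  | env, a :: l => envAfter (Function.update env a.1 (a.2.bnd env)) l

/-- The code. -/
def code : Block → List Instr
  | [] => []
  | a :: l => (a.2.code 64 ++ [.bin a.1 .add (.reg 64) (.const 0)]) ++ code l

/-- A bound for the cost, in units of `wordCost n`. -/
def weight : Block → ℕ
  | [] => 0
  | a :: l => (a.2.nodes + 1) * 22 + weight l

/-- The block as a program. -/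
def cmd (l : Block) : Cmd := .blk (code l)

variable {w n inp wc S : ℕ} {env : ℕ → ℕ}

theorem Bd.update {m : ℕ → ℕ} {r k v : ℕ} (hm : Bd env S m) (hv : v < 2 ^ (k * S)) :
    Bd (Function.update env r k) S (Function.update m r v) := by
  intro j hj
  by_cases h : j = r
  · subst h; simpa using hv
  · simpa [h] using hm j hj

/-- Each assignment is first evaluated in the scratch area and then moved to its target. The actual
memory differs from the idealized one in scratch registers only, and the relation `Sim` is carried
along. -/
theorem raw_code (hS : 1 ≤ S) (o : List Bool) :
    ∀ (l : Block) (env : ℕ → ℕ) (m₀ m : ℕ → ℕ), chk wc env l = true → Bd env S m₀ →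
      l.Legal m₀ → Sim m m₀ → ∃ m', Sim m' (den l m₀) ∧
        Raw (wc * S) n inp (.blk (code l)) ⟨m, o⟩ ⟨m', o⟩ (weight l * wordCost n)
  | [], _, _, m, _, _, _, h => ⟨m, h, by simpa [weight, code] using Raw.nil _⟩
  | a :: l, env, m₀, m, hc, hb, hl, hs => by
    simp only [chk, Bool.and_eq_true, decide_eq_true_eq] at hc
    obtain ⟨⟨⟨⟨h1, h2⟩, h3⟩, h4⟩, h5⟩ := hc
    have hf := Expr.fits_of_top hS hb a.2 h1 h4
    obtain ⟨m1, e1, e2, hr1⟩ := Expr.raw_code (n := n) (inp := inp) a.2 h1 hl.1 hf o 64 m le_rfl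
      (by omega) (fun i hi => hs i (Or.inl hi))
    have hr2 : Raw (wc * S) n inp (.blk [.bin a.1 .add (.reg 64) (.const 0)]) ⟨m1, o⟩
        ⟨Function.update m1 a.1 (a.2.eval m₀), o⟩ (22 * wordCost n) := by
      refine Raw.instr (fun pc => ?_) ?_
      · simp [exec, St.withPc, BinOp.eval, Arg.eval, assign, e1, Expr.eval_lt_of_fits hf]
      · have := accessCost_low (show 64 < 128 by norm_num)
        have := accessCost_low (show a.1 < 128 by omega)
        have := wordCost_pos n
        simp only [Instr.cost, Arg.cost, BinOp.cost]
        omega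
    have hs1 : Sim (Function.update m1 a.1 (a.2.eval m₀))
        (Function.update m₀ a.1 (a.2.eval m₀)) := by
      intro i hi
      by_cases h : i = a.1
      · subst h; simp
      · simp only [Function.update_of_ne h]
        rw [e2 i (by omega), hs i hi]
    obtain ⟨m', h6, h7⟩ := raw_code hS o l _ _ _ h5
      (Bd.update hb (Expr.eval_lt_bnd hS hb a.2 h1)) hl.2 hs1
    refine ⟨m', h6, Raw.mono ((hr1.append hr2).append h7) ?_⟩
    simp only [weight]
    apply le_of_eq; ring

theorem runs {l : Block} {m : ℕ → ℕ} {o : List Bool} (hS : 1 ≤ S) (hb : Bd env S m)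
    (hc : chk wc env l = true) (hl : l.Legal m) :
    Runs (wc * S) n inp l.cmd ⟨m, o⟩ ⟨l.den m, o⟩ (weight l * wordCost n) :=
  fun m' hm' => raw_code hS o l env m m' hc hb hl hm'

theorem bd_den (hS : 1 ≤ S) : ∀ (l : Block) (env : ℕ → ℕ) (m : ℕ → ℕ), chk wc env l = true →
    Bd env S m → Bd (envAfter env l) S (den l m)
  | [], _, _, _, h => h
  | a :: l, env, m, hc, hb => by
    simp only [chk, Bool.and_eq_true, decide_eq_true_eq] at hc
    exact bd_den hS l _ _ hc.2 (Bd.update hb (Expr.eval_lt_bnd hS hb a.2 hc.1.1.1.1))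

theorem den_of_ne : ∀ (l : Block) (m : ℕ → ℕ) (i : ℕ), (∀ a ∈ l, a.1 ≠ i) → den l m i = m i
  | [], _, _, _ => rfl
  | a :: l, m, i, h => by
    rw [den, den_of_ne l _ i (fun b hb => h b (List.mem_cons_of_mem _ hb)),
      Function.update_of_ne (h a List.mem_cons_self).symm]

/-- All assigned registers are in the given range. -/
def within (lo hi : ℕ) (l : Block) : Bool := l.all fun a => decide (lo ≤ a.1) && decide (a.1 < hi)

theorem den_outside {l : Block} {lo hi : ℕ} (h : within lo hi l = true) {m : ℕ → ℕ} {i : ℕ}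
    (hi' : i < lo ∨ hi ≤ i) : den l m i = m i := by
  refine den_of_ne l m i fun a ha => ?_
  simp only [within, List.all_eq_true, Bool.and_eq_true, decide_eq_true_eq] at h
  have := h a ha
  omega

end Block

/-! ### Vector copies, input and output -/

/-- The memory after a vector copy. -/
def cpy (a b l : ℕ) (m : ℕ → ℕ) : ℕ → ℕ :=
  fun r => if b ≤ r ∧ r < b + l then m (a + (r - b)) else m r

/-- A single vector copy as a program. -/
def copyCmd (A A' A'' : Arg) : Cmd := .blk [.copy A A' A'']

/-- A single input instruction as a program. -/
def inputCmd (i : ℕ) (A A' : Arg) : Cmd := .blk [.input i A A']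

/-- A single output instruction as a program. -/
def outputCmd (j : ℕ) (A : Arg) : Cmd := .blk [.output j A]

variable {w n inp : ℕ}

/-- Source and target have to avoid the scratch area: a copy from it would carry unspecified
contents to registers whose values matter. A copy from or into the area of variables has to end at
register 63 or before. -/
theorem runs_copy {A A' A'' : Arg} (hA : A.Low) (hA' : A'.Low) (hA'' : A''.Low) {m : ℕ → ℕ}
    {o : List Bool} {a b l K : ℕ} (ea : A.eval m = a) (eb : A'.eval m = b) (el : A''.eval m = l)
    (ha : a + l ≤ 64 ∨ 128 ≤ a) (hb : b + l ≤ 64 ∨ 128 ≤ b)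
    (hK1 : 1 ≤ K) (hKa : a ≤ 2 ^ K) (hKb : b ≤ 2 ^ K) (hKl : l ≤ K) :
    Runs w n inp (copyCmd A A' A'') ⟨m, o⟩ ⟨cpy a b l m, o⟩ K := by
  intro m1 hm1
  rw [← hA.eval_eq hm1] at ea
  rw [← hA'.eval_eq hm1] at eb
  rw [← hA''.eval_eq hm1] at el
  refine ⟨cpy a b l m1, fun i hi => ?_, Raw.instr (fun pc => ?_) ?_⟩
  · simp only [cpy]
    split_ifs with h
    · exact hm1 _ (by omega)
    · exact hm1 i hi
  · simp [exec, St.withPc, ea, eb, el]; rfl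
  · have h1 : Nat.clog 2 a ≤ K := Nat.clog_le_of_le_pow hKa
    have h2 : Nat.clog 2 b ≤ K := Nat.clog_le_of_le_pow hKb
    simp only [Instr.cost, ea, eb, el]
    omega

theorem runs_input {A A' : Arg} (hA : A.Low) (hA' : A'.Low) {m : ℕ → ℕ} {o : List Bool}
    {i a b : ℕ} (hi : i < 64) (ea : A.eval m = a) (eb : A'.eval m = b) (hab : a ≤ b)
    (hbn : b < n) (hlen : b + 1 - a ≤ w) :
    Runs w n inp (inputCmd i A A') ⟨m, o⟩
      ⟨Function.update m i (inp / 2 ^ a % 2 ^ (b + 1 - a)), o⟩ (22 * wordCost n) := by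
  intro m1 hm1
  rw [← hA.eval_eq hm1] at ea
  rw [← hA'.eval_eq hm1] at eb
  refine ⟨Function.update m1 i (inp / 2 ^ a % 2 ^ (b + 1 - a)), fun j hj => ?_,
    Raw.instr (fun pc => ?_) ?_⟩
  · by_cases h : j = i
    · subst h; simp
    · simpa [h] using hm1 j hj
  · have : inp / 2 ^ a % 2 ^ (b + 1 - a) < 2 ^ w :=
      (Nat.mod_lt _ (by positivity)).trans_le (Nat.pow_le_pow_right (by norm_num) hlen)
    simp [exec, St.withPc, ea, eb, assign, hab, hbn, hlen, this]
  · have := accessCost_low (show i < 128 by omega)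
    have := hA.cost_le m1
    have := hA'.cost_le m1
    have := wordCost_pos n
    simp only [Instr.cost]
    omega

theorem runs_output {A : Arg} (hA : A.Low) {m : ℕ → ℕ} {o : List Bool} {j a : ℕ} (hj : j < 64)
    (ea : A.eval m = a) (haw : a ≤ w) :
    Runs w n inp (outputCmd j A) ⟨m, o⟩ ⟨m, o ++ bits a (m j)⟩ (22 * wordCost n) := by
  intro m1 hm1
  rw [← hA.eval_eq hm1] at ea
  refine ⟨m1, hm1, Raw.instr (fun pc => ?_) ?_⟩
  · simp [exec, St.withPc, ea, haw, hm1 j (Or.inl hj)]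
  · have := accessCost_low (show j < 128 by omega)
    have := hA.cost_le m1
    have := wordCost_pos n
    simp only [Instr.cost]
    omega

/-! ### Positions of butterflies -/

/-- The upper position of butterfly number `k` of the level with distance `h`; the lower one is
`upper h k + h`. -/
def upper (h k : ℕ) : ℕ := k + h * (k / h)

/-- The number of the butterfly that position `i` belongs to. -/
def bfly (h i : ℕ) : ℕ := h * (i / (2 * h)) + i % h

section positions

variable {h : ℕ}

theorem upper_eq {b j : ℕ} (hj : j < h) : upper h (h * b + j) = 2 * h * b + j := by
  have : (h * b + j) / h = b := by
    rw [Nat.mul_add_div (by omega), Nat.div_eq_of_lt hj, add_zero]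
  rw [upper, this]; ring

theorem upper_mod_two {b j : ℕ} (hj : j < h) : (2 * h * b + j) % (2 * h) = j := by
  rw [Nat.mul_add_mod, Nat.mod_eq_of_lt (by omega)]

theorem lower_mod_two {b j : ℕ} (hj : j < h) : (2 * h * b + h + j) % (2 * h) = h + j := by
  rw [add_assoc, Nat.mul_add_mod, Nat.mod_eq_of_lt (by omega)]

theorem upper_mod {b j : ℕ} (hj : j < h) : (2 * h * b + j) % h = j := by
  rw [show 2 * h * b + j = h * (2 * b) + j by ring, Nat.mul_add_mod, Nat.mod_eq_of_lt hj]

theorem lower_mod {b j : ℕ} (hj : j < h) : (2 * h * b + h + j) % h = j := by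
  rw [show 2 * h * b + h + j = h * (2 * b + 1) + j by ring, Nat.mul_add_mod, Nat.mod_eq_of_lt hj]

theorem bfly_upper_eq {b j : ℕ} (hj : j < h) : bfly h (2 * h * b + j) = h * b + j := by
  rw [bfly, upper_mod hj, Nat.mul_add_div (by omega), Nat.div_eq_of_lt (by omega), add_zero]

theorem bfly_lower_eq {b j : ℕ} (hj : j < h) : bfly h (2 * h * b + h + j) = h * b + j := by
  rw [bfly, lower_mod hj, add_assoc, Nat.mul_add_div (by omega), Nat.div_eq_of_lt (by omega),
    add_zero]

theorem exists_eq_mul_add (hh : 0 < h) (k : ℕ) : ∃ b j, j < h ∧ k = h * b + j :=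
  ⟨k / h, k % h, Nat.mod_lt _ hh, (Nat.div_add_mod k h).symm⟩

theorem position_cases (hh : 0 < h) (i : ℕ) :
    ∃ b j, j < h ∧ (i = 2 * h * b + j ∨ i = 2 * h * b + h + j) := by
  obtain ⟨b, j, hj, rfl⟩ := exists_eq_mul_add (h := 2 * h) (by omega) i
  rcases Nat.lt_or_ge j h with hlt | hge
  · exact ⟨b, j, hlt, Or.inl rfl⟩
  · exact ⟨b, j - h, by omega, Or.inr (by omega)⟩

theorem bfly_upper (hh : 0 < h) (k : ℕ) : bfly h (upper h k) = k := by
  obtain ⟨b, j, hj, rfl⟩ := exists_eq_mul_add hh k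
  rw [upper_eq hj, bfly_upper_eq hj]

theorem bfly_lower (hh : 0 < h) (k : ℕ) : bfly h (upper h k + h) = k := by
  obtain ⟨b, j, hj, rfl⟩ := exists_eq_mul_add hh k
  rw [upper_eq hj, show 2 * h * b + j + h = 2 * h * b + h + j by ring, bfly_lower_eq hj]

theorem eq_of_bfly (hh : 0 < h) {i k : ℕ} (hi : bfly h i = k) :
    i = upper h k ∨ i = upper h k + h := by
  obtain ⟨b, j, hj, rfl | rfl⟩ := position_cases hh i
  · left; rw [← hi, bfly_upper_eq hj, upper_eq hj]
  · right; rw [← hi, bfly_lower_eq hj, upper_eq hj]; ring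

theorem upper_mod_two_lt (hh : 0 < h) (k : ℕ) : upper h k % (2 * h) < h := by
  obtain ⟨b, j, hj, rfl⟩ := exists_eq_mul_add hh k
  rw [upper_eq hj, upper_mod_two hj]; exact hj

theorem not_lower_mod_two_lt (hh : 0 < h) (k : ℕ) : ¬ (upper h k + h) % (2 * h) < h := by
  obtain ⟨b, j, hj, rfl⟩ := exists_eq_mul_add hh k
  rw [upper_eq hj, show 2 * h * b + j + h = 2 * h * b + h + j by ring, lower_mod_two hj]; omega

theorem upper_mod_self (k : ℕ) : upper h k % h = k % h := by
  simp [upper]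

theorem lower_mod_self (k : ℕ) : (upper h k + h) % h = k % h := by
  simp [upper]

theorem bfly_lt {i T : ℕ} (hh : 0 < h) (hT : h ∣ T) (hi : i < 2 * T) : bfly h i < T := by
  obtain ⟨q, rfl⟩ := hT
  obtain ⟨b, j, hj, rfl | rfl⟩ := position_cases hh i
  · rw [bfly_upper_eq hj]
    have : b < q := by by_contra hb; nlinarith [Nat.mul_le_mul_left h (not_lt.1 hb)]
    nlinarith [Nat.mul_le_mul_left h (show b + 1 ≤ q from this)]
  · rw [bfly_lower_eq hj]
    have : b < q := by by_contra hb; nlinarith [Nat.mul_le_mul_left h (not_lt.1 hb)]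
    nlinarith [Nat.mul_le_mul_left h (show b + 1 ≤ q from this)]

theorem lower_lt {k T : ℕ} (hh : 0 < h) (hT : h ∣ T) (hk : k < T) : upper h k + h < 2 * T := by
  obtain ⟨q, rfl⟩ := hT
  obtain ⟨b, j, hj, rfl⟩ := exists_eq_mul_add hh k
  rw [upper_eq hj]
  have : b < q := by by_contra hb; nlinarith [Nat.mul_le_mul_left h (not_lt.1 hb)]
  nlinarith [Nat.mul_le_mul_left h (show b + 1 ≤ q from this)]

/-- The position of entry number `l` of the two vectors of length `B` that contain the positions of
the butterflies `k₀, …, k₀ + B - 1`. -/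
def place (h B k₀ l : ℕ) : ℕ :=
  if l < B then upper h k₀ + l else upper h k₀ + max h B + (l - B)

variable {B k₀ : ℕ}

theorem min_dvd_of_dvd (hh : 0 < h) (hB : 0 < B) (hd : h ∣ B ∨ B ∣ h) : min h B ∣ B := by
  rcases hd with hd | hd
  · rwa [min_eq_left (Nat.le_of_dvd hB hd)]
  · rw [min_eq_right (Nat.le_of_dvd hh hd)]

/-- The reason why chunks work. If h divides B, a chunk consists of whole blocks, its 2B positions
form one interval, and the butterflies inside keep their distance h. If B divides h, the chunk lies
inside one block: its upper positions are B consecutive ones, its lower positions are these shifted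
by h, and once the two vectors are stored next to each other the distance becomes B. In both cases
the local distance is min(h, B), and the second vector starts max(h, B) behind the first. -/
theorem place_upper_and_lower (hh : 0 < h) (hB : 0 < B) (hd : h ∣ B ∨ B ∣ h) (hk : B ∣ k₀) {t : ℕ}
    (ht : t < B) : place h B k₀ (upper (min h B) t) = upper h (k₀ + t) ∧
      place h B k₀ (upper (min h B) t + min h B) = upper h (k₀ + t) + h := by
  rcases hd with hd | hd
  · have hle := Nat.le_of_dvd hB hd
    rw [min_eq_left hle]
    have hlt := lower_lt hh hd ht
    obtain ⟨q, rfl⟩ : h ∣ k₀ := hd.trans hk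
    have e1 : upper h (h * q) = 2 * h * q := by
      have := upper_eq (b := q) hh; simpa using this
    have e2 : upper h (h * q + t) = 2 * h * q + upper h t := by
      simp only [upper, Nat.mul_add_div hh]; ring
    have e3 : ∀ l, l < 2 * B → place h B (h * q) l = 2 * h * q + l := by
      intro l hl
      rw [place, e1, max_eq_right hle]; split_ifs <;> omega
    rw [e3 _ (by omega), e3 _ hlt, e2]
    exact ⟨rfl, by ring⟩
  · have hle := Nat.le_of_dvd hh hd
    rw [min_eq_right hle]
    have e1 : upper B t = t := by simp [upper, Nat.div_eq_of_lt ht]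
    have e2 : upper h (k₀ + t) = upper h k₀ + t := by
      obtain ⟨q, rfl⟩ := hd
      obtain ⟨c, rfl⟩ := hk
      -- The quotient by h does not change within the chunk, because both the start of the chunk and
      -- h are multiples of B.
      have : (B * c + t) / (B * q) = (B * c) / (B * q) := by
        rw [← Nat.div_div_eq_div_mul, ← Nat.div_div_eq_div_mul, Nat.mul_add_div hB,
          Nat.div_eq_of_lt ht, Nat.mul_div_cancel_left _ hB, add_zero]
      simp only [upper, this]; ring
    rw [e1, e2, place, place, if_pos ht, if_neg (by omega), max_eq_left hle]
    exact ⟨rfl, by omega⟩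

theorem exists_local (hh : 0 < h) (hB : 0 < B) (hd : h ∣ B ∨ B ∣ h) {l : ℕ} (hl : l < 2 * B) :
    ∃ t < B, l = upper (min h B) t ∨ l = upper (min h B) t + min h B :=
  ⟨bfly (min h B) l, bfly_lt (by omega) (min_dvd_of_dvd hh hB hd) hl, eq_of_bfly (by omega) rfl⟩

/-- Together with `exists_place`: the positions copied are exactly those belonging to the
butterflies of the chunk. Hence nothing outside needs to be read and nothing outside is overwritten.
-/
theorem bfly_place (hh : 0 < h) (hB : 0 < B) (hd : h ∣ B ∨ B ∣ h) (hk : B ∣ k₀) {l : ℕ}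
    (hl : l < 2 * B) : k₀ ≤ bfly h (place h B k₀ l) ∧ bfly h (place h B k₀ l) < k₀ + B := by
  obtain ⟨t, ht, hlt⟩ := exists_local hh hB hd hl
  have := place_upper_and_lower hh hB hd hk ht
  rcases hlt with rfl | rfl
  · rw [this.1, bfly_upper hh]; omega
  · rw [this.2, bfly_lower hh]; omega

theorem place_injective {l l' : ℕ} (h' : place h B k₀ l = place h B k₀ l') :
    l = l' := by
  simp only [place] at h'
  split_ifs at h' <;> omega

theorem eq_of_bfly_place (hh : 0 < h) (hB : 0 < B) (hd : h ∣ B ∨ B ∣ h) (hk : B ∣ k₀) {l t : ℕ}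
    (ht : t < B) (he : bfly h (place h B k₀ l) = k₀ + t) :
    l = upper (min h B) t ∨ l = upper (min h B) t + min h B := by
  have hlt := lower_lt (h := min h B) (by omega) (min_dvd_of_dvd hh hB hd) ht
  have := place_upper_and_lower hh hB hd hk ht
  rcases eq_of_bfly hh he with h1 | h1
  · exact Or.inl (place_injective (h1.trans this.1.symm))
  · exact Or.inr (place_injective (h1.trans this.2.symm))

theorem exists_place (hh : 0 < h) (hB : 0 < B) (hd : h ∣ B ∨ B ∣ h) (hk : B ∣ k₀) {i : ℕ}
    (h1 : k₀ ≤ bfly h i) (h2 : bfly h i < k₀ + B) : ∃ l < 2 * B, place h B k₀ l = i := by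
  obtain ⟨t, ht⟩ := Nat.exists_eq_add_of_le h1
  have hlt := lower_lt (h := min h B) (by omega) (min_dvd_of_dvd hh hB hd) (show t < B by omega)
  have := place_upper_and_lower hh hB hd hk (show t < B by omega)
  rcases eq_of_bfly hh ht with rfl | rfl
  · exact ⟨_, by omega, this.1⟩
  · exact ⟨_, hlt, this.2⟩

theorem place_lt (hh : 0 < h) (hB : 0 < B) (hd : h ∣ B ∨ B ∣ h) (hk : B ∣ k₀) {T l : ℕ}
    (hT : h ∣ T) (hkT : k₀ + B ≤ T) (hl : l < 2 * B) : place h B k₀ l < 2 * T := by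
  obtain ⟨t, ht, hlt⟩ := exists_local hh hB hd hl
  have := place_upper_and_lower hh hB hd hk ht
  have h3 := lower_lt hh hT (show k₀ + t < T by omega)
  rcases hlt with rfl | rfl
  · rw [this.1]; omega
  · rw [this.2]; omega

end positions

/-! ### Fixed-point numbers and levels of the transforms -/

/-- Four registers, for the complex number `(a - b) + (c - d) i`. -/
structure Quad where
  a : ℕ
  b : ℕ
  c : ℕ
  d : ℕ

/-- The four registers from `R_i` on. -/
def quad (m : ℕ → ℕ) (i : ℕ) : Quad := ⟨m i, m (i + 1), m (i + 2), m (i + 3)⟩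

/-- All four registers are at most `M`. -/
def Quad.Le (q : Quad) (M : ℕ) : Prop := q.a ≤ M ∧ q.b ≤ M ∧ q.c ≤ M ∧ q.d ≤ M

/-- The product of two complex numbers with real and imaginary part stored with offset `2 * D` in
units of `1 / D`. -/
def zmul (D : ℕ) (x y : ℕ × ℕ) : ℕ × ℕ :=
  ((x.1 * y.1 + x.2 * (2 * D) + 2 * D * y.2 + 2 * D * D -
      (x.1 * (2 * D) + 2 * D * y.1 + x.2 * y.2)) / D,
    (x.1 * y.2 + x.2 * y.1 + 2 * (2 * D) * (2 * D) + 2 * D * D -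
      (x.1 * (2 * D) + 2 * D * y.2 + x.2 * (2 * D) + 2 * D * y.1)) / D)

/-- The differences in `zmul` are nonnegative. -/
def ZmulLegal (D : ℕ) (x y : ℕ × ℕ) : Prop :=
  x.1 * (2 * D) + 2 * D * y.1 + x.2 * y.2 ≤
      x.1 * y.1 + x.2 * (2 * D) + 2 * D * y.2 + 2 * D * D ∧
    x.1 * (2 * D) + 2 * D * y.2 + x.2 * (2 * D) + 2 * D * y.1 ≤
      x.1 * y.2 + x.2 * y.1 + 2 * (2 * D) * (2 * D) + 2 * D * D

/-- The powers of `ω`. -/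
def zpow (D : ℕ) (ω : ℕ × ℕ) : ℕ → ℕ × ℕ
  | 0 => (D + 2 * D, 2 * D)
  | j + 1 => zmul D (zpow D ω j) ω

/-- The sum in a butterfly of the forward transform. -/
def fwdLo (_D : ℕ) (_z : ℕ × ℕ) (u v : Quad) : Quad :=
  ⟨u.a + v.a, u.b + v.b, u.c + v.c, u.d + v.d⟩

/-- The twisted difference in a butterfly of the forward transform. -/
def fwdHi (D : ℕ) (z : ℕ × ℕ) (u v : Quad) : Quad :=
  ⟨((u.a + v.b) * z.1 + (u.b + v.a) * (2 * D) + (u.c + v.d) * (2 * D) + (u.d + v.c) * z.2) / D,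
    ((u.a + v.b) * (2 * D) + (u.b + v.a) * z.1 + (u.c + v.d) * z.2 + (u.d + v.c) * (2 * D)) / D,
    ((u.a + v.b) * z.2 + (u.b + v.a) * (2 * D) + (u.c + v.d) * z.1 + (u.d + v.c) * (2 * D)) / D,
    ((u.a + v.b) * (2 * D) + (u.b + v.a) * z.2 + (u.c + v.d) * (2 * D) + (u.d + v.c) * z.1) / D⟩

/-- The product of `v` and the conjugate of `z`. -/
def twist (D : ℕ) (z : ℕ × ℕ) (v : Quad) : Quad :=
  ⟨(v.a * z.1 + v.b * (2 * D) + v.c * z.2 + v.d * (2 * D)) / D,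
    (v.a * (2 * D) + v.b * z.1 + v.c * (2 * D) + v.d * z.2) / D,
    (v.c * z.1 + v.d * (2 * D) + v.a * (2 * D) + v.b * z.2) / D,
    (v.c * (2 * D) + v.d * z.1 + v.a * z.2 + v.b * (2 * D)) / D⟩

/-- The sum in a butterfly of the inverse transform. -/
def invLo (D : ℕ) (z : ℕ × ℕ) (u v : Quad) : Quad :=
  ⟨u.a + (twist D z v).a, u.b + (twist D z v).b, u.c + (twist D z v).c, u.d + (twist D z v).d⟩

/-- The difference in a butterfly of the inverse transform. -/
def invHi (D : ℕ) (z : ℕ × ℕ) (u v : Quad) : Quad :=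
  ⟨u.a + (twist D z v).b, u.b + (twist D z v).a, u.c + (twist D z v).d, u.d + (twist D z v).c⟩

/-- The product of two stored complex numbers. -/
def quadMul (D : ℕ) (u v : Quad) : Quad :=
  ⟨(u.a * v.a + u.b * v.b + u.c * v.d + u.d * v.c) / D,
    (u.a * v.b + u.b * v.a + u.c * v.c + u.d * v.d) / D,
    (u.a * v.c + u.b * v.d + u.c * v.a + u.d * v.b) / D,
    (u.a * v.d + u.b * v.c + u.c * v.b + u.d * v.a) / D⟩

/-- One level of a transform with butterflies at distance `h` and roots of unity `ζ`. -/
def level (lo hi : ℕ × ℕ → Quad → Quad → Quad) (h : ℕ) (ζ : ℕ → ℕ × ℕ) (A : ℕ → Quad) (i : ℕ) :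
    Quad :=
  if i % (2 * h) < h then lo (ζ (i % h)) (A i) (A (i + h)) else hi (ζ (i % h)) (A (i - h)) (A i)

theorem level_upper {lo hi : ℕ × ℕ → Quad → Quad → Quad} {h : ℕ} (hh : 0 < h)
    (ζ : ℕ → ℕ × ℕ) (A : ℕ → Quad) (k : ℕ) :
    level lo hi h ζ A (upper h k) = lo (ζ (k % h)) (A (upper h k)) (A (upper h k + h)) := by
  rw [level, if_pos (upper_mod_two_lt hh k), upper_mod_self]

theorem level_lower {lo hi : ℕ × ℕ → Quad → Quad → Quad} {h : ℕ} (hh : 0 < h)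
    (ζ : ℕ → ℕ × ℕ) (A : ℕ → Quad) (k : ℕ) :
    level lo hi h ζ A (upper h k + h) = hi (ζ (k % h)) (A (upper h k)) (A (upper h k + h)) := by
  rw [level, if_neg (not_lower_mod_two_lt hh k), lower_mod_self, Nat.add_sub_cancel]

end DepthCostRAM

namespace DepthCostRAM

open _root_.DepthCostRAM.Expr Block

/-! ### The program -/

/-- The words have `200 * S` bits, where `S` is the binary length of the input length. -/
abbrev wordFactor : ℕ := 200

/-- Bounds for the lengths of the contents of the registers, in units of `S`.  Registers:
`0` to `14` hold `n`, `S`, `2 ^ S`, `m`, the number `N` of points, the chunk size `B`, `D = 2 ^ p`,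
`2 * D`, the root of unity of order `2 * N`, `4 * B`, the address of the data, the address
`128 + 4 * B`, the address of the second half of the data, and `D * D`;
`16` and `17` hold `h` and the number of butterflies of the level. -/
def genv (j : ℕ) : ℕ :=
  [1, 1, 2, 1, 2, 2, 17, 18, 19, 19, 6, 6, 6, 6, 33, 2,
    2, 3, 19, 19, 3, 3, 12, 12, 12, 12, 3, 2, 34, 34, 34, 34,
    34, 34, 34, 34, 80, 80, 80, 80, 80, 80, 80, 80, 19, 19, 2, 3,
    34, 34, 36, 70, 3, 6, 40, 6, 8, 8, 8, 8, 1, 1, 1, 1].getD j 0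

/-- The real part of `zmul`, from the registers of the two factors. -/
def zmulRe (a b c d : ℕ) : Expr :=
  (var a * var c + var b * var 7 + var 7 * var d + var 7 * var 6 -
    (var a * var 7 + var 7 * var c + var b * var d)) / var 6

/-- The imaginary part of `zmul`, from the registers of the two factors. -/
def zmulIm (a b c d : ℕ) : Expr :=
  (var a * var d + var b * var c + lit 2 * var 7 * var 7 + var 7 * var 6 -
    (var a * var 7 + var 7 * var d + var b * var 7 + var 7 * var c)) / var 6

/-- Butterfly of the forward transform. -/
def fwdBlock : Block :=
  [(36, var 28 + var 32), (37, var 29 + var 33), (38, var 30 + var 34), (39, var 31 + var 35),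
    (40, ((var 28 + var 33) * var 44 + (var 29 + var 32) * var 7 + (var 30 + var 35) * var 7 +
      (var 31 + var 34) * var 45) / var 6),
    (41, ((var 28 + var 33) * var 7 + (var 29 + var 32) * var 44 + (var 30 + var 35) * var 45 +
      (var 31 + var 34) * var 7) / var 6),
    (42, ((var 28 + var 33) * var 45 + (var 29 + var 32) * var 7 + (var 30 + var 35) * var 44 +
      (var 31 + var 34) * var 7) / var 6),
    (43, ((var 28 + var 33) * var 7 + (var 29 + var 32) * var 45 + (var 30 + var 35) * var 7 +
      (var 31 + var 34) * var 44) / var 6)]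

/-- Butterfly of the inverse transform. -/
def invBlock : Block :=
  [(36, (var 32 * var 44 + var 33 * var 7 + var 34 * var 45 + var 35 * var 7) / var 6),
    (37, (var 32 * var 7 + var 33 * var 44 + var 34 * var 7 + var 35 * var 45) / var 6),
    (38, (var 34 * var 44 + var 35 * var 7 + var 32 * var 7 + var 33 * var 45) / var 6),
    (39, (var 34 * var 7 + var 35 * var 44 + var 32 * var 45 + var 33 * var 7) / var 6),
    (40, var 28 + var 37), (41, var 29 + var 36), (42, var 30 + var 39), (43, var 31 + var 38),
    (36, var 28 + var 36), (37, var 29 + var 37), (38, var 30 + var 38), (39, var 31 + var 39)]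

/-- Choice of the root of unity and of the two positions of a butterfly. -/
def prepBlock : Block :=
  [(46, lit 1 / (var 26 - var 26 / var 16 * var 16 + lit 1)),
    (44, var 46 * (var 6 + var 7) + (lit 1 - var 46) * var 44),
    (45, var 46 * var 7 + (lit 1 - var 46) * var 45),
    (24, lit 128 + lit 4 * (var 27 + var 21 * (var 27 / var 21))),
    (25, var 24 + lit 4 * var 21)]

/-- Passage to the next root of unity and the next butterfly. -/
def nextBlock : Block :=
  [(36, zmulRe 44 45 18 19), (45, zmulIm 44 45 18 19), (44, var 36),
    (27, var 27 + lit 1), (26, var 26 + lit 1)]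

/-- One butterfly in the near memory. -/
def bflyCmd (bf : Block) : Cmd :=
  .seq prepBlock.cmd <| .seq (copyCmd (.reg 24) (.const 28) (.const 4)) <|
  .seq (copyCmd (.reg 25) (.const 32) (.const 4)) <| .seq bf.cmd <|
  .seq (copyCmd (.const 36) (.reg 24) (.const 4)) <|
  .seq (copyCmd (.const 40) (.reg 25) (.const 4)) nextBlock.cmd

/-- The addresses of a chunk. -/
def chunkBlock : Block :=
  [(22, var 11 + lit 4 * (var 26 + var 16 * (var 26 / var 16))),
    (23, var 22 + lit 4 * var 20), (27, lit 0)]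

/-- A chunk of butterflies: copy to the near memory, process, copy back. -/
def chunkCmd (bf : Block) : Cmd :=
  .seq chunkBlock.cmd <| .seq (copyCmd (.reg 22) (.const 128) (.reg 10)) <|
  .seq (copyCmd (.reg 23) (.reg 12) (.reg 10)) <|
  .seq (.loop (.reg 27) (.reg 5) (bflyCmd bf)) <|
  .seq (copyCmd (.const 128) (.reg 22) (.reg 10)) (copyCmd (.reg 12) (.reg 23) (.reg 10))

/-- Preparation of the computation of the root of unity of a level. -/
def rootInitBlock : Block := [(47, var 4), (18, var 8), (19, var 9)]

/-- Squaring of a root of unity. -/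
def squareBlock : Block :=
  [(36, zmulRe 18 19 18 19), (19, zmulIm 18 19 18 19), (18, var 36), (47, var 47 / lit 2)]

/-- Maximum and minimum of `h` and `B`. -/
def maxBlock : Block :=
  [(46, lit 1 / (var 5 / (var 16 + lit 1) + lit 1)),
    (20, var 46 * var 16 + (lit 1 - var 46) * var 5),
    (21, var 16 + var 5 - var 20), (26, lit 0)]

/-- One level of a transform. -/
def levelCmd (bf : Block) : Cmd :=
  .seq rootInitBlock.cmd <| .seq (.loop (.reg 47) (.reg 16) squareBlock.cmd) <|
  .seq maxBlock.cmd (.loop (.reg 26) (.reg 17) (chunkCmd bf))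

/-! ### Auxiliary facts on memories -/

section memory

variable {m : ℕ → ℕ} {a b l r : ℕ}

theorem cpy_below (h : r < b) : cpy a b l m r = m r := if_neg (by omega)

theorem cpy_above (h : b + l ≤ r) : cpy a b l m r = m r := if_neg (by omega)

theorem cpy_apply {i : ℕ} (h : i < l) : cpy a b l m (b + i) = m (a + i) := by
  rw [cpy, if_pos (by omega), Nat.add_sub_cancel_left]

theorem quad_cpy_apply {i : ℕ} (h : i + 4 ≤ l) : quad (cpy a b l m) (b + i) = quad m (a + i) := by
  simp only [quad, Nat.add_assoc]
  rw [cpy_apply (by omega), cpy_apply (by omega), cpy_apply (by omega), cpy_apply (by omega)]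

theorem quad_cpy_of_disjoint (h : r + 4 ≤ b ∨ b + l ≤ r) : quad (cpy a b l m) r = quad m r := by
  simp only [quad, cpy]
  rw [if_neg (by omega), if_neg (by omega), if_neg (by omega), if_neg (by omega)]

theorem quad_congr {m m' : ℕ → ℕ} {i i' : ℕ} (h : ∀ j < 4, m (i + j) = m' (i' + j)) :
    quad m i = quad m' i' := by
  simp only [quad]
  rw [h 1 (by norm_num), h 2 (by norm_num), h 3 (by norm_num),
    show m i = m' i' from h 0 (by norm_num)]

theorem bd_cpy_high {env : ℕ → ℕ} {S : ℕ} (hm : Bd env S m) (hb : 64 ≤ b) :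
    Bd env S (cpy a b l m) := fun j hj => by
  rw [cpy_below (by omega)]; exact hm j hj

theorem bd_cpy_low {env : ℕ → ℕ} {S : ℕ} (hm : Bd env S m)
    (h : ∀ i < l, m (a + i) < 2 ^ (env (b + i) * S)) : Bd env S (cpy a b l m) := fun j hj => by
  rw [cpy]
  split_ifs with hj'
  · have := h (j - b) (by omega)
    rwa [show b + (j - b) = j by omega] at this
  · exact hm j hj

/-- For most registers the static bound after a block is no worse than before, which `decide`
confirms. The list `exc` collects the others, such as counters, doubled numbers and roots of unity,
whose static bound would grow with every iteration; for these the bound comes from knowledge of the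
actual value. -/
theorem bd_of_envAfter {wc S : ℕ} (hS : 1 ≤ S) {l : Block} (hc : chk wc genv l = true)
    (hm : Bd genv S m) (exc : List ℕ)
    (hst : (List.range 64).all (fun j => exc.contains j || decide (envAfter genv l j ≤ genv j)) =
      true)
    (hex : ∀ j ∈ exc, den l m j < 2 ^ (genv j * S)) : Bd genv S (den l m) := by
  intro j hj
  rw [List.all_eq_true] at hst
  have := hst j (List.mem_range.2 hj)
  simp only [Bool.or_eq_true, List.contains_iff_mem, decide_eq_true_eq] at this
  rcases this with h | h
  · exact hex j h
  · exact (bd_den hS l genv m hc hm j hj).trans_le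
      (Nat.pow_le_pow_right (by norm_num) (Nat.mul_le_mul_right _ h))

end memory

/-! ### Parameters of a run -/

/-- The numbers on which the run depends: the length `n` of the input, its binary length `S`, the
number `2 ^ L` of points, and the chunk size `2 ^ f`. -/
structure Setting where
  n : ℕ
  S : ℕ
  L : ℕ
  f : ℕ
  two_le_S : 2 ≤ S
  n_lt : n < 2 ^ S
  f_lt : f < L
  L_le : L ≤ S
  chunk_lt : 2 ^ f < 2 * S

namespace Setting

variable (P : Setting)

/-- The number of points. -/
def N : ℕ := 2 ^ P.L

/-- The chunk size. -/
def B : ℕ := 2 ^ P.f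

/-- The unit of fixed-point numbers is `1 / D`. -/
def D : ℕ := 2 ^ (16 * P.S)

/-- The address of the data. -/
def base : ℕ := 128 + 8 * P.B

/-- A bound for the cost of a copy within the near memory. -/
def near : ℕ := Nat.clog 2 P.base

/-- A bound for the cost of a copy from or to the data. -/
def far : ℕ := 8 * P.S

theorem N_le : P.N ≤ 2 ^ P.S := Nat.pow_le_pow_right (by norm_num) P.L_le

theorem N_pos : 0 < P.N := by unfold N; positivity

theorem B_pos : 0 < P.B := by unfold B; positivity

theorem D_pos : 0 < P.D := by unfold D; positivity

theorem two_B_dvd_N : 2 * P.B ∣ P.N := by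
  unfold B N
  rw [← pow_succ']
  exact pow_dvd_pow 2 P.f_lt

theorem two_B_le_N : 2 * P.B ≤ P.N := Nat.le_of_dvd P.N_pos P.two_B_dvd_N

theorem base_le_near : P.base ≤ 2 ^ P.near := Nat.le_pow_clog (by norm_num) _

theorem near_ge : 7 ≤ P.near := by
  have h1 : 128 ≤ 2 ^ P.near := le_trans (by simp [base]) P.base_le_near
  by_contra h
  have : 2 ^ P.near ≤ 2 ^ 6 := Nat.pow_le_pow_right (by norm_num) (by omega)
  omega

theorem address_le {x : ℕ} (h : x ≤ P.base + 16 * P.N) : x ≤ 2 ^ (6 * P.S) ∧ x < 2 ^ (6 * P.S) := by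
  have h1 := P.two_B_le_N
  have h2 := P.N_le
  have h3 : (2 : ℕ) ^ (P.S + 8) ≤ 2 ^ (6 * P.S) :=
    Nat.pow_le_pow_right (by norm_num) (by have := P.two_le_S; omega)
  have h4 : 4 ≤ 2 ^ P.S :=
    le_trans (by norm_num) (Nat.pow_le_pow_right (n := 2) (by norm_num) P.two_le_S)
  rw [pow_add] at h3
  unfold base at h
  omega

theorem address_le_far {x : ℕ} (h : x ≤ P.base + 16 * P.N) : x ≤ 2 ^ P.far :=
  (P.address_le h).1.trans (Nat.pow_le_pow_right (by norm_num) (by unfold far; omega))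

theorem four_B_le_far : 4 * P.B ≤ P.far := by
  have := P.chunk_lt; unfold B far; omega

/-- The word length. -/
abbrev w : ℕ := wordFactor * P.S

end Setting

/-- The fixed registers of a run, after the preparations. -/
structure Fix (P : Setting) (w₀ : ℕ × ℕ) (m : ℕ → ℕ) : Prop where
  r0 : m 0 = P.n
  r1 : m 1 = P.S
  r2 : m 2 = 2 ^ P.S
  r3 : m 3 = P.n / 2
  r4 : m 4 = P.N
  r5 : m 5 = P.B
  r6 : m 6 = P.D
  r7 : m 7 = 2 * P.D
  r8 : m 8 = w₀.1
  r9 : m 9 = w₀.2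
  r10 : m 10 = 4 * P.B
  r11 : m 11 = P.base
  r12 : m 12 = 128 + 4 * P.B
  r13 : m 13 = P.base + 4 * P.N

theorem Fix.congr {P : Setting} {w₀ : ℕ × ℕ} {m m' : ℕ → ℕ} (h : Fix P w₀ m)
    (he : ∀ j < 16, m' j = m j) : Fix P w₀ m' where
  r0 := by rw [he 0 (by norm_num), h.r0]
  r1 := by rw [he 1 (by norm_num), h.r1]
  r2 := by rw [he 2 (by norm_num), h.r2]
  r3 := by rw [he 3 (by norm_num), h.r3]
  r4 := by rw [he 4 (by norm_num), h.r4]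
  r5 := by rw [he 5 (by norm_num), h.r5]
  r6 := by rw [he 6 (by norm_num), h.r6]
  r7 := by rw [he 7 (by norm_num), h.r7]
  r8 := by rw [he 8 (by norm_num), h.r8]
  r9 := by rw [he 9 (by norm_num), h.r9]
  r10 := by rw [he 10 (by norm_num), h.r10]
  r11 := by rw [he 11 (by norm_num), h.r11]
  r12 := by rw [he 12 (by norm_num), h.r12]
  r13 := by rw [he 13 (by norm_num), h.r13]

/-- A block that performs the butterfly given by `lo` and `hi`. -/
structure IsButterfly (D : ℕ) (bf : Block) (lo hi : ℕ × ℕ → Quad → Quad → Quad) : Prop where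
  chk : Block.chk wordFactor genv bf = true
  within : Block.within 36 44 bf = true
  env : (List.range 64).all (fun j => [].contains j || decide (envAfter genv bf j ≤ genv j)) = true
  weight : Block.weight bf ≤ 5000
  legal : ∀ m : ℕ → ℕ, m 6 = D → m 7 = 2 * D → bf.Legal m
  lo : ∀ m : ℕ → ℕ, m 6 = D → m 7 = 2 * D →
    quad (den bf m) 36 = lo (m 44, m 45) (quad m 28) (quad m 32)
  hi : ∀ m : ℕ → ℕ, m 6 = D → m 7 = 2 * D →
    quad (den bf m) 40 = hi (m 44, m 45) (quad m 28) (quad m 32)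

theorem isButterfly_fwd {D : ℕ} (hD : 0 < D) :
    IsButterfly D fwdBlock (fwdLo D) (fwdHi D) where
  chk := by decide
  within := by decide
  env := by decide
  weight := by decide
  legal m h6 h7 := by
    simp [Block.Legal, fwdBlock, h6, hD.ne']
  lo m h6 h7 := by
    simp [quad, den, fwdBlock, fwdLo]
  hi m h6 h7 := by
    simp [quad, den, fwdBlock, fwdHi, h6, h7]

theorem isButterfly_inv {D : ℕ} (hD : 0 < D) :
    IsButterfly D invBlock (invLo D) (invHi D) where
  chk := by decide
  within := by decide
  env := by decide
  weight := by decide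
  legal m h6 h7 := by
    simp [Block.Legal, invBlock, h6, hD.ne']
  lo m h6 h7 := by
    simp [quad, den, invBlock, invLo, twist, h6, h7]
  hi m h6 h7 := by
    simp [quad, den, invBlock, invHi, twist, h6, h7]

end DepthCostRAM

namespace DepthCostRAM

open _root_.DepthCostRAM.Expr Block

/-! ### A butterfly -/

variable {inp : ℕ}

/-- The roots of unity used in a level are computed legally and remain small. -/
structure RootsOK (P : Setting) (h : ℕ) (ω : ℕ × ℕ) : Prop where
  legal : ∀ j < h, ZmulLegal P.D (zpow P.D ω j) ω
  bound : ∀ j ≤ h, (zpow P.D ω j).1 < 2 ^ (19 * P.S) ∧ (zpow P.D ω j).2 < 2 ^ (19 * P.S)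

/-- The state of the near memory after `t` butterflies of a chunk. -/
structure ChunkInv (P : Setting) (lo hi : ℕ × ℕ → Quad → Quad → Quad) (h k₀ : ℕ) (ω : ℕ × ℕ)
    (A : ℕ → Quad) (ms : ℕ → ℕ) (t : ℕ) (m : ℕ → ℕ) : Prop where
  frame : ∀ j < 24, m j = ms j
  far : ∀ r, P.base ≤ r → m r = ms r
  cnt : m 26 = k₀ + t
  loc : m 27 = t
  zeta : (k₀ + t) % h ≠ 0 → (m 44, m 45) = zpow P.D ω ((k₀ + t) % h)
  near : ∀ l < 2 * P.B, quad m (128 + 4 * l) =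
    if bfly h (place h P.B k₀ l) < k₀ + t then level lo hi h (zpow P.D ω) A (place h P.B k₀ l)
    else A (place h P.B k₀ l)
  bd : Bd genv P.S m

theorem sub_div_mul_eq_mod (k h : ℕ) : k - k / h * h = k % h := by
  have := Nat.div_add_mod' k h
  omega

theorem prepBlock_legal {m : ℕ → ℕ} (h16 : m 16 ≠ 0) (h21 : m 21 ≠ 0) : prepBlock.Legal m := by
  simp [Block.Legal, prepBlock, h16, h21, Nat.div_mul_le_self, sub_div_mul_eq_mod,
    Nat.div_le_self]

/-- The quotient 1 / (k mod h + 1) is 1 if h divides k and 0 otherwise. It serves as a flag that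
restarts the running power of ω at 1 (stored as 3D, 2D) at the beginning of each block, without a
conditional jump. Therefore nothing needs to be known about registers 44 and 45 at such a point. -/
theorem prepBlock_zeta {m : ℕ → ℕ} {D h k : ℕ} {ω : ℕ × ℕ} (h6 : m 6 = D) (h7 : m 7 = 2 * D)
    (h16 : m 16 = h) (h26 : m 26 = k) (hz : k % h ≠ 0 → (m 44, m 45) = zpow D ω (k % h)) :
    (den prepBlock m 44, den prepBlock m 45) = zpow D ω (k % h) := by
  have e1 : den prepBlock m 44 = 1 / (k % h + 1) * (D + 2 * D) + (1 - 1 / (k % h + 1)) * m 44 := by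
    simp [den, prepBlock, h6, h7, h16, h26, sub_div_mul_eq_mod]
  have e2 : den prepBlock m 45 = 1 / (k % h + 1) * (2 * D) + (1 - 1 / (k % h + 1)) * m 45 := by
    simp [den, prepBlock, h7, h16, h26, sub_div_mul_eq_mod]
  rw [e1, e2]
  by_cases h0 : k % h = 0
  · simp [h0, zpow]
  · rw [← hz h0, Nat.div_eq_of_lt (by omega)]
    simp

theorem nextBlock_legal {m : ℕ → ℕ} {D : ℕ} (hD : 0 < D) (h6 : m 6 = D) (h7 : m 7 = 2 * D)
    (hz : ZmulLegal D (m 44, m 45) (m 18, m 19)) : nextBlock.Legal m := by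
  obtain ⟨h1, h2⟩ := hz
  simp only at h1 h2
  simp [Block.Legal, nextBlock, zmulRe, zmulIm, h6, h7, hD.ne', h1, h2]

theorem nextBlock_zeta {m : ℕ → ℕ} {D : ℕ} (h6 : m 6 = D) (h7 : m 7 = 2 * D) :
    (den nextBlock m 44, den nextBlock m 45) = zmul D (m 44, m 45) (m 18, m 19) := by
  simp [den, nextBlock, zmulRe, zmulIm, h6, h7, zmul]

theorem quad_lt_of_le {m : ℕ → ℕ} {i M K : ℕ} (h : (quad m i).Le M) (hM : M < K) :
    ∀ j < 4, m (i + j) < K := by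
  intro j hj
  obtain ⟨h1, h2, h3, h4⟩ := h
  simp only [quad] at h1 h2 h3 h4
  interval_cases j
  · simpa using h1.trans_lt hM
  · exact h2.trans_lt hM
  · exact h3.trans_lt hM
  · exact h4.trans_lt hM

/-- All four copies have length 4 and addresses within the near area, hence cost `P.near` each,
which is of order log log n. The remaining work is a fixed number of operations on variables. -/
theorem bflyCmd_runs (P : Setting) {bf : Block} {lo hi : ℕ × ℕ → Quad → Quad → Quad}
    (hbf : IsButterfly P.D bf lo hi) {h k₀ M t : ℕ} {w₀ ω : ℕ × ℕ} {A : ℕ → Quad}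
    {ms m : ℕ → ℕ} {o : List Bool}
    (hfix : Fix P w₀ ms) (h16 : ms 16 = h) (hω : (ms 18, ms 19) = ω) (h21 : ms 21 = min h P.B)
    (hh : 0 < h) (hd : h ∣ P.B ∨ P.B ∣ h) (hk : P.B ∣ k₀) (ht : t < P.B)
    (hkt : k₀ + t + 1 < 2 ^ (3 * P.S))
    (hA : ∀ l < 2 * P.B, (A (place h P.B k₀ l)).Le M) (hM : M < 2 ^ (34 * P.S))
    (hroots : RootsOK P h ω) (hI : ChunkInv P lo hi h k₀ ω A ms t m) :
    ∃ m', ChunkInv P lo hi h k₀ ω A ms (t + 1) m' ∧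
      Runs P.w P.n inp (bflyCmd bf) ⟨m, o⟩ ⟨m', o⟩ (10000 * wordCost P.n + 4 * P.near) := by
  have hS : 1 ≤ P.S := by have := P.two_le_S; omega
  have hB := P.B_pos
  have hnear := P.near_ge
  have hbase := P.base_le_near
  have hbdef : P.base = 128 + 8 * P.B := rfl
  have hfixm := hfix.congr (m' := m) fun j hj => hI.frame j (by omega)
  have e16 : m 16 = h := (hI.frame 16 (by norm_num)).trans h16
  have e21 : m 21 = min h P.B := (hI.frame 21 (by norm_num)).trans h21
  -- positions
  set la := upper (min h P.B) t with hla
  set lb := la + min h P.B with hlb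
  have hlb_lt : lb < 2 * P.B := lower_lt (by omega) (min_dvd_of_dvd hh hB hd) ht
  have hab : la < lb := by omega
  obtain ⟨pa, pb⟩ := place_upper_and_lower hh hB hd hk ht
  rw [← hla] at pa pb
  rw [← hlb] at pb
  have hmodlt : (k₀ + t) % h < h := Nat.mod_lt _ hh
  -- preparation
  have hr1 : Runs P.w P.n inp prepBlock.cmd ⟨m, o⟩ ⟨den prepBlock m, o⟩
      (weight prepBlock * wordCost P.n) :=
    Block.runs hS hI.bd (by decide) (prepBlock_legal (by omega) (by omega))
  have z1 := prepBlock_zeta (D := P.D) (ω := ω) hfixm.r6 hfixm.r7 e16 hI.cnt hI.zeta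
  have a1 : den prepBlock m 24 = 128 + 4 * la := by
    simp [den, prepBlock, hI.loc, e21, hla, upper]
  have b1 : den prepBlock m 25 = 128 + 4 * lb := by
    simp [den, prepBlock, hI.loc, e21, hlb, hla, upper]; ring
  have f1 : ∀ j, j < 24 ∨ 47 ≤ j ∨ j = 26 ∨ j = 27 → den prepBlock m j = m j := by
    intro j hj
    refine den_of_ne _ _ _ ?_
    simp [prepBlock]; omega
  -- Registers 44 and 45 are exceptions: statically, the flag times a root could be too long, but by
  -- `prepBlock_zeta` they hold a power of ω, which `RootsOK` bounds.
  have bd1 : Bd genv P.S (den prepBlock m) := by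
    refine bd_of_envAfter (wc := wordFactor) hS (by decide) hI.bd [44, 45] (by decide) ?_
    have := hroots.bound _ hmodlt.le
    rw [← z1] at this
    simpa [genv] using this
  -- After each stage the new memory is made opaque, and only the recorded facts on it are passed
  -- on; otherwise the terms would grow with every stage.
  generalize hm1 : den prepBlock m = m1 at hr1 z1 a1 b1 f1 bd1
  -- fetch
  have n1 : ∀ l < 2 * P.B, quad m1 (128 + 4 * l) = quad m (128 + 4 * l) := fun l _ =>
    quad_congr fun j _ => f1 _ (by omega)
  have hna : ∀ l < 2 * P.B, ¬ bfly h (place h P.B k₀ l) < k₀ + t →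
      quad m1 (128 + 4 * l) = A (place h P.B k₀ l) := by
    intro l hl hn
    rw [n1 l hl, hI.near l hl, if_neg hn]
  have qa : quad m1 (128 + 4 * la) = A (place h P.B k₀ la) :=
    hna la (by omega) (by rw [pa, bfly_upper hh]; omega)
  have qb : quad m1 (128 + 4 * lb) = A (place h P.B k₀ lb) :=
    hna lb hlb_lt (by rw [pb, bfly_lower hh]; omega)
  have hr2 : Runs P.w P.n inp (copyCmd (.reg 24) (.const 28) (.const 4)) ⟨m1, o⟩
      ⟨cpy (128 + 4 * la) 28 4 m1, o⟩ P.near :=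
    runs_copy (by simp [Arg.Low]) (by trivial) (by trivial) a1 rfl rfl (by omega) (by omega)
      (by omega)
      (by omega) (by omega) (by omega)
  have bd2 : Bd genv P.S (cpy (128 + 4 * la) 28 4 m1) := by
    refine bd_cpy_low bd1 fun i hi => ?_
    have := quad_lt_of_le (K := 2 ^ (34 * P.S)) (qa ▸ hA la (by omega)) hM i hi
    interval_cases i <;> simpa [genv] using this
  generalize hm2 : cpy (128 + 4 * la) 28 4 m1 = m2 at hr2 bd2
  have f2 : ∀ j, j < 28 ∨ 32 ≤ j → m2 j = m1 j := by
    intro j hj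
    rw [← hm2]
    rcases hj with hj | hj
    · exact cpy_below hj
    · exact cpy_above (by omega)
  have u2 : quad m2 28 = A (place h P.B k₀ la) := by
    rw [← qa, ← hm2]; exact quad_cpy_apply (i := 0) le_rfl
  have qb2 : quad m2 (128 + 4 * lb) = A (place h P.B k₀ lb) := by
    rw [← qb]; exact quad_congr fun j _ => f2 _ (by omega)
  have hr3 : Runs P.w P.n inp (copyCmd (.reg 25) (.const 32) (.const 4)) ⟨m2, o⟩
      ⟨cpy (128 + 4 * lb) 32 4 m2, o⟩ P.near :=
    runs_copy (by simp [Arg.Low]) (by trivial) (by trivial) ((f2 25 (by omega)).trans b1) rfl rfl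
      (by omega) (by omega) (by omega) (by omega) (by omega) (by omega)
  have bd3 : Bd genv P.S (cpy (128 + 4 * lb) 32 4 m2) := by
    refine bd_cpy_low bd2 fun i hi => ?_
    have := quad_lt_of_le (K := 2 ^ (34 * P.S)) (qb2 ▸ hA lb hlb_lt) hM i hi
    interval_cases i <;> simpa [genv] using this
  generalize hm3 : cpy (128 + 4 * lb) 32 4 m2 = m3 at hr3 bd3
  have f3 : ∀ j, j < 32 ∨ 36 ≤ j → m3 j = m2 j := by
    intro j hj
    rw [← hm3]
    rcases hj with hj | hj
    · exact cpy_below hj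
    · exact cpy_above (by omega)
  have u3 : quad m3 28 = A (place h P.B k₀ la) := by
    rw [← u2]; exact quad_congr fun j _ => f3 _ (by omega)
  have v3 : quad m3 32 = A (place h P.B k₀ lb) := by
    rw [← qb2, ← hm3]; exact quad_cpy_apply (i := 0) le_rfl
  have g3 : ∀ j, j < 24 ∨ 47 ≤ j ∨ j = 26 ∨ j = 27 → m3 j = m j := fun j hj => by
    rw [f3 j (by omega), f2 j (by omega), f1 j hj]
  have z3 : (m3 44, m3 45) = zpow P.D ω ((k₀ + t) % h) := by
    rw [f3 44 (by omega), f3 45 (by omega), f2 44 (by omega), f2 45 (by omega), z1]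
  have hfix3 := hfixm.congr (m' := m3) fun j hj => g3 j (by omega)
  -- butterfly
  have hr4 : Runs P.w P.n inp bf.cmd ⟨m3, o⟩ ⟨den bf m3, o⟩ (weight bf * wordCost P.n) :=
    Block.runs hS bd3 hbf.chk (hbf.legal m3 hfix3.r6 hfix3.r7)
  have x4 := hbf.lo m3 hfix3.r6 hfix3.r7
  have y4 := hbf.hi m3 hfix3.r6 hfix3.r7
  have bd4 : Bd genv P.S (den bf m3) := bd_of_envAfter hS hbf.chk bd3 [] hbf.env (by simp)
  have f4 : ∀ j, j < 36 ∨ 44 ≤ j → den bf m3 j = m3 j := fun j hj => den_outside hbf.within hj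
  generalize hm4 : den bf m3 = m4 at hr4 x4 y4 bd4 f4
  rw [z3, u3, v3, pa, pb, ← level_upper (lo := lo) (hi := hi) hh (zpow P.D ω) A] at x4
  rw [z3, u3, v3, pa, pb, ← level_lower (lo := lo) (hi := hi) hh (zpow P.D ω) A] at y4
  have a4 : m4 24 = 128 + 4 * la := by
    rw [f4 24 (by omega), f3 24 (by omega), f2 24 (by omega), a1]
  have b4 : m4 25 = 128 + 4 * lb := by
    rw [f4 25 (by omega), f3 25 (by omega), f2 25 (by omega), b1]
  -- store
  have hr5 : Runs P.w P.n inp (copyCmd (.const 36) (.reg 24) (.const 4)) ⟨m4, o⟩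
      ⟨cpy 36 (128 + 4 * la) 4 m4, o⟩ P.near :=
    runs_copy (by trivial) (by simp [Arg.Low]) (by trivial) rfl a4 rfl (by omega) (by omega)
      (by omega)
      (by omega) (by omega) (by omega)
  have bd5 : Bd genv P.S (cpy 36 (128 + 4 * la) 4 m4) := bd_cpy_high bd4 (by omega)
  generalize hm5 : cpy 36 (128 + 4 * la) 4 m4 = m5 at hr5 bd5
  have f5 : ∀ j, j < 128 + 4 * la ∨ 128 + 4 * la + 4 ≤ j → m5 j = m4 j := by
    intro j hj
    rw [← hm5]
    rcases hj with hj | hj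
    · exact cpy_below hj
    · exact cpy_above (by omega)
  have hr6 : Runs P.w P.n inp (copyCmd (.const 40) (.reg 25) (.const 4)) ⟨m5, o⟩
      ⟨cpy 40 (128 + 4 * lb) 4 m5, o⟩ P.near :=
    runs_copy (by trivial) (by simp [Arg.Low]) (by trivial) rfl ((f5 25 (by omega)).trans b4) rfl
      (by omega) (by omega) (by omega) (by omega) (by omega) (by omega)
  have bd6 : Bd genv P.S (cpy 40 (128 + 4 * lb) 4 m5) := bd_cpy_high bd5 (by omega)
  generalize hm6 : cpy 40 (128 + 4 * lb) 4 m5 = m6 at hr6 bd6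
  have f6 : ∀ j, j < 128 + 4 * lb ∨ 128 + 4 * lb + 4 ≤ j → m6 j = m5 j := by
    intro j hj
    rw [← hm6]
    rcases hj with hj | hj
    · exact cpy_below hj
    · exact cpy_above (by omega)
  have g6 : ∀ j, j < 24 ∨ (47 ≤ j ∧ j < 128) ∨ j = 26 ∨ j = 27 ∨ P.base ≤ j → m6 j = m j :=
    fun j hj => by
      rw [f6 j (by omega), f5 j (by omega), f4 j (by omega), g3 j (by omega)]
  have z6 : (m6 44, m6 45) = zpow P.D ω ((k₀ + t) % h) := by
    rw [f6 44 (by omega), f6 45 (by omega), f5 44 (by omega), f5 45 (by omega),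
      f4 44 (by omega), f4 45 (by omega), z3]
  have n6a : quad m6 (128 + 4 * la) = level lo hi h (zpow P.D ω) A (upper h (k₀ + t)) := by
    have e : quad m6 (128 + 4 * la) = quad m5 (128 + 4 * la) :=
      quad_congr fun j _ => f6 _ (by omega)
    rw [e, ← x4, ← hm5]
    exact quad_cpy_apply (i := 0) le_rfl
  have n6b : quad m6 (128 + 4 * lb) = level lo hi h (zpow P.D ω) A (upper h (k₀ + t) + h) := by
    have e : quad m5 40 = quad m4 40 := quad_congr fun j _ => f5 _ (by omega)
    rw [← y4, ← e, ← hm6]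
    exact quad_cpy_apply (i := 0) le_rfl
  have n6 : ∀ l < 2 * P.B, l ≠ la → l ≠ lb → quad m6 (128 + 4 * l) = quad m (128 + 4 * l) := by
    intro l hl h1 h2
    refine quad_congr fun j _ => ?_
    rw [f6 _ (by omega), f5 _ (by omega), f4 _ (by omega), g3 _ (by omega)]
  have hfix6 := hfixm.congr (m' := m6) fun j hj => g6 j (by omega)
  have w6 : (m6 18, m6 19) = ω := by
    rw [g6 18 (by omega), g6 19 (by omega), hI.frame 18 (by omega), hI.frame 19 (by omega), hω]
  -- next root
  have hr7 : Runs P.w P.n inp nextBlock.cmd ⟨m6, o⟩ ⟨den nextBlock m6, o⟩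
      (weight nextBlock * wordCost P.n) :=
    Block.runs hS bd6 (by decide) (nextBlock_legal P.D_pos hfix6.r6 hfix6.r7
      (by rw [z6, w6]; exact hroots.legal _ hmodlt))
  have z7 : (den nextBlock m6 44, den nextBlock m6 45) = zpow P.D ω ((k₀ + t) % h + 1) := by
    rw [nextBlock_zeta hfix6.r6 hfix6.r7, z6, w6]; rfl
  have k7 : den nextBlock m6 26 = k₀ + t + 1 := by
    have : m6 26 = k₀ + t := (g6 26 (by omega)).trans hI.cnt
    simp [den, nextBlock, this]
  have t7 : den nextBlock m6 27 = t + 1 := by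
    have : m6 27 = t := (g6 27 (by omega)).trans hI.loc
    simp [den, nextBlock, this]
  have f7 : ∀ j, j < 26 ∨ 46 ≤ j → den nextBlock m6 j = m6 j := fun j hj =>
    den_outside (lo := 26) (hi := 46) (by decide) hj
  have bd7 : Bd genv P.S (den nextBlock m6) := by
    refine bd_of_envAfter (wc := wordFactor) hS (by decide) bd6 [26, 27, 44, 45] (by decide) ?_
    have h1 := hroots.bound ((k₀ + t) % h + 1) hmodlt
    rw [← z7] at h1
    have h2 : t + 1 < 2 ^ (2 * P.S) := by
      have h3 := P.two_B_le_N
      have h4 := P.N_le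
      have : 2 ^ P.S ≤ 2 ^ (2 * P.S) := Nat.pow_le_pow_right (by norm_num) (by omega)
      omega
    simp only [List.mem_cons, List.not_mem_nil, or_false, forall_eq_or_imp, forall_eq]
    refine ⟨?_, ?_, ?_, ?_⟩
    · rw [k7]; exact hkt
    · rw [t7]; exact h2
    · exact h1.1
    · exact h1.2
  refine ⟨den nextBlock m6, ⟨?_, ?_, by rw [k7]; ring, t7, ?_, ?_, bd7⟩, ?_⟩
  · intro j hj
    rw [f7 j (by omega), g6 j (by omega), hI.frame j hj]
  · intro r hr
    rw [f7 r (by omega), g6 r (by omega), hI.far r hr]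
  -- If the running exponent has reached h, the next butterfly starts a new block and the hypothesis
  -- `hne` fails; otherwise the remainder has just increased by 1.
  · intro hne
    rw [z7]
    congr 1
    rw [← Nat.add_assoc] at hne ⊢
    have h1 := Nat.div_add_mod (k₀ + t) h
    by_cases hlt : (k₀ + t) % h + 1 < h
    · have : k₀ + t + 1 = h * ((k₀ + t) / h) + ((k₀ + t) % h + 1) := by omega
      rw [this, Nat.mul_add_mod, Nat.mod_eq_of_lt hlt]
    · exfalso
      apply hne
      have : k₀ + t + 1 = h * ((k₀ + t) / h) + h := by omega
      rw [this, Nat.mul_add_mod, Nat.mod_self]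
  · intro l hl
    have e7 : quad (den nextBlock m6) (128 + 4 * l) = quad m6 (128 + 4 * l) :=
      quad_congr fun j _ => f7 _ (by omega)
    rw [e7]
    by_cases h1 : l = la
    · rw [h1, n6a, pa, bfly_upper hh, if_pos (by omega)]
    by_cases h2 : l = lb
    · rw [h2, n6b, pb, bfly_lower hh, if_pos (by omega)]
    rw [n6 l hl h1 h2, hI.near l hl]
    -- An entry different from the two just written belongs to another butterfly, so being already
    -- processed means the same before and after this step.
    have h3 : bfly h (place h P.B k₀ l) ≠ k₀ + t := fun he => by
      rcases eq_of_bfly_place hh hB hd hk ht he with h' | h'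
      · exact h1 h'
      · exact h2 h'
    by_cases h4 : bfly h (place h P.B k₀ l) < k₀ + t
    · rw [if_pos h4, if_pos (by omega)]
    · rw [if_neg h4, if_neg (by omega)]
  · have := hr1.seq (hr2.seq (hr3.seq (hr4.seq (hr5.seq (hr6.seq hr7)))))
    refine this.mono ?_
    have e1 : weight prepBlock ≤ 2000 := by decide
    have e2 : weight nextBlock ≤ 2000 := by decide
    have e3 := hbf.weight
    nlinarith [Nat.mul_le_mul_right (wordCost P.n) e1, Nat.mul_le_mul_right (wordCost P.n) e2,
      Nat.mul_le_mul_right (wordCost P.n) e3]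

end DepthCostRAM

namespace DepthCostRAM

open _root_.DepthCostRAM.Expr Block

/-! ### A chunk of butterflies -/

variable {inp : ℕ}

/-- The state of the memory after the first `k₀` butterflies of a level. -/
structure LevelInv (P : Setting) (lo hi : ℕ × ℕ → Quad → Quad → Quad) (h T : ℕ) (ω : ℕ × ℕ)
    (A : ℕ → Quad) (ms : ℕ → ℕ) (k₀ : ℕ) (m : ℕ → ℕ) : Prop where
  frame : ∀ j < 22, m j = ms j
  rest : ∀ r, P.base + 8 * T ≤ r → m r = ms r
  cnt : m 26 = k₀
  zeta : k₀ % h ≠ 0 → (m 44, m 45) = zpow P.D ω (k₀ % h)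
  data : ∀ i < 2 * T, quad m (P.base + 4 * i) =
    if bfly h i < k₀ then level lo hi h (zpow P.D ω) A i else A i
  bd : Bd genv P.S m

/-- Four long copies at cost `P.far`, of order log n, are paid once for B butterflies. This
amortization is what brings the cost of a butterfly down to order log log n. -/
theorem chunkCmd_runs (P : Setting) {bf : Block} {lo hi : ℕ × ℕ → Quad → Quad → Quad}
    (hbf : IsButterfly P.D bf lo hi) {h k₀ M T : ℕ} {w₀ ω : ℕ × ℕ} {A : ℕ → Quad}
    {ms m : ℕ → ℕ} {o : List Bool}
    (hfix : Fix P w₀ ms) (h16 : ms 16 = h) (hω : (ms 18, ms 19) = ω) (h20 : ms 20 = max h P.B)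
    (h21 : ms 21 = min h P.B)
    (hh : 0 < h) (hd : h ∣ P.B ∨ P.B ∣ h) (hk : P.B ∣ k₀) (hT : T ≤ P.N) (hhT : h ∣ T)
    (hkT : k₀ + P.B ≤ T)
    (hA : ∀ i < 2 * T, (A i).Le M) (hM : M < 2 ^ (34 * P.S))
    (hroots : RootsOK P h ω) (hI : LevelInv P lo hi h T ω A ms k₀ m) :
    ∃ m', LevelInv P lo hi h T ω A ms (k₀ + P.B) m' ∧
      Runs P.w P.n inp (chunkCmd bf) ⟨m, o⟩ ⟨m', o⟩
        (P.B * (10016 * wordCost P.n + 4 * P.near) + 2000 * wordCost P.n + 4 * P.far) := by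
  have hS : 1 ≤ P.S := by have := P.two_le_S; omega
  have hB := P.B_pos
  have hbdef : P.base = 128 + 8 * P.B := rfl
  have hfar := P.four_B_le_far
  have hbase_far : P.base ≤ 2 ^ P.far := P.address_le_far (by omega)
  have hfixm := hfix.congr (m' := m) fun j hj => hI.frame j (by omega)
  have e16 : m 16 = h := (hI.frame 16 (by norm_num)).trans h16
  have e20 : m 20 = max h P.B := (hI.frame 20 (by norm_num)).trans h20
  set u₀ := upper h k₀ with hu₀
  set v₀ := u₀ + max h P.B with hv₀
  have hplace : ∀ l, place h P.B k₀ l = if l < P.B then u₀ + l else v₀ + (l - P.B) := fun l => rfl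
  have hlt : ∀ l < 2 * P.B, place h P.B k₀ l < 2 * T := fun l hl => place_lt hh hB hd hk hhT hkT hl
  -- The last entry of the second vector is a valid position, which bounds the whole vector and
  -- hence all addresses that occur.
  have hv₀T : v₀ + P.B ≤ 2 * T := by
    have := hlt (2 * P.B - 1) (by omega)
    rw [hplace, if_neg (by omega)] at this
    omega
  have huv : u₀ + P.B ≤ v₀ := by omega
  -- addresses
  have hr1 : Runs P.w P.n inp chunkBlock.cmd ⟨m, o⟩ ⟨den chunkBlock m, o⟩
      (weight chunkBlock * wordCost P.n) :=
    Block.runs hS hI.bd (by decide) (by simp [Block.Legal, chunkBlock, e16, hh.ne'])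
  have a1 : den chunkBlock m 22 = P.base + 4 * u₀ := by
    simp [den, chunkBlock, hI.cnt, e16, hu₀, upper, hfixm.r11]
  have b1 : den chunkBlock m 23 = P.base + 4 * v₀ := by
    simp [den, chunkBlock, hI.cnt, e16, e20, hv₀, hu₀, upper, hfixm.r11]; ring
  have t1 : den chunkBlock m 27 = 0 := by simp [den, chunkBlock]
  have f1 : ∀ j, j < 22 ∨ 28 ≤ j ∨ j = 26 → den chunkBlock m j = m j := by
    intro j hj
    refine den_of_ne _ _ _ ?_
    simp [chunkBlock]; omega
  have bd1 : Bd genv P.S (den chunkBlock m) :=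
    bd_of_envAfter (wc := wordFactor) hS (by decide) hI.bd [] (by decide) (by simp)
  generalize hm1 : den chunkBlock m = m1 at hr1 a1 b1 t1 f1 bd1
  -- copy to the near memory
  have hr2 : Runs P.w P.n inp (copyCmd (.reg 22) (.const 128) (.reg 10)) ⟨m1, o⟩
      ⟨cpy (P.base + 4 * u₀) 128 (4 * P.B) m1, o⟩ P.far :=
    runs_copy (by simp [Arg.Low]) (by trivial) (by simp [Arg.Low]) a1 rfl
      ((f1 10 (by omega)).trans hfixm.r10) (by omega) (by omega) (by omega)
      (P.address_le_far (by omega)) (by omega) hfar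
  have bd2 : Bd genv P.S (cpy (P.base + 4 * u₀) 128 (4 * P.B) m1) := bd_cpy_high bd1 (by omega)
  generalize hm2 : cpy (P.base + 4 * u₀) 128 (4 * P.B) m1 = m2 at hr2 bd2
  have f2 : ∀ j, j < 128 ∨ 128 + 4 * P.B ≤ j → m2 j = m1 j := by
    intro j hj
    rw [← hm2]
    rcases hj with hj | hj
    · exact cpy_below hj
    · exact cpy_above (by omega)
  have hr3 : Runs P.w P.n inp (copyCmd (.reg 23) (.reg 12) (.reg 10)) ⟨m2, o⟩
      ⟨cpy (P.base + 4 * v₀) (128 + 4 * P.B) (4 * P.B) m2, o⟩ P.far :=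
    runs_copy (by simp [Arg.Low]) (by simp [Arg.Low]) (by simp [Arg.Low])
      ((f2 23 (by omega)).trans b1)
      (by show m2 12 = _; rw [f2 12 (by omega), f1 12 (by omega), hfixm.r12])
      (by show m2 10 = _; rw [f2 10 (by omega), f1 10 (by omega), hfixm.r10])
      (by omega) (by omega) (by omega) (P.address_le_far (by omega)) (by omega) hfar
  have bd3 : Bd genv P.S (cpy (P.base + 4 * v₀) (128 + 4 * P.B) (4 * P.B) m2) :=
    bd_cpy_high bd2 (by omega)
  generalize hm3 : cpy (P.base + 4 * v₀) (128 + 4 * P.B) (4 * P.B) m2 = m3 at hr3 bd3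
  have f3 : ∀ j, j < 128 + 4 * P.B ∨ P.base ≤ j → m3 j = m2 j := by
    intro j hj
    rw [← hm3]
    rcases hj with hj | hj
    · exact cpy_below hj
    · exact cpy_above (by omega)
  have g3 : ∀ j, j < 22 ∨ (28 ≤ j ∧ j < 128) ∨ j = 26 ∨ P.base ≤ j → m3 j = m j := fun j hj => by
    rw [f3 j (by omega), f2 j (by omega), f1 j (by omega)]
  -- The positions of the chunk belong to butterflies from number k₀ on, so none of them has been
  -- processed in this level.
  have near3 : ∀ l < 2 * P.B, quad m3 (128 + 4 * l) = A (place h P.B k₀ l) := by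
    intro l hl
    have hdat := hI.data _ (hlt l hl)
    rw [if_neg (by have := (bfly_place hh hB hd hk hl).1; omega)] at hdat
    rw [← hdat, hplace]
    split_ifs with hlB
    · have e1 : quad m3 (128 + 4 * l) = quad m2 (128 + 4 * l) :=
        quad_congr fun j _ => f3 _ (by omega)
      rw [e1, ← hm2, quad_cpy_apply (by omega)]
      refine quad_congr fun j _ => ?_
      rw [f1 _ (by omega)]
      congr 1; omega
    · have e1 : 128 + 4 * l = 128 + 4 * P.B + 4 * (l - P.B) := by omega
      rw [e1, ← hm3, quad_cpy_apply (by omega)]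
      refine quad_congr fun j _ => ?_
      rw [f2 _ (by omega), f1 _ (by omega)]
      congr 1; omega
  have hfix3 := hfixm.congr (m' := m3) fun j hj => g3 j (by omega)
  -- butterflies
  have hinv0 : ChunkInv P lo hi h k₀ ω A m3 0 m3 := by
    refine ⟨fun _ _ => rfl, fun _ _ => rfl, ?_, ?_, ?_, ?_, bd3⟩
    · rw [g3 26 (by omega), hI.cnt, Nat.add_zero]
    · rw [f3 27 (by omega), f2 27 (by omega), t1]
    · intro hne
      rw [g3 44 (by omega), g3 45 (by omega)]
      exact hI.zeta hne
    · intro l hl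
      rw [if_neg (by have := (bfly_place hh hB hd hk hl).1; omega), near3 l hl]
  obtain ⟨m4, hs4, hr4⟩ := Runs.loop_mem (o := o) (w := P.w) (n := P.n) (inp := inp)
    (A := .reg 27) (A' := .reg 5) (by simp [Arg.Low]) (by simp [Arg.Low]) (c := bflyCmd bf)
    (fun t m' => ChunkInv P lo hi h k₀ ω A m3 t m') (T := P.B)
    (K := 10000 * wordCost P.n + 4 * P.near)
    (by
      intro t ht m' hI'
      constructor
      · show m' 27 ≠ m' 5
        rw [hI'.loc, hI'.frame 5 (by norm_num), hfix3.r5]; omega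
      · obtain ⟨m'', h1, h2⟩ := bflyCmd_runs P hbf hfix3 (ms := m3) (o := o)
          (by rw [g3 16 (by omega), e16])
          (by rw [g3 18 (by omega), g3 19 (by omega), hI.frame 18 (by omega),
                hI.frame 19 (by omega), hω])
          (by rw [g3 21 (by omega), hI.frame 21 (by omega), h21]) hh hd hk ht
          (by
            have h1 := P.N_le
            have h2 : 2 ^ (P.S + 1) ≤ 2 ^ (3 * P.S) :=
              Nat.pow_le_pow_right (by norm_num) (by omega)
            rw [pow_succ] at h2
            have h3 := P.N_pos
            omega)
          (fun l hl => hA _ (hlt l hl)) hM hroots hI'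
        exact ⟨m'', h1, h2⟩)
    (by
      intro m' hI'
      show m' 27 = m' 5
      rw [hI'.loc, hI'.frame 5 (by norm_num), hfix3.r5])
    hinv0
  have a4 : m4 22 = P.base + 4 * u₀ := by
    rw [hs4.frame 22 (by omega), f3 22 (by omega), f2 22 (by omega), a1]
  have b4 : m4 23 = P.base + 4 * v₀ := by
    rw [hs4.frame 23 (by omega), f3 23 (by omega), f2 23 (by omega), b1]
  have c4 : m4 10 = 4 * P.B := by rw [hs4.frame 10 (by omega), hfix3.r10]
  have d4 : m4 12 = 128 + 4 * P.B := by rw [hs4.frame 12 (by omega), hfix3.r12]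
  have near4 : ∀ l < 2 * P.B, quad m4 (128 + 4 * l) =
      level lo hi h (zpow P.D ω) A (place h P.B k₀ l) := fun l hl => by
    rw [hs4.near l hl, if_pos (bfly_place hh hB hd hk hl).2]
  have g4 : ∀ r, P.base ≤ r → m4 r = m r := fun r hr => by
    rw [hs4.far r hr, g3 r (by omega)]
  -- copy back
  have hr5 : Runs P.w P.n inp (copyCmd (.const 128) (.reg 22) (.reg 10)) ⟨m4, o⟩
      ⟨cpy 128 (P.base + 4 * u₀) (4 * P.B) m4, o⟩ P.far :=
    runs_copy (by trivial) (by simp [Arg.Low]) (by simp [Arg.Low]) rfl a4 c4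
      (by omega) (by omega) (by omega) (by omega) (P.address_le_far (by omega)) hfar
  have bd5 : Bd genv P.S (cpy 128 (P.base + 4 * u₀) (4 * P.B) m4) :=
    bd_cpy_high hs4.bd (by omega)
  generalize hm5 : cpy 128 (P.base + 4 * u₀) (4 * P.B) m4 = m5 at hr5 bd5
  have f5 : ∀ j, j < P.base + 4 * u₀ ∨ P.base + 4 * u₀ + 4 * P.B ≤ j → m5 j = m4 j := by
    intro j hj
    rw [← hm5]
    rcases hj with hj | hj
    · exact cpy_below hj
    · exact cpy_above (by omega)
  have hr6 : Runs P.w P.n inp (copyCmd (.reg 12) (.reg 23) (.reg 10)) ⟨m5, o⟩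
      ⟨cpy (128 + 4 * P.B) (P.base + 4 * v₀) (4 * P.B) m5, o⟩ P.far :=
    runs_copy (by simp [Arg.Low]) (by simp [Arg.Low]) (by simp [Arg.Low])
      ((f5 12 (by omega)).trans d4) ((f5 23 (by omega)).trans b4) ((f5 10 (by omega)).trans c4)
      (by omega) (by omega) (by omega) (by omega) (P.address_le_far (by omega)) hfar
  have bd6 : Bd genv P.S (cpy (128 + 4 * P.B) (P.base + 4 * v₀) (4 * P.B) m5) :=
    bd_cpy_high bd5 (by omega)
  generalize hm6 : cpy (128 + 4 * P.B) (P.base + 4 * v₀) (4 * P.B) m5 = m6 at hr6 bd6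
  have f6 : ∀ j, j < P.base + 4 * v₀ ∨ P.base + 4 * v₀ + 4 * P.B ≤ j → m6 j = m5 j := by
    intro j hj
    rw [← hm6]
    rcases hj with hj | hj
    · exact cpy_below hj
    · exact cpy_above (by omega)
  refine ⟨m6, ⟨?_, ?_, ?_, ?_, ?_, bd6⟩, ?_⟩
  · intro j hj
    rw [f6 j (by omega), f5 j (by omega), hs4.frame j (by omega), g3 j (by omega), hI.frame j hj]
  · intro r hr
    rw [f6 r (by omega), f5 r (by omega), g4 r (by omega), hI.rest r hr]
  · rw [f6 26 (by omega), f5 26 (by omega), hs4.cnt]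
  · intro hne
    rw [f6 44 (by omega), f5 44 (by omega), f6 45 (by omega), f5 45 (by omega)]
    exact hs4.zeta hne
  · intro i hi'
    -- Positions in the chunk have been written back from the near area. All others are unchanged,
    -- and by `exists_place` their butterflies lie outside the chunk, so their status is unchanged
    -- too.
    by_cases hex : ∃ l < 2 * P.B, place h P.B k₀ l = i
    · obtain ⟨l, hl, rfl⟩ := hex
      rw [if_pos (bfly_place hh hB hd hk hl).2, ← near4 l hl, hplace]
      split_ifs with hlB
      · have e1 : quad m6 (P.base + 4 * (u₀ + l)) = quad m5 (P.base + 4 * u₀ + 4 * l) := by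
          refine quad_congr fun j _ => ?_
          rw [f6 _ (by omega)]; congr 1; omega
        rw [e1, ← hm5, quad_cpy_apply (by omega)]
      · have e1 : P.base + 4 * (v₀ + (l - P.B)) = P.base + 4 * v₀ + 4 * (l - P.B) := by ring
        rw [e1, ← hm6, quad_cpy_apply (by omega)]
        refine quad_congr fun j _ => ?_
        rw [f5 _ (by omega)]; congr 1; omega
    · have h1 : ¬ (u₀ ≤ i ∧ i < u₀ + P.B) := fun hc => hex ⟨i - u₀, by omega, by
        rw [hplace, if_pos (by omega)]; omega⟩
      have h2 : ¬ (v₀ ≤ i ∧ i < v₀ + P.B) := fun hc => hex ⟨P.B + (i - v₀), by omega, by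
        rw [hplace, if_neg (by omega)]; omega⟩
      have e1 : quad m6 (P.base + 4 * i) = quad m (P.base + 4 * i) := by
        refine quad_congr fun j _ => ?_
        rw [f6 _ (by omega), f5 _ (by omega), g4 _ (by omega)]
      rw [e1, hI.data i hi']
      have h3 : ¬ (k₀ ≤ bfly h i ∧ bfly h i < k₀ + P.B) := fun hc =>
        hex (exists_place hh hB hd hk hc.1 hc.2)
      by_cases h4 : bfly h i < k₀
      · rw [if_pos h4, if_pos (by omega)]
      · rw [if_neg h4, if_neg (by omega)]
  · have := hr1.seq (hr2.seq (hr3.seq (hr4.seq (hr5.seq hr6))))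
    refine this.mono ?_
    have e1 : weight chunkBlock ≤ 1000 := by decide
    have e2 : 10000 * wordCost P.n + 4 * P.near + 16 * wordCost P.n =
      10016 * wordCost P.n + 4 * P.near := by ring
    rw [e2]
    have := Nat.mul_le_mul_right (wordCost P.n) e1
    omega

/-! ### A level -/

/-- Iterated squares of a root of unity. -/
def zsq (D : ℕ) (w₀ : ℕ × ℕ) : ℕ → ℕ × ℕ
  | 0 => w₀
  | i + 1 => zmul D (zsq D w₀ i) (zsq D w₀ i)

/-- The roots of unity of all levels are computed legally and remain small. -/
structure SquaresOK (P : Setting) (w₀ : ℕ × ℕ) : Prop where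
  legal : ∀ i < P.L, ZmulLegal P.D (zsq P.D w₀ i) (zsq P.D w₀ i)
  bound : ∀ i ≤ P.L, (zsq P.D w₀ i).1 < 2 ^ (19 * P.S) ∧ (zsq P.D w₀ i).2 < 2 ^ (19 * P.S)
  roots : ∀ i, 1 ≤ i → i ≤ P.L → RootsOK P (2 ^ (P.L - i)) (zsq P.D w₀ i)

/-- The root `w₀` approximates one of order 2N; after e squarings the order is 2h with h = 2^(L -
e). Register 47 starts at N and is halved along with each squaring, so reaching h signals the right
number. The count T is N for the two forward transforms done together and N/2 for the inverse
transform. -/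
theorem levelCmd_runs (P : Setting) {bf : Block} {lo hi : ℕ × ℕ → Quad → Quad → Quad}
    (hbf : IsButterfly P.D bf lo hi) {e M T : ℕ} {w₀ : ℕ × ℕ} {A : ℕ → Quad}
    {m : ℕ → ℕ} {o : List Bool} (hfix : Fix P w₀ m) (hsq : SquaresOK P w₀)
    (he : 1 ≤ e) (heL : e ≤ P.L) (h16 : m 16 = 2 ^ (P.L - e)) (h17 : m 17 = T) (hT : T ≤ P.N)
    (hhT : 2 ^ (P.L - e) ∣ T) (hBT : P.B ∣ T)
    (hA : ∀ i < 2 * T, quad m (P.base + 4 * i) = A i) (hAM : ∀ i < 2 * T, (A i).Le M)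
    (hM : M < 2 ^ (34 * P.S)) (hbd : Bd genv P.S m) :
    ∃ m', (∀ j < 18, m' j = m j) ∧ (∀ r, P.base + 8 * T ≤ r → m' r = m r) ∧
      (∀ i < 2 * T, quad m' (P.base + 4 * i) =
        level lo hi (2 ^ (P.L - e)) (zpow P.D (zsq P.D w₀ e)) A i) ∧ Bd genv P.S m' ∧
      Runs P.w P.n inp (levelCmd bf) ⟨m, o⟩ ⟨m', o⟩
        (P.L * (3000 * wordCost P.n) + 2000 * wordCost P.n +
          T / P.B * (P.B * (10016 * wordCost P.n + 4 * P.near) + 2016 * wordCost P.n +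
            4 * P.far)) := by
  have hS : 1 ≤ P.S := by have := P.two_le_S; omega
  have hB := P.B_pos
  set h := 2 ^ (P.L - e) with hh_def
  have hh : 0 < h := by positivity
  -- initialization
  have hr1 : Runs P.w P.n inp rootInitBlock.cmd ⟨m, o⟩ ⟨den rootInitBlock m, o⟩
      (weight rootInitBlock * wordCost P.n) :=
    Block.runs hS hbd (by decide) (by simp [Block.Legal, rootInitBlock])
  have g1 : den rootInitBlock m 47 = P.N := by simp [den, rootInitBlock, hfix.r4]
  have w1 : (den rootInitBlock m 18, den rootInitBlock m 19) = w₀ := by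
    simp [den, rootInitBlock, hfix.r8, hfix.r9]
  have f1 : ∀ j, j < 18 ∨ 48 ≤ j → den rootInitBlock m j = m j := fun j hj =>
    den_outside (lo := 18) (hi := 48) (by decide) hj
  have bd1 : Bd genv P.S (den rootInitBlock m) :=
    bd_of_envAfter (wc := wordFactor) hS (by decide) hbd [] (by decide) (by simp)
  generalize hm1 : den rootInitBlock m = m1 at hr1 g1 w1 f1 bd1
  -- squaring
  obtain ⟨m2, ⟨g2, w2, f2, bd2⟩, hr2⟩ := Runs.loop_mem (o := o) (w := P.w) (n := P.n) (inp := inp)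
    (A := .reg 47) (A' := .reg 16) (by simp [Arg.Low]) (by simp [Arg.Low]) (c := squareBlock.cmd)
    (fun i m' => m' 47 = 2 ^ (P.L - i) ∧ (m' 18, m' 19) = zsq P.D w₀ i ∧
      (∀ j, j < 18 ∨ 48 ≤ j → m' j = m j) ∧ Bd genv P.S m') (T := e)
    (K := weight squareBlock * wordCost P.n)
    (by
      rintro i hi m' ⟨hg, hw, hf, hb⟩
      have hfix' := hfix.congr (m' := m') fun j hj => hf j (by omega)
      constructor
      · show m' 47 ≠ m' 16
        rw [hg, hf 16 (by omega), h16, hh_def]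
        intro hc
        have := Nat.pow_right_injective (le_refl 2) hc
        omega
      · have hw1 : m' 18 = (zsq P.D w₀ i).1 := by rw [← hw]
        have hw2 : m' 19 = (zsq P.D w₀ i).2 := by rw [← hw]
        have hleg := hsq.legal i (by omega)
        rw [← hw] at hleg
        obtain ⟨l1, l2⟩ := hleg
        simp only at l1 l2
        have hz : (den squareBlock m' 18, den squareBlock m' 19) = zsq P.D w₀ (i + 1) := by
          rw [zsq, ← hw]
          simp [den, squareBlock, zmulRe, zmulIm, hfix'.r6, hfix'.r7, zmul]
        refine ⟨den squareBlock m', ⟨?_, hz, ?_, ?_⟩, Block.runs hS hb (by decide) ?_⟩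
        · have : P.L - i = P.L - (i + 1) + 1 := by omega
          simp [den, squareBlock, hg]
          rw [this, pow_succ, Nat.mul_div_cancel _ (by norm_num)]
        · intro j hj
          rw [← hf j hj]
          exact den_outside (lo := 18) (hi := 48) (by decide) hj
        · refine bd_of_envAfter (wc := wordFactor) hS (by decide) hb [18, 19] (by decide) ?_
          have := hsq.bound (i + 1) (by omega)
          rw [← hz] at this
          simpa [genv] using this
        · simp [Block.Legal, squareBlock, zmulRe, zmulIm, hfix'.r6, hfix'.r7, P.D_pos.ne', l1, l2])
    (by
      rintro m' ⟨hg, -, hf, -⟩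
      show m' 47 = m' 16
      rw [hg, hf 16 (by omega), h16])
    ⟨g1, w1, f1, bd1⟩
  have hfix2 := hfix.congr (m' := m2) fun j hj => f2 j (by omega)
  have e16 : m2 16 = h := (f2 16 (by omega)).trans h16
  -- maximum and minimum
  have hmax : 1 / (P.B / (h + 1) + 1) * h + (1 - 1 / (P.B / (h + 1) + 1)) * P.B = max h P.B := by
    rcases Nat.lt_or_ge h P.B with hlt | hge
    · have : 1 ≤ P.B / (h + 1) := (Nat.one_le_div_iff (by omega)).2 hlt
      rw [Nat.div_eq_of_lt (by omega), max_eq_right hlt.le]; simp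
    · rw [Nat.div_eq_of_lt (show P.B < h + 1 by omega), max_eq_left hge]; simp
  have hr3 : Runs P.w P.n inp maxBlock.cmd ⟨m2, o⟩ ⟨den maxBlock m2, o⟩
      (weight maxBlock * wordCost P.n) := by
    refine Block.runs hS bd2 (by decide) ?_
    simp only [Block.Legal, maxBlock]
    simp [e16, hfix2.r5, Nat.div_le_self]
    rw [hmax]; omega
  have c3 : den maxBlock m2 20 = max h P.B := by
    simp only [den, maxBlock]
    simp [e16, hfix2.r5, hmax]
  have d3 : den maxBlock m2 21 = min h P.B := by
    simp only [den, maxBlock]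
    simp [e16, hfix2.r5, hmax]
    omega
  have k3 : den maxBlock m2 26 = 0 := by simp [den, maxBlock]
  have f3 : ∀ j, j < 20 ∨ 47 ≤ j → den maxBlock m2 j = m2 j := fun j hj =>
    den_outside (lo := 20) (hi := 47) (by decide) hj
  have bd3 : Bd genv P.S (den maxBlock m2) := by
    refine bd_of_envAfter (wc := wordFactor) hS (by decide) bd2 [20, 21] (by decide) ?_
    have h1 : max h P.B < 2 ^ (3 * P.S) := by
      have h1 := P.two_B_le_N
      have h2 := P.N_le
      have h3 : h ≤ P.N := Nat.pow_le_pow_right (by norm_num) (by omega)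
      have h4 : 2 ^ P.S < 2 ^ (3 * P.S) := Nat.pow_lt_pow_right (by norm_num) (by omega)
      omega
    simp only [List.mem_cons, List.not_mem_nil, or_false, forall_eq_or_imp, forall_eq, c3, d3]
    exact ⟨h1, lt_of_le_of_lt (by omega) h1⟩
  generalize hm3 : den maxBlock m2 = m3 at hr3 c3 d3 k3 f3 bd3
  have g3 : ∀ j, j < 18 ∨ 48 ≤ j → m3 j = m j := fun j hj => by
    rw [f3 j (by omega), f2 j hj]
  have hfix3 := hfix.congr (m' := m3) fun j hj => g3 j (by omega)
  have hd : h ∣ P.B ∨ P.B ∣ h := by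
    rcases Nat.le_total (P.L - e) P.f with hle | hle
    · exact Or.inl (pow_dvd_pow 2 hle)
    · exact Or.inr (pow_dvd_pow 2 hle)
  -- chunks
  have hq : T / P.B * P.B = T := Nat.div_mul_cancel hBT
  have hbdef : P.base = 128 + 8 * P.B := rfl
  obtain ⟨m4, hs4, hr4⟩ := Runs.loop_mem (o := o) (w := P.w) (n := P.n) (inp := inp)
    (A := .reg 26) (A' := .reg 17) (by simp [Arg.Low]) (by simp [Arg.Low]) (c := chunkCmd bf)
    (fun i m' => LevelInv P lo hi h T (zsq P.D w₀ e) A m3 (i * P.B) m')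
    (T := T / P.B)
    (K := P.B * (10016 * wordCost P.n + 4 * P.near) + 2000 * wordCost P.n + 4 * P.far)
    (by
      intro i hi m' hI'
      have hle : i * P.B + P.B ≤ T := by
        have : (i + 1) * P.B ≤ T / P.B * P.B := Nat.mul_le_mul_right _ hi
        rw [hq] at this
        linarith
      constructor
      · show m' 26 ≠ m' 17
        rw [hI'.cnt, hI'.frame 17 (by norm_num), g3 17 (by omega), h17]; omega
      · obtain ⟨m'', h1, h2⟩ := chunkCmd_runs P hbf hfix3 (ms := m3) (o := o)
          (by rw [f3 16 (by omega), e16])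
          (by rw [f3 18 (by omega), f3 19 (by omega), w2]) c3 d3 hh hd
          (Dvd.intro_left _ rfl) hT hhT hle hAM hM (hsq.roots e he heL) hI'
        refine ⟨m'', ?_, h2⟩
        rwa [add_mul, one_mul])
    (by
      intro m' hI'
      show m' 26 = m' 17
      rw [hI'.cnt, hI'.frame 17 (by norm_num), g3 17 (by omega), h17, hq])
    (by
      refine ⟨fun _ _ => rfl, fun _ _ => rfl, ?_, ?_, ?_, bd3⟩
      · rw [k3, zero_mul]
      · simp
      · intro i hi'
        rw [if_neg (by simp), ← hA i hi']
        exact quad_congr fun j _ => g3 _ (by omega))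
  rw [hq] at hs4
  refine ⟨m4, ?_, ?_, ?_, hs4.bd, ?_⟩
  · intro j hj
    rw [hs4.frame j (by omega), g3 j (by omega)]
  · intro r hr
    rw [hs4.rest r hr, g3 r (by omega)]
  · intro i hi'
    rw [hs4.data i hi', if_pos (bfly_lt hh hhT hi')]
  · refine (hr1.seq (hr2.seq (hr3.seq hr4))).mono ?_
    have e1 : weight rootInitBlock ≤ 500 := by decide
    have e2 : weight maxBlock ≤ 1000 := by decide
    have e3 : weight squareBlock + 16 ≤ 3000 := by decide
    have i1 := Nat.mul_le_mul_right (wordCost P.n) e1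
    have i2 := Nat.mul_le_mul_right (wordCost P.n) e2
    have i3 : e * (weight squareBlock * wordCost P.n + 16 * wordCost P.n) ≤
        P.L * (3000 * wordCost P.n) := by
      rw [← add_mul]
      exact Nat.mul_le_mul heL (Nat.mul_le_mul_right _ e3)
    have e4 : P.B * (10016 * wordCost P.n + 4 * P.near) + 2000 * wordCost P.n + 4 * P.far +
      16 * wordCost P.n = P.B * (10016 * wordCost P.n + 4 * P.near) + 2016 * wordCost P.n +
        4 * P.far := by ring
    rw [e4]
    omega

end DepthCostRAM

namespace DepthCostRAM

open _root_.DepthCostRAM.Expr Block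

variable {inp : ℕ}

/-! ### Integer square roots -/

/-- Initialization of the computation of a square root. -/
def sqrtInit : Block := [(49, lit 0), (50, lit 4 * var 14)]

/-- One step of the computation of a square root: the next binary digit. -/
def sqrtStep : Block :=
  [(49, var 49 + var 50 *
      (lit 1 / ((var 49 + var 50) * (var 49 + var 50) / (var 51 + lit 1) + lit 1))),
    (50, var 50 / lit 2)]

/-- Square root of the number in register 51. -/
def sqrtCmd : Cmd := .seq sqrtInit.cmd (.loop (.reg 50) (.const 0) sqrtStep.cmd)

/-- Binary digits of the root from the top: r² ≤ a < (r + 2b)² is kept, where b is the next digit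
weight to be tried. The hypothesis on a says that the root has at most 32S + 3 bits, the top weight
being 4·2^(32S). -/
theorem sqrtCmd_runs (P : Setting) {m : ℕ → ℕ} {o : List Bool} {a : ℕ} (hbd : Bd genv P.S m)
    (h14 : m 14 = 2 ^ (32 * P.S)) (h51 : m 51 = a) (ha : a < (8 * 2 ^ (32 * P.S)) ^ 2) :
    ∃ m', m' 49 = Nat.sqrt a ∧ (∀ j, j ≠ 49 → j ≠ 50 → m' j = m j) ∧ Bd genv P.S m' ∧
      Runs P.w P.n inp sqrtCmd ⟨m, o⟩ ⟨m', o⟩ (40 * P.S * (1000 * wordCost P.n)) := by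
  have hS : 1 ≤ P.S := by have := P.two_le_S; omega
  have hS2 := P.two_le_S
  set q := 32 * P.S + 2 with hq
  have ha' : a < 2 ^ (34 * P.S) * 2 ^ (34 * P.S) := by
    refine ha.trans_le ?_
    rw [← pow_add, mul_pow, ← pow_mul, show (8 : ℕ) ^ 2 = 2 ^ 6 by norm_num, ← pow_add]
    exact Nat.pow_le_pow_right (by norm_num) (by omega)
  have hr1 : Runs P.w P.n inp sqrtInit.cmd ⟨m, o⟩ ⟨den sqrtInit m, o⟩
      (weight sqrtInit * wordCost P.n) :=
    Block.runs hS hbd (by decide) (by simp [Block.Legal, sqrtInit])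
  have r1 : den sqrtInit m 49 = 0 := by simp [den, sqrtInit]
  have b1 : den sqrtInit m 50 = 2 ^ (q + 1) / 2 := by
    simp [den, sqrtInit, h14, hq, pow_succ]; omega
  have f1 : ∀ j, j ≠ 49 → j ≠ 50 → den sqrtInit m j = m j := by
    intro j h1 h2; refine den_of_ne _ _ _ ?_; simp [sqrtInit]; omega
  have bd1 : Bd genv P.S (den sqrtInit m) :=
    bd_of_envAfter (wc := wordFactor) hS (by decide) hbd [] (by decide) (by simp)
  generalize den sqrtInit m = m1 at hr1 r1 b1 f1 bd1
  obtain ⟨m2, ⟨b2, l2, u2, f2, bd2⟩, hr2⟩ := Runs.loop_mem (o := o) (w := P.w) (n := P.n)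
    (inp := inp) (A := .reg 50) (A' := .const 0) (by simp [Arg.Low]) (by trivial)
    (c := sqrtStep.cmd) (K := weight sqrtStep * wordCost P.n)
    -- Writing the weight as 2^(q + 1 - i) / 2 makes it 0 after the digit of weight 1 has been
    -- treated, which is precisely the exit condition of the loop.
    (fun i m' => m' 50 = 2 ^ (q + 1 - i) / 2 ∧ m' 49 * m' 49 ≤ a ∧
      a < (m' 49 + 2 ^ (q + 1 - i)) * (m' 49 + 2 ^ (q + 1 - i)) ∧
      (∀ j, j ≠ 49 → j ≠ 50 → m' j = m j) ∧ Bd genv P.S m') (T := q + 1)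
    (by
      rintro i hi m' ⟨hb, hl, hu, hf, hbd'⟩
      have e1 : q + 1 - i = q + 1 - (i + 1) + 1 := by omega
      rw [e1, pow_succ, Nat.mul_div_cancel _ (by norm_num)] at hb
      rw [e1, pow_succ] at hu
      set b := 2 ^ (q + 1 - (i + 1)) with hbdef
      have hbpos : 0 < b := by positivity
      have e51 : m' 51 = a := (hf 51 (by norm_num) (by norm_num)).trans h51
      have hstep : ∃ r', den sqrtStep m' 49 = r' ∧ r' * r' ≤ a ∧ a < (r' + b) * (r' + b) := by
        refine ⟨_, rfl, ?_⟩
        have : den sqrtStep m' 49 =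
            m' 49 + b * (1 / ((m' 49 + b) * (m' 49 + b) / (a + 1) + 1)) := by
          simp [den, sqrtStep, hb, e51]
        rw [this]
        rcases Nat.lt_or_ge a ((m' 49 + b) * (m' 49 + b)) with hlt | hge
        · have h1 : 1 ≤ (m' 49 + b) * (m' 49 + b) / (a + 1) :=
            (Nat.one_le_div_iff (by omega)).2 hlt
          rw [Nat.div_eq_of_lt (show 1 < (m' 49 + b) * (m' 49 + b) / (a + 1) + 1 by omega)]
          exact ⟨by simpa using hl, by simpa using hlt⟩
        · rw [Nat.div_eq_of_lt (show (m' 49 + b) * (m' 49 + b) < a + 1 by omega)]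
          refine ⟨by simpa using hge, ?_⟩
          have : m' 49 + b * (1 / (0 + 1)) + b = m' 49 + b * 2 := by simp; ring
          rw [this]; exact hu
      obtain ⟨r', hr', hl', hu'⟩ := hstep
      refine ⟨?_, den sqrtStep m', ⟨?_, by rw [hr']; exact hl', by rw [hr']; exact hu', ?_, ?_⟩,
        Block.runs hS hbd' (by decide) ?_⟩
      · show m' 50 ≠ 0
        omega
      · simp [den, sqrtStep, hb]
      · intro j h1 h2
        rw [← hf j h1 h2]
        refine den_of_ne _ _ _ ?_
        simp [sqrtStep]; omega
      · refine bd_of_envAfter (wc := wordFactor) hS (by decide) hbd' [49] (by decide) ?_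
        simp only [List.mem_singleton, forall_eq, hr']
        show r' < 2 ^ (34 * P.S)
        by_contra hc
        have := Nat.mul_le_mul (not_lt.1 hc) (not_lt.1 hc)
        omega
      · simp [Block.Legal, sqrtStep])
    (by rintro m' ⟨hb, -⟩; show m' 50 = 0; rw [hb]; simp)
    ⟨b1, by rw [r1]; omega, by
      rw [r1]
      refine ha.trans_le (le_of_eq ?_)
      simp [hq, pow_succ]; ring, f1, bd1⟩
  refine ⟨m2, ?_, f2, bd2, (hr1.seq hr2).mono ?_⟩
  · refine Nat.eq_sqrt.2 ⟨l2, ?_⟩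
    simpa using u2
  · have e1 : weight sqrtInit ≤ 200 := by decide
    have e2 : weight sqrtStep + 16 ≤ 1000 := by decide
    have i1 := Nat.mul_le_mul_right (wordCost P.n) e1
    have i2 : (q + 1) * (weight sqrtStep * wordCost P.n + 16 * wordCost P.n) ≤
        (q + 1) * (1000 * wordCost P.n) := by
      rw [← add_mul]; exact Nat.mul_le_mul_left _ (Nat.mul_le_mul_right _ e2)
    have i3 : (q + 2) * (1000 * wordCost P.n) ≤ 40 * P.S * (1000 * wordCost P.n) :=
      Nat.mul_le_mul_right _ (by omega)
    have e3 : (q + 2) * (1000 * wordCost P.n) =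
      (q + 1) * (1000 * wordCost P.n) + 1000 * wordCost P.n := by ring
    omega

/-! ### Preparations -/

/-- Approximations of `2 * cos (π / 2 ^ (i + 1))` in units of `1 / E`. -/
def cosSeq (E : ℕ) : ℕ → ℕ
  | 0 => 0
  | i + 1 => Nat.sqrt ((2 * E + cosSeq E i) * E)

/-- The approximation, with offset, of the root of unity `exp (π * I / 2 ^ L)`. -/
def rootZero (D L : ℕ) : ℕ × ℕ :=
  (cosSeq (D * D) (L - 1) / (2 * D) + 2 * D,
    Nat.sqrt (4 * (D * D) * (D * D) - cosSeq (D * D) (L - 1) * cosSeq (D * D) (L - 1)) / (2 * D) +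
      2 * D)

/-- The value 2E, standing for 2 cos 0, is a fixed point of the recursion. -/
theorem cosSeq_le (E i : ℕ) : cosSeq E i ≤ 2 * E := by
  induction i with
  | zero => simp [cosSeq]
  | succ i ih =>
    rw [cosSeq]
    have h1 := Nat.sqrt_le ((2 * E + cosSeq E i) * E)
    by_contra hc
    have h2 : 2 * E + 1 ≤ Nat.sqrt ((2 * E + cosSeq E i) * E) := by omega
    have h3 := Nat.mul_le_mul h2 h2
    have h4 : (2 * E + cosSeq E i) * E ≤ (4 * E) * E := Nat.mul_le_mul_right _ (by omega)
    nlinarith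

/-- Before the computation of the binary length of `n`. -/
def sizeInit : Block := [(47, var 0), (1, lit 0), (2, lit 1)]

/-- One step of the computation of the binary length of `n`. -/
def sizeStep : Block := [(47, var 47 / lit 2), (1, var 1 + lit 1), (2, var 2 * lit 2)]

/-- Unit of fixed-point numbers and number of pieces. -/
def unitBlock : Block :=
  [(3, var 0 / lit 2), (6, var 2 * var 2), (6, var 6 * var 6), (6, var 6 * var 6),
    (6, var 6 * var 6), (7, lit 2 * var 6), (14, var 6 * var 6),
    (15, (var 3 + var 1 - lit 1) / var 1), (4, lit 1),
    (46, lit 1 / (var 4 / (lit 2 * var 15) + lit 1))]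

/-- One step of the computation of the number of points. -/
def pointsStep : Block := [(4, lit 2 * var 4), (46, lit 1 / (var 4 / (lit 2 * var 15) + lit 1))]

/-- Before the computation of the chunk size. -/
def chunkInit : Block :=
  [(5, lit 1), (46, lit 1 / (var 5 / var 1 + lit 2 * var 5 / var 4 + lit 1))]

/-- One step of the computation of the chunk size. -/
def chunkStep : Block :=
  [(5, lit 2 * var 5), (46, lit 1 / (var 5 / var 1 + lit 2 * var 5 / var 4 + lit 1))]

/-- Addresses. -/
def addrBlock : Block :=
  [(10, lit 4 * var 5), (11, lit 128 + lit 8 * var 5), (12, lit 128 + lit 4 * var 5),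
    (13, var 11 + lit 4 * var 4), (48, lit 0), (47, lit 2)]

/-- Radicand of the half-angle formula. -/
def halfBlock : Block := [(51, (lit 2 * var 14 + var 48) * var 14)]

/-- Passage to the next half-angle. -/
def halfNext : Block := [(48, var 49), (47, lit 2 * var 47)]

/-- Radicand for the sine. -/
def sinBlock : Block := [(51, lit 4 * var 14 * var 14 - var 48 * var 48)]

/-- The first root of unity. -/
def rootBlock : Block :=
  [(8, var 48 / (lit 2 * var 6) + var 7), (9, var 49 / (lit 2 * var 6) + var 7)]

/-- The computation of all parameters. -/
def paramsCmd : Cmd :=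
  .seq sizeInit.cmd <| .seq (.loop (.reg 47) (.const 0) sizeStep.cmd) <|
  .seq unitBlock.cmd <| .seq (.loop (.reg 46) (.const 0) pointsStep.cmd) <|
  .seq chunkInit.cmd <| .seq (.loop (.reg 46) (.const 0) chunkStep.cmd) addrBlock.cmd

/-- The computation of the first root of unity. -/
def rootCmd : Cmd :=
  .seq (.loop (.reg 47) (.reg 4) (.seq halfBlock.cmd (.seq sqrtCmd halfNext.cmd))) <|
  .seq sinBlock.cmd (.seq sqrtCmd rootBlock.cmd)

theorem Setting.D_mul_D (P : Setting) : P.D * P.D = 2 ^ (32 * P.S) := by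
  unfold Setting.D; rw [← pow_add]; congr 1; ring

/-- After i half-angle steps register 48 approximates 2 cos(π / 2^(i + 1)), so L - 1 steps lead to
the angle π / 2^L; the doubling counter in register 47 reaches N at that moment. The sine is the
square root of 4E² - x². The O(S) roots take O(S) digit steps each, which gives the quadratic cost.
-/
theorem rootCmd_runs (P : Setting) {m : ℕ → ℕ} {o : List Bool} {w₀ : ℕ × ℕ} (hfix : Fix P w₀ m)
    (h14 : m 14 = P.D * P.D) (h48 : m 48 = 0) (h47 : m 47 = 2) (hbd : Bd genv P.S m) :
    ∃ m', Fix P (rootZero P.D P.L) m' ∧ (∀ r, 64 ≤ r → m' r = m r) ∧ m' 15 = m 15 ∧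
      Bd genv P.S m' ∧
      Runs P.w P.n inp rootCmd ⟨m, o⟩ ⟨m', o⟩ (100 * P.S * P.S * (1000 * wordCost P.n)) := by
  have hS : 1 ≤ P.S := by have := P.two_le_S; omega
  have hS2 := P.two_le_S
  have hL : 1 ≤ P.L := by have := P.f_lt; omega
  set E := P.D * P.D with hE
  have hE2 : E = 2 ^ (32 * P.S) := P.D_mul_D
  have hEpos : 0 < E := by rw [hE2]; positivity
  have hW := wordCost_pos P.n
  obtain ⟨m1, ⟨g1, x1, f1, bd1⟩, hr1⟩ := Runs.loop_mem (o := o) (w := P.w) (n := P.n)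
    (inp := inp) (A := .reg 47) (A' := .reg 4) (by simp [Arg.Low]) (by simp [Arg.Low])
    (c := .seq halfBlock.cmd (.seq sqrtCmd halfNext.cmd))
    (K := 42 * P.S * (1000 * wordCost P.n))
    (fun i m' => m' 47 = 2 ^ (i + 1) ∧ m' 48 = cosSeq E i ∧
      (∀ j, j < 47 ∨ 52 ≤ j → m' j = m j) ∧ Bd genv P.S m') (T := P.L - 1)
    (by
      rintro i hi m' ⟨hg, hx, hf, hb⟩
      have e14 : m' 14 = E := (hf 14 (by omega)).trans h14
      have hxl := cosSeq_le E i
      refine ⟨?_, ?_⟩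
      · show m' 47 ≠ m' 4
        rw [hg, hf 4 (by omega), hfix.r4, Setting.N]
        intro hc
        have := Nat.pow_right_injective (le_refl 2) hc
        omega
      · have hra : Runs P.w P.n inp halfBlock.cmd ⟨m', o⟩ ⟨den halfBlock m', o⟩
            (weight halfBlock * wordCost P.n) :=
          Block.runs hS hb (by decide) (by simp [Block.Legal, halfBlock])
        have a1 : den halfBlock m' 51 = (2 * E + cosSeq E i) * E := by
          simp [den, halfBlock, e14, hx]
        have fa : ∀ j, j ≠ 51 → den halfBlock m' j = m' j := by
          intro j h1; refine den_of_ne _ _ _ ?_; simp [halfBlock]; omega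
        have bda : Bd genv P.S (den halfBlock m') :=
          bd_of_envAfter (wc := wordFactor) hS (by decide) hb [] (by decide) (by simp)
        generalize den halfBlock m' = ma at hra a1 fa bda
        obtain ⟨mb, hrb, fb, bdb, runb⟩ := sqrtCmd_runs (inp := inp) (o := o) P bda
          (by rw [fa 14 (by omega), e14, hE2]) a1 (by rw [← hE2]; nlinarith)
        have hrc : Runs P.w P.n inp halfNext.cmd ⟨mb, o⟩ ⟨den halfNext mb, o⟩
            (weight halfNext * wordCost P.n) :=
          Block.runs hS bdb (by decide) (by simp [Block.Legal, halfNext])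
        refine ⟨den halfNext mb, ⟨?_, ?_, ?_, ?_⟩, (hra.seq (runb.seq hrc)).mono ?_⟩
        · have : mb 47 = 2 ^ (i + 1) := by
            rw [fb 47 (by omega) (by omega), fa 47 (by omega), hg]
          simp [den, halfNext, this, pow_succ]; ring
        · simp [den, halfNext, hrb, cosSeq]
        · intro j hj
          rw [← hf j hj, ← fa j (by omega), ← fb j (by omega) (by omega)]
          refine den_of_ne _ _ _ ?_
          simp [halfNext]; omega
        · refine bd_of_envAfter (wc := wordFactor) hS (by decide) bdb [47] (by decide) ?_
          have : mb 47 = 2 ^ (i + 1) := by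
            rw [fb 47 (by omega) (by omega), fa 47 (by omega), hg]
          have e : den halfNext mb 47 = 2 ^ (i + 2) := by
            simp [den, halfNext, this, pow_succ]; ring
          simp only [List.mem_singleton, forall_eq, e]
          have := P.L_le
          exact Nat.pow_lt_pow_right (by norm_num) (by show i + 2 < 3 * P.S; omega)
        · have e1 : weight halfBlock ≤ 500 := by decide
          have e2 : weight halfNext ≤ 500 := by decide
          have i1 := Nat.mul_le_mul_right (wordCost P.n) e1
          have i2 := Nat.mul_le_mul_right (wordCost P.n) e2
          have e3 : 42 * P.S * (1000 * wordCost P.n) =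
            40 * P.S * (1000 * wordCost P.n) + 2 * P.S * (1000 * wordCost P.n) := by ring
          have i3 : 1 * (1000 * wordCost P.n) ≤ 2 * P.S * (1000 * wordCost P.n) :=
            Nat.mul_le_mul_right _ (by omega)
          omega)
    (by
      rintro m' ⟨hg, -, hf, -⟩
      show m' 47 = m' 4
      rw [hg, hf 4 (by omega), hfix.r4, Setting.N, Nat.sub_add_cancel hL])
    ⟨by rw [h47]; rfl, by rw [h48]; rfl, fun _ _ => rfl, hbd⟩
  have e14 : m1 14 = E := (f1 14 (by omega)).trans h14
  have hxl := cosSeq_le E (P.L - 1)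
  have hfix1 := hfix.congr (m' := m1) fun j hj => f1 j (by omega)
  set x := cosSeq E (P.L - 1) with hx
  have hxx : x * x ≤ 4 * E * E := by nlinarith [Nat.mul_le_mul hxl hxl]
  have hr2 : Runs P.w P.n inp sinBlock.cmd ⟨m1, o⟩ ⟨den sinBlock m1, o⟩
      (weight sinBlock * wordCost P.n) :=
    Block.runs hS bd1 (by decide) (by simp [Block.Legal, sinBlock, e14, x1, hxx])
  have a2 : den sinBlock m1 51 = 4 * E * E - x * x := by simp [den, sinBlock, e14, x1]
  have f2 : ∀ j, j ≠ 51 → den sinBlock m1 j = m1 j := by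
    intro j h1; refine den_of_ne _ _ _ ?_; simp [sinBlock]; omega
  have bd2 : Bd genv P.S (den sinBlock m1) :=
    bd_of_envAfter (wc := wordFactor) hS (by decide) bd1 [] (by decide) (by simp)
  generalize den sinBlock m1 = m2 at hr2 a2 f2 bd2
  obtain ⟨m3, r3, f3, bd3, hr3⟩ := sqrtCmd_runs (inp := inp) (o := o) P bd2
    (by rw [f2 14 (by omega), e14, hE2]) a2 (by
      rw [← hE2]
      refine (Nat.sub_le _ _).trans_lt ?_
      nlinarith)
  have g3 : ∀ j, j < 47 ∨ 52 ≤ j → m3 j = m j := fun j hj => by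
    rw [f3 j (by omega) (by omega), f2 j (by omega), f1 j hj]
  have x3 : m3 48 = x := by rw [f3 48 (by omega) (by omega), f2 48 (by omega), x1]
  have hfix3 := hfix.congr (m' := m3) fun j hj => g3 j (by omega)
  have hr4 : Runs P.w P.n inp rootBlock.cmd ⟨m3, o⟩ ⟨den rootBlock m3, o⟩
      (weight rootBlock * wordCost P.n) :=
    Block.runs hS bd3 (by decide) (by simp [Block.Legal, rootBlock, hfix3.r6, P.D_pos.ne'])
  have e8 : den rootBlock m3 8 = (rootZero P.D P.L).1 := by
    simp [den, rootBlock, hfix3.r6, hfix3.r7, x3, rootZero, hx, hE]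
  have e9 : den rootBlock m3 9 = (rootZero P.D P.L).2 := by
    simp [den, rootBlock, hfix3.r6, hfix3.r7, r3, rootZero, hx, hE]
  have hlt : ∀ v, v ≤ 2 * E → v / (2 * P.D) + 2 * P.D < 2 ^ (19 * P.S) := by
    intro v hv
    have h1 : v / (2 * P.D) ≤ P.D := by
      refine Nat.div_le_of_le_mul (hv.trans (le_of_eq ?_))
      rw [hE]; ring
    have h2 : 2 ^ (16 * P.S + 2) ≤ 2 ^ (19 * P.S) := Nat.pow_le_pow_right (by norm_num) (by omega)
    rw [pow_add] at h2
    have h3 : P.D = 2 ^ (16 * P.S) := rfl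
    have := P.D_pos
    omega
  have hsq : Nat.sqrt (4 * E * E - x * x) ≤ 2 * E := by
    have h1 : 4 * E * E - x * x ≤ 2 * E * (2 * E) := (Nat.sub_le _ _).trans (le_of_eq (by ring))
    exact (Nat.sqrt_le_sqrt h1).trans_eq (Nat.sqrt_eq _)
  refine ⟨den rootBlock m3, ?_, ?_, ?_, ?_, ?_⟩
  · have h : ∀ j, j ≠ 8 → j ≠ 9 → den rootBlock m3 j = m3 j := by
      intro j h1 h2; refine den_of_ne _ _ _ ?_; simp [rootBlock]; omega
    refine ⟨?_, ?_, ?_, ?_, ?_, ?_, ?_, ?_, e8, e9, ?_, ?_, ?_, ?_⟩ <;>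
      rw [h _ (by norm_num) (by norm_num)]
    exacts [hfix3.r0, hfix3.r1, hfix3.r2, hfix3.r3, hfix3.r4, hfix3.r5, hfix3.r6, hfix3.r7,
      hfix3.r10, hfix3.r11, hfix3.r12, hfix3.r13]
  · intro r hr
    rw [den_outside (lo := 8) (hi := 10) (by decide) (by omega), g3 r (by omega)]
  · rw [den_outside (lo := 8) (hi := 10) (by decide) (by omega), g3 15 (by omega)]
  · refine bd_of_envAfter (wc := wordFactor) hS (by decide) bd3 [8, 9] (by decide) ?_
    simp only [List.mem_cons, List.not_mem_nil, or_false, forall_eq_or_imp, forall_eq, e8, e9]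
    exact ⟨hlt _ hxl, hlt _ hsq⟩
  · refine (hr1.seq (hr2.seq (hr3.seq hr4))).mono ?_
    have e1 : weight sinBlock ≤ 500 := by decide
    have e2 : weight rootBlock ≤ 485 := by decide
    have i1 := Nat.mul_le_mul_right (wordCost P.n) e1
    have i2 := Nat.mul_le_mul_right (wordCost P.n) e2
    have i0 : (P.L - 1) * (42 * P.S * (1000 * wordCost P.n) + 16 * wordCost P.n) ≤
        P.S * (43 * P.S * (1000 * wordCost P.n)) := by
      refine Nat.mul_le_mul (by have := P.L_le; omega) ?_
      nlinarith [Nat.mul_le_mul hS hW]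
    have i3 : 1 * (P.S * (1000 * wordCost P.n)) ≤ P.S * (P.S * (1000 * wordCost P.n)) :=
      Nat.mul_le_mul_right _ hS
    have i4 : 1 * (1000 * wordCost P.n) ≤ P.S * (1000 * wordCost P.n) := Nat.mul_le_mul_right _ hS
    have j1 : P.S * (43 * P.S * (1000 * wordCost P.n)) =
      43 * (P.S * (P.S * (1000 * wordCost P.n))) := by ring
    have j2 : 40 * P.S * (1000 * wordCost P.n) = 40 * (P.S * (1000 * wordCost P.n)) := by ring
    have j3 : 100 * P.S * P.S * (1000 * wordCost P.n) =
      100 * (P.S * (P.S * (1000 * wordCost P.n))) := by ring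
    rw [j3, j2]
    rw [j1] at i0
    generalize P.S * (P.S * (1000 * wordCost P.n)) = X at *
    generalize P.S * (1000 * wordCost P.n) = Y at *
    omega

end DepthCostRAM

namespace DepthCostRAM

open _root_.DepthCostRAM.Expr Block

/-! ### Binary length, fixed-point unit, number of points and chunk size -/

variable {inp : ℕ}

/-- Loops can only test for inequality of two arguments, and subtraction may be illegal. An order
comparison is therefore expressed by a vanishing quotient x, and 1 / (x + 1) turns this into a flag
that keeps the loop running. -/
theorem one_div_add_one_ne_zero {x : ℕ} : 1 / (x + 1) ≠ 0 ↔ x = 0 := by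
  constructor
  · intro h
    by_contra hx
    exact h (Nat.div_eq_of_lt (by omega))
  · rintro rfl; simp

/-- The parameters are those that the program computes. -/
structure Setting.Computed (P : Setting) (d : ℕ) : Prop where
  size_eq : P.S = Nat.size P.n
  pieces_eq : d = (P.n / 2 + P.S - 1) / P.S
  pieces_pos : 0 < d
  levels_eq : P.L = Nat.clog 2 (2 * d)
  chunk_eq : P.f = min (Nat.clog 2 P.S) (P.L - 1)

/-- The binary length is the number of halvings until n vanishes, and 2^S is accumulated along the
way; four squarings of it give D = 2^(16 S). The number of points and the chunk size are found by
doubling. -/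
theorem paramsCmd_runs (P : Setting) {d : ℕ} (hP : P.Computed d) {m : ℕ → ℕ} {o : List Bool}
    (hm : m = Function.update (fun _ => 0) 0 P.n) :
    ∃ m', Fix P (0, 0) m' ∧ m' 14 = P.D * P.D ∧ m' 48 = 0 ∧ m' 47 = 2 ∧ m' 15 = d ∧
      (∀ r, 64 ≤ r → m' r = 0) ∧ Bd genv P.S m' ∧
      Runs P.w P.n inp paramsCmd ⟨m, o⟩ ⟨m', o⟩ (P.S * (10000 * wordCost P.n)) := by
  have hS : 1 ≤ P.S := by have := P.two_le_S; omega
  have hS2 := P.two_le_S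
  have hL : 1 ≤ P.L := by have := P.f_lt; omega
  have hW := wordCost_pos P.n
  have hSlt : P.S < 2 ^ P.S := Nat.lt_two_pow_self
  have m0 : m 0 = P.n := by simp [hm]
  have mz : ∀ j, j ≠ 0 → m j = 0 := fun j hj => by simp [hm, hj]
  have hbd : Bd genv P.S m := by
    intro j hj
    by_cases h : j = 0
    · subst h; rw [m0]; simpa [genv] using P.n_lt
    · rw [mz j h]; positivity
  have hpow : ∀ a b : ℕ, a < b → 2 ^ a < 2 ^ b := fun a b h => Nat.pow_lt_pow_right (by norm_num) h
  -- binary length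
  have hr1 : Runs P.w P.n inp sizeInit.cmd ⟨m, o⟩ ⟨den sizeInit m, o⟩
      (weight sizeInit * wordCost P.n) :=
    Block.runs hS hbd (by decide) (by simp [Block.Legal, sizeInit])
  have g1 : den sizeInit m 47 = P.n := by simp [den, sizeInit, m0]
  have s1 : den sizeInit m 1 = 0 := by simp [den, sizeInit]
  have t1 : den sizeInit m 2 = 1 := by simp [den, sizeInit]
  have f1 : ∀ j, j ≠ 47 → j ≠ 1 → j ≠ 2 → den sizeInit m j = m j := by
    intro j h1 h2 h3; refine den_of_ne _ _ _ ?_; simp [sizeInit]; omega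
  have bd1 : Bd genv P.S (den sizeInit m) :=
    bd_of_envAfter (wc := wordFactor) hS (by decide) hbd [] (by decide) (by simp)
  generalize den sizeInit m = m1 at hr1 g1 s1 t1 f1 bd1
  obtain ⟨m2, ⟨g2, s2, t2, f2, bd2⟩, hr2⟩ := Runs.loop_mem (o := o) (w := P.w) (n := P.n)
    (inp := inp) (A := .reg 47) (A' := .const 0) (by simp [Arg.Low]) (by trivial)
    (c := sizeStep.cmd) (K := weight sizeStep * wordCost P.n)
    (fun i m' => m' 47 = P.n / 2 ^ i ∧ m' 1 = i ∧ m' 2 = 2 ^ i ∧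
      (∀ j, j ≠ 47 → j ≠ 1 → j ≠ 2 → m' j = m j) ∧ Bd genv P.S m') (T := P.S)
    (by
      rintro i hi m' ⟨hg, hs, ht, hf, hb⟩
      have e1 : den sizeStep m' 1 = i + 1 := by simp [den, sizeStep, hs]
      have e2 : den sizeStep m' 2 = 2 ^ (i + 1) := by simp [den, sizeStep, ht, pow_succ]
      refine ⟨?_, den sizeStep m', ⟨?_, e1, e2, ?_, ?_⟩,
        Block.runs hS hb (by decide) (by simp [Block.Legal, sizeStep])⟩
      · show m' 47 ≠ 0
        rw [hg]
        rw [hP.size_eq, Nat.lt_size] at hi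
        exact (Nat.div_pos hi (by positivity)).ne'
      · simp [den, sizeStep, hg, Nat.div_div_eq_div_mul, pow_succ]
      · intro j h1 h2 h3
        rw [← hf j h1 h2 h3]
        refine den_of_ne _ _ _ ?_
        simp [sizeStep]; omega
      · refine bd_of_envAfter (wc := wordFactor) hS (by decide) hb [1, 2] (by decide) ?_
        simp only [List.mem_cons, List.not_mem_nil, or_false, forall_eq_or_imp, forall_eq, e1, e2]
        exact ⟨by show i + 1 < 2 ^ (1 * P.S); rw [one_mul]; omega,
          hpow _ _ (by show i + 1 < 2 * P.S; omega)⟩)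
    (by
      rintro m' ⟨hg, -⟩
      show m' 47 = 0
      rw [hg, hP.size_eq]
      exact Nat.div_eq_of_lt (Nat.lt_size_self _))
    ⟨by rw [g1]; simp, s1, t1, f1, bd1⟩
  have e0 : m2 0 = P.n := (f2 0 (by norm_num) (by norm_num) (by norm_num)).trans m0
  -- unit and number of pieces
  have hr3 : Runs P.w P.n inp unitBlock.cmd ⟨m2, o⟩ ⟨den unitBlock m2, o⟩
      (weight unitBlock * wordCost P.n) :=
    Block.runs hS bd2 (by decide) (by
      simp [Block.Legal, unitBlock, s2, e0, ← hP.pieces_eq]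
      have := hP.pieces_pos
      omega)
  have d3 : den unitBlock m2 6 = P.D := by
    have : P.D = 2 ^ P.S * 2 ^ P.S * (2 ^ P.S * 2 ^ P.S) *
        (2 ^ P.S * 2 ^ P.S * (2 ^ P.S * 2 ^ P.S)) *
        (2 ^ P.S * 2 ^ P.S * (2 ^ P.S * 2 ^ P.S) *
        (2 ^ P.S * 2 ^ P.S * (2 ^ P.S * 2 ^ P.S))) := by
      unfold Setting.D; rw [mul_comm 16, pow_mul]; ring
    rw [this]
    simp [den, unitBlock, t2]
  have k3 : den unitBlock m2 7 = 2 * P.D := by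
    rw [← d3]; simp [den, unitBlock]
  have q3 : den unitBlock m2 14 = P.D * P.D := by
    rw [← d3]; simp [den, unitBlock]
  have h3 : den unitBlock m2 3 = P.n / 2 := by simp [den, unitBlock, e0]
  have p3 : den unitBlock m2 15 = d := by
    rw [hP.pieces_eq]; simp [den, unitBlock, e0, s2]
  have n3 : den unitBlock m2 4 = 1 := by simp [den, unitBlock]
  have c3 : den unitBlock m2 46 = 1 / (1 / (2 * d) + 1) := by
    rw [hP.pieces_eq]; simp [den, unitBlock, e0, s2]
  have f3 : ∀ j, j < 3 ∨ 47 ≤ j ∨ j = 8 ∨ j = 9 → den unitBlock m2 j = m2 j := by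
    intro j hj; refine den_of_ne _ _ _ ?_; simp [unitBlock]; omega
  have bd3 : Bd genv P.S (den unitBlock m2) := by
    refine bd_of_envAfter (wc := wordFactor) hS (by decide) bd2 [6, 7, 14] (by decide) ?_
    simp only [List.mem_cons, List.not_mem_nil, or_false, forall_eq_or_imp, forall_eq, d3, k3, q3,
      P.D_mul_D]
    refine ⟨hpow _ _ (by show _ < 17 * P.S; omega), ?_, hpow _ _ (by show _ < 33 * P.S; omega)⟩
    rw [Setting.D, ← pow_succ']
    exact hpow _ _ (by show _ < 18 * P.S; omega)
  generalize den unitBlock m2 = m3 at hr3 d3 k3 q3 h3 p3 n3 c3 f3 bd3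
  -- number of points
  obtain ⟨m4, ⟨n4, c4, f4, bd4⟩, hr4⟩ := Runs.loop_mem (o := o) (w := P.w) (n := P.n)
    (inp := inp) (A := .reg 46) (A' := .const 0) (by simp [Arg.Low]) (by trivial)
    (c := pointsStep.cmd) (K := weight pointsStep * wordCost P.n)
    (fun i m' => m' 4 = 2 ^ i ∧ m' 46 = 1 / (2 ^ i / (2 * d) + 1) ∧
      (∀ j, j ≠ 4 → j ≠ 46 → m' j = m3 j) ∧ Bd genv P.S m') (T := P.L)
    (by
      rintro i hi m' ⟨hn, hc, hf, hb⟩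
      have e15 : m' 15 = d := (hf 15 (by norm_num) (by norm_num)).trans p3
      have e1 : den pointsStep m' 4 = 2 ^ (i + 1) := by
        simp [den, pointsStep, hn, pow_succ]; ring
      refine ⟨?_, den pointsStep m', ⟨e1, ?_, ?_, ?_⟩,
        Block.runs hS hb (by decide)
          (by simp [Block.Legal, pointsStep, e15, hP.pieces_pos.ne'])⟩
      · show m' 46 ≠ 0
        rw [hc, one_div_add_one_ne_zero]
        rw [hP.levels_eq, Nat.lt_clog_iff_pow_lt (by norm_num)] at hi
        exact Nat.div_eq_of_lt hi
      · rw [← e1]; simp [den, pointsStep, e15]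
      · intro j h1 h2
        rw [← hf j h1 h2]
        refine den_of_ne _ _ _ ?_
        simp [pointsStep]; omega
      · refine bd_of_envAfter (wc := wordFactor) hS (by decide) hb [4] (by decide) ?_
        simp only [List.mem_singleton, forall_eq, e1]
        exact hpow _ _ (by show _ < 2 * P.S; have := P.L_le; omega))
    (by
      rintro m' ⟨-, hc, -⟩
      show m' 46 = 0
      rw [hc, ← not_ne_iff, one_div_add_one_ne_zero]
      have : 2 * d ≤ 2 ^ P.L := by rw [hP.levels_eq]; exact Nat.le_pow_clog (by norm_num) _
      exact (Nat.div_pos this (by have := hP.pieces_pos; omega)).ne')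
    ⟨by rw [n3]; rfl, by rw [c3]; simp, fun _ _ _ => rfl, bd3⟩
  have e1 : m4 1 = P.S := by rw [f4 1 (by norm_num) (by norm_num), f3 1 (by omega), s2]
  -- chunk size
  have hr5 : Runs P.w P.n inp chunkInit.cmd ⟨m4, o⟩ ⟨den chunkInit m4, o⟩
      (weight chunkInit * wordCost P.n) :=
    Block.runs hS bd4 (by decide) (by
      simp [Block.Legal, chunkInit, e1, n4]; omega)
  have b5 : den chunkInit m4 5 = 1 := by simp [den, chunkInit]
  have c5 : den chunkInit m4 46 = 1 / (1 / P.S + 2 * 1 / 2 ^ P.L + 1) := by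
    simp [den, chunkInit, e1, n4]
  have f5 : ∀ j, j ≠ 5 → j ≠ 46 → den chunkInit m4 j = m4 j := by
    intro j h1 h2; refine den_of_ne _ _ _ ?_; simp [chunkInit]; omega
  have bd5 : Bd genv P.S (den chunkInit m4) :=
    bd_of_envAfter (wc := wordFactor) hS (by decide) bd4 [] (by decide) (by simp)
  generalize den chunkInit m4 = m5 at hr5 b5 c5 f5 bd5
  obtain ⟨m6, ⟨b6, c6, f6, bd6⟩, hr6⟩ := Runs.loop_mem (o := o) (w := P.w) (n := P.n)
    (inp := inp) (A := .reg 46) (A' := .const 0) (by simp [Arg.Low]) (by trivial)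
    (c := chunkStep.cmd) (K := weight chunkStep * wordCost P.n)
    -- The flag drops to 0 as soon as 2^i ≥ S or 2·2^i ≥ 2^L, whichever comes first. This is the
    -- minimum in the definition of f.
    (fun i m' => m' 5 = 2 ^ i ∧ m' 46 = 1 / (2 ^ i / P.S + 2 * 2 ^ i / 2 ^ P.L + 1) ∧
      (∀ j, j ≠ 5 → j ≠ 46 → m' j = m4 j) ∧ Bd genv P.S m') (T := P.f)
    (by
      rintro i hi m' ⟨hn, hc, hf, hb⟩
      have e1' : m' 1 = P.S := (hf 1 (by norm_num) (by norm_num)).trans e1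
      have e4' : m' 4 = 2 ^ P.L := (hf 4 (by norm_num) (by norm_num)).trans n4
      have ev : den chunkStep m' 5 = 2 ^ (i + 1) := by
        simp [den, chunkStep, hn, pow_succ]; ring
      refine ⟨?_, den chunkStep m', ⟨ev, ?_, ?_, ?_⟩,
        Block.runs hS hb (by decide)
          (by simp [Block.Legal, chunkStep, e1', e4']; omega)⟩
      · show m' 46 ≠ 0
        rw [hc, one_div_add_one_ne_zero]
        rw [hP.chunk_eq, lt_min_iff, Nat.lt_clog_iff_pow_lt (by norm_num)] at hi
        rw [Nat.div_eq_of_lt hi.1, ← pow_succ', Nat.div_eq_of_lt (hpow _ _ (by omega))]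
      · rw [← ev]; simp [den, chunkStep, e1', e4']
      · intro j h1 h2
        rw [← hf j h1 h2]
        refine den_of_ne _ _ _ ?_
        simp [chunkStep]; omega
      · refine bd_of_envAfter (wc := wordFactor) hS (by decide) hb [5] (by decide) ?_
        simp only [List.mem_singleton, forall_eq, ev]
        exact hpow _ _ (by show _ < 2 * P.S; have := P.L_le; have := P.f_lt; omega))
    (by
      rintro m' ⟨-, hc, -⟩
      show m' 46 = 0
      rw [hc, ← not_ne_iff, one_div_add_one_ne_zero]
      intro h0
      obtain ⟨h1, h2⟩ := Nat.add_eq_zero_iff.1 h0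
      rw [Nat.div_eq_zero_iff] at h1 h2
      have h1' : 2 ^ P.f < P.S := by
        rcases h1 with h1 | h1
        · omega
        · exact h1
      have h2' : 2 * 2 ^ P.f < 2 ^ P.L := by
        rcases h2 with h2 | h2
        · exact absurd h2 (by positivity)
        · exact h2
      rw [← Nat.lt_clog_iff_pow_lt (by norm_num)] at h1'
      rw [← pow_succ', Nat.pow_lt_pow_iff_right (by norm_num)] at h2'
      have := hP.chunk_eq
      omega)
    ⟨b5, by rw [c5]; simp, f5, bd5⟩
  have g6 : ∀ j, j ≠ 5 → j ≠ 46 → j ≠ 4 → m6 j = m3 j := fun j h1 h2 h3 => by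
    rw [f6 j h1 h2, f4 j h3 h2]
  have n6 : m6 4 = P.N := by rw [f6 4 (by norm_num) (by norm_num), n4]; rfl
  have b6' : m6 5 = P.B := b6
  -- addresses
  have hr7 : Runs P.w P.n inp addrBlock.cmd ⟨m6, o⟩ ⟨den addrBlock m6, o⟩
      (weight addrBlock * wordCost P.n) :=
    Block.runs hS bd6 (by decide) (by simp [Block.Legal, addrBlock])
  have f7 : ∀ j, j < 10 ∨ (14 ≤ j ∧ j < 47) ∨ 49 ≤ j → den addrBlock m6 j = m6 j := by
    intro j hj; refine den_of_ne _ _ _ ?_; simp [addrBlock]; omega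
  have a10 : den addrBlock m6 10 = 4 * P.B := by simp [den, addrBlock, b6']
  have a11 : den addrBlock m6 11 = P.base := by simp [den, addrBlock, b6', Setting.base]
  have a12 : den addrBlock m6 12 = 128 + 4 * P.B := by simp [den, addrBlock, b6']
  have a13 : den addrBlock m6 13 = P.base + 4 * P.N := by
    simp [den, addrBlock, b6', Setting.base, n6]
  have bd7 : Bd genv P.S (den addrBlock m6) := by
    refine bd_of_envAfter (wc := wordFactor) hS (by decide) bd6 [10, 11, 12, 13] (by decide) ?_
    simp only [List.mem_cons, List.not_mem_nil, or_false, forall_eq_or_imp, forall_eq, a10, a11,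
      a12, a13]
    have hb : P.base = 128 + 8 * P.B := rfl
    exact ⟨(P.address_le (by omega)).2, (P.address_le (by omega)).2, (P.address_le (by omega)).2,
      (P.address_le (by omega)).2⟩
  refine ⟨den addrBlock m6, ⟨?_, ?_, ?_, ?_, ?_, ?_, ?_, ?_, ?_, ?_, a10, a11, a12, a13⟩, ?_, ?_,
    ?_, ?_, ?_, bd7, ?_⟩
  · rw [f7 0 (by omega), g6 0 (by omega) (by omega) (by omega), f3 0 (by omega), e0]
  · rw [f7 1 (by omega), g6 1 (by omega) (by omega) (by omega), f3 1 (by omega), s2]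
  · rw [f7 2 (by omega), g6 2 (by omega) (by omega) (by omega), f3 2 (by omega), t2]
  · rw [f7 3 (by omega), g6 3 (by omega) (by omega) (by omega), h3]
  · rw [f7 4 (by omega), n6]
  · rw [f7 5 (by omega), b6']
  · rw [f7 6 (by omega), g6 6 (by omega) (by omega) (by omega), d3]
  · rw [f7 7 (by omega), g6 7 (by omega) (by omega) (by omega), k3]
  · rw [f7 8 (by omega), g6 8 (by omega) (by omega) (by omega), f3 8 (by omega),
      f2 8 (by omega) (by omega) (by omega), mz 8 (by omega)]
  · rw [f7 9 (by omega), g6 9 (by omega) (by omega) (by omega), f3 9 (by omega),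
      f2 9 (by omega) (by omega) (by omega), mz 9 (by omega)]
  · rw [f7 14 (by omega), g6 14 (by omega) (by omega) (by omega), q3]
  · simp [den, addrBlock]
  · simp [den, addrBlock]
  · rw [f7 15 (by omega), g6 15 (by omega) (by omega) (by omega), p3]
  · intro r hr
    rw [f7 r (by omega), g6 r (by omega) (by omega) (by omega), f3 r (by omega),
      f2 r (by omega) (by omega) (by omega), mz r (by omega)]
  · refine (hr1.seq (hr2.seq (hr3.seq (hr4.seq (hr5.seq (hr6.seq hr7)))))).mono ?_
    have w1 : weight sizeInit + weight unitBlock + weight chunkInit + weight addrBlock + 45 ≤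
      4000 := by decide
    have w2 : weight sizeStep + 16 ≤ 1000 := by decide
    have w3 : weight pointsStep + 16 ≤ 1000 := by decide
    have w4 : weight chunkStep + 16 ≤ 1000 := by decide
    have i1 := Nat.mul_le_mul_right (wordCost P.n) w1
    have step : ∀ k c : ℕ, k ≤ P.S → c + 16 ≤ 1000 →
        k * (c * wordCost P.n + 16 * wordCost P.n) ≤ P.S * (1000 * wordCost P.n) := by
      intro k c hk hc
      rw [← add_mul]
      exact Nat.mul_le_mul hk (Nat.mul_le_mul_right _ hc)
    have i2 := step P.S _ le_rfl w2
    have i3 := step P.L _ P.L_le w3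
    have i4 := step P.f _ (by have := P.L_le; have := P.f_lt; omega) w4
    have i5 : 1 * (1000 * wordCost P.n) ≤ P.S * (1000 * wordCost P.n) := Nat.mul_le_mul_right _ hS
    have i6 : P.S * (10000 * wordCost P.n) = 10 * (P.S * (1000 * wordCost P.n)) := by ring
    simp only [add_mul] at i1
    rw [i6]
    omega

end DepthCostRAM

namespace DepthCostRAM

open _root_.DepthCostRAM.Expr Block

variable {inp : ℕ}

/-! ### Input -/

/-- Before the input. -/
def inputInit : Block :=
  [(52, lit 0), (57, var 11), (58, var 13), (59, var 15 * var 1), (29, lit 0), (30, lit 0),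
    (31, lit 0)]

/-- The positions of a piece of either factor in the input. -/
def rangeBlock : Block :=
  [(46, lit 1 / ((var 52 + var 1) / (var 3 + lit 1) + lit 1)),
    (53, var 46 * (var 52 + var 1) + (lit 1 - var 46) * var 3 - lit 1),
    (55, var 52 + var 3), (56, var 53 + var 3)]

/-- Conversion to a fixed-point number. -/
def scaleBlock : Block := [(28, var 28 * var 6)]

/-- Passage to the next piece. -/
def inputNext : Block := [(52, var 52 + var 1), (57, var 57 + lit 4), (58, var 58 + lit 4)]

/-- Input of a piece of either factor. -/
def pieceCmd : Cmd :=
  .seq rangeBlock.cmd <| .seq (inputCmd 28 (.reg 52) (.reg 53)) <| .seq scaleBlock.cmd <|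
  .seq (copyCmd (.const 28) (.reg 57) (.const 4)) <|
  .seq (inputCmd 28 (.reg 55) (.reg 56)) <| .seq scaleBlock.cmd <|
  .seq (copyCmd (.const 28) (.reg 58) (.const 4)) inputNext.cmd

/-- Input of the factors. -/
def readCmd : Cmd := .seq inputInit.cmd (.loop (.reg 52) (.reg 59) pieceCmd)

/-- The pieces of the two factors, as fixed-point numbers. -/
def initArray (P : Setting) (x y : ℕ) (q : ℕ) : Quad :=
  ⟨(if q < P.N then x / 2 ^ (P.S * q) % 2 ^ P.S else y / 2 ^ (P.S * (q - P.N)) % 2 ^ P.S) * P.D,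
    0, 0, 0⟩

/-- The last piece may be shorter than S bits: the range read is cut off at position m so that no
bit of y enters, and the missing bits of x are 0 because x < 2^m. -/
theorem low_piece {x y m pos S : ℕ} (hx : x < 2 ^ m) (hpos : pos ≤ m) :
    (x + 2 ^ m * y) / 2 ^ pos % 2 ^ (min (pos + S) m - pos) = x / 2 ^ pos % 2 ^ S := by
  have h1 : (x + 2 ^ m * y) / 2 ^ pos = x / 2 ^ pos + 2 ^ (m - pos) * y := by
    rw [show m = pos + (m - pos) by omega, pow_add, mul_assoc,
      Nat.add_mul_div_left _ _ (by positivity), Nat.add_sub_cancel_left]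
  have h2 : x / 2 ^ pos < 2 ^ (m - pos) := by
    rw [Nat.div_lt_iff_lt_mul (by positivity), ← pow_add]
    rwa [Nat.sub_add_cancel hpos]
  rw [h1]
  rcases Nat.le_total (pos + S) m with h | h
  · rw [min_eq_left h, Nat.add_sub_cancel_left, show m - pos = S + (m - pos - S) by omega,
      pow_add, mul_assoc, Nat.add_mul_mod_self_left]
  · rw [min_eq_right h, Nat.add_mul_mod_self_left, Nat.mod_eq_of_lt h2, Nat.mod_eq_of_lt]
    exact h2.trans_le (Nat.pow_le_pow_right (by norm_num) (by omega))

theorem high_piece {x y m pos S : ℕ} (hx : x < 2 ^ m) (hy : y < 2 ^ m) (hpos : pos ≤ m) :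
    (x + 2 ^ m * y) / 2 ^ (pos + m) % 2 ^ (min (pos + S) m - pos) = y / 2 ^ pos % 2 ^ S := by
  rw [add_comm pos m, pow_add, ← Nat.div_div_eq_div_mul, Nat.add_mul_div_left _ _ (by positivity),
    Nat.div_eq_of_lt hx, zero_add]
  have := low_piece (y := 0) (S := S) hy hpos
  simpa using this

/-- The flag is 1 exactly if a ≤ b; the same device as for the maximum of h and B. -/
theorem min_eq_flag {a b : ℕ} :
    1 / (a / (b + 1) + 1) * a + (1 - 1 / (a / (b + 1) + 1)) * b = min a b := by
  rcases Nat.lt_or_ge b a with hlt | hge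
  · have : 1 ≤ a / (b + 1) := (Nat.one_le_div_iff (by omega)).2 hlt
    rw [Nat.div_eq_of_lt (by omega), min_eq_right hlt.le]; simp
  · rw [Nat.div_eq_of_lt (show a < b + 1 by omega), min_eq_left hge]; simp

/-- Only the d nonempty pieces of each factor are read. The other entries of both halves are never
written, which is correct because the memory there is still 0 from the start. -/
theorem readCmd_runs (P : Setting) {d : ℕ} (hP : P.Computed d) {w₀ : ℕ × ℕ} {mm x y : ℕ}
    (hn : P.n = 2 * mm) (hx : x < 2 ^ mm) (hy : y < 2 ^ mm) (hmm : 1 ≤ mm)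
    (hinp : inp = inputOf mm x y) {m : ℕ → ℕ} {o : List Bool}
    (hfix : Fix P w₀ m) (h15 : m 15 = d) (hzero : ∀ r, 64 ≤ r → m r = 0) (hbd : Bd genv P.S m)
    (hdN : 2 * d ≤ P.N) :
    ∃ m', (∀ j < 16, m' j = m j) ∧
      (∀ q < 2 * P.N, quad m' (P.base + 4 * q) = initArray P x y q) ∧ Bd genv P.S m' ∧
      Runs P.w P.n inp readCmd ⟨m, o⟩ ⟨m', o⟩
        (d * (4000 * wordCost P.n + 2 * P.far) + 2000 * wordCost P.n) := by
  have hS : 1 ≤ P.S := by have := P.two_le_S; omega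
  have hS2 := P.two_le_S
  have hW := wordCost_pos P.n
  have hD := P.D_pos
  have hB := P.B_pos
  have hNle := P.N_le
  have hbdef : P.base = 128 + 8 * P.B := rfl
  have hfar : 4 ≤ P.far := by unfold Setting.far; omega
  have h3 : m 3 = mm := by rw [hfix.r3, hn]; omega
  have hnlt := P.n_lt
  have hpowS : ∀ k v : ℕ, 2 ≤ k → v ≤ 2 * 2 ^ P.S → v < 2 ^ (k * P.S) := by
    intro k v hk hv
    have h1 : 2 ^ (P.S + 2) ≤ 2 ^ (k * P.S) :=
      Nat.pow_le_pow_right (by norm_num) (by nlinarith)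
    have h2 : 0 < 2 ^ P.S := by positivity
    rw [pow_add] at h1
    omega
  -- number of pieces
  have hdS : mm ≤ d * P.S := by
    have h1 := hP.pieces_eq
    have h2 : mm + P.S - 1 < (d + 1) * P.S := by
      rw [← Nat.div_lt_iff_lt_mul (by omega), show mm + P.S - 1 = P.n / 2 + P.S - 1 by omega, ← h1]
      omega
    rw [add_mul, one_mul] at h2
    omega
  have hidS : ∀ i < d, i * P.S < mm := by
    intro i hi
    have h1 := hP.pieces_eq
    have h2 : d * P.S ≤ mm + P.S - 1 := by
      rw [h1, show mm + P.S - 1 = P.n / 2 + P.S - 1 by omega]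
      exact Nat.div_mul_le_self _ _
    have h3 : (i + 1) * P.S ≤ d * P.S := Nat.mul_le_mul_right _ hi
    rw [add_mul, one_mul] at h3
    omega
  have hr1 : Runs P.w P.n inp inputInit.cmd ⟨m, o⟩ ⟨den inputInit m, o⟩
      (weight inputInit * wordCost P.n) :=
    Block.runs hS hbd (by decide) (by simp [Block.Legal, inputInit])
  have bd1 : Bd genv P.S (den inputInit m) :=
    bd_of_envAfter (wc := wordFactor) hS (by decide) hbd [] (by decide) (by simp)
  have v1 : den inputInit m 52 = 0 ∧ den inputInit m 57 = P.base ∧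
      den inputInit m 58 = P.base + 4 * P.N ∧ den inputInit m 59 = d * P.S ∧
      den inputInit m 29 = 0 ∧ den inputInit m 30 = 0 ∧ den inputInit m 31 = 0 := by
    simp [den, inputInit, hfix.r11, hfix.r13, h15, hfix.r1]
  have f1 : ∀ j, j < 16 ∨ 64 ≤ j → den inputInit m j = m j := fun j hj =>
    den_outside (lo := 16) (hi := 64) (by decide) hj
  generalize den inputInit m = m1 at hr1 bd1 v1 f1
  obtain ⟨p1, a1, b1, l1, z1, z1', z1''⟩ := v1
  obtain ⟨m2, ⟨p2, a2, b2, l2, z2, f2, dat2, bd2⟩, hr2⟩ := Runs.loop_mem (o := o) (w := P.w)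
    (n := P.n) (inp := inp) (A := .reg 52) (A' := .reg 59) (by simp [Arg.Low]) (by simp [Arg.Low])
    (c := pieceCmd) (K := 3900 * wordCost P.n + 2 * P.far)
    (fun i m' => m' 52 = i * P.S ∧ m' 57 = P.base + 4 * i ∧ m' 58 = P.base + 4 * P.N + 4 * i ∧
      m' 59 = d * P.S ∧ (m' 29 = 0 ∧ m' 30 = 0 ∧ m' 31 = 0) ∧ (∀ j < 16, m' j = m j) ∧
      (∀ q < 2 * P.N, quad m' (P.base + 4 * q) =
        if q < i ∨ (P.N ≤ q ∧ q < P.N + i) then initArray P x y q else ⟨0, 0, 0, 0⟩) ∧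
      Bd genv P.S m') (T := d)
    (by
      rintro i hi m' ⟨hp, ha, hb, hl, ⟨hz, hz', hz''⟩, hf, hdat, hbd'⟩
      have hpos := hidS i hi
      have hfix' := hfix.congr (m' := m') fun j hj => hf j hj
      have e3 : m' 3 = mm := (hf 3 (by omega)).trans h3
      refine ⟨?_, ?_⟩
      · show m' 52 ≠ m' 59
        rw [hp, hl]
        exact (Nat.mul_lt_mul_of_pos_right hi (by omega)).ne
      -- positions
      set pos := i * P.S with hposdef
      set fin := min (pos + P.S) mm with hfin
      have hra : Runs P.w P.n inp rangeBlock.cmd ⟨m', o⟩ ⟨den rangeBlock m', o⟩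
          (weight rangeBlock * wordCost P.n) := by
        refine Block.runs hS hbd' (by decide) ?_
        simp only [Block.Legal, rangeBlock]
        simp [hp, hfix'.r1, e3, Nat.div_le_self]
        rw [min_eq_flag]; omega
      have e53 : den rangeBlock m' 53 = fin - 1 := by
        simp only [den, rangeBlock]
        simp [hp, hfix'.r1, e3]
        rw [min_eq_flag]
      have e55 : den rangeBlock m' 55 = pos + mm := by simp [den, rangeBlock, hp, e3]
      have e56 : den rangeBlock m' 56 = fin - 1 + mm := by
        rw [← e53]; simp [den, rangeBlock, e3]
      have bda : Bd genv P.S (den rangeBlock m') :=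
        bd_of_envAfter (wc := wordFactor) hS (by decide) hbd' [] (by decide) (by simp)
      have fa : ∀ j, j < 46 ∨ 57 ≤ j ∨ j = 52 → den rangeBlock m' j = m' j := by
        intro j hj; refine den_of_ne _ _ _ ?_; simp [rangeBlock]; omega
      generalize den rangeBlock m' = ma at hra e53 e55 e56 bda fa
      -- first factor
      have hlen : fin - 1 + 1 - pos = fin - pos := by omega
      have hpiece : ∀ v, v / 2 ^ pos % 2 ^ P.S < 2 ^ P.S := fun v => Nat.mod_lt _ (by positivity)
      have hpieceD : ∀ v, v / 2 ^ pos % 2 ^ P.S * P.D < 2 ^ (34 * P.S) := by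
        intro v
        have : v / 2 ^ pos % 2 ^ P.S * P.D < 2 ^ P.S * 2 ^ (16 * P.S) :=
          (Nat.mul_lt_mul_right hD).2 (hpiece v)
        rw [← pow_add] at this
        exact this.trans_le (Nat.pow_le_pow_right (by norm_num) (by omega))
      have hrb := runs_input (w := P.w) (n := P.n) (inp := inp) (A := .reg 52) (A' := .reg 53)
        (by simp [Arg.Low]) (by simp [Arg.Low]) (m := ma) (o := o) (i := 28) (a := pos)
        (b := fin - 1) (by norm_num) ((fa 52 (by omega)).trans hp) e53 (by omega) (by omega)
        (by
          have : fin - pos ≤ P.S := by omega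
          rw [hlen]
          exact this.trans (by unfold Setting.w wordFactor; omega))
      have ex : inp / 2 ^ pos % 2 ^ (fin - 1 + 1 - pos) = x / 2 ^ pos % 2 ^ P.S := by
        rw [hlen, hinp, inputOf, low_piece hx hpos.le]
      rw [ex] at hrb
      set ux := x / 2 ^ pos % 2 ^ P.S with hux
      have bdb : Bd genv P.S (Function.update ma 28 ux) := by
        intro j hj
        by_cases h : j = 28
        · subst h
          simp only [Function.update_self]
          exact (hpiece x).trans_le (Nat.pow_le_pow_right (by norm_num)
            (by show P.S ≤ 34 * P.S; omega))
        · rw [Function.update_of_ne h]; exact bda j hj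
      have fb : ∀ j, j ≠ 28 → Function.update ma 28 ux j = ma j := fun j hj =>
        Function.update_of_ne hj _ _
      have vb : Function.update ma 28 ux 28 = ux := Function.update_self ..
      generalize Function.update ma 28 ux = mb at hrb bdb fb vb
      have e6 : mb 6 = P.D := by
        rw [fb 6 (by omega), fa 6 (by omega), hfix'.r6]
      have hrc : Runs P.w P.n inp scaleBlock.cmd ⟨mb, o⟩ ⟨den scaleBlock mb, o⟩
          (weight scaleBlock * wordCost P.n) :=
        Block.runs hS bdb (by decide) (by simp [Block.Legal, scaleBlock])
      have vc : den scaleBlock mb 28 = ux * P.D := by simp [den, scaleBlock, vb, e6]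
      have fc : ∀ j, j ≠ 28 → den scaleBlock mb j = mb j := by
        intro j hj; refine den_of_ne _ _ _ ?_; simp [scaleBlock]; omega
      have bdc : Bd genv P.S (den scaleBlock mb) := by
        refine bd_of_envAfter (wc := wordFactor) hS (by decide) bdb [28] (by decide) ?_
        simp only [List.mem_singleton, forall_eq, vc]
        exact hpieceD x
      generalize den scaleBlock mb = mc at hrc vc fc bdc
      have gc : ∀ j, j < 28 ∨ (29 ≤ j ∧ j < 46) ∨ 57 ≤ j ∨ j = 52 → mc j = m' j := fun j hj => by
        rw [fc j (by omega), fb j (by omega), fa j (by omega)]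
      have hrd : Runs P.w P.n inp (copyCmd (.const 28) (.reg 57) (.const 4)) ⟨mc, o⟩
          ⟨cpy 28 (P.base + 4 * i) 4 mc, o⟩ P.far :=
        runs_copy (by trivial) (by simp [Arg.Low]) (by trivial) rfl
          ((gc 57 (by omega)).trans ha) rfl (by omega) (by omega) (by omega)
          (P.address_le_far (by omega)) (P.address_le_far (by omega)) hfar
      have bdd : Bd genv P.S (cpy 28 (P.base + 4 * i) 4 mc) := bd_cpy_high bdc (by omega)
      have fd : ∀ j, j < P.base + 4 * i ∨ P.base + 4 * i + 4 ≤ j →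
          cpy 28 (P.base + 4 * i) 4 mc j = mc j := by
        intro j hj
        rcases hj with hj | hj
        · exact cpy_below hj
        · exact cpy_above (by omega)
      have qd : quad (cpy 28 (P.base + 4 * i) 4 mc) (P.base + 4 * i) = ⟨ux * P.D, 0, 0, 0⟩ := by
        have := quad_cpy_apply (a := 28) (b := P.base + 4 * i) (l := 4) (m := mc) (i := 0) le_rfl
        simp only [Nat.add_zero] at this
        rw [this]
        simp only [quad, vc]
        rw [gc 29 (by omega), gc 30 (by omega), gc 31 (by omega), hz, hz', hz'']
      generalize cpy 28 (P.base + 4 * i) 4 mc = md at hrd bdd fd qd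
      -- second factor
      have e55d : md 55 = pos + mm := by
        rw [fd 55 (by omega), fc 55 (by omega), fb 55 (by omega), e55]
      have e56d : md 56 = fin - 1 + mm := by
        rw [fd 56 (by omega), fc 56 (by omega), fb 56 (by omega), e56]
      have hlen' : fin - 1 + mm + 1 - (pos + mm) = fin - pos := by omega
      have hre := runs_input (w := P.w) (n := P.n) (inp := inp) (A := .reg 55) (A' := .reg 56)
        (by simp [Arg.Low]) (by simp [Arg.Low]) (m := md) (o := o) (i := 28) (a := pos + mm)
        (b := fin - 1 + mm) (by norm_num) e55d e56d (by omega) (by omega)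
        (by
          have : fin - pos ≤ P.S := by omega
          rw [hlen']
          exact this.trans (by unfold Setting.w wordFactor; omega))
      have ey : inp / 2 ^ (pos + mm) % 2 ^ (fin - 1 + mm + 1 - (pos + mm)) =
          y / 2 ^ pos % 2 ^ P.S := by
        rw [hlen', hinp, inputOf, high_piece hx hy hpos.le]
      rw [ey] at hre
      set uy := y / 2 ^ pos % 2 ^ P.S with huy
      have bde : Bd genv P.S (Function.update md 28 uy) := by
        intro j hj
        by_cases h : j = 28
        · subst h
          simp only [Function.update_self]
          exact (hpiece y).trans_le (Nat.pow_le_pow_right (by norm_num)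
            (by show P.S ≤ 34 * P.S; omega))
        · rw [Function.update_of_ne h]; exact bdd j hj
      have fe : ∀ j, j ≠ 28 → Function.update md 28 uy j = md j := fun j hj =>
        Function.update_of_ne hj _ _
      have ve : Function.update md 28 uy 28 = uy := Function.update_self ..
      generalize Function.update md 28 uy = me at hre bde fe ve
      have e6' : me 6 = P.D := by
        rw [fe 6 (by omega), fd 6 (by omega), gc 6 (by omega), hfix'.r6]
      have hrf : Runs P.w P.n inp scaleBlock.cmd ⟨me, o⟩ ⟨den scaleBlock me, o⟩
          (weight scaleBlock * wordCost P.n) :=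
        Block.runs hS bde (by decide) (by simp [Block.Legal, scaleBlock])
      have vf : den scaleBlock me 28 = uy * P.D := by simp [den, scaleBlock, ve, e6']
      have ff : ∀ j, j ≠ 28 → den scaleBlock me j = me j := by
        intro j hj; refine den_of_ne _ _ _ ?_; simp [scaleBlock]; omega
      have bdf : Bd genv P.S (den scaleBlock me) := by
        refine bd_of_envAfter (wc := wordFactor) hS (by decide) bde [28] (by decide) ?_
        simp only [List.mem_singleton, forall_eq, vf]
        exact hpieceD y
      generalize den scaleBlock me = mf at hrf vf ff bdf
      have gf : ∀ j, j < 28 ∨ (29 ≤ j ∧ j < 46) ∨ (57 ≤ j ∧ j < 128) ∨ j = 52 → mf j = m' j :=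
        fun j hj => by
          rw [ff j (by omega), fe j (by omega), fd j (by omega), gc j (by omega)]
      have gfd : ∀ j, 128 ≤ j → mf j = md j := fun j hj => by
        rw [ff j (by omega), fe j (by omega)]
      have hrg : Runs P.w P.n inp (copyCmd (.const 28) (.reg 58) (.const 4)) ⟨mf, o⟩
          ⟨cpy 28 (P.base + 4 * P.N + 4 * i) 4 mf, o⟩ P.far :=
        runs_copy (by trivial) (by simp [Arg.Low]) (by trivial) rfl
          ((gf 58 (by omega)).trans hb) rfl (by omega) (by omega) (by omega)
          (P.address_le_far (by omega)) (P.address_le_far (by omega)) hfar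
      have bdg : Bd genv P.S (cpy 28 (P.base + 4 * P.N + 4 * i) 4 mf) := bd_cpy_high bdf (by omega)
      have fg : ∀ j, j < P.base + 4 * P.N + 4 * i ∨ P.base + 4 * P.N + 4 * i + 4 ≤ j →
          cpy 28 (P.base + 4 * P.N + 4 * i) 4 mf j = mf j := by
        intro j hj
        rcases hj with hj | hj
        · exact cpy_below hj
        · exact cpy_above (by omega)
      have qg : quad (cpy 28 (P.base + 4 * P.N + 4 * i) 4 mf) (P.base + 4 * P.N + 4 * i) =
          ⟨uy * P.D, 0, 0, 0⟩ := by
        have := quad_cpy_apply (a := 28) (b := P.base + 4 * P.N + 4 * i) (l := 4) (m := mf) (i := 0)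
          le_rfl
        simp only [Nat.add_zero] at this
        rw [this]
        simp only [quad, vf]
        rw [gf 29 (by omega), gf 30 (by omega), gf 31 (by omega), hz, hz', hz'']
      generalize cpy 28 (P.base + 4 * P.N + 4 * i) 4 mf = mg at hrg bdg fg qg
      have gg : ∀ j, j < 28 ∨ (29 ≤ j ∧ j < 46) ∨ (57 ≤ j ∧ j < 128) ∨ j = 52 → mg j = m' j :=
        fun j hj => by rw [fg j (by omega), gf j (by omega)]
      -- next
      have hrh : Runs P.w P.n inp inputNext.cmd ⟨mg, o⟩ ⟨den inputNext mg, o⟩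
          (weight inputNext * wordCost P.n) :=
        Block.runs hS bdg (by decide) (by simp [Block.Legal, inputNext])
      have v52 : den inputNext mg 52 = (i + 1) * P.S := by
        simp [den, inputNext, gg 52 (by omega), hp, gg 1 (by omega), hfix'.r1, hposdef]; ring
      have v57 : den inputNext mg 57 = P.base + 4 * (i + 1) := by
        simp [den, inputNext, gg 57 (by omega), ha]; ring
      have v58 : den inputNext mg 58 = P.base + 4 * P.N + 4 * (i + 1) := by
        simp [den, inputNext, gg 58 (by omega), hb]; ring
      have fh : ∀ j, j < 52 ∨ 59 ≤ j → den inputNext mg j = mg j := fun j hj =>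
        den_outside (lo := 52) (hi := 59) (by decide) hj
      have bdh : Bd genv P.S (den inputNext mg) := by
        refine bd_of_envAfter (wc := wordFactor) hS (by decide) bdg [52, 57, 58] (by decide) ?_
        simp only [List.mem_cons, List.not_mem_nil, or_false, forall_eq_or_imp, forall_eq, v52,
          v57, v58]
        have h6 : 2 ^ (6 * P.S) ≤ 2 ^ (8 * P.S) := Nat.pow_le_pow_right (by norm_num) (by omega)
        refine ⟨hpowS 3 _ (by norm_num) ?_,
          (P.address_le (by omega)).2.trans_le h6, (P.address_le (by omega)).2.trans_le h6⟩
        rw [add_mul, one_mul]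
        have : P.S < 2 ^ P.S := Nat.lt_two_pow_self
        omega
      refine ⟨den inputNext mg, ⟨v52, v57, v58, ?_, ⟨?_, ?_, ?_⟩, ?_, ?_, bdh⟩, ?_⟩
      · rw [fh 59 (by omega), gg 59 (by omega), hl]
      · rw [fh 29 (by omega), gg 29 (by omega), hz]
      · rw [fh 30 (by omega), gg 30 (by omega), hz']
      · rw [fh 31 (by omega), gg 31 (by omega), hz'']
      · intro j hj
        rw [fh j (by omega), gg j (by omega), hf j hj]
      · intro q hq
        have eh : quad (den inputNext mg) (P.base + 4 * q) = quad mg (P.base + 4 * q) :=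
          quad_congr fun j _ => fh _ (by omega)
        rw [eh]
        by_cases h1 : q = P.N + i
        · subst h1
          rw [if_pos (by omega), show P.base + 4 * (P.N + i) = P.base + 4 * P.N + 4 * i by ring, qg]
          simp [initArray, huy, hposdef, mul_comm]
        have eg : quad mg (P.base + 4 * q) = quad md (P.base + 4 * q) :=
          quad_congr fun j _ => by rw [fg _ (by omega), gfd _ (by omega)]
        rw [eg]
        by_cases h2 : q = i
        · subst h2
          rw [if_pos (by omega), qd]
          simp [initArray, show q < P.N by omega, hux, hposdef, mul_comm]
        have ed : quad md (P.base + 4 * q) = quad m' (P.base + 4 * q) :=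
          quad_congr fun j _ => by rw [fd _ (by omega), gc _ (by omega)]
        rw [ed, hdat q hq]
        by_cases h3 : q < i ∨ (P.N ≤ q ∧ q < P.N + i)
        · rw [if_pos h3, if_pos (by omega)]
        · rw [if_neg h3, if_neg (by omega)]
      · refine (hra.seq (hrb.seq (hrc.seq (hrd.seq (hre.seq (hrf.seq (hrg.seq hrh))))))).mono ?_
        have w1 : weight rangeBlock + 22 + weight scaleBlock + 22 + weight scaleBlock +
          weight inputNext ≤ 3900 := by decide
        have i1 := Nat.mul_le_mul_right (wordCost P.n) w1
        simp only [add_mul] at i1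
        omega)
    (by
      rintro m' ⟨hp, ha, hb, hl, -⟩
      show m' 52 = m' 59
      rw [hp, hl])
    ⟨by rw [p1, zero_mul], by rw [a1]; rfl, by rw [b1]; rfl, l1, ⟨z1, z1', z1''⟩,
      fun j hj => f1 j (by omega), fun q hq => by
        rw [if_neg (by omega)]
        simp only [quad]
        rw [f1 _ (by omega), f1 _ (by omega), f1 _ (by omega), f1 _ (by omega), hzero _ (by omega),
          hzero _ (by omega), hzero _ (by omega), hzero _ (by omega)], bd1⟩
  refine ⟨m2, f2, ?_, bd2, (hr1.seq hr2).mono ?_⟩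
  · intro q hq
    rw [dat2 q hq]
    split_ifs with h
    · rfl
    · have hzero : ∀ v k, v < 2 ^ mm → d ≤ k → v / 2 ^ (P.S * k) % 2 ^ P.S = 0 := by
        intro v k hv hk
        rw [Nat.div_eq_of_lt, Nat.zero_mod]
        refine hv.trans_le (Nat.pow_le_pow_right (by norm_num) ?_)
        calc mm ≤ d * P.S := hdS
          _ ≤ k * P.S := Nat.mul_le_mul_right _ hk
          _ = P.S * k := mul_comm _ _
      simp only [initArray]
      split_ifs with h'
      · rw [hzero x q hx (by omega), zero_mul]
      · rw [hzero y (q - P.N) hy (by omega), zero_mul]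
  · have w1 : weight inputInit + 15 ≤ 2000 := by decide
    have i1 := Nat.mul_le_mul_right (wordCost P.n) w1
    simp only [add_mul] at i1
    have i2 : d * (3900 * wordCost P.n + 2 * P.far + 16 * wordCost P.n) ≤
        d * (4000 * wordCost P.n + 2 * P.far) := Nat.mul_le_mul_left _ (by omega)
    omega

end DepthCostRAM

namespace DepthCostRAM

open _root_.DepthCostRAM.Expr Block

variable {inp : ℕ}

/-! ### Products of corresponding values -/

/-- The product of two stored complex numbers. -/
def mulBlock : Block :=
  [(36, (var 28 * var 32 + var 29 * var 33 + var 30 * var 35 + var 31 * var 34) / var 6),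
    (37, (var 28 * var 33 + var 29 * var 32 + var 30 * var 34 + var 31 * var 35) / var 6),
    (38, (var 28 * var 34 + var 29 * var 35 + var 30 * var 32 + var 31 * var 33) / var 6),
    (39, (var 28 * var 35 + var 29 * var 34 + var 30 * var 33 + var 31 * var 32) / var 6)]

/-- The addresses of the two halves of the data. -/
def halvesBlock : Block := [(57, var 11), (58, var 13)]

/-- Passage to the next product. -/
def mulNext : Block := [(57, var 57 + lit 4), (58, var 58 + lit 4)]

/-- The products of corresponding values. -/
def mulCmd : Cmd :=
  .seq halvesBlock.cmd <| .loop (.reg 57) (.reg 13) <|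
  .seq (copyCmd (.reg 57) (.const 28) (.const 4)) <|
  .seq (copyCmd (.reg 58) (.const 32) (.const 4)) <| .seq mulBlock.cmd <|
  .seq (copyCmd (.const 36) (.reg 57) (.const 4)) mulNext.cmd

theorem halvesBlock_runs (P : Setting) {w₀ : ℕ × ℕ} {m : ℕ → ℕ} (o : List Bool)
    (hfix : Fix P w₀ m) (hbd : Bd genv P.S m) :
    Runs P.w P.n inp halvesBlock.cmd ⟨m, o⟩ ⟨den halvesBlock m, o⟩ (100 * wordCost P.n) ∧
      den halvesBlock m 57 = P.base ∧ den halvesBlock m 58 = P.base + 4 * P.N ∧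
      (∀ j, j < 57 ∨ 59 ≤ j → den halvesBlock m j = m j) ∧ Bd genv P.S (den halvesBlock m) := by
  have hS : 1 ≤ P.S := by have := P.two_le_S; omega
  refine ⟨(Block.runs hS hbd (by decide) (by simp [Block.Legal, halvesBlock])).mono
    (Nat.mul_le_mul_right _ (by decide)), by simp [den, halvesBlock, hfix.r11],
    by simp [den, halvesBlock, hfix.r13],
    fun j hj => den_outside (lo := 57) (hi := 59) (by decide) hj,
    bd_of_envAfter (wc := wordFactor) hS (by decide) hbd [] (by decide) (by simp)⟩

theorem Setting.address_lt_genv (P : Setting) {x : ℕ} (h : x ≤ P.base + 16 * P.N) :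
    x < 2 ^ (8 * P.S) :=
  (P.address_le h).2.trans_le (Nat.pow_le_pow_right (by norm_num) (by omega))

/-- No chunks are needed here: N products with three long copies of cost O(S) each amount to O(N S)
= O(n). The same holds for rounding, carries and output. -/
theorem mulCmd_runs (P : Setting) {w₀ : ℕ × ℕ} {m : ℕ → ℕ} {o : List Bool}
    (hfix : Fix P w₀ m) {A : ℕ → Quad} {M : ℕ}
    (hA : ∀ q < 2 * P.N, quad m (P.base + 4 * q) = A q)
    (hAM : ∀ q < 2 * P.N, (A q).Le M) (hM : M < 2 ^ (34 * P.S)) (hbd : Bd genv P.S m) :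
    ∃ m', (∀ j < 16, m' j = m j) ∧
      (∀ q < P.N, quad m' (P.base + 4 * q) = quadMul P.D (A q) (A (P.N + q))) ∧ Bd genv P.S m' ∧
      Runs P.w P.n inp mulCmd ⟨m, o⟩ ⟨m', o⟩
        (P.N * (4000 * wordCost P.n + 3 * P.far) + 2000 * wordCost P.n) := by
  have hS : 1 ≤ P.S := by have := P.two_le_S; omega
  have hW := wordCost_pos P.n
  have hD := P.D_pos
  have hbdef : P.base = 128 + 8 * P.B := rfl
  have hfar : 4 ≤ P.far := by unfold Setting.far; omega
  obtain ⟨hr1, a1, b1, f1, bd1⟩ := halvesBlock_runs (inp := inp) P o hfix hbd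
  generalize den halvesBlock m = m1 at hr1 a1 b1 f1 bd1
  obtain ⟨m2, ⟨-, -, f2, dat2, bd2⟩, hr2⟩ := Runs.loop_mem (o := o) (w := P.w)
    (n := P.n) (inp := inp) (A := .reg 57) (A' := .reg 13) (by simp [Arg.Low]) (by simp [Arg.Low])
    (c := .seq (copyCmd (.reg 57) (.const 28) (.const 4)) <|
      .seq (copyCmd (.reg 58) (.const 32) (.const 4)) <| .seq mulBlock.cmd <|
      .seq (copyCmd (.const 36) (.reg 57) (.const 4)) mulNext.cmd)
    (K := 3900 * wordCost P.n + 3 * P.far)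
    (fun i m' => m' 57 = P.base + 4 * i ∧ m' 58 = P.base + 4 * P.N + 4 * i ∧
      (∀ j < 16, m' j = m j) ∧
      (∀ q < 2 * P.N, quad m' (P.base + 4 * q) =
        if q < i then quadMul P.D (A q) (A (P.N + q)) else A q) ∧
      Bd genv P.S m') (T := P.N)
    (by
      rintro i hi m' ⟨ha, hb, hf, hdat, hbd'⟩
      have hfix' := hfix.congr (m' := m') fun j hj => hf j hj
      refine ⟨?_, ?_⟩
      · show m' 57 ≠ m' 13
        rw [ha, hfix'.r13]; omega
      have qu : quad m' (P.base + 4 * i) = A i := by rw [hdat i (by omega), if_neg (by omega)]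
      have qv : quad m' (P.base + 4 * P.N + 4 * i) = A (P.N + i) := by
        rw [show P.base + 4 * P.N + 4 * i = P.base + 4 * (P.N + i) by ring, hdat _ (by omega),
          if_neg (by omega)]
      -- load
      have hra : Runs P.w P.n inp (copyCmd (.reg 57) (.const 28) (.const 4)) ⟨m', o⟩
          ⟨cpy (P.base + 4 * i) 28 4 m', o⟩ P.far :=
        runs_copy (by simp [Arg.Low]) (by trivial) (by trivial) ha rfl rfl (by omega) (by omega)
          (by omega) (P.address_le_far (by omega)) (P.address_le_far (by omega)) hfar
      have qa : quad (cpy (P.base + 4 * i) 28 4 m') 28 = A i := by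
        have := quad_cpy_apply (a := P.base + 4 * i) (b := 28) (l := 4) (m := m') (i := 0) le_rfl
        simp only [Nat.add_zero] at this
        rw [this, qu]
      have bda : Bd genv P.S (cpy (P.base + 4 * i) 28 4 m') := by
        refine bd_cpy_low hbd' fun k hk => ?_
        obtain ⟨h1, h2, h3, h4⟩ := hAM i (by omega)
        rw [← qu] at h1 h2 h3 h4
        simp only [quad] at h1 h2 h3 h4
        interval_cases k
        · exact lt_of_le_of_lt h1 hM
        · exact lt_of_le_of_lt h2 hM
        · exact lt_of_le_of_lt h3 hM
        · exact lt_of_le_of_lt h4 hM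
      have fa : ∀ j, j < 28 ∨ 32 ≤ j → cpy (P.base + 4 * i) 28 4 m' j = m' j := by
        rintro j (hj | hj)
        · exact cpy_below hj
        · exact cpy_above (by omega)
      generalize cpy (P.base + 4 * i) 28 4 m' = ma at hra qa bda fa
      have hrb : Runs P.w P.n inp (copyCmd (.reg 58) (.const 32) (.const 4)) ⟨ma, o⟩
          ⟨cpy (P.base + 4 * P.N + 4 * i) 32 4 ma, o⟩ P.far :=
        runs_copy (by simp [Arg.Low]) (by trivial) (by trivial) ((fa 58 (by omega)).trans hb) rfl
          rfl (by omega) (by omega)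
          (by omega) (P.address_le_far (by omega)) (P.address_le_far (by omega)) hfar
      have qva : quad ma (P.base + 4 * P.N + 4 * i) = A (P.N + i) := by
        rw [← qv]; exact quad_congr fun j _ => fa _ (by omega)
      have qb : quad (cpy (P.base + 4 * P.N + 4 * i) 32 4 ma) 32 = A (P.N + i) := by
        have := quad_cpy_apply (a := P.base + 4 * P.N + 4 * i) (b := 32) (l := 4) (m := ma) (i := 0)
          le_rfl
        simp only [Nat.add_zero] at this
        rw [this, qva]
      have bdb : Bd genv P.S (cpy (P.base + 4 * P.N + 4 * i) 32 4 ma) := by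
        refine bd_cpy_low bda fun k hk => ?_
        obtain ⟨h1, h2, h3, h4⟩ := hAM (P.N + i) (by omega)
        rw [← qva] at h1 h2 h3 h4
        simp only [quad] at h1 h2 h3 h4
        interval_cases k
        · exact lt_of_le_of_lt h1 hM
        · exact lt_of_le_of_lt h2 hM
        · exact lt_of_le_of_lt h3 hM
        · exact lt_of_le_of_lt h4 hM
      have fb : ∀ j, j < 32 ∨ 36 ≤ j → cpy (P.base + 4 * P.N + 4 * i) 32 4 ma j = ma j := by
        rintro j (hj | hj)
        · exact cpy_below hj
        · exact cpy_above (by omega)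
      have qa' : quad (cpy (P.base + 4 * P.N + 4 * i) 32 4 ma) 28 = A i := by
        rw [quad_cpy_of_disjoint (by omega), qa]
      generalize cpy (P.base + 4 * P.N + 4 * i) 32 4 ma = mb at hrb qb bdb fb qa'
      -- multiply
      have e6 : mb 6 = P.D := by rw [fb 6 (by omega), fa 6 (by omega), hfix'.r6]
      have hrc : Runs P.w P.n inp mulBlock.cmd ⟨mb, o⟩ ⟨den mulBlock mb, o⟩
          (weight mulBlock * wordCost P.n) :=
        Block.runs hS bdb (by decide) (by simp [Block.Legal, mulBlock, e6, hD.ne'])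
      have qc : quad (den mulBlock mb) 36 = quadMul P.D (A i) (A (P.N + i)) := by
        rw [← qa', ← qb]
        simp [quad, den, mulBlock, quadMul, e6]
      have fc : ∀ j, j < 36 ∨ 40 ≤ j → den mulBlock mb j = mb j := fun j hj =>
        den_outside (lo := 36) (hi := 40) (by decide) hj
      have bdc : Bd genv P.S (den mulBlock mb) :=
        bd_of_envAfter (wc := wordFactor) hS (by decide) bdb [] (by decide) (by simp)
      generalize den mulBlock mb = mc at hrc qc fc bdc
      have gc : ∀ j, j < 28 ∨ 40 ≤ j → mc j = m' j := fun j hj => by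
        rw [fc j (by omega), fb j (by omega), fa j (by omega)]
      -- store
      have hrd : Runs P.w P.n inp (copyCmd (.const 36) (.reg 57) (.const 4)) ⟨mc, o⟩
          ⟨cpy 36 (P.base + 4 * i) 4 mc, o⟩ P.far :=
        runs_copy (by trivial) (by simp [Arg.Low]) (by trivial) rfl ((gc 57 (by omega)).trans ha)
          rfl (by omega) (by omega) (by omega) (P.address_le_far (by omega))
          (P.address_le_far (by omega)) hfar
      have bdd : Bd genv P.S (cpy 36 (P.base + 4 * i) 4 mc) := bd_cpy_high bdc (by omega)
      have qd : quad (cpy 36 (P.base + 4 * i) 4 mc) (P.base + 4 * i) =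
          quadMul P.D (A i) (A (P.N + i)) := by
        have := quad_cpy_apply (a := 36) (b := P.base + 4 * i) (l := 4) (m := mc) (i := 0) le_rfl
        simp only [Nat.add_zero] at this
        rw [this, qc]
      have fd : ∀ j, j < P.base + 4 * i ∨ P.base + 4 * i + 4 ≤ j →
          cpy 36 (P.base + 4 * i) 4 mc j = mc j := by
        rintro j (hj | hj)
        · exact cpy_below hj
        · exact cpy_above (by omega)
      generalize cpy 36 (P.base + 4 * i) 4 mc = md at hrd bdd qd fd
      -- next
      have hre : Runs P.w P.n inp mulNext.cmd ⟨md, o⟩ ⟨den mulNext md, o⟩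
          (weight mulNext * wordCost P.n) :=
        Block.runs hS bdd (by decide) (by simp [Block.Legal, mulNext])
      have v57 : den mulNext md 57 = P.base + 4 * (i + 1) := by
        simp [den, mulNext, fd 57 (by omega), gc 57 (by omega), ha]; ring
      have v58 : den mulNext md 58 = P.base + 4 * P.N + 4 * (i + 1) := by
        simp [den, mulNext, fd 58 (by omega), gc 58 (by omega), hb]; ring
      have fe : ∀ j, j < 57 ∨ 59 ≤ j → den mulNext md j = md j := fun j hj =>
        den_outside (lo := 57) (hi := 59) (by decide) hj
      have bde : Bd genv P.S (den mulNext md) := by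
        refine bd_of_envAfter (wc := wordFactor) hS (by decide) bdd [57, 58] (by decide) ?_
        simp only [List.mem_cons, List.not_mem_nil, or_false, forall_eq_or_imp, forall_eq, v57, v58]
        exact ⟨P.address_lt_genv (by omega), P.address_lt_genv (by omega)⟩
      refine ⟨den mulNext md, ⟨v57, v58, ?_, ?_, bde⟩, ?_⟩
      · intro j hj
        rw [fe j (by omega), fd j (by omega), gc j (by omega), hf j hj]
      · intro q hq
        have eh : quad (den mulNext md) (P.base + 4 * q) = quad md (P.base + 4 * q) :=
          quad_congr fun j _ => fe _ (by omega)
        rw [eh]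
        by_cases h1 : q = i
        · subst h1
          rw [if_pos (by omega), qd]
        have ed : quad md (P.base + 4 * q) = quad m' (P.base + 4 * q) :=
          quad_congr fun j _ => by rw [fd _ (by omega), gc _ (by omega)]
        rw [ed, hdat q hq]
        by_cases h3 : q < i
        · rw [if_pos h3, if_pos (by omega)]
        · rw [if_neg h3, if_neg (by omega)]
      · refine (hra.seq (hrb.seq (hrc.seq (hrd.seq hre)))).mono ?_
        have w1 : weight mulBlock + weight mulNext ≤ 3900 := by decide
        have i1 := Nat.mul_le_mul_right (wordCost P.n) w1
        simp only [add_mul] at i1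
        omega)
    (by
      rintro m' ⟨ha, -, hf, -⟩
      show m' 57 = m' 13
      rw [ha, hf 13 (by omega), hfix.r13])
    ⟨by rw [a1]; rfl, by rw [b1]; rfl, fun j hj => f1 j (by omega), fun q hq => by
        rw [if_neg (by omega), ← hA q hq]
        exact quad_congr fun j _ => f1 _ (by omega), bd1⟩
  refine ⟨m2, f2, ?_, bd2, (hr1.seq hr2).mono ?_⟩
  · intro q hq
    rw [dat2 q (by omega), if_pos hq]
  · have i2 : P.N * (3900 * wordCost P.n + 3 * P.far + 16 * wordCost P.n) ≤
        P.N * (4000 * wordCost P.n + 3 * P.far) := Nat.mul_le_mul_left _ (by omega)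
    omega

/-! ### Rounding -/

/-- Division by the number of points and rounding. -/
def roundBlock : Block :=
  [(36, (var 28 + var 6 * var 4 / lit 2 - var 29) / (var 6 * var 4))]

/-- Passage to the next coefficient. -/
def roundNext : Block := [(57, var 57 + lit 4), (58, var 58 + lit 1)]

/-- Rounding of the coefficients. -/
def roundCmd : Cmd :=
  .seq halvesBlock.cmd <| .loop (.reg 57) (.reg 13) <|
  .seq (copyCmd (.reg 57) (.const 28) (.const 2)) <| .seq roundBlock.cmd <|
  .seq (copyCmd (.const 36) (.reg 58) (.const 1)) roundNext.cmd

/-- The integer next to the real part of a stored number, divided by the number of points. -/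
def Setting.round (P : Setting) (q : Quad) : ℕ := (q.a + P.D * P.N / 2 - q.b) / (P.D * P.N)

/-- The integers are written to the second half of the data, which is free once the products have
been formed, so the transformed vector remains intact. Half a unit D N is added before the
subtraction, which rounds to the nearest integer; `hAb` makes that subtraction legal. -/
theorem roundCmd_runs (P : Setting) {w₀ : ℕ × ℕ} {m : ℕ → ℕ} {o : List Bool}
    (hfix : Fix P w₀ m) {A : ℕ → Quad} {M : ℕ}
    (hA : ∀ q < P.N, quad m (P.base + 4 * q) = A q)
    (hAM : ∀ q < P.N, (A q).Le M) (hM : M < 2 ^ (34 * P.S))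
    (hAb : ∀ q < P.N, (A q).b ≤ (A q).a + P.D * P.N / 2) (hbd : Bd genv P.S m) :
    ∃ m', (∀ j < 16, m' j = m j) ∧
      (∀ q < P.N, m' (P.base + 4 * P.N + q) = P.round (A q)) ∧ Bd genv P.S m' ∧
      Runs P.w P.n inp roundCmd ⟨m, o⟩ ⟨m', o⟩
        (P.N * (4000 * wordCost P.n + 2 * P.far) + 2000 * wordCost P.n) := by
  have hS : 1 ≤ P.S := by have := P.two_le_S; omega
  have hW := wordCost_pos P.n
  have hD := P.D_pos
  have hN := P.N_pos
  have hbdef : P.base = 128 + 8 * P.B := rfl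
  have hfar : 4 ≤ P.far := by unfold Setting.far; omega
  obtain ⟨hr1, a1, b1, f1, bd1⟩ := halvesBlock_runs (inp := inp) P o hfix hbd
  generalize den halvesBlock m = m1 at hr1 a1 b1 f1 bd1
  obtain ⟨m2, ⟨-, -, f2, dat2, z2, bd2⟩, hr2⟩ := Runs.loop_mem (o := o) (w := P.w)
    (n := P.n) (inp := inp) (A := .reg 57) (A' := .reg 13) (by simp [Arg.Low]) (by simp [Arg.Low])
    (c := .seq (copyCmd (.reg 57) (.const 28) (.const 2)) <| .seq roundBlock.cmd <|
      .seq (copyCmd (.const 36) (.reg 58) (.const 1)) roundNext.cmd)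
    (K := 3900 * wordCost P.n + 2 * P.far)
    (fun i m' => m' 57 = P.base + 4 * i ∧ m' 58 = P.base + 4 * P.N + i ∧
      (∀ j < 16, m' j = m j) ∧
      (∀ q < P.N, quad m' (P.base + 4 * q) = A q) ∧
      (∀ q < i, m' (P.base + 4 * P.N + q) = P.round (A q)) ∧
      Bd genv P.S m') (T := P.N)
    (by
      rintro i hi m' ⟨ha, hb, hf, hdat, hz, hbd'⟩
      have hfix' := hfix.congr (m' := m') fun j hj => hf j hj
      refine ⟨?_, ?_⟩
      · show m' 57 ≠ m' 13
        rw [ha, hfix'.r13]; omega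
      have qu := hdat i hi
      have hra : Runs P.w P.n inp (copyCmd (.reg 57) (.const 28) (.const 2)) ⟨m', o⟩
          ⟨cpy (P.base + 4 * i) 28 2 m', o⟩ P.far :=
        runs_copy (by simp [Arg.Low]) (by trivial) (by trivial) ha rfl rfl (by omega) (by omega)
          (by omega) (P.address_le_far (by omega)) (P.address_le_far (by omega)) (by omega)
      have va : cpy (P.base + 4 * i) 28 2 m' 28 = (A i).a := by
        have := cpy_apply (a := P.base + 4 * i) (b := 28) (l := 2) (m := m') (i := 0) (by omega)
        rw [← qu]; exact this
      have vb : cpy (P.base + 4 * i) 28 2 m' 29 = (A i).b := by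
        have := cpy_apply (a := P.base + 4 * i) (b := 28) (l := 2) (m := m') (i := 1) (by omega)
        rw [← qu]; exact this
      have bda : Bd genv P.S (cpy (P.base + 4 * i) 28 2 m') := by
        refine bd_cpy_low hbd' fun k hk => ?_
        obtain ⟨h1, h2, -, -⟩ := hAM i hi
        rw [← qu] at h1 h2
        simp only [quad] at h1 h2
        interval_cases k
        · exact lt_of_le_of_lt h1 hM
        · exact lt_of_le_of_lt h2 hM
      have fa : ∀ j, j < 28 ∨ 30 ≤ j → cpy (P.base + 4 * i) 28 2 m' j = m' j := by
        rintro j (hj | hj)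
        · exact cpy_below hj
        · exact cpy_above (by omega)
      generalize cpy (P.base + 4 * i) 28 2 m' = ma at hra va vb bda fa
      have e6 : ma 6 = P.D := by rw [fa 6 (by omega), hfix'.r6]
      have e4 : ma 4 = P.N := by rw [fa 4 (by omega), hfix'.r4]
      have hrc : Runs P.w P.n inp roundBlock.cmd ⟨ma, o⟩ ⟨den roundBlock ma, o⟩
          (weight roundBlock * wordCost P.n) :=
        Block.runs hS bda (by decide)
          (by simp [Block.Legal, roundBlock, e6, e4, va, vb, hAb i hi, hD.ne', hN.ne'])
      have vc : den roundBlock ma 36 = P.round (A i) := by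
        simp [den, roundBlock, e6, e4, va, vb, Setting.round]
      have fc : ∀ j, j < 36 ∨ 37 ≤ j → den roundBlock ma j = ma j := fun j hj =>
        den_outside (lo := 36) (hi := 37) (by decide) hj
      have bdc : Bd genv P.S (den roundBlock ma) :=
        bd_of_envAfter (wc := wordFactor) hS (by decide) bda [] (by decide) (by simp)
      generalize den roundBlock ma = mc at hrc vc fc bdc
      have gc : ∀ j, j < 28 ∨ 40 ≤ j → mc j = m' j := fun j hj => by
        rw [fc j (by omega), fa j (by omega)]
      have hrd : Runs P.w P.n inp (copyCmd (.const 36) (.reg 58) (.const 1)) ⟨mc, o⟩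
          ⟨cpy 36 (P.base + 4 * P.N + i) 1 mc, o⟩ P.far :=
        runs_copy (by trivial) (by simp [Arg.Low]) (by trivial) rfl ((gc 58 (by omega)).trans hb)
          rfl (by omega) (by omega) (by omega) (P.address_le_far (by omega))
          (P.address_le_far (by omega)) (by omega)
      have bdd : Bd genv P.S (cpy 36 (P.base + 4 * P.N + i) 1 mc) := bd_cpy_high bdc (by omega)
      have vd : cpy 36 (P.base + 4 * P.N + i) 1 mc (P.base + 4 * P.N + i) = P.round (A i) := by
        have := cpy_apply (a := 36) (b := P.base + 4 * P.N + i) (l := 1) (m := mc) (i := 0)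
          (by omega)
        rw [← vc]; exact this
      have fd : ∀ j, j < P.base + 4 * P.N + i ∨ P.base + 4 * P.N + i + 1 ≤ j →
          cpy 36 (P.base + 4 * P.N + i) 1 mc j = mc j := by
        rintro j (hj | hj)
        · exact cpy_below hj
        · exact cpy_above (by omega)
      generalize cpy 36 (P.base + 4 * P.N + i) 1 mc = md at hrd bdd vd fd
      have hre : Runs P.w P.n inp roundNext.cmd ⟨md, o⟩ ⟨den roundNext md, o⟩
          (weight roundNext * wordCost P.n) :=
        Block.runs hS bdd (by decide) (by simp [Block.Legal, roundNext])
      have v57 : den roundNext md 57 = P.base + 4 * (i + 1) := by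
        simp [den, roundNext, fd 57 (by omega), gc 57 (by omega), ha]; ring
      have v58 : den roundNext md 58 = P.base + 4 * P.N + (i + 1) := by
        simp [den, roundNext, fd 58 (by omega), gc 58 (by omega), hb]; ring
      have fe : ∀ j, j < 57 ∨ 59 ≤ j → den roundNext md j = md j := fun j hj =>
        den_outside (lo := 57) (hi := 59) (by decide) hj
      have bde : Bd genv P.S (den roundNext md) := by
        refine bd_of_envAfter (wc := wordFactor) hS (by decide) bdd [57, 58] (by decide) ?_
        simp only [List.mem_cons, List.not_mem_nil, or_false, forall_eq_or_imp, forall_eq, v57, v58]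
        exact ⟨P.address_lt_genv (by omega), P.address_lt_genv (by omega)⟩
      refine ⟨den roundNext md, ⟨v57, v58, ?_, ?_, ?_, bde⟩, ?_⟩
      · intro j hj
        rw [fe j (by omega), fd j (by omega), gc j (by omega), hf j hj]
      · intro q hq
        rw [← hdat q hq]
        exact quad_congr fun j _ => by rw [fe _ (by omega), fd _ (by omega), gc _ (by omega)]
      · intro q hq
        rw [fe _ (by omega)]
        by_cases h1 : q = i
        · rw [h1, vd]
        · rw [fd _ (by omega), gc _ (by omega), hz q (by omega)]
      · refine (hra.seq (hrc.seq (hrd.seq hre))).mono ?_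
        have w1 : weight roundBlock + weight roundNext ≤ 3900 := by decide
        have i1 := Nat.mul_le_mul_right (wordCost P.n) w1
        simp only [add_mul] at i1
        omega)
    (by
      rintro m' ⟨ha, -, hf, -⟩
      show m' 57 = m' 13
      rw [ha, hf 13 (by omega), hfix.r13])
    ⟨by rw [a1]; rfl, by rw [b1]; rfl, fun j hj => f1 j (by omega), fun q hq => by
        rw [← hA q hq]
        exact quad_congr fun j _ => f1 _ (by omega), fun q hq => by omega, bd1⟩
  refine ⟨m2, f2, z2, bd2, (hr1.seq hr2).mono ?_⟩
  have i2 : P.N * (3900 * wordCost P.n + 2 * P.far + 16 * wordCost P.n) ≤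
      P.N * (4000 * wordCost P.n + 2 * P.far) := Nat.mul_le_mul_left _ (by omega)
  omega

/-! ### Carries -/

/-- Before the carries. -/
def carryInit : Block := [(58, var 13), (54, lit 0), (59, var 13 + var 4)]

/-- Separation of digit and carry. -/
def carryBlock : Block :=
  [(36, var 28 + var 54), (54, var 36 / var 2), (36, var 36 - var 54 * var 2)]

/-- Passage to the next digit. -/
def carryNext : Block := [(58, var 58 + lit 1)]

/-- Conversion of the coefficients to digits. -/
def carryCmd : Cmd :=
  .seq carryInit.cmd <| .loop (.reg 58) (.reg 59) <|
  .seq (copyCmd (.reg 58) (.const 28) (.const 1)) <| .seq carryBlock.cmd <|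
  .seq (copyCmd (.const 36) (.reg 58) (.const 1)) carryNext.cmd

/-- The number with the given coefficients. -/
def valueOf (S : ℕ) (z : ℕ → ℕ) (k : ℕ) : ℕ := ∑ i ∈ Finset.range k, z i * 2 ^ (S * i)

theorem valueOf_succ_div (S : ℕ) (z : ℕ → ℕ) (k : ℕ) :
    valueOf S z (k + 1) / 2 ^ (S * k) = valueOf S z k / 2 ^ (S * k) + z k := by
  rw [valueOf, Finset.sum_range_succ, Nat.add_mul_div_right _ _ (by positivity)]
  rfl

theorem valueOf_succ_div_succ (S : ℕ) (z : ℕ → ℕ) (k : ℕ) :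
    valueOf S z (k + 1) / 2 ^ (S * (k + 1)) = (z k + valueOf S z k / 2 ^ (S * k)) / 2 ^ S := by
  rw [mul_add, mul_one, pow_add, ← Nat.div_div_eq_div_mul, valueOf_succ_div, add_comm]

/-- Digit k depends on the coefficients up to k only: later ones contribute multiples of 2^(S (k +
1)). The earlier ones enter through the carry, the quotient of their value by 2^(S k). -/
theorem valueOf_digit (S : ℕ) (z : ℕ → ℕ) {k N : ℕ} (hk : k < N) :
    valueOf S z N / 2 ^ (S * k) % 2 ^ S = (z k + valueOf S z k / 2 ^ (S * k)) % 2 ^ S := by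
  induction N, hk using Nat.le_induction with
  | base => rw [valueOf_succ_div, add_comm]
  | succ N hN ih =>
    rw [← ih, valueOf, Finset.sum_range_succ, show S * N = S * k + S + S * (N - (k + 1)) by
      conv_lhs => rw [show N = k + 1 + (N - (k + 1)) by have : k + 1 ≤ N := hN; omega]
      ring, pow_add, pow_add,
      show z N * (2 ^ (S * k) * 2 ^ S * 2 ^ (S * (N - (k + 1)))) =
        z N * 2 ^ (S * (N - (k + 1))) * 2 ^ S * 2 ^ (S * k) by ring,
      Nat.add_mul_div_right _ _ (by positivity), Nat.add_mul_mod_self_right]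
    rfl

theorem carryCmd_runs (P : Setting) {w₀ : ℕ × ℕ} {m : ℕ → ℕ} {o : List Bool}
    (hfix : Fix P w₀ m) {z : ℕ → ℕ}
    (hz : ∀ q < P.N, m (P.base + 4 * P.N + q) = z q) (hzlt : ∀ q < P.N, z q < 2 ^ (4 * P.S))
    (hbd : Bd genv P.S m) :
    ∃ m', (∀ j < 16, m' j = m j) ∧
      (∀ q < P.N, m' (P.base + 4 * P.N + q) = valueOf P.S z P.N / 2 ^ (P.S * q) % 2 ^ P.S) ∧
      Bd genv P.S m' ∧
      Runs P.w P.n inp carryCmd ⟨m, o⟩ ⟨m', o⟩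
        (P.N * (4000 * wordCost P.n + 2 * P.far) + 2000 * wordCost P.n) := by
  have hS : 1 ≤ P.S := by have := P.two_le_S; omega
  have hW := wordCost_pos P.n
  have hN := P.N_pos
  have hbdef : P.base = 128 + 8 * P.B := rfl
  have hfar : 4 ≤ P.far := by unfold Setting.far; omega
  -- Carries stay below 2^(4 S): the sum of a carry and a coefficient is below twice this number and
  -- is then divided by 2^S ≥ 2.
  have hcarry : ∀ k ≤ P.N, valueOf P.S z k / 2 ^ (P.S * k) < 2 ^ (4 * P.S) := by
    intro k
    induction k with
    | zero => intro _; simp [valueOf]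
    | succ k ih =>
      intro hk
      rw [valueOf_succ_div_succ, Nat.div_lt_iff_lt_mul (by positivity)]
      have h1 := ih (by omega)
      have h2 := hzlt k (by omega)
      have h3 : 2 ≤ 2 ^ P.S := Nat.le_self_pow (by omega) 2
      nlinarith
  have hr1 : Runs P.w P.n inp carryInit.cmd ⟨m, o⟩ ⟨den carryInit m, o⟩
      (weight carryInit * wordCost P.n) :=
    Block.runs hS hbd (by decide) (by simp [Block.Legal, carryInit])
  have b1 : den carryInit m 58 = P.base + 4 * P.N := by simp [den, carryInit, hfix.r13]
  have c1 : den carryInit m 54 = 0 := by simp [den, carryInit]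
  have l1 : den carryInit m 59 = P.base + 4 * P.N + P.N := by
    simp [den, carryInit, hfix.r13, hfix.r4]
  have f1 : ∀ j, j < 54 ∨ 60 ≤ j → den carryInit m j = m j := fun j hj =>
    den_outside (lo := 54) (hi := 60) (by decide) hj
  have bd1 : Bd genv P.S (den carryInit m) :=
    bd_of_envAfter (wc := wordFactor) hS (by decide) hbd [] (by decide) (by simp)
  generalize den carryInit m = m1 at hr1 b1 c1 l1 f1 bd1
  obtain ⟨m2, ⟨-, -, -, f2, dat2, z2, bd2⟩, hr2⟩ := Runs.loop_mem (o := o) (w := P.w)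
    (n := P.n) (inp := inp) (A := .reg 58) (A' := .reg 59) (by simp [Arg.Low]) (by simp [Arg.Low])
    (c := .seq (copyCmd (.reg 58) (.const 28) (.const 1)) <| .seq carryBlock.cmd <|
      .seq (copyCmd (.const 36) (.reg 58) (.const 1)) carryNext.cmd)
    (K := 3900 * wordCost P.n + 2 * P.far)
    (fun i m' => m' 58 = P.base + 4 * P.N + i ∧ m' 59 = P.base + 4 * P.N + P.N ∧
      m' 54 = valueOf P.S z i / 2 ^ (P.S * i) ∧
      (∀ j < 16, m' j = m j) ∧
      (∀ q, i ≤ q → q < P.N → m' (P.base + 4 * P.N + q) = z q) ∧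
      (∀ q < i, m' (P.base + 4 * P.N + q) = valueOf P.S z P.N / 2 ^ (P.S * q) % 2 ^ P.S) ∧
      Bd genv P.S m') (T := P.N)
    (by
      rintro i hi m' ⟨hb, hl, hc, hf, hdat, hdig, hbd'⟩
      have hfix' := hfix.congr (m' := m') fun j hj => hf j hj
      refine ⟨?_, ?_⟩
      · show m' 58 ≠ m' 59
        rw [hb, hl]; omega
      have qu := hdat i le_rfl hi
      have hra : Runs P.w P.n inp (copyCmd (.reg 58) (.const 28) (.const 1)) ⟨m', o⟩
          ⟨cpy (P.base + 4 * P.N + i) 28 1 m', o⟩ P.far :=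
        runs_copy (by simp [Arg.Low]) (by trivial) (by trivial) hb rfl rfl (by omega) (by omega)
          (by omega) (P.address_le_far (by omega)) (P.address_le_far (by omega)) (by omega)
      have va : cpy (P.base + 4 * P.N + i) 28 1 m' 28 = z i := by
        have := cpy_apply (a := P.base + 4 * P.N + i) (b := 28) (l := 1) (m := m') (i := 0)
          (by omega)
        rw [← qu]; exact this
      have bda : Bd genv P.S (cpy (P.base + 4 * P.N + i) 28 1 m') := by
        refine bd_cpy_low hbd' fun k hk => ?_
        interval_cases k
        rw [Nat.add_zero, qu]
        exact (hzlt i hi).trans_le (Nat.pow_le_pow_right (by norm_num)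
          (by show 4 * P.S ≤ 34 * P.S; omega))
      have fa : ∀ j, j < 28 ∨ 29 ≤ j → cpy (P.base + 4 * P.N + i) 28 1 m' j = m' j := by
        rintro j (hj | hj)
        · exact cpy_below hj
        · exact cpy_above (by omega)
      generalize cpy (P.base + 4 * P.N + i) 28 1 m' = ma at hra va bda fa
      have e2 : ma 2 = 2 ^ P.S := by rw [fa 2 (by omega), hfix'.r2]
      have e54 : ma 54 = valueOf P.S z i / 2 ^ (P.S * i) := by rw [fa 54 (by omega), hc]
      have hrc : Runs P.w P.n inp carryBlock.cmd ⟨ma, o⟩ ⟨den carryBlock ma, o⟩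
          (weight carryBlock * wordCost P.n) := by
        refine Block.runs hS bda (by decide) ?_
        simp only [Block.Legal, carryBlock]
        simp [e2, Nat.div_mul_le_self]
      have vc : den carryBlock ma 36 = valueOf P.S z P.N / 2 ^ (P.S * i) % 2 ^ P.S := by
        rw [valueOf_digit _ _ hi, Nat.mod_eq_sub_div_mul]
        simp [den, carryBlock, e2, va, e54]
      have vc' : den carryBlock ma 54 = valueOf P.S z (i + 1) / 2 ^ (P.S * (i + 1)) := by
        rw [valueOf_succ_div_succ]
        simp [den, carryBlock, e2, va, e54]
      have fc : ∀ j, j ≠ 36 → j ≠ 54 → den carryBlock ma j = ma j := by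
        intro j hj hj'; refine den_of_ne _ _ _ ?_; simp [carryBlock]; omega
      have bdc : Bd genv P.S (den carryBlock ma) := by
        refine bd_of_envAfter (wc := wordFactor) hS (by decide) bda [54] (by decide) ?_
        simp only [List.mem_singleton, forall_eq, vc']
        exact (hcarry (i + 1) hi).trans_le (Nat.pow_le_pow_right (by norm_num)
          (by show 4 * P.S ≤ 40 * P.S; omega))
      generalize den carryBlock ma = mc at hrc vc vc' fc bdc
      have gc : ∀ j, j < 28 ∨ (40 ≤ j ∧ j ≠ 54) → mc j = m' j := fun j hj => by
        rw [fc j (by omega) (by omega), fa j (by omega)]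
      have hrd : Runs P.w P.n inp (copyCmd (.const 36) (.reg 58) (.const 1)) ⟨mc, o⟩
          ⟨cpy 36 (P.base + 4 * P.N + i) 1 mc, o⟩ P.far :=
        runs_copy (by trivial) (by simp [Arg.Low]) (by trivial) rfl ((gc 58 (by omega)).trans hb)
          rfl (by omega) (by omega) (by omega) (P.address_le_far (by omega))
          (P.address_le_far (by omega)) (by omega)
      have bdd : Bd genv P.S (cpy 36 (P.base + 4 * P.N + i) 1 mc) := bd_cpy_high bdc (by omega)
      have vd : cpy 36 (P.base + 4 * P.N + i) 1 mc (P.base + 4 * P.N + i) = mc 36 := by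
        exact cpy_apply (a := 36) (b := P.base + 4 * P.N + i) (l := 1) (m := mc) (i := 0)
          (by omega)
      have fd : ∀ j, j < P.base + 4 * P.N + i ∨ P.base + 4 * P.N + i + 1 ≤ j →
          cpy 36 (P.base + 4 * P.N + i) 1 mc j = mc j := by
        rintro j (hj | hj)
        · exact cpy_below hj
        · exact cpy_above (by omega)
      generalize cpy 36 (P.base + 4 * P.N + i) 1 mc = md at hrd bdd vd fd
      have hre : Runs P.w P.n inp carryNext.cmd ⟨md, o⟩ ⟨den carryNext md, o⟩
          (weight carryNext * wordCost P.n) :=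
        Block.runs hS bdd (by decide) (by simp [Block.Legal, carryNext])
      have v58 : den carryNext md 58 = P.base + 4 * P.N + (i + 1) := by
        simp [den, carryNext, fd 58 (by omega), gc 58 (by omega), hb]; ring
      have fe : ∀ j, j < 58 ∨ 59 ≤ j → den carryNext md j = md j := fun j hj =>
        den_outside (lo := 58) (hi := 59) (by decide) hj
      have bde : Bd genv P.S (den carryNext md) := by
        refine bd_of_envAfter (wc := wordFactor) hS (by decide) bdd [58] (by decide) ?_
        simp only [List.mem_singleton, forall_eq, v58]
        exact P.address_lt_genv (by omega)
      refine ⟨den carryNext md, ⟨v58, ?_, ?_, ?_, ?_, ?_, bde⟩, ?_⟩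
      · rw [fe _ (by omega), fd _ (by omega), gc _ (by omega), hl]
      · rw [fe _ (by omega), fd _ (by omega), vc']
      · intro j hj
        rw [fe j (by omega), fd j (by omega), gc j (by omega), hf j hj]
      · intro q hq hq'
        rw [fe _ (by omega), fd _ (by omega), gc _ (by omega), hdat q (by omega) hq']
      · intro q hq
        rw [fe _ (by omega)]
        by_cases h1 : q = i
        · rw [h1, vd, vc]
        · rw [fd _ (by omega), gc _ (by omega), hdig q (by omega)]
      · refine (hra.seq (hrc.seq (hrd.seq hre))).mono ?_
        have w1 : weight carryBlock + weight carryNext ≤ 3900 := by decide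
        have i1 := Nat.mul_le_mul_right (wordCost P.n) w1
        simp only [add_mul] at i1
        omega)
    (by
      rintro m' ⟨ha, hl, -⟩
      show m' 58 = m' 59
      rw [ha, hl])
    ⟨by rw [b1]; rfl, l1, by rw [c1]; simp [valueOf], fun j hj => f1 j (by omega),
      fun q _ hq => by rw [f1 _ (by omega), hz q hq], fun q hq => by omega, bd1⟩
  refine ⟨m2, f2, z2, bd2, (hr1.seq hr2).mono ?_⟩
  have w1 : weight carryInit + 15 ≤ 2000 := by decide
  have i1 := Nat.mul_le_mul_right (wordCost P.n) w1
  simp only [add_mul] at i1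
  have i2 : P.N * (3900 * wordCost P.n + 2 * P.far + 16 * wordCost P.n) ≤
      P.N * (4000 * wordCost P.n + 2 * P.far) := Nat.mul_le_mul_left _ (by omega)
  omega

/-! ### Output -/

theorem bits_add (a b v : ℕ) : bits (a + b) v = bits a (v / 2 ^ b) ++ bits b v := by
  apply List.ext_getElem
  · simp [bits]
  · intro i h1 h2
    simp only [bits, List.length_map, List.length_range] at h1
    simp only [bits, List.getElem_map, List.getElem_range, List.getElem_append, List.length_map,
      List.length_range]
    split_ifs with h
    · rw [Nat.testBit_div_two_pow]; congr 1; omega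
    · congr 1; omega

theorem bits_mod {a S : ℕ} (h : a ≤ S) (v : ℕ) : bits a (v % 2 ^ S) = bits a v := by
  apply List.ext_getElem
  · simp [bits]
  · intro i h1 h2
    simp only [bits, List.length_map, List.length_range] at h1
    simp only [bits, List.getElem_map, List.getElem_range, Nat.testBit_mod_two_pow]
    simp; omega

/-- Before the output. -/
def outInit : Block :=
  [(55, (var 0 - lit 1) / var 1), (56, var 0 - var 55 * var 1), (58, var 13 + var 55)]

/-- Passage to the next digit. -/
def outNext : Block := [(55, var 55 - lit 1), (58, var 58 - lit 1)]

/-- Output of the digits. -/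
def outCmd : Cmd :=
  .seq outInit.cmd <| .seq (copyCmd (.reg 58) (.const 28) (.const 1)) <|
  .seq (outputCmd 28 (.reg 56)) <| .loop (.reg 55) (.const 0) <| .seq outNext.cmd <|
  .seq (copyCmd (.reg 58) (.const 28) (.const 1)) (outputCmd 28 (.reg 1))

/-- Output is appended on the right, so the digits are written from the top. The first one, number k
= (n - 1) / S, contributes only its n - k S lowest bits; each later one contributes exactly S, and
`bits_add` glues them together. -/
theorem outCmd_runs (P : Setting) {w₀ : ℕ × ℕ} {m : ℕ → ℕ} {o : List Bool}
    (hfix : Fix P w₀ m) {V : ℕ} (hn : 1 ≤ P.n) (hlast : (P.n - 1) / P.S < P.N)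
    (hV : ∀ q < P.N, m (P.base + 4 * P.N + q) = V / 2 ^ (P.S * q) % 2 ^ P.S)
    (hbd : Bd genv P.S m) :
    ∃ m', Runs P.w P.n inp outCmd ⟨m, o⟩ ⟨m', o ++ bits P.n V⟩
        (P.N * (4000 * wordCost P.n + P.far) + 2000 * wordCost P.n + P.far) := by
  have hS : 1 ≤ P.S := by have := P.two_le_S; omega
  have hW := wordCost_pos P.n
  have hbdef : P.base = 128 + 8 * P.B := rfl
  have hfar : 4 ≤ P.far := by unfold Setting.far; omega
  set k := (P.n - 1) / P.S with hk
  have hk1 : k * P.S ≤ P.n - 1 := Nat.div_mul_le_self _ _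
  have hk2 : P.n - 1 < (k + 1) * P.S := by
    rw [← Nat.div_lt_iff_lt_mul (by omega)]; omega
  rw [add_mul, one_mul] at hk2
  -- Fetching a digit, stated for an arbitrary memory because it occurs both before the loop and in
  -- its body.
  have hcpy : ∀ (m' : ℕ → ℕ) (o' : List Bool) (q : ℕ), q < P.N → m' 58 = P.base + 4 * P.N + q →
      m' (P.base + 4 * P.N + q) = V / 2 ^ (P.S * q) % 2 ^ P.S → Bd genv P.S m' →
      ∃ m'', m'' 28 = V / 2 ^ (P.S * q) % 2 ^ P.S ∧ (∀ j, j ≠ 28 → m'' j = m' j) ∧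
        Bd genv P.S m'' ∧
        Runs P.w P.n inp (copyCmd (.reg 58) (.const 28) (.const 1)) ⟨m', o'⟩ ⟨m'', o'⟩ P.far := by
    intro m' o' q hq h58 hd hb
    refine ⟨cpy (P.base + 4 * P.N + q) 28 1 m', ?_, ?_, ?_, ?_⟩
    · rw [← hd]
      exact cpy_apply (a := P.base + 4 * P.N + q) (b := 28) (l := 1) (m := m') (i := 0) (by omega)
    · intro j hj
      rcases Nat.lt_or_ge j 28 with h | h
      · exact cpy_below h
      · exact cpy_above (by omega)
    · refine bd_cpy_low hb fun j hj => ?_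
      interval_cases j
      rw [Nat.add_zero, hd]
      exact (Nat.mod_lt _ (by positivity)).trans_le (Nat.pow_le_pow_right (by norm_num)
        (by show P.S ≤ 34 * P.S; omega))
    · exact runs_copy (by simp [Arg.Low]) (by trivial) (by trivial) h58 rfl rfl (by omega)
        (by omega) (by omega) (P.address_le_far (by omega)) (P.address_le_far (by omega)) (by omega)
  have hr1 : Runs P.w P.n inp outInit.cmd ⟨m, o⟩ ⟨den outInit m, o⟩
      (weight outInit * wordCost P.n) := by
    refine Block.runs hS hbd (by decide) ?_
    simp only [Block.Legal, outInit]
    simp [hfix.r0, hfix.r1, ← hk]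
    omega
  have a1 : den outInit m 55 = k := by simp [den, outInit, hfix.r0, hfix.r1, ← hk]
  have b1 : den outInit m 56 = P.n - k * P.S := by simp [den, outInit, hfix.r0, hfix.r1, ← hk]
  have c1 : den outInit m 58 = P.base + 4 * P.N + k := by
    simp [den, outInit, hfix.r0, hfix.r1, hfix.r13, ← hk]
  have f1 : ∀ j, j < 55 ∨ 59 ≤ j → den outInit m j = m j := fun j hj =>
    den_outside (lo := 55) (hi := 59) (by decide) hj
  have bd1 : Bd genv P.S (den outInit m) :=
    bd_of_envAfter (wc := wordFactor) hS (by decide) hbd [] (by decide) (by simp)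
  generalize den outInit m = m1 at hr1 a1 b1 c1 f1 bd1
  obtain ⟨m2, v2, f2, bd2, hr2⟩ := hcpy m1 o k hlast c1 (by rw [f1 _ (by omega), hV k hlast]) bd1
  have hr3 : Runs P.w P.n inp (outputCmd 28 (.reg 56)) ⟨m2, o⟩
      ⟨m2, o ++ bits (P.n - k * P.S) (m2 28)⟩ (22 * wordCost P.n) :=
    runs_output (by simp [Arg.Low]) (by omega) ((f2 56 (by omega)).trans b1)
      (by unfold Setting.w wordFactor; omega)
  rw [v2, bits_mod (by omega)] at hr3
  obtain ⟨s4, ⟨a4, c4, o4, d4, bd4⟩, hr4⟩ := Runs.loop (w := P.w)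
    (n := P.n) (inp := inp) (A := .reg 55) (A' := .const 0) (by simp [Arg.Low]) (by trivial)
    (c := .seq outNext.cmd <|
      .seq (copyCmd (.reg 58) (.const 28) (.const 1)) (outputCmd 28 (.reg 1)))
    (K := 3900 * wordCost P.n + P.far)
    (fun i s => s.mem 55 = k - i ∧ s.mem 58 = P.base + 4 * P.N + (k - i) ∧
      s.out = o ++ bits (P.n - (k - i) * P.S) (V / 2 ^ (P.S * (k - i))) ∧
      (∀ j, j < 16 ∨ 64 ≤ j → s.mem j = m j) ∧ Bd genv P.S s.mem) (T := k)
    (by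
      rintro i hi ⟨m', o'⟩ ⟨ha, hb, ho, hf, hbd'⟩
      simp only at ha hb ho hf hbd'
      have hfix' := hfix.congr (m' := m') fun j hj => hf j (by omega)
      refine ⟨?_, ?_⟩
      · show m' 55 ≠ 0
        rw [ha]; omega
      have hra : Runs P.w P.n inp outNext.cmd ⟨m', o'⟩ ⟨den outNext m', o'⟩
          (weight outNext * wordCost P.n) := by
        refine Block.runs hS hbd' (by decide) ?_
        simp only [Block.Legal, outNext]
        simp [ha, hb]
        omega
      have aa : den outNext m' 55 = k - (i + 1) := by simp [den, outNext, ha]; omega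
      have ba : den outNext m' 58 = P.base + 4 * P.N + (k - (i + 1)) := by
        simp [den, outNext, hb]; omega
      have fa : ∀ j, j < 55 ∨ 59 ≤ j → den outNext m' j = m' j := fun j hj =>
        den_outside (lo := 55) (hi := 59) (by decide) hj
      have bda : Bd genv P.S (den outNext m') :=
        bd_of_envAfter (wc := wordFactor) hS (by decide) hbd' [] (by decide) (by simp)
      generalize den outNext m' = ma at hra aa ba fa bda
      obtain ⟨mb, vb, fb, bdb, hrb⟩ := hcpy ma o' (k - (i + 1)) (by omega) ba
        (by rw [fa _ (by omega), hf _ (by omega), hV _ (by omega)]) bda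
      have hrc : Runs P.w P.n inp (outputCmd 28 (.reg 1)) ⟨mb, o'⟩
          ⟨mb, o' ++ bits P.S (mb 28)⟩ (22 * wordCost P.n) :=
        runs_output (by simp [Arg.Low]) (by omega)
          (by show mb 1 = P.S; rw [fb 1 (by omega), fa 1 (by omega), hfix'.r1])
          (by unfold Setting.w wordFactor; omega)
      rw [vb, bits_mod le_rfl] at hrc
      refine ⟨⟨mb, _⟩, ⟨?_, ?_, ?_, ?_, bdb⟩, (hra.seq (hrb.seq hrc)).mono ?_⟩
      · show mb 55 = _
        rw [fb 55 (by omega), aa]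
      · show mb 58 = _
        rw [fb 58 (by omega), ba]
      · obtain ⟨j, hj⟩ : ∃ j, k - i = j + 1 := ⟨k - i - 1, by omega⟩
        have hj' : k - (i + 1) = j := by omega
        have hjS : (j + 1) * P.S ≤ k * P.S := Nat.mul_le_mul_right _ (by omega)
        have e : P.n - j * P.S = P.n - (j + 1) * P.S + P.S := by
          rw [add_mul, one_mul] at hjS ⊢; omega
        simp only [hj', hj] at ho ⊢
        rw [ho, List.append_assoc, e, bits_add, Nat.div_div_eq_div_mul, ← pow_add,
          mul_add P.S j 1, mul_one]
      · intro j hj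
        show mb j = _
        rw [fb j (by omega), fa j (by omega), hf j hj]
      · have w1 : weight outNext + 22 ≤ 3900 := by decide
        have i1 := Nat.mul_le_mul_right (wordCost P.n) w1
        simp only [add_mul] at i1
        omega)
    (by
      rintro ⟨m', o'⟩ ⟨ha, -⟩
      show m' 55 = 0
      simp only at ha
      omega) (s := ⟨m2, _⟩)
    ⟨(f2 55 (by omega)).trans a1, (f2 58 (by omega)).trans c1, rfl,
      fun j hj => (f2 j (by omega)).trans (f1 j (by omega)), bd2⟩
  obtain ⟨m4, out4⟩ := s4
  simp only [Nat.sub_self, Nat.zero_mul, Nat.sub_zero, Nat.mul_zero, pow_zero, Nat.div_one] at o4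
  subst o4
  refine ⟨m4, (hr1.seq (hr2.seq (hr3.seq hr4))).mono ?_⟩
  have w1 : weight outInit + 22 + 15 ≤ 2000 := by decide
  have i1 := Nat.mul_le_mul_right (wordCost P.n) w1
  simp only [add_mul] at i1
  have i2 : k * (3900 * wordCost P.n + P.far + 16 * wordCost P.n) ≤
      P.N * (4000 * wordCost P.n + P.far) := Nat.mul_le_mul hlast.le (by omega)
  omega

end DepthCostRAM

namespace DepthCostRAM

open _root_.DepthCostRAM.Expr Block

variable {inp : ℕ}

/-! ### The whole program -/

/-- The data after `s` levels of the forward transforms. -/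
def fwdArr (P : Setting) (w₀ : ℕ × ℕ) (A : ℕ → Quad) : ℕ → ℕ → Quad
  | 0 => A
  | s + 1 => level (fwdLo P.D) (fwdHi P.D) (2 ^ (P.L - (s + 1))) (zpow P.D (zsq P.D w₀ (s + 1)))
      (fwdArr P w₀ A s)

/-- The products of corresponding values. -/
def prodArr (P : Setting) (A : ℕ → Quad) (q : ℕ) : Quad := quadMul P.D (A q) (A (P.N + q))

/-- The data after `s` levels of the inverse transform. -/
def invArr (P : Setting) (w₀ : ℕ × ℕ) (A : ℕ → Quad) : ℕ → ℕ → Quad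
  | 0 => A
  | s + 1 => level (invLo P.D) (invHi P.D) (2 ^ s) (zpow P.D (zsq P.D w₀ (P.L - s)))
      (invArr P w₀ A s)

/-- Before the forward transforms. -/
def fwdInit : Block := [(16, var 4 / lit 2), (17, var 4)]

/-- Passage to the next level of the forward transforms. -/
def fwdNext : Block := [(16, var 16 / lit 2)]

/-- Before the inverse transform. -/
def invInit : Block := [(16, lit 1), (17, var 4 / lit 2)]

/-- Passage to the next level of the inverse transform. -/
def invNext : Block := [(16, lit 2 * var 16)]

/-- The levels of the forward transforms. -/
def fwdLoop : Cmd := .loop (.reg 16) (.const 0) (.seq (levelCmd fwdBlock) fwdNext.cmd)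

/-- The levels of the inverse transform. -/
def invLoop : Cmd := .loop (.reg 16) (.reg 4) (.seq (levelCmd invBlock) invNext.cmd)

/-- Everything up to the forward transforms. -/
def startCmd : Cmd := .seq paramsCmd (.seq rootCmd (.seq readCmd fwdInit.cmd))

/-- What stands between the transforms. -/
def middleCmd : Cmd := .seq mulCmd invInit.cmd

/-- Everything after the coefficients have been rounded. -/
def finishCmd : Cmd := .seq carryCmd outCmd

/-- The program that multiplies integers. -/
def program : Cmd :=
  .seq startCmd <| .seq fwdLoop <| .seq middleCmd <| .seq invLoop <| .seq roundCmd finishCmd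

/-- The machine that multiplies integers. -/
def multiplier : Machine := ⟨program.compile 0, wordFactor⟩

/-- A bound for the cost of a level of a transform. -/
def Setting.levelCost (P : Setting) : ℕ :=
  P.L * (3000 * wordCost P.n) + 2000 * wordCost P.n +
    P.N / P.B * (P.B * (10016 * wordCost P.n + 4 * P.near) + 2016 * wordCost P.n + 4 * P.far)

/-- The state before level `s` of the forward transforms. -/
structure FwdInv (P : Setting) (w₀ : ℕ × ℕ) (A : ℕ → Quad) (s : ℕ) (m : ℕ → ℕ) : Prop where
  fix : Fix P w₀ m
  dist : m 16 = 2 ^ P.L / 2 ^ (s + 1)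
  count : m 17 = P.N
  data : ∀ i < 2 * P.N, quad m (P.base + 4 * i) = fwdArr P w₀ A s i
  bd : Bd genv P.S m

/-- The state before level `s` of the inverse transform. -/
structure InvInv (P : Setting) (w₀ : ℕ × ℕ) (A : ℕ → Quad) (s : ℕ) (m : ℕ → ℕ) : Prop where
  fix : Fix P w₀ m
  dist : m 16 = 2 ^ s
  count : m 17 = P.N / 2
  data : ∀ i < P.N, quad m (P.base + 4 * i) = invArr P w₀ A s i
  bd : Bd genv P.S m

theorem startCmd_runs (P : Setting) {d : ℕ} (hP : P.Computed d) {mm x y : ℕ}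
    (hn : P.n = 2 * mm) (hx : x < 2 ^ mm) (hy : y < 2 ^ mm) (hmm : 1 ≤ mm)
    (hinp : inp = inputOf mm x y) (hdN : 2 * d ≤ P.N) (o : List Bool) :
    ∃ m', FwdInv P (rootZero P.D P.L) (initArray P x y) 0 m' ∧
      Runs P.w P.n inp startCmd ⟨Function.update (fun _ => 0) 0 P.n, o⟩ ⟨m', o⟩
        (P.S * (10000 * wordCost P.n) + 100 * P.S * P.S * (1000 * wordCost P.n) +
          (P.N * (4000 * wordCost P.n + 2 * P.far) + 3000 * wordCost P.n)) := by
  have hS : 1 ≤ P.S := by have := P.two_le_S; omega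
  have hbdef : P.base = 128 + 8 * P.B := rfl
  obtain ⟨m1, fix1, h14, h48, h47, h15, z1, bd1, hr1⟩ :=
    paramsCmd_runs (inp := inp) P hP (o := o) rfl
  obtain ⟨m2, fix2, f2, h15', bd2, hr2⟩ := rootCmd_runs (inp := inp) (o := o) P fix1 h14 h48 h47 bd1
  obtain ⟨m3, f3, dat3, bd3, hr3⟩ := readCmd_runs P hP hn hx hy hmm hinp (o := o) fix2
    (h15'.trans h15) (fun r hr => (f2 r hr).trans (z1 r hr)) bd2 hdN
  have fix3 := fix2.congr f3
  have hr4 : Runs P.w P.n inp fwdInit.cmd ⟨m3, o⟩ ⟨den fwdInit m3, o⟩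
      (weight fwdInit * wordCost P.n) :=
    Block.runs hS bd3 (by decide) (by simp [Block.Legal, fwdInit])
  have f4 : ∀ j, j < 16 ∨ 18 ≤ j → den fwdInit m3 j = m3 j := fun j hj =>
    den_outside (lo := 16) (hi := 18) (by decide) hj
  refine ⟨den fwdInit m3, ⟨fix3.congr fun j hj => f4 j (by omega), ?_, ?_, ?_, ?_⟩, ?_⟩
  · simp [den, fwdInit, fix3.r4, Setting.N]
  · simp [den, fwdInit, fix3.r4]
  · intro i hi
    rw [fwdArr, ← dat3 i hi]
    exact quad_congr fun j _ => f4 _ (by omega)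
  · exact bd_of_envAfter (wc := wordFactor) hS (by decide) bd3 [] (by decide) (by simp)
  · refine (hr1.seq (hr2.seq (hr3.seq hr4))).mono ?_
    have w1 : weight fwdInit ≤ 1000 := by decide
    have i1 := Nat.mul_le_mul_right (wordCost P.n) w1
    have i2 : d * (4000 * wordCost P.n + 2 * P.far) ≤ P.N * (4000 * wordCost P.n + 2 * P.far) :=
      Nat.mul_le_mul_right _ (by omega)
    omega

/-- Both factors are transformed at once, as a single vector of 2N entries: since 2h divides N, no
butterfly straddles the two halves. The distance is the quotient 2^L / 2^(s + 1), which becomes 0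
after the last level and ends the loop. -/
theorem fwdLoop_body (P : Setting) {w₀ : ℕ × ℕ} (hsq : SquaresOK P w₀) {A : ℕ → Quad} {M s : ℕ}
    (hs : s < P.L) (hM : M < 2 ^ (34 * P.S)) (hAM : ∀ i < 2 * P.N, (fwdArr P w₀ A s i).Le M)
    {m : ℕ → ℕ} (hI : FwdInv P w₀ A s m) (o : List Bool) :
    m 16 ≠ 0 ∧ ∃ m', FwdInv P w₀ A (s + 1) m' ∧
      Runs P.w P.n inp (.seq (levelCmd fwdBlock) fwdNext.cmd) ⟨m, o⟩ ⟨m', o⟩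
        (P.levelCost + 1000 * wordCost P.n) := by
  have hS : 1 ≤ P.S := by have := P.two_le_S; omega
  have hbdef : P.base = 128 + 8 * P.B := rfl
  have h16 : m 16 = 2 ^ (P.L - (s + 1)) := by
    rw [hI.dist, Nat.pow_div (by omega) (by norm_num)]
  refine ⟨by rw [h16]; positivity, ?_⟩
  obtain ⟨m1, f1, r1, d1, bd1, hr1⟩ := levelCmd_runs (inp := inp) (o := o) P
    (isButterfly_fwd P.D_pos) hI.fix hsq (e := s + 1) (by omega) hs h16 hI.count le_rfl
    (pow_dvd_pow 2 (by omega)) ((Dvd.intro_left 2 rfl).trans P.two_B_dvd_N) hI.data hAM hM hI.bd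
  have hr2 : Runs P.w P.n inp fwdNext.cmd ⟨m1, o⟩ ⟨den fwdNext m1, o⟩
      (weight fwdNext * wordCost P.n) :=
    Block.runs hS bd1 (by decide) (by simp [Block.Legal, fwdNext])
  have f2 : ∀ j, j < 16 ∨ 17 ≤ j → den fwdNext m1 j = m1 j := fun j hj =>
    den_outside (lo := 16) (hi := 17) (by decide) hj
  refine ⟨den fwdNext m1, ⟨hI.fix.congr fun j hj => ?_, ?_, ?_, ?_, ?_⟩, ?_⟩
  · rw [f2 j (by omega), f1 j (by omega)]
  · simp only [den, fwdNext]
    simp [f1 16 (by omega), hI.dist, Nat.div_div_eq_div_mul, pow_succ]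
  · rw [f2 17 (by omega), f1 17 (by omega), hI.count]
  · intro i hi
    rw [fwdArr, ← d1 i hi]
    exact quad_congr fun j _ => f2 _ (by omega)
  · exact bd_of_envAfter (wc := wordFactor) hS (by decide) bd1 [] (by decide) (by simp)
  · refine (hr1.seq hr2).mono ?_
    have w1 : weight fwdNext ≤ 1000 := by decide
    have i1 := Nat.mul_le_mul_right (wordCost P.n) w1
    unfold Setting.levelCost
    omega

theorem middleCmd_runs (P : Setting) {w₀ : ℕ × ℕ} {A : ℕ → Quad} {M : ℕ}
    (hM : M < 2 ^ (34 * P.S)) (hAM : ∀ i < 2 * P.N, (fwdArr P w₀ A P.L i).Le M)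
    {m : ℕ → ℕ} (hI : FwdInv P w₀ A P.L m) (o : List Bool) :
    ∃ m', InvInv P w₀ (prodArr P (fwdArr P w₀ A P.L)) 0 m' ∧
      Runs P.w P.n inp middleCmd ⟨m, o⟩ ⟨m', o⟩
        (P.N * (4000 * wordCost P.n + 3 * P.far) + 3000 * wordCost P.n) := by
  have hS : 1 ≤ P.S := by have := P.two_le_S; omega
  have hbdef : P.base = 128 + 8 * P.B := rfl
  obtain ⟨m1, f1, d1, bd1, hr1⟩ := mulCmd_runs (inp := inp) (o := o) P hI.fix hI.data hAM hM hI.bd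
  have fix1 := hI.fix.congr f1
  have hr2 : Runs P.w P.n inp invInit.cmd ⟨m1, o⟩ ⟨den invInit m1, o⟩
      (weight invInit * wordCost P.n) :=
    Block.runs hS bd1 (by decide) (by simp [Block.Legal, invInit])
  have f2 : ∀ j, j < 16 ∨ 18 ≤ j → den invInit m1 j = m1 j := fun j hj =>
    den_outside (lo := 16) (hi := 18) (by decide) hj
  refine ⟨den invInit m1, ⟨fix1.congr fun j hj => f2 j (by omega), ?_, ?_, ?_, ?_⟩, ?_⟩
  · simp [den, invInit]
  · simp [den, invInit, fix1.r4]
  · intro i hi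
    rw [invArr, prodArr, ← d1 i hi]
    exact quad_congr fun j _ => f2 _ (by omega)
  · exact bd_of_envAfter (wc := wordFactor) hS (by decide) bd1 [] (by decide) (by simp)
  · refine (hr1.seq hr2).mono ?_
    have w1 : weight invInit ≤ 1000 := by decide
    have i1 := Nat.mul_le_mul_right (wordCost P.n) w1
    omega

/-- Level s has distance 2^s and thus takes the squared root number L - s, the same root as the
forward level of that distance; the conjugation is built into the butterfly. -/
theorem invLoop_body (P : Setting) {w₀ : ℕ × ℕ} (hsq : SquaresOK P w₀) {A : ℕ → Quad} {M s : ℕ}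
    (hs : s < P.L) (hM : M < 2 ^ (34 * P.S)) (hAM : ∀ i < P.N, (invArr P w₀ A s i).Le M)
    {m : ℕ → ℕ} (hI : InvInv P w₀ A s m) (o : List Bool) :
    m 16 ≠ m 4 ∧ ∃ m', InvInv P w₀ A (s + 1) m' ∧
      Runs P.w P.n inp (.seq (levelCmd invBlock) invNext.cmd) ⟨m, o⟩ ⟨m', o⟩
        (P.levelCost + 1000 * wordCost P.n) := by
  have hS : 1 ≤ P.S := by have := P.two_le_S; omega
  have hbdef : P.base = 128 + 8 * P.B := rfl
  have hL : P.N = 2 * 2 ^ (P.L - 1) := by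
    unfold Setting.N; rw [← pow_succ', Nat.sub_add_cancel (by omega)]
  have hN2 : P.N / 2 = 2 ^ (P.L - 1) := by omega
  have h16 : m 16 = 2 ^ (P.L - (P.L - s)) := by
    rw [hI.dist]; congr 1; omega
  have h2T : 2 * (P.N / 2) = P.N := by omega
  refine ⟨?_, ?_⟩
  · rw [hI.dist, hI.fix.r4]
    exact (Nat.pow_lt_pow_right (by norm_num) hs).ne
  obtain ⟨m1, f1, r1, d1, bd1, hr1⟩ := levelCmd_runs (inp := inp) (o := o) P
    (isButterfly_inv P.D_pos) hI.fix hsq (e := P.L - s) (by omega) (by omega) h16 hI.count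
    (by omega) (by rw [hN2]; exact pow_dvd_pow 2 (by omega))
    (by rw [hN2]; exact pow_dvd_pow 2 (by have := P.f_lt; omega))
    (by rw [h2T]; exact hI.data) (by rw [h2T]; exact hAM) hM hI.bd
  rw [show P.L - (P.L - s) = s by omega] at d1
  have hr2 : Runs P.w P.n inp invNext.cmd ⟨m1, o⟩ ⟨den invNext m1, o⟩
      (weight invNext * wordCost P.n) :=
    Block.runs hS bd1 (by decide) (by simp [Block.Legal, invNext])
  have f2 : ∀ j, j < 16 ∨ 17 ≤ j → den invNext m1 j = m1 j := fun j hj =>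
    den_outside (lo := 16) (hi := 17) (by decide) hj
  have v16 : den invNext m1 16 = 2 ^ (s + 1) := by
    simp only [den, invNext]
    simp [f1 16 (by omega), hI.dist, pow_succ']
  refine ⟨den invNext m1, ⟨hI.fix.congr fun j hj => ?_, v16, ?_, ?_, ?_⟩, ?_⟩
  · rw [f2 j (by omega), f1 j (by omega)]
  · rw [f2 17 (by omega), f1 17 (by omega), hI.count]
  · intro i hi
    rw [invArr, ← d1 i (by omega)]
    exact quad_congr fun j _ => f2 _ (by omega)
  · refine bd_of_envAfter (wc := wordFactor) hS (by decide) bd1 [16] (by decide) ?_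
    simp only [List.mem_singleton, forall_eq, v16]
    exact Nat.pow_lt_pow_right (by norm_num)
      (by have := P.L_le; show s + 1 < 2 * P.S; omega)
  · refine (hr1.seq hr2).mono ?_
    have w1 : weight invNext ≤ 1000 := by decide
    have i1 := Nat.mul_le_mul_right (wordCost P.n) w1
    have i2 : P.N / 2 / P.B * (P.B * (10016 * wordCost P.n + 4 * P.near) + 2016 * wordCost P.n +
        4 * P.far) ≤ P.N / P.B * (P.B * (10016 * wordCost P.n + 4 * P.near) +
        2016 * wordCost P.n + 4 * P.far) :=
      Nat.mul_le_mul_right _ (Nat.div_le_div_right (Nat.div_le_self _ _))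
    unfold Setting.levelCost
    omega

/-- A bound for the total cost. -/
def Setting.totalCost (P : Setting) : ℕ :=
  P.S * (10000 * wordCost P.n) + 100 * P.S * P.S * (1000 * wordCost P.n) +
    P.N * (20000 * wordCost P.n + 10 * P.far) + P.far + 20000 * wordCost P.n +
    2 * (P.L * (P.levelCost + 1016 * wordCost P.n))

theorem configAt_of_isAt {M : Machine} {n inp t pc k : ℕ} {s : St} (h : M.IsAt n inp t pc s k) :
    ∃ σ, M.configAt n inp t = some σ ∧ ∀ r, 128 ≤ r → σ.mem r = s.mem r := by
  obtain ⟨m, hm, hc, -⟩ := h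
  exact ⟨_, hc, fun r hr => hm r (Or.inr hr)⟩

/-- Everything about real and complex numbers enters through hypotheses: admissible roots, size
bounds, legality of the rounding and its result. What remains is to chain the parts of the program
and to keep the times at which the loops of the transforms are at their heads. -/
theorem multiplier_run (P : Setting) {d : ℕ} (hP : P.Computed d) {mm x y : ℕ}
    (hn : P.n = 2 * mm) (hx : x < 2 ^ mm) (hy : y < 2 ^ mm) (hmm : 1 ≤ mm) (hdN : 2 * d ≤ P.N)
    {w₀ : ℕ × ℕ} (hw₀ : w₀ = rootZero P.D P.L) (hsq : SquaresOK P w₀) {M : ℕ}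
    (hM : M < 2 ^ (34 * P.S)) {F H : ℕ → ℕ → Quad} (hF : F = fwdArr P w₀ (initArray P x y))
    (hH : H = invArr P w₀ (prodArr P (F P.L)))
    (hFM : ∀ s ≤ P.L, ∀ i < 2 * P.N, (F s i).Le M) (hHM : ∀ s ≤ P.L, ∀ i < P.N, (H s i).Le M)
    (hround : ∀ q < P.N, (H P.L q).b ≤ (H P.L q).a + P.D * P.N / 2) {z : ℕ → ℕ}
    (hz : ∀ q < P.N, z q = P.round (H P.L q)) (hzlt : ∀ q < P.N, z q < 2 ^ (4 * P.S))
    (hlast : (P.n - 1) / P.S < P.N) :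
    ∃ (tF tH : ℕ → ℕ) (tz T : ℕ), Monotone tF ∧ Monotone tH ∧ tF P.L ≤ tH 0 ∧ tH P.L ≤ tz ∧
      tz ≤ T ∧
      (∀ s ≤ P.L, ∃ σ, multiplier.configAt P.n (inputOf mm x y) (tF s) = some σ ∧
        ∀ i < 2 * P.N, quad σ.mem (P.base + 4 * i) = F s i) ∧
      (∀ s ≤ P.L, ∃ σ, multiplier.configAt P.n (inputOf mm x y) (tH s) = some σ ∧
        ∀ i < P.N, quad σ.mem (P.base + 4 * i) = H s i) ∧
      (∃ σ, multiplier.configAt P.n (inputOf mm x y) tz = some σ ∧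
        ∀ i < P.N, σ.mem (P.base + 4 * P.N + i) = z i) ∧
      multiplier.HaltsWith P.n (inputOf mm x y) T (bits P.n (valueOf P.S z P.N)) ∧
      multiplier.cost P.n (inputOf mm x y) T ≤ P.totalCost := by
  have hbdef : P.base = 128 + 8 * P.B := rfl
  have hw : multiplier.wordLen P.n = P.w := by
    rw [Machine.wordLen, ← hP.size_eq]; rfl
  set inp := inputOf mm x y with hinp
  subst hw₀
  have hpl : program.Placed multiplier 0 := ⟨[], [], by simp [multiplier], rfl⟩
  have pl1 := hpl.seq_left
  have pl2 := hpl.seq_right.seq_left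
  have pl3 := hpl.seq_right.seq_right.seq_left
  have pl4 := hpl.seq_right.seq_right.seq_right.seq_left
  have pl5 := hpl.seq_right.seq_right.seq_right.seq_right.seq_left
  have pl6 := hpl.seq_right.seq_right.seq_right.seq_right.seq_right
  have at0 : multiplier.IsAt P.n inp 0 0 ⟨Function.update (fun _ => 0) 0 P.n, []⟩ 0 :=
    ⟨_, Sim.refl _, rfl, by simp [Machine.cost]⟩
  -- start
  obtain ⟨m1, inv1, hr1⟩ := startCmd_runs P hP hn hx hy hmm hinp hdN []
  rw [← hw] at hr1
  obtain ⟨t1, -, at1⟩ := at0.run hr1 pl1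
  -- forward transforms
  obtain ⟨tF, monoF, hF0, atF⟩ := Machine.IsAt.loop (A := .reg 16) (A' := .const 0)
    (by simp [Arg.Low]) (by trivial) (T := P.L) (K := P.levelCost + 1000 * wordCost P.n)
    (fun s st => st.out = [] ∧ FwdInv P (rootZero P.D P.L) (initArray P x y) s st.mem)
    (by
      rintro s hs ⟨m, o⟩ ⟨ho, hI⟩
      simp only at ho hI
      subst ho
      obtain ⟨h1, m', h2, h3⟩ := fwdLoop_body (inp := inp) P hsq hs hM
        (by rw [← hF]; exact hFM s hs.le) hI []
      exact ⟨h1, ⟨m', []⟩, ⟨rfl, h2⟩, by rw [hw]; exact h3⟩)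
    (s := ⟨m1, []⟩) ⟨rfl, inv1⟩ at1 pl2
  obtain ⟨⟨m2, o2⟩, ⟨ho2, inv2⟩, at2⟩ := atF P.L le_rfl
  simp only at ho2 inv2
  subst ho2
  -- After L levels the distance is 2^L / 2^(L + 1) = 0.
  obtain ⟨t2, ht2, at2'⟩ := at2.loop_exit (A := .reg 16) (A' := .const 0)
    (by simp [Arg.Low]) (by trivial) (by
      show m2 16 = 0
      rw [inv2.dist]
      exact Nat.div_eq_of_lt (Nat.pow_lt_pow_right (by norm_num) (by omega))) pl2
  -- products
  obtain ⟨m3, inv3, hr3⟩ := middleCmd_runs (inp := inp) P hM (by rw [← hF]; exact hFM _ le_rfl)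
    inv2 []
  rw [← hw] at hr3
  rw [← fwdLoop] at at2'
  obtain ⟨t3, ht3, at3⟩ := at2'.run hr3 pl3
  rw [← hF] at inv3
  -- inverse transform
  obtain ⟨tH, monoH, hH0, atH⟩ := Machine.IsAt.loop (A := .reg 16) (A' := .reg 4)
    (by simp [Arg.Low]) (by simp [Arg.Low]) (T := P.L) (K := P.levelCost + 1000 * wordCost P.n)
    (fun s st => st.out = [] ∧ InvInv P (rootZero P.D P.L) (prodArr P (F P.L)) s st.mem)
    (by
      rintro s hs ⟨m, o⟩ ⟨ho, hI⟩
      simp only at ho hI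
      subst ho
      obtain ⟨h1, m', h2, h3⟩ := invLoop_body (inp := inp) P hsq hs hM
        (by rw [← hH]; exact hHM s hs.le) hI []
      exact ⟨h1, ⟨m', []⟩, ⟨rfl, h2⟩, by rw [hw]; exact h3⟩)
    (s := ⟨m3, []⟩) ⟨rfl, inv3⟩ at3 pl4
  obtain ⟨⟨m4, o4⟩, ⟨ho4, inv4⟩, at4⟩ := atH P.L le_rfl
  simp only at ho4 inv4
  subst ho4
  obtain ⟨t4, ht4, at4'⟩ := at4.loop_exit (A := .reg 16) (A' := .reg 4)
    (by simp [Arg.Low]) (by simp [Arg.Low]) (by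
      show m4 16 = m4 4
      rw [inv4.dist, inv4.fix.r4]
      rfl) pl4
  -- rounding
  have dat4 := inv4.data
  rw [← hH] at dat4
  obtain ⟨m5, f5, z5, bd5, hr5⟩ := roundCmd_runs (inp := inp) (o := []) P inv4.fix dat4
    (hHM _ le_rfl) hM hround inv4.bd
  rw [← hw] at hr5
  rw [← invLoop] at at4'
  obtain ⟨t5, ht5, at5⟩ := at4'.run hr5 pl5
  have fix5 := inv4.fix.congr f5
  have z5' : ∀ q < P.N, m5 (P.base + 4 * P.N + q) = z q := fun q hq => by rw [z5 q hq, hz q hq]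
  -- carries and output
  obtain ⟨m6, f6, z6, bd6, hr6⟩ := carryCmd_runs (inp := inp) (o := []) P fix5 z5' hzlt bd5
  obtain ⟨m7, hr7⟩ := outCmd_runs (inp := inp) (o := []) P (fix5.congr f6) (by omega) hlast z6 bd6
  have hr67 := hr6.seq hr7
  rw [← hw] at hr67
  obtain ⟨t6, ht6, at6⟩ := at5.run hr67 pl6
  refine ⟨tF, tH, t5, t6, monoF, monoH, by omega, by omega, ht6, ?_, ?_, ?_, ?_, ?_⟩
  · intro s hs
    obtain ⟨st, ⟨-, hI⟩, hat⟩ := atF s hs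
    obtain ⟨σ, h1, h2⟩ := configAt_of_isAt hat
    refine ⟨σ, h1, fun i hi => ?_⟩
    rw [hF, ← hI.data i hi]
    exact quad_congr fun j _ => h2 _ (by omega)
  · intro s hs
    obtain ⟨st, ⟨-, hI⟩, hat⟩ := atH s hs
    obtain ⟨σ, h1, h2⟩ := configAt_of_isAt hat
    refine ⟨σ, h1, fun i hi => ?_⟩
    rw [hH, ← hI.data i hi]
    exact quad_congr fun j _ => h2 _ (by omega)
  · obtain ⟨σ, h1, h2⟩ := configAt_of_isAt at5
    exact ⟨σ, h1, fun i hi => by rw [h2 _ (by omega)]; exact z5' i hi⟩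
  · obtain ⟨m, hm, hc, -⟩ := at6
    refine ⟨_, hc, ?_, ?_⟩
    · show (program.compile 0).length ≤ _
      rw [Cmd.length_compile]
      simp only [program, finishCmd, Cmd.len]
      omega
    · simp
  · obtain ⟨m, hm, -, hk⟩ := at6
    refine hk.trans ?_
    unfold Setting.totalCost
    have e1 : P.L * (P.levelCost + 1000 * wordCost P.n + 16 * wordCost P.n) =
      P.L * (P.levelCost + 1016 * wordCost P.n) := by ring
    rw [e1]
    have e2 : P.N * (20000 * wordCost P.n + 10 * P.far) =
      P.N * (4000 * wordCost P.n + 2 * P.far) + P.N * (4000 * wordCost P.n + 3 * P.far) +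
      P.N * (4000 * wordCost P.n + 2 * P.far) + P.N * (4000 * wordCost P.n + 2 * P.far) +
      P.N * (4000 * wordCost P.n + P.far) := by ring
    rw [e2]
    omega

end DepthCostRAM

namespace DepthCostRAM

open Polynomial

/-! ### The exact transforms -/

/-- The root of unity `exp (2 π i j / (2 h))`. -/
noncomputable def unity (h : ℕ) (j : ℤ) : ℂ :=
  Complex.exp (2 * Real.pi * Complex.I * ((j : ℂ) / ((2 * h : ℕ) : ℂ)))

theorem norm_unity (h : ℕ) (j : ℤ) : ‖unity h j‖ = 1 := by
  have : 2 * Real.pi * Complex.I * ((j : ℂ) / ((2 * h : ℕ) : ℂ)) =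
      ((2 * Real.pi * ((j : ℝ) / ((2 * h : ℕ) : ℝ)) : ℝ) : ℂ) * Complex.I := by
    push_cast; ring
  rw [unity, this, Complex.norm_exp_ofReal_mul_I]

theorem unity_add (h : ℕ) (i j : ℤ) : unity h (i + j) = unity h i * unity h j := by
  rw [unity, unity, unity, ← Complex.exp_add]; congr 1; push_cast; ring

theorem unity_zero (h : ℕ) : unity h 0 = 1 := by simp [unity]

theorem unity_nat (h j : ℕ) : unity h j = unity h 1 ^ j := by
  induction j with
  | zero => simpa using unity_zero h
  | succ j ih => rw [pow_succ, ← ih, ← unity_add]; norm_cast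

theorem unity_neg_mul (h : ℕ) (j : ℤ) : unity h (-j) * unity h j = 1 := by
  rw [← unity_add, neg_add_cancel, unity_zero]

theorem unity_pow_self {h : ℕ} (hh : 0 < h) : unity h 1 ^ h = -1 := by
  rw [← unity_nat, unity, show 2 * Real.pi * Complex.I * (((h : ℤ) : ℂ) / ((2 * h : ℕ) : ℂ)) =
    Real.pi * Complex.I by
      have : (h : ℂ) ≠ 0 := by exact_mod_cast hh.ne'
      push_cast; field_simp, Complex.exp_pi_mul_I]

theorem unity_ne_zero (h : ℕ) (j : ℤ) : unity h j ≠ 0 := Complex.exp_ne_zero _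

theorem unity_neg (h : ℕ) (j : ℤ) : unity h (-j) = (starRingEnd ℂ) (unity h j) := by
  rw [unity, unity, ← Complex.exp_conj]
  congr 1
  simp only [map_mul, map_div₀, Complex.conj_I, Complex.conj_ofReal, map_natCast, map_intCast,
    map_ofNat]
  push_cast; ring

/-- One exact level of the forward transform. -/
noncomputable def exactFwd (h : ℕ) (a : ℕ → ℂ) (i : ℕ) : ℂ :=
  if i % (2 * h) < h then a i + a (i + h) else (a (i - h) - a i) * unity h (i % h : ℕ)

/-- One exact level of the inverse transform. -/
noncomputable def exactInv (h : ℕ) (a : ℕ → ℂ) (i : ℕ) : ℂ :=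
  if i % (2 * h) < h then a i + unity h (-(i % h : ℕ)) * a (i + h)
  else a (i - h) - unity h (-(i % h : ℕ)) * a i

section levels

variable {h b j : ℕ} (a : ℕ → ℂ)

theorem exactFwd_upper (hj : j < h) :
    exactFwd h a (2 * h * b + j) = a (2 * h * b + j) + a (2 * h * b + h + j) := by
  rw [exactFwd, upper_mod_two hj, if_pos hj, add_right_comm]

theorem exactFwd_lower (hj : j < h) : exactFwd h a (2 * h * b + h + j) =
    (a (2 * h * b + j) - a (2 * h * b + h + j)) * unity h j := by
  rw [exactFwd, lower_mod_two hj, if_neg (by omega), lower_mod hj,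
    show 2 * h * b + h + j - h = 2 * h * b + j by omega]

theorem exactInv_upper (hj : j < h) : exactInv h a (2 * h * b + j) =
    a (2 * h * b + j) + unity h (-j) * a (2 * h * b + h + j) := by
  rw [exactInv, upper_mod_two hj, if_pos hj, upper_mod hj, add_right_comm]

theorem exactInv_lower (hj : j < h) : exactInv h a (2 * h * b + h + j) =
    a (2 * h * b + j) - unity h (-j) * a (2 * h * b + h + j) := by
  rw [exactInv, lower_mod_two hj, if_neg (by omega), lower_mod hj,
    show 2 * h * b + h + j - h = 2 * h * b + j by omega]

/-- The value at `x` of the polynomial whose coefficients form block number `b` of length `h`. -/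
noncomputable def blockEval (h : ℕ) (a : ℕ → ℂ) (b : ℕ) (x : ℂ) : ℂ :=
  ∑ j ∈ Finset.range h, a (h * b + j) * x ^ j

theorem blockEval_two_mul (x : ℂ) : blockEval (2 * h) a b x =
    ∑ j ∈ Finset.range h, (a (2 * h * b + j) + x ^ h * a (2 * h * b + h + j)) * x ^ j := by
  rw [blockEval, two_mul h, Finset.sum_range_add, ← Finset.sum_add_distrib]
  refine Finset.sum_congr rfl fun j _ => ?_
  rw [pow_add, ← add_assoc]; ring

/-- The sums in a forward level are the coefficients of the block polynomial reduced modulo X^h - 1,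
which does not change values at points with x^h = 1. -/
theorem blockEval_fwd_even {x : ℂ} (hx : x ^ h = 1) :
    blockEval h (exactFwd h a) (2 * b) x = blockEval (2 * h) a b x := by
  rw [blockEval_two_mul, blockEval]
  refine Finset.sum_congr rfl fun j hj => ?_
  rw [show h * (2 * b) + j = 2 * h * b + j by ring, exactFwd_upper a (Finset.mem_range.1 hj), hx,
    one_mul]

/-- The differences are the coefficients of the reduction modulo X^h + 1. Multiplying the j-th one
by the j-th power of a root with ζ^h = -1 substitutes ζX for X, which turns the points with x^h = -1
into points with x^h = 1, so that the next level can proceed in the same way. -/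
theorem blockEval_fwd_odd {x : ℂ} (hh : 0 < h) (hx : x ^ h = 1) :
    blockEval h (exactFwd h a) (2 * b + 1) x = blockEval (2 * h) a b (unity h 1 * x) := by
  rw [blockEval_two_mul, blockEval]
  refine Finset.sum_congr rfl fun j hj => ?_
  rw [show h * (2 * b + 1) + j = 2 * h * b + h + j by ring,
    exactFwd_lower a (Finset.mem_range.1 hj), mul_pow, mul_pow, hx, unity_pow_self hh, unity_nat]
  ring

/-- In the sum of the two results of an inverse butterfly the lower entry cancels; in their
difference, as in `blockEval_inv_odd`, the upper one does. Each level leaves a factor 2. -/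
theorem blockEval_inv_even {x : ℂ} (hx : x ^ h = 1) :
    blockEval (2 * h) (exactInv h a) b x = 2 * blockEval h a (2 * b) x := by
  rw [blockEval_two_mul, blockEval, Finset.mul_sum]
  refine Finset.sum_congr rfl fun j hj => ?_
  rw [show h * (2 * b) + j = 2 * h * b + j by ring, exactInv_upper a (Finset.mem_range.1 hj),
    exactInv_lower a (Finset.mem_range.1 hj), hx]
  ring

theorem blockEval_inv_odd {x : ℂ} (hh : 0 < h) (hx : x ^ h = 1) :
    blockEval (2 * h) (exactInv h a) b (unity h 1 * x) = 2 * blockEval h a (2 * b + 1) x := by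
  rw [blockEval_two_mul, blockEval, Finset.mul_sum]
  refine Finset.sum_congr rfl fun j hj => ?_
  rw [show h * (2 * b + 1) + j = 2 * h * b + h + j by ring,
    exactInv_upper a (Finset.mem_range.1 hj),
    exactInv_lower a (Finset.mem_range.1 hj), mul_pow, mul_pow, hx, unity_pow_self hh]
  have h1 := unity_neg_mul h j
  rw [unity_nat] at h1
  linear_combination (2 * a (2 * h * b + h + j) * x ^ j) * h1

end levels

/-! ### The inverse transform of a pointwise product -/

/-- The exact vectors after the levels of the forward transform. -/
noncomputable def exactFwds (L : ℕ) (a : ℕ → ℂ) : ℕ → ℕ → ℂ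
  | 0 => a
  | s + 1 => exactFwd (2 ^ (L - 1 - s)) (exactFwds L a s)

/-- The exact vectors after the levels of the inverse transform. -/
noncomputable def exactInvs (a : ℕ → ℂ) : ℕ → ℕ → ℂ
  | 0 => a
  | s + 1 => exactInv (2 ^ s) (exactInvs a s)

/-- Induction from the innermost level outwards. For s = 0 blocks are single entries, and the claim
is the definition of the products. Passing from s to s + 1 pairs the inverse level of distance 2^s
with the forward level of the same distance, so multiplicativity of evaluation is lifted one level
at a time. -/
theorem blockEval_exactInvs (L : ℕ) (a a' : ℕ → ℂ) {s : ℕ} (hs : s ≤ L) :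
    ∀ (b : ℕ) (x : ℂ), x ^ 2 ^ s = 1 →
      blockEval (2 ^ s) (exactInvs (fun i => exactFwds L a L i * exactFwds L a' L i) s) b x =
        2 ^ s * (blockEval (2 ^ s) (exactFwds L a (L - s)) b x *
          blockEval (2 ^ s) (exactFwds L a' (L - s)) b x) := by
  induction s with
  | zero => intro b x _; simp [blockEval, exactInvs]
  | succ s ih =>
    intro b y hy
    have hh : 0 < 2 ^ s := by positivity
    have e : ∀ c, exactFwds L c (L - s) = exactFwd (2 ^ s) (exactFwds L c (L - (s + 1))) := by
      intro c
      rw [show L - s = L - (s + 1) + 1 by omega, exactFwds,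
        show L - 1 - (L - (s + 1)) = s by omega]
    have ih' := ih (by omega)
    rw [e a, e a'] at ih'
    rw [pow_succ', mul_comm, pow_mul] at hy
    rw [show 2 ^ (s + 1) = 2 * 2 ^ s from pow_succ' 2 s, exactInvs]
    -- A point y with y^(2^(s+1)) = 1 satisfies y^(2^s) = 1 or y^(2^s) = -1. The first kind is
    -- governed by the even blocks; the second kind is ζ times a point of the first kind and is
    -- governed by the odd blocks.
    rcases mul_self_eq_one_iff.1 ((sq _).symm.trans hy) with h1 | h1
    · rw [blockEval_inv_even _ h1, ih' _ _ h1, blockEval_fwd_even _ h1, blockEval_fwd_even _ h1,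
        pow_succ']
      ring
    · obtain ⟨x, rfl⟩ : ∃ x, y = unity (2 ^ s) 1 * x :=
        ⟨(unity (2 ^ s) 1)⁻¹ * y, by rw [mul_inv_cancel_left₀ (unity_ne_zero _ _)]⟩
      have hx : x ^ 2 ^ s = 1 := by
        rw [mul_pow, unity_pow_self hh] at h1
        linear_combination -h1
      rw [blockEval_inv_odd _ hh hx, ih' _ _ hx, blockEval_fwd_odd _ hh hx,
        blockEval_fwd_odd _ hh hx, pow_succ']
      ring

/-- A polynomial of degree below N is determined by its values at the N distinct N-th roots of
unity. -/
theorem eq_of_blockEval_eq {N : ℕ} (hN : 0 < N) {u v : ℕ → ℂ}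
    (h : ∀ x : ℂ, x ^ N = 1 → blockEval N u 0 x = blockEval N v 0 x) {i : ℕ} (hi : i < N) :
    u i = v i := by
  set p : ℂ[X] := ∑ j ∈ Finset.range N, monomial j (u j - v j) with hp
  have hcoeff : ∀ k < N, p.coeff k = u k - v k := by
    intro k hk
    simp only [hp, finsetSum_coeff, coeff_monomial]
    rw [Finset.sum_ite_eq' _ k, if_pos (Finset.mem_range.2 hk)]
  have hdeg : p.natDegree < N := by
    refine lt_of_le_of_lt (natDegree_sum_le_of_forall_le (n := N - 1) _ _ fun j hj => ?_)
      (by omega)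
    exact (natDegree_monomial_le _).trans (by have := Finset.mem_range.1 hj; omega)
  have hzero : p = 0 := by
    have hprim := Complex.isPrimitiveRoot_exp N hN.ne'
    refine eq_zero_of_natDegree_lt_card_of_eval_eq_zero' p (nthRootsFinset N (1 : ℂ)) ?_ ?_
    · intro x hx
      rw [mem_nthRootsFinset hN] at hx
      have := h x hx
      rw [blockEval, blockEval, ← sub_eq_zero, ← Finset.sum_sub_distrib] at this
      rw [hp, eval_finsetSum, ← this]
      refine Finset.sum_congr rfl fun j _ => ?_
      rw [eval_monomial, mul_zero, zero_add]; ring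
    · rw [hprim.card_nthRootsFinset]; exact hdeg
  have := hcoeff i hi
  rw [hzero, coeff_zero] at this
  exact (sub_eq_zero.1 this.symm)

/-- The transform computes the product modulo X^(2^L) - 1; the degree bound on the product excludes
wraparound. -/
theorem exactInvs_eq_coeff (L : ℕ) {p q : ℕ[X]} (hpq : (p * q).natDegree < 2 ^ L)
    (hp : p.natDegree < 2 ^ L) (hq : q.natDegree < 2 ^ L) {a a' : ℕ → ℂ}
    (ha : ∀ i < 2 ^ L, a i = p.coeff i) (ha' : ∀ i < 2 ^ L, a' i = q.coeff i) {i : ℕ}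
    (hi : i < 2 ^ L) :
    exactInvs (fun i => exactFwds L a L i * exactFwds L a' L i) L i =
      2 ^ L * ((p * q).coeff i : ℂ) := by
  refine eq_of_blockEval_eq (N := 2 ^ L) (v := fun i => 2 ^ L * ((p * q).coeff i : ℂ))
    (by positivity) (fun x hx => ?_) hi
  rw [blockEval_exactInvs L a a' le_rfl 0 x hx, Nat.sub_self]
  have key : ∀ {r : ℕ[X]} {c : ℕ → ℂ}, r.natDegree < 2 ^ L → (∀ i < 2 ^ L, c i = r.coeff i) →
      blockEval (2 ^ L) c 0 x = r.eval₂ (Nat.castRingHom ℂ) x := by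
    intro r c hr hc
    rw [eval₂_eq_sum_range' _ hr, blockEval]
    refine Finset.sum_congr rfl fun j hj => ?_
    rw [mul_zero, zero_add, hc j (Finset.mem_range.1 hj)]
    rfl
  have h1 := key (c := fun i => ((p * q).coeff i : ℂ)) hpq (fun _ _ => rfl)
  have h2 : blockEval (2 ^ L) (fun i => 2 ^ L * ((p * q).coeff i : ℂ)) 0 x =
      2 ^ L * blockEval (2 ^ L) (fun i => ((p * q).coeff i : ℂ)) 0 x := by
    simp only [blockEval, Finset.mul_sum, mul_assoc]
  rw [h2, h1, exactFwds, exactFwds, key hp ha, key hq ha', eval₂_mul]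

/-! ### Propagation of errors -/

theorem norm_exactFwd_le {a : ℕ → ℂ} {V : ℝ} (ha : ∀ i, ‖a i‖ ≤ V) (h i : ℕ) :
    ‖exactFwd h a i‖ ≤ 2 * V := by
  rw [exactFwd]
  split_ifs
  · exact (norm_add_le _ _).trans (by linarith [ha i, ha (i + h)])
  · rw [norm_mul, norm_unity, mul_one]
    exact (norm_sub_le _ _).trans (by linarith [ha i, ha (i - h)])

theorem norm_exactInv_le {a : ℕ → ℂ} {V : ℝ} (ha : ∀ i, ‖a i‖ ≤ V) (h i : ℕ) :
    ‖exactInv h a i‖ ≤ 2 * V := by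
  rw [exactInv]
  split_ifs
  · refine (norm_add_le _ _).trans ?_
    rw [norm_mul, norm_unity, one_mul]; linarith [ha i, ha (i + h)]
  · refine (norm_sub_le _ _).trans ?_
    rw [norm_mul, norm_unity, one_mul]; linarith [ha i, ha (i - h)]

theorem norm_exactFwds_le {a : ℕ → ℂ} {V : ℝ} (ha : ∀ i, ‖a i‖ ≤ V) (L s i : ℕ) :
    ‖exactFwds L a s i‖ ≤ 2 ^ s * V := by
  induction s generalizing i with
  | zero => simpa [exactFwds] using ha i
  | succ s ih => rw [exactFwds, pow_succ', mul_assoc]; exact norm_exactFwd_le ih _ _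

theorem norm_exactInvs_le {a : ℕ → ℂ} {V : ℝ} (ha : ∀ i, ‖a i‖ ≤ V) (s i : ℕ) :
    ‖exactInvs a s i‖ ≤ 2 ^ s * V := by
  induction s generalizing i with
  | zero => simpa [exactInvs] using ha i
  | succ s ih => rw [exactInvs, pow_succ', mul_assoc]; exact norm_exactInv_le ih _ _

theorem two_mul_block_le {h b i N : ℕ} (hN : 2 * h ∣ N) (hb : 2 * h * b ≤ i) (hi : i < N) :
    2 * h * (b + 1) ≤ N := by
  obtain ⟨q, rfl⟩ := hN
  refine Nat.mul_le_mul_left _ (Nat.succ_le_of_lt ?_)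
  by_contra hq
  exact absurd (hi.trans_le' hb) (not_lt.2 (Nat.mul_le_mul_left _ (not_lt.1 hq)))

namespace Params

variable {P : Params}

theorem err_pos : 0 < P.err := by unfold err; positivity

theorem err_le_one : P.err ≤ 1 := pow_le_one₀ (by norm_num) (by norm_num)

/-- The difference of two entries carries an error up to 2δ and is multiplied by an approximate root
of modulus at most 2, giving 4δ. The error of the root acts on a difference of size at most 2V, and
the rounding error is at most V times the unit error since V ≥ 1. -/
theorem norm_sub_exactFwd_le {h : ℕ} (hh : 0 < h) (hN : 2 * h ∣ P.points) {a a' c : ℕ → ℂ}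
    {V δ : ℝ} (hlev : P.ForwardLevel h a a') (hc : ∀ i, ‖c i‖ ≤ V) (hV : 1 ≤ V)
    (hδ : ∀ i < P.points, ‖a i - c i‖ ≤ δ) {i : ℕ} (hi : i < P.points) :
    ‖a' i - exactFwd h c i‖ ≤ 4 * δ + 4 * V * P.err := by
  have hε := err_pos (P := P)
  have hε1 := err_le_one (P := P)
  obtain ⟨b, j, hj, hij⟩ := position_cases hh i
  have hb : 2 * h * (b + 1) ≤ P.points := two_mul_block_le hN (by omega) hi
  obtain ⟨ζ, ⟨-, hζ⟩, hlo, hhi⟩ := hlev b j hb hj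
  have hb' : 2 * h * b + 2 * h ≤ P.points := by linarith
  have h1 := hδ (2 * h * b + j) (by omega)
  have h2 := hδ (2 * h * b + h + j) (by omega)
  have c1 := hc (2 * h * b + j)
  have c2 := hc (2 * h * b + h + j)
  have hδ0 : 0 ≤ δ := (norm_nonneg _).trans h1
  have hVε : P.err ≤ V * P.err := by nlinarith
  rcases hij with rfl | rfl
  · rw [exactFwd_upper c hj]
    set u := a (2 * h * b + j)
    set v := a (2 * h * b + h + j)
    set u' := c (2 * h * b + j)
    set v' := c (2 * h * b + h + j)
    calc ‖a' (2 * h * b + j) - (u' + v')‖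
        = ‖(a' (2 * h * b + j) - (u + v)) + (u - u') + (v - v')‖ := by congr 1; ring
      _ ≤ ‖a' (2 * h * b + j) - (u + v)‖ + ‖u - u'‖ + ‖v - v'‖ := norm_add₃_le
      _ ≤ _ := by nlinarith
  · rw [exactFwd_lower c hj]
    set u := a (2 * h * b + j)
    set v := a (2 * h * b + h + j)
    set u' := c (2 * h * b + j)
    set v' := c (2 * h * b + h + j)
    set r := a' (2 * h * b + h + j)
    change ‖ζ - unity h j‖ ≤ P.err at hζ
    have hζn : ‖ζ‖ ≤ 2 := by
      have := norm_add_le (ζ - unity h j) (unity h j)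
      rw [sub_add_cancel, norm_unity] at this
      linarith
    have e1 : ‖((u - u') - (v - v')) * ζ‖ ≤ (δ + δ) * 2 := by
      rw [norm_mul]
      exact mul_le_mul ((norm_sub_le _ _).trans (add_le_add h1 h2)) hζn (norm_nonneg _)
        (by linarith)
    have e2 : ‖(u' - v') * (ζ - unity h j)‖ ≤ (V + V) * P.err := by
      rw [norm_mul]
      exact mul_le_mul ((norm_sub_le _ _).trans (add_le_add c1 c2)) hζ (norm_nonneg _)
        (by linarith)
    calc ‖r - (u' - v') * unity h j‖
        = ‖(r - (u - v) * ζ) + ((u - u') - (v - v')) * ζ + (u' - v') * (ζ - unity h j)‖ := by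
          congr 1; ring
      _ ≤ ‖r - (u - v) * ζ‖ + ‖((u - u') - (v - v')) * ζ‖ + ‖(u' - v') * (ζ - unity h j)‖ :=
          norm_add₃_le
      _ ≤ _ := by nlinarith

theorem norm_sub_exactInv_le {h : ℕ} (hh : 0 < h) (hN : 2 * h ∣ P.points) {a a' c : ℕ → ℂ}
    {V δ : ℝ} (hlev : P.InverseLevel h a a') (hc : ∀ i, ‖c i‖ ≤ V) (hV : 1 ≤ V)
    (hδ : ∀ i < P.points, ‖a i - c i‖ ≤ δ) {i : ℕ} (hi : i < P.points) :
    ‖a' i - exactInv h c i‖ ≤ 4 * δ + 4 * V * P.err := by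
  have hε := err_pos (P := P)
  have hε1 := err_le_one (P := P)
  obtain ⟨b, j, hj, hij⟩ := position_cases hh i
  have hb : 2 * h * (b + 1) ≤ P.points := two_mul_block_le hN (by omega) hi
  obtain ⟨ζ, ⟨-, hζ⟩, hlo, hhi⟩ := hlev b j hb hj
  have hb' : 2 * h * b + 2 * h ≤ P.points := by linarith
  have h1 := hδ (2 * h * b + j) (by omega)
  have h2 := hδ (2 * h * b + h + j) (by omega)
  have c2 := hc (2 * h * b + h + j)
  have hδ0 : 0 ≤ δ := (norm_nonneg _).trans h1
  have hVε : P.err ≤ V * P.err := by nlinarith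
  change ‖ζ - unity h (-j)‖ ≤ P.err at hζ
  have hζn : ‖ζ‖ ≤ 2 := by
    have := norm_add_le (ζ - unity h (-j)) (unity h (-j))
    rw [sub_add_cancel, norm_unity] at this
    linarith
  set u := a (2 * h * b + j)
  set v := a (2 * h * b + h + j)
  set u' := c (2 * h * b + j) with hu'
  set v' := c (2 * h * b + h + j) with hv'
  have e : ‖ζ * v - unity h (-j) * v'‖ ≤ 2 * δ + P.err * V := by
    calc ‖ζ * v - unity h (-j) * v'‖ = ‖ζ * (v - v') + (ζ - unity h (-j)) * v'‖ := by
          congr 1; ring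
      _ ≤ ‖ζ * (v - v')‖ + ‖(ζ - unity h (-j)) * v'‖ := norm_add_le _ _
      _ ≤ _ := by
        rw [norm_mul, norm_mul]
        exact add_le_add (mul_le_mul hζn h2 (norm_nonneg _) (by norm_num))
          (mul_le_mul hζ c2 (norm_nonneg _) hε.le)
  rcases hij with rfl | rfl
  · rw [exactInv_upper c hj, ← hu', ← hv']
    calc ‖a' (2 * h * b + j) - (u' + unity h (-j) * v')‖
        = ‖(a' (2 * h * b + j) - (u + ζ * v)) + (u - u') + (ζ * v - unity h (-j) * v')‖ := by
          congr 1; ring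
      _ ≤ ‖a' (2 * h * b + j) - (u + ζ * v)‖ + ‖u - u'‖ + ‖ζ * v - unity h (-j) * v'‖ :=
          norm_add₃_le
      _ ≤ _ := by nlinarith
  · rw [exactInv_lower c hj, ← hu', ← hv']
    calc ‖a' (2 * h * b + h + j) - (u' - unity h (-j) * v')‖
        = ‖(a' (2 * h * b + h + j) - (u - ζ * v)) + (u - u') + -(ζ * v - unity h (-j) * v')‖ := by
          congr 1; ring
      _ ≤ ‖a' (2 * h * b + h + j) - (u - ζ * v)‖ + ‖u - u'‖ + ‖-(ζ * v - unity h (-j) * v')‖ :=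
          norm_add₃_le
      _ ≤ _ := by rw [norm_neg]; nlinarith

/-- Entries double with each level while the error follows δ ↦ 4δ + 4·2^s V ε. The term with -2^s
makes the closed bound inductive: 4^s alone would not absorb the additive part. -/
theorem norm_sub_exactFwds_le {F : ℕ → ℕ → ℂ} {c : ℕ → ℂ} {V : ℝ} (hV : 1 ≤ V)
    (hlev : ∀ s < P.levels, P.ForwardLevel (2 ^ (P.levels - 1 - s)) (F s) (F (s + 1)))
    (hc : ∀ i, ‖c i‖ ≤ V) (h0 : ∀ i < P.points, F 0 i = c i) {s : ℕ} (hs : s ≤ P.levels) :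
    ∀ i < P.points, ‖F s i - exactFwds P.levels c s i‖ ≤ 4 * (4 ^ s - 2 ^ s) * V * P.err := by
  induction s with
  | zero => intro i hi; simp [exactFwds, h0 i hi]
  | succ s ih =>
    intro i hi
    have hε := err_pos (P := P)
    have hdvd : 2 * 2 ^ (P.levels - 1 - s) ∣ P.points := by
      rw [← pow_succ']; exact pow_dvd_pow 2 (by omega)
    have h2 : (1 : ℝ) ≤ 2 ^ s := one_le_pow₀ (by norm_num)
    refine (norm_sub_exactFwd_le (by positivity) hdvd (hlev s (by omega))
      (norm_exactFwds_le hc P.levels s) (by nlinarith) (ih (by omega)) hi).trans ?_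
    have : 0 ≤ 2 ^ s * V * P.err := by positivity
    rw [pow_succ, pow_succ]
    nlinarith

theorem norm_sub_exactInvs_le {H : ℕ → ℕ → ℂ} {c : ℕ → ℂ} {V δ : ℝ} (hV : 1 ≤ V)
    (hlev : ∀ s < P.levels, P.InverseLevel (2 ^ s) (H s) (H (s + 1)))
    (hc : ∀ i, ‖c i‖ ≤ V) (h0 : ∀ i < P.points, ‖H 0 i - c i‖ ≤ δ) {s : ℕ} (hs : s ≤ P.levels) :
    ∀ i < P.points, ‖H s i - exactInvs c s i‖ ≤
      4 ^ s * δ + 4 * (4 ^ s - 2 ^ s) * V * P.err := by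
  induction s with
  | zero => intro i hi; simpa [exactInvs] using h0 i hi
  | succ s ih =>
    intro i hi
    have hε := err_pos (P := P)
    have hdvd : 2 * 2 ^ s ∣ P.points := by
      rw [← pow_succ']; exact pow_dvd_pow 2 (by omega)
    have h2 : (1 : ℝ) ≤ 2 ^ s := one_le_pow₀ (by norm_num)
    refine (norm_sub_exactInv_le (by positivity) hdvd (hlev s (by omega))
      (norm_exactInvs_le hc s) (by nlinarith) (ih (by omega)) hi).trans ?_
    have : 0 ≤ 2 ^ s * V * P.err := by positivity
    rw [pow_succ, pow_succ]
    nlinarith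

end Params

end DepthCostRAM

namespace DepthCostRAM

open Polynomial

/-! ### The product polynomial -/

/-- The polynomial whose coefficients are the first `d` pieces of length `S` of `x`. -/
noncomputable def piecePoly (S d x : ℕ) : ℕ[X] :=
  ∑ i ∈ Finset.range d, monomial i (x / 2 ^ (S * i) % 2 ^ S)

theorem sum_pieces (S d x : ℕ) :
    ∑ i ∈ Finset.range d, x / 2 ^ (S * i) % 2 ^ S * 2 ^ (S * i) = x % 2 ^ (S * d) := by
  induction d with
  | zero => simp [Nat.mod_one]
  | succ d ih => rw [Finset.sum_range_succ, ih, mul_add, mul_one, pow_add, Nat.mod_mul]; ring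

theorem piece_eq_zero {S d x i : ℕ} (hx : x < 2 ^ (S * d)) (hi : d ≤ i) :
    x / 2 ^ (S * i) % 2 ^ S = 0 := by
  rw [Nat.div_eq_of_lt, Nat.zero_mod]
  exact hx.trans_le (Nat.pow_le_pow_right (by norm_num) (Nat.mul_le_mul_left _ hi))

/-- Valid for every index, also from d on, where the pieces vanish because x < 2^(S d). -/
theorem coeff_piecePoly {S d x : ℕ} (hx : x < 2 ^ (S * d)) (i : ℕ) :
    (piecePoly S d x).coeff i = x / 2 ^ (S * i) % 2 ^ S := by
  simp only [piecePoly, finsetSum_coeff, coeff_monomial]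
  rw [Finset.sum_ite_eq' _ i]
  split_ifs with h
  · rfl
  · rw [piece_eq_zero hx (by simpa using h)]

theorem natDegree_piecePoly_le (S d x : ℕ) : (piecePoly S d x).natDegree ≤ d - 1 := by
  refine natDegree_sum_le_of_forall_le _ _ fun j hj => ?_
  exact (natDegree_monomial_le _).trans (by have := Finset.mem_range.1 hj; omega)

theorem eval_piecePoly {S d x : ℕ} (hx : x < 2 ^ (S * d)) :
    (piecePoly S d x).eval (2 ^ S) = x := by
  rw [piecePoly, eval_finsetSum]
  simp only [eval_monomial, ← pow_mul]
  rw [sum_pieces, Nat.mod_eq_of_lt hx]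

/-- The coefficients of the product polynomial. -/
noncomputable def prodCoeff (S d x y i : ℕ) : ℕ := (piecePoly S d x * piecePoly S d y).coeff i

section product

variable {S d N x y : ℕ}

/-- The degree is at most 2(d - 1). This is why the number of points is at least twice the number of
pieces. -/
theorem natDegree_piecePoly_mul_lt (hd : 0 < d) (hdN : 2 * d ≤ N) :
    (piecePoly S d x * piecePoly S d y).natDegree < N := by
  have := natDegree_mul_le (p := piecePoly S d x) (q := piecePoly S d y)
  have := natDegree_piecePoly_le S d x
  have := natDegree_piecePoly_le S d y
  omega

theorem valueOf_prodCoeff (hd : 0 < d) (hdN : 2 * d ≤ N) (hx : x < 2 ^ (S * d))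
    (hy : y < 2 ^ (S * d)) :
    valueOf S (prodCoeff S d x y) N = x * y := by
  conv_rhs => rw [← eval_piecePoly hx, ← eval_piecePoly hy, ← eval_mul,
    eval_eq_sum_range' (natDegree_piecePoly_mul_lt hd hdN)]
  simp only [valueOf, prodCoeff, pow_mul]

/-- A coefficient is a sum of at most N ≤ 2^S products of two S-bit numbers, hence in fact below
2^(3 S). -/
theorem prodCoeff_lt (hx : x < 2 ^ (S * d)) (hy : y < 2 ^ (S * d)) {i : ℕ} (hi : i < N)
    (hN : N ≤ 2 ^ S) : prodCoeff S d x y i < 2 ^ (4 * S) := by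
  have h1 : prodCoeff S d x y i ≤ (i + 1) * (2 ^ S * 2 ^ S - 1) := by
    rw [prodCoeff, coeff_mul]
    have hcard : (Finset.HasAntidiagonal.antidiagonal i).card = i + 1 :=
      Finset.Nat.card_antidiagonal i
    rw [← hcard, ← smul_eq_mul]
    refine Finset.sum_le_card_nsmul _ _ _ fun k _ => ?_
    rw [coeff_piecePoly hx, coeff_piecePoly hy]
    have a1 : x / 2 ^ (S * k.1) % 2 ^ S < 2 ^ S := Nat.mod_lt _ (by positivity)
    have a2 : y / 2 ^ (S * k.2) % 2 ^ S < 2 ^ S := Nat.mod_lt _ (by positivity)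
    exact Nat.le_sub_one_of_lt (Nat.mul_lt_mul'' a1 a2)
  have h0 : 0 < 2 ^ S := by positivity
  calc prodCoeff S d x y i ≤ (i + 1) * (2 ^ S * 2 ^ S - 1) := h1
    _ ≤ 2 ^ S * (2 ^ S * 2 ^ S - 1) := Nat.mul_le_mul_right _ (by omega)
    _ < 2 ^ S * (2 ^ S * 2 ^ S) := (Nat.mul_lt_mul_left h0).2 (by
        have : 0 < 2 ^ S * 2 ^ S := by positivity
        omega)
    _ = 2 ^ (3 * S) := by rw [← pow_add, ← pow_add]; congr 1; ring
    _ ≤ 2 ^ (4 * S) := Nat.pow_le_pow_right (by norm_num) (by omega)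

end product

/-- The result of the inverse transform is close to the coefficients of the product. -/
theorem norm_sub_prodCoeff_le {P : Params} {x y d : ℕ} {F G H : ℕ → ℕ → ℂ}
    (hS : 2 ≤ P.pieceLen) (hL : P.levels ≤ P.pieceLen) (hacc : P.accBits = 9 * P.pieceLen)
    (hd : 0 < d) (hdN : 2 * d ≤ P.points)
    (hx : x < 2 ^ (P.pieceLen * d)) (hy : y < 2 ^ (P.pieceLen * d))
    (pieces_x : ∀ i < P.points, F 0 i = ((x / 2 ^ (P.pieceLen * i) % 2 ^ P.pieceLen : ℕ) : ℂ))
    (pieces_y : ∀ i < P.points, G 0 i = ((y / 2 ^ (P.pieceLen * i) % 2 ^ P.pieceLen : ℕ) : ℂ))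
    (fft_x : ∀ s < P.levels, P.ForwardLevel (2 ^ (P.levels - 1 - s)) (F s) (F (s + 1)))
    (fft_y : ∀ s < P.levels, P.ForwardLevel (2 ^ (P.levels - 1 - s)) (G s) (G (s + 1)))
    (mul_values : ∀ i < P.points, ‖H 0 i - F P.levels i * G P.levels i‖ ≤ P.err)
    (inverse_fft : ∀ s < P.levels, P.InverseLevel (2 ^ s) (H s) (H (s + 1)))
    {i : ℕ} (hi : i < P.points) :
    ‖H P.levels i - P.points * (prodCoeff P.pieceLen d x y i : ℂ)‖ ≤ P.points * (17 / 64) := by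
  set S := P.pieceLen with hSdef
  set L := P.levels with hLdef
  set V : ℝ := 2 ^ S with hVdef
  have hV1 : 1 ≤ V := one_le_pow₀ (by norm_num)
  set N : ℝ := 2 ^ L with hNdef
  have hN1 : 1 ≤ N := one_le_pow₀ (by norm_num)
  have hNV : N ≤ V := pow_le_pow_right₀ (by norm_num) hL
  have hpts : (P.points : ℝ) = N := by simp [Params.points, hNdef, hLdef]
  set ε := P.err with hεdef
  have hε : 0 < ε := Params.err_pos
  -- All estimates are reduced to powers of V = 2^S; the accuracy of 9S bits means ε = V^(-9).
  have hεV : ε * V ^ 9 = 1 := by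
    rw [hεdef, Params.err, hacc, hVdef, ← pow_mul, mul_comm S 9, ← mul_pow]; norm_num
  have hV4 : 4 ≤ V := by
    rw [hVdef]
    calc (4 : ℝ) = 2 ^ 2 := by norm_num
      _ ≤ 2 ^ S := pow_le_pow_right₀ (by norm_num) hS
  have hpiece : ∀ v i : ℕ, ‖((v / 2 ^ (S * i) % 2 ^ S : ℕ) : ℂ)‖ ≤ V := by
    intro v i
    rw [Complex.norm_natCast, hVdef]
    exact_mod_cast (Nat.mod_lt _ (by positivity : 0 < 2 ^ S)).le
  set cx : ℕ → ℂ := fun i => ((x / 2 ^ (S * i) % 2 ^ S : ℕ) : ℂ) with hcx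
  set cy : ℕ → ℂ := fun i => ((y / 2 ^ (S * i) % 2 ^ S : ℕ) : ℂ) with hcy
  have h4 : (4 : ℝ) ^ L = N ^ 2 := by rw [hNdef, ← pow_mul, mul_comm, pow_mul]; norm_num
  set φ : ℝ := 4 * N ^ 2 * V * ε with hφ
  have hFerr : ∀ i < P.points, ‖F L i - exactFwds L cx L i‖ ≤ φ := fun i hi => by
    refine (Params.norm_sub_exactFwds_le hV1 fft_x (hpiece x) pieces_x le_rfl i hi).trans ?_
    rw [← hLdef, ← hεdef, h4, hφ]
    gcongr
    linarith
  have hGerr : ∀ i < P.points, ‖G L i - exactFwds L cy L i‖ ≤ φ := fun i hi => by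
    refine (Params.norm_sub_exactFwds_le hV1 fft_y (hpiece y) pieces_y le_rfl i hi).trans ?_
    rw [← hLdef, ← hεdef, h4, hφ]
    gcongr
    linarith
  have hFmag : ∀ i, ‖exactFwds L cx L i‖ ≤ N * V := norm_exactFwds_le (hpiece x) L L
  have hGmag : ∀ i, ‖exactFwds L cy L i‖ ≤ N * V := norm_exactFwds_le (hpiece y) L L
  have hφ0 : 0 < φ := by positivity
  have hφle : φ ≤ N * V := by
    have : φ = (4 * N * ε) * (N * V) := by rw [hφ]; ring
    rw [this]
    refine mul_le_of_le_one_left (by positivity) ?_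
    calc 4 * N * ε ≤ V * V * ε := by gcongr
      _ ≤ V ^ 9 * ε := by
        gcongr
        rw [← sq]; exact pow_le_pow_right₀ hV1 (by norm_num)
      _ = 1 := by rw [mul_comm]; exact hεV
  set c : ℕ → ℂ := fun i => exactFwds L cx L i * exactFwds L cy L i with hc
  have hcmag : ∀ i, ‖c i‖ ≤ N ^ 2 * V ^ 2 := by
    intro i
    rw [hc, norm_mul]
    calc _ ≤ (N * V) * (N * V) := mul_le_mul (hFmag i) (hGmag i) (norm_nonneg _) (by positivity)
      _ = _ := by ring
  -- A product of approximate values contributes 2NV·φ + φ·NV = 12 N³V²ε, and its own rounding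
  -- contributes ε, which is absorbed by making the constant 13.
  have hHerr : ∀ i < P.points, ‖H 0 i - c i‖ ≤ 13 * N ^ 3 * V ^ 2 * ε := by
    intro i hi
    set f := F L i
    set g := G L i
    set f' := exactFwds L cx L i with hf'
    set g' := exactFwds L cy L i with hg'
    have hfmag : ‖f‖ ≤ 2 * (N * V) := by
      have := norm_add_le (f - f') f'
      rw [sub_add_cancel] at this
      linarith [hFerr i hi, hFmag i]
    calc ‖H 0 i - f' * g'‖ = ‖(H 0 i - f * g) + f * (g - g') + (f - f') * g'‖ := by
          congr 1; ring
      _ ≤ ‖H 0 i - f * g‖ + ‖f * (g - g')‖ + ‖(f - f') * g'‖ := norm_add₃_le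
      _ ≤ ε + 2 * (N * V) * φ + φ * (N * V) := by
        rw [norm_mul, norm_mul]
        exact add_le_add_three (mul_values i hi)
          (mul_le_mul hfmag (hGerr i hi) (norm_nonneg _) (by positivity))
          (mul_le_mul (hFerr i hi) (hGmag i) (norm_nonneg _) hφ0.le)
      _ = ε + 12 * N ^ 3 * V ^ 2 * ε := by rw [hφ]; ring
      _ ≤ _ := by
        have : 1 ≤ N ^ 3 * V ^ 2 := one_le_mul_of_one_le_of_one_le (one_le_pow₀ hN1)
          (one_le_pow₀ hV1)
        nlinarith
  have hfin := Params.norm_sub_exactInvs_le (P := P) (H := H) (c := c)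
    (one_le_mul_of_one_le_of_one_le (one_le_pow₀ hN1) (one_le_pow₀ hV1)) inverse_fft hcmag hHerr
    le_rfl i hi
  rw [← hLdef] at hfin
  have hdeg := natDegree_piecePoly_mul_lt (S := S) (x := x) (y := y) hd hdN
  have hex : exactInvs c L i = 2 ^ L * (prodCoeff S d x y i : ℂ) := by
    have hdx := natDegree_piecePoly_le S d x
    have hdy := natDegree_piecePoly_le S d y
    have hdN' : 2 * d ≤ 2 ^ L := hdN
    exact exactInvs_eq_coeff L hdeg (by omega) (by omega)
      (fun i _ => by rw [coeff_piecePoly hx]) (fun i _ => by rw [coeff_piecePoly hy]) hi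
  have hptsC : (P.points : ℂ) = 2 ^ L := by simp [Params.points, hLdef]
  rw [hptsC, ← hex, hpts]
  refine hfin.trans ?_
  rw [h4, ← hNdef, ← hεdef]
  -- The error relative to N is at most 17 N⁴V²ε ≤ 17 V⁶ε = 17 V^(-3), and V ≥ 4. The bound 17/64 is
  -- safely below 1/2.
  calc N ^ 2 * (13 * N ^ 3 * V ^ 2 * ε) + 4 * (N ^ 2 - N) * (N ^ 2 * V ^ 2) * ε
      ≤ N ^ 2 * (13 * N ^ 3 * V ^ 2 * ε) + 4 * (N ^ 2) * (N ^ 3 * V ^ 2) * ε := by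
        gcongr
        · linarith
        · norm_num
    _ = N * (17 * (N ^ 4 * V ^ 2 * ε)) := by ring
    _ ≤ N * (17 * (V ^ 4 * V ^ 2 * ε)) := by gcongr
    _ ≤ N * (17 / 64) := by
      gcongr
      have h3 : 64 ≤ V ^ 3 := by
        calc (64 : ℝ) = 4 ^ 3 := by norm_num
          _ ≤ V ^ 3 := by gcongr
      have h6 : V ^ 4 * V ^ 2 * ε * V ^ 3 = 1 := by rw [← hεV]; ring
      have h7 : 0 ≤ V ^ 4 * V ^ 2 * ε := by positivity
      nlinarith

/-! ### Fixed-point arithmetic -/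

theorem natDiv_bounds (p : ℕ) {D : ℕ} (hD : 0 < D) :
    (p : ℝ) / D - 1 ≤ ((p / D : ℕ) : ℝ) ∧ ((p / D : ℕ) : ℝ) ≤ (p : ℝ) / D := by
  refine ⟨?_, Nat.cast_div_le⟩
  have h : p < D * (p / D + 1) := Nat.lt_mul_div_succ p hD
  have hD' : (0 : ℝ) < D := by exact_mod_cast hD
  have h' : (p : ℝ) ≤ D * ((p / D : ℕ) + 1) := by exact_mod_cast h.le
  rw [sub_le_iff_le_add, div_le_iff₀ hD']
  linarith

theorem norm_le_two_mul {w : ℂ} {t : ℝ} (hr : |w.re| ≤ t) (hi : |w.im| ≤ t) : ‖w‖ ≤ 2 * t :=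
  (Complex.norm_le_abs_re_add_abs_im w).trans (by linarith)

/-- The complex number with real and imaginary part stored with offset `2 * D`. -/
noncomputable def zval (D : ℕ) (z : ℕ × ℕ) : ℂ :=
  ⟨((z.1 : ℝ) - 2 * D) / D, ((z.2 : ℝ) - 2 * D) / D⟩

/-- The complex number stored in four registers. -/
noncomputable def Quad.val (D : ℕ) (q : Quad) : ℂ :=
  ⟨((q.a : ℝ) - q.b) / D, ((q.c : ℝ) - q.d) / D⟩

section arithmetic

variable {D : ℕ}

theorem fst_eq_zval (hD : 0 < D) (z : ℕ × ℕ) : (z.1 : ℝ) = D * ((zval D z).re + 2) := by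
  have : (D : ℝ) ≠ 0 := by exact_mod_cast hD.ne'
  simp only [zval]; field_simp; ring

theorem snd_eq_zval (hD : 0 < D) (z : ℕ × ℕ) : (z.2 : ℝ) = D * ((zval D z).im + 2) := by
  have : (D : ℝ) ≠ 0 := by exact_mod_cast hD.ne'
  simp only [zval]; field_simp; ring

theorem le_four_mul_of_norm_zval_le (hD : 0 < D) {z : ℕ × ℕ} (hz : ‖zval D z‖ ≤ 5 / 4) :
    z.1 ≤ 4 * D ∧ z.2 ≤ 4 * D := by
  have hD' : (0 : ℝ) < D := by exact_mod_cast hD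
  have h1 := (le_abs_self _).trans ((Complex.abs_re_le_norm (zval D z)).trans hz)
  have h2 := (le_abs_self _).trans ((Complex.abs_im_le_norm (zval D z)).trans hz)
  have e1 := fst_eq_zval hD z
  have e2 := snd_eq_zval hD z
  constructor
  · have : (z.1 : ℝ) ≤ 4 * D := by rw [e1]; nlinarith
    exact_mod_cast this
  · have : (z.2 : ℝ) ≤ 4 * D := by rw [e2]; nlinarith
    exact_mod_cast this

/-- Before the division, the two subtractions yield exactly D²(Re XY + 2) and D²(Im XY + 2). The
offset 2 keeps them nonnegative, since the moduli are at most 5/4 and so |XY| ≤ 2; the division then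
loses at most one unit 1/D per coordinate. -/
theorem zmul_spec (hD : 0 < D) {x y : ℕ × ℕ} (hx : ‖zval D x‖ ≤ 5 / 4) (hy : ‖zval D y‖ ≤ 5 / 4) :
    ZmulLegal D x y ∧ ‖zval D (zmul D x y) - zval D x * zval D y‖ ≤ 2 / D := by
  have hD' : (0 : ℝ) < D := by exact_mod_cast hD
  set X := zval D x with hX
  set Y := zval D y with hY
  have hXY : ‖X * Y‖ ≤ 2 := by
    rw [norm_mul]
    exact (mul_le_mul hx hy (norm_nonneg _) (by norm_num)).trans (by norm_num)
  have hre := (abs_le.1 ((Complex.abs_re_le_norm (X * Y)).trans hXY)).1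
  have him := (abs_le.1 ((Complex.abs_im_le_norm (X * Y)).trans hXY)).1
  have x1 := fst_eq_zval hD x
  have x2 := snd_eq_zval hD x
  have y1 := fst_eq_zval hD y
  have y2 := snd_eq_zval hD y
  rw [← hX] at x1 x2
  rw [← hY] at y1 y2
  have d1 : ((x.1 * y.1 + x.2 * (2 * D) + 2 * D * y.2 + 2 * D * D : ℕ) : ℝ) -
      ((x.1 * (2 * D) + 2 * D * y.1 + x.2 * y.2 : ℕ) : ℝ) = D * (D * ((X * Y).re + 2)) := by
    push_cast
    rw [x1, x2, y1, y2, Complex.mul_re]; ring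
  have d2 : ((x.1 * y.2 + x.2 * y.1 + 2 * (2 * D) * (2 * D) + 2 * D * D : ℕ) : ℝ) -
      ((x.1 * (2 * D) + 2 * D * y.2 + x.2 * (2 * D) + 2 * D * y.1 : ℕ) : ℝ) =
        D * (D * ((X * Y).im + 2)) := by
    push_cast
    rw [x1, x2, y1, y2, Complex.mul_im]; ring
  have l1 : x.1 * (2 * D) + 2 * D * y.1 + x.2 * y.2 ≤
      x.1 * y.1 + x.2 * (2 * D) + 2 * D * y.2 + 2 * D * D := by
    have : (0 : ℝ) ≤ D * (D * ((X * Y).re + 2)) := by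
      have : 0 ≤ (X * Y).re + 2 := by linarith
      positivity
    rw [← d1] at this
    exact_mod_cast sub_nonneg.1 this
  have l2 : x.1 * (2 * D) + 2 * D * y.2 + x.2 * (2 * D) + 2 * D * y.1 ≤
      x.1 * y.2 + x.2 * y.1 + 2 * (2 * D) * (2 * D) + 2 * D * D := by
    have : (0 : ℝ) ≤ D * (D * ((X * Y).im + 2)) := by
      have : 0 ≤ (X * Y).im + 2 := by linarith
      positivity
    rw [← d2] at this
    exact_mod_cast sub_nonneg.1 this
  refine ⟨⟨l1, l2⟩, ?_⟩
  rw [← Nat.cast_sub l1] at d1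
  rw [← Nat.cast_sub l2] at d2
  have b1 := natDiv_bounds (x.1 * y.1 + x.2 * (2 * D) + 2 * D * y.2 + 2 * D * D -
      (x.1 * (2 * D) + 2 * D * y.1 + x.2 * y.2)) hD
  have b2 := natDiv_bounds (x.1 * y.2 + x.2 * y.1 + 2 * (2 * D) * (2 * D) + 2 * D * D -
      (x.1 * (2 * D) + 2 * D * y.2 + x.2 * (2 * D) + 2 * D * y.1)) hD
  rw [d1, mul_div_cancel_left₀ _ hD'.ne'] at b1
  rw [d2, mul_div_cancel_left₀ _ hD'.ne'] at b2
  have f1 := fst_eq_zval hD (zmul D x y)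
  have f2 := snd_eq_zval hD (zmul D x y)
  rw [show 2 / (D : ℝ) = 2 * (1 / D) by ring]
  set Z := zval D (zmul D x y)
  have key : ∀ {t u : ℝ}, D * (u + 2) - 1 ≤ D * (t + 2) → D * (t + 2) ≤ D * (u + 2) →
      |t - u| ≤ 1 / D := by
    intro t u h1 h2
    have h3 : |(t - u) * D| ≤ 1 := abs_le.2 ⟨by linarith, by linarith⟩
    rw [abs_mul, abs_of_pos hD'] at h3
    exact (le_div_iff₀ hD').2 h3
  refine norm_le_two_mul ?_ ?_
  · rw [Complex.sub_re]
    refine key ?_ ?_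
    · rw [← f1]; exact b1.1
    · rw [← f1]; exact b1.2
  · rw [Complex.sub_im]
    refine key ?_ ?_
    · rw [← f2]; exact b2.1
    · rw [← f2]; exact b2.2

theorem norm_zval_le_of_close {z : ℕ × ℕ} {ρ : ℂ} (hρ : ‖ρ‖ = 1) (h : ‖zval D z - ρ‖ ≤ 1 / 4) :
    ‖zval D z‖ ≤ 5 / 4 := by
  have := norm_add_le (zval D z - ρ) ρ
  rw [sub_add_cancel, hρ] at this
  linarith

/-- From Z² - r² = (Z - r)(Z + r) with |Z + r| ≤ 3, one squaring turns an error δ into at most 3δ +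
2/D. Starting at 8/D, this stays within a factor 4 per step. -/
theorem zsq_spec (hD : 0 < D) {w₀ : ℕ × ℕ} {ρ : ℂ} {L : ℕ} (hρ : ‖ρ‖ = 1)
    (h0 : ‖zval D w₀ - ρ‖ ≤ 8 / D) (hsmall : (8 : ℝ) * 4 ^ L / D ≤ 1 / 4) {e : ℕ} (he : e ≤ L) :
    ‖zval D (zsq D w₀ e) - ρ ^ 2 ^ e‖ ≤ 8 * 4 ^ e / D := by
  have hD' : (0 : ℝ) < D := by exact_mod_cast hD
  induction e with
  | zero => simpa [zsq] using h0
  | succ e ih =>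
    have ih := ih (by omega)
    have hρe : ‖ρ ^ 2 ^ e‖ = 1 := by rw [norm_pow, hρ, one_pow]
    have hle : (8 : ℝ) * 4 ^ e / D ≤ 1 / 4 := by
      refine le_trans ?_ hsmall
      gcongr
      · norm_num
      · omega
    have hn := norm_zval_le_of_close hρe (ih.trans hle)
    have h1 := (zmul_spec hD hn hn).2
    rw [zsq, pow_succ 2 e, pow_mul]
    set Z := zval D (zsq D w₀ e)
    set r := ρ ^ 2 ^ e
    calc ‖zval D (zmul D (zsq D w₀ e) (zsq D w₀ e)) - r ^ 2‖
        = ‖(zval D (zmul D (zsq D w₀ e) (zsq D w₀ e)) - Z * Z) + (Z - r) * (Z + r)‖ := by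
          congr 1; ring
      _ ≤ 2 / D + 8 * 4 ^ e / D * 3 := by
        refine (norm_add_le _ _).trans (add_le_add h1 ?_)
        rw [norm_mul]
        refine mul_le_mul ih ?_ (norm_nonneg _) (by positivity)
        exact (norm_add_le _ _).trans (by rw [hρe]; linarith)
      _ ≤ 8 * 4 ^ (e + 1) / D := by
        rw [show 2 / (D : ℝ) + 8 * 4 ^ e / D * 3 = (2 + 24 * 4 ^ e) / D by ring]
        gcongr
        have : (1 : ℝ) ≤ 4 ^ e := one_le_pow₀ (by norm_num)
        rw [pow_succ]; linarith

theorem zval_one (hD : 0 < D) : zval D (D + 2 * D, 2 * D) = 1 := by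
  have : (D : ℝ) ≠ 0 := by exact_mod_cast hD.ne'
  apply Complex.ext <;> simp [zval, this]

/-- Powers are formed by repeated multiplication by the same ω, so errors add up instead of
doubling: each factor contributes at most 5/4 δ + 2/D. -/
theorem zpow_spec (hD : 0 < D) {ω : ℕ × ℕ} {ρ : ℂ} {δ : ℝ} {h : ℕ} (hρ : ‖ρ‖ = 1)
    (hω : ‖zval D ω - ρ‖ ≤ δ) (hδ : δ ≤ 1 / 4) (hsmall : h * (2 * δ + 2 / D) ≤ 1 / 4) {j : ℕ}
    (hj : j ≤ h) : ‖zval D (zpow D ω j) - ρ ^ j‖ ≤ j * (2 * δ + 2 / D) := by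
  have hD' : (0 : ℝ) < D := by exact_mod_cast hD
  have hδ0 : 0 ≤ δ := (norm_nonneg _).trans hω
  induction j with
  | zero => simp [zpow, zval_one hD]
  | succ j ih =>
    have ih := ih (by omega)
    have hρj : ‖ρ ^ j‖ = 1 := by rw [norm_pow, hρ, one_pow]
    have hle : j * (2 * δ + 2 / D) ≤ 1 / 4 := by
      refine le_trans ?_ hsmall
      gcongr
      omega
    have hn := norm_zval_le_of_close hρj (ih.trans hle)
    have hn' := norm_zval_le_of_close hρ (hω.trans hδ)
    have h1 := (zmul_spec hD hn hn').2
    rw [zpow, pow_succ]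
    set Z := zval D (zpow D ω j)
    set W := zval D ω
    calc ‖zval D (zmul D (zpow D ω j) ω) - ρ ^ j * ρ‖
        = ‖(zval D (zmul D (zpow D ω j) ω) - Z * W) + (Z - ρ ^ j) * ρ + Z * (W - ρ)‖ := by
          congr 1; ring
      _ ≤ 2 / D + j * (2 * δ + 2 / D) * 1 + 5 / 4 * δ := by
        refine norm_add₃_le.trans (add_le_add_three h1 ?_ ?_)
        · rw [norm_mul, hρ]; gcongr
        · rw [norm_mul]; exact mul_le_mul hn hω (norm_nonneg _) (by norm_num)
      _ ≤ ((j + 1 : ℕ) : ℝ) * (2 * δ + 2 / D) := by push_cast; linarith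

end arithmetic

/-! ### The initial root of unity -/

theorem natSqrt_bounds (p : ℕ) : √(p : ℝ) - 1 ≤ (Nat.sqrt p : ℝ) ∧ (Nat.sqrt p : ℝ) ≤ √(p : ℝ) := by
  refine ⟨?_, Real.nat_sqrt_le_real_sqrt⟩
  have := Real.real_sqrt_le_nat_sqrt_succ (a := p)
  linarith

/-- The half-angle map c ↦ √(2 + c) contracts by a factor 1/2 on nonnegative numbers. The truncation
error 1/E of each step therefore never accumulates beyond 2/E. -/
theorem cosSeq_close {E : ℕ} (hE : 0 < E) (i : ℕ) :
    |(cosSeq E i : ℝ) / E - Real.sqrtTwoAddSeries 0 i| ≤ 2 / E := by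
  have hE' : (0 : ℝ) < E := by exact_mod_cast hE
  induction i with
  | zero =>
    simp only [cosSeq, Real.sqrtTwoAddSeries, Nat.cast_zero, zero_div, sub_zero, abs_zero]
    positivity
  | succ i ih =>
    set X : ℝ := (cosSeq E i : ℝ) / E with hX
    set c := Real.sqrtTwoAddSeries 0 i with hc
    have hX0 : 0 ≤ X := by positivity
    have hc0 : 0 ≤ c := Real.sqrtTwoAddSeries_zero_nonneg i
    have e1 : √((((2 * E + cosSeq E i) * E : ℕ)) : ℝ) = E * √(2 + X) := by
      have : ((((2 * E + cosSeq E i) * E : ℕ)) : ℝ) = E ^ 2 * (2 + X) := by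
        push_cast; rw [hX]; field_simp
      rw [this, Real.sqrt_mul (by positivity), Real.sqrt_sq hE'.le]
    have hb := natSqrt_bounds ((2 * E + cosSeq E i) * E)
    rw [e1] at hb
    have h1 : |(cosSeq E (i + 1) : ℝ) / E - √(2 + X)| ≤ 1 / E := by
      have h2 : (cosSeq E (i + 1) : ℝ) / E - √(2 + X) =
          ((Nat.sqrt ((2 * E + cosSeq E i) * E) : ℝ) - E * √(2 + X)) / E := by
        rw [cosSeq]; field_simp
      rw [h2, abs_div, abs_of_pos hE']
      gcongr
      rw [abs_le]; constructor <;> linarith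
    have h2 : |√(2 + X) - √(2 + c)| ≤ |X - c| / 2 := by
      have s1 : 1 ≤ √(2 + X) := Real.one_le_sqrt.2 (by linarith)
      have s2 : 1 ≤ √(2 + c) := Real.one_le_sqrt.2 (by linarith)
      have s3 : (√(2 + X) - √(2 + c)) * (√(2 + X) + √(2 + c)) = X - c := by
        have := Real.mul_self_sqrt (show 0 ≤ 2 + X by linarith)
        have := Real.mul_self_sqrt (show 0 ≤ 2 + c by linarith)
        ring_nf
        rw [Real.sq_sqrt (by linarith), Real.sq_sqrt (by linarith)]; ring
      rw [← s3, abs_mul, abs_of_pos (show 0 < √(2 + X) + √(2 + c) by linarith)]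
      have := abs_nonneg (√(2 + X) - √(2 + c))
      nlinarith
    rw [Real.sqrtTwoAddSeries]
    have h3 := abs_add_le ((cosSeq E (i + 1) : ℝ) / E - √(2 + X)) (√(2 + X) - √(2 + c))
    rw [sub_add_sub_cancel] at h3
    have : 2 / (E : ℝ) = 1 / E + 2 / E / 2 := by ring
    linarith

theorem unity_eq (L : ℕ) : unity (2 ^ L) 1 =
    ⟨Real.cos (Real.pi / 2 ^ L), Real.sin (Real.pi / 2 ^ L)⟩ := by
  have : 2 * Real.pi * Complex.I * (((1 : ℤ) : ℂ) / ((2 * 2 ^ L : ℕ) : ℂ)) =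
      ((Real.pi / 2 ^ L : ℝ) : ℂ) * Complex.I := by
    push_cast; field_simp
  rw [unity, this, Complex.exp_mul_I, ← Complex.ofReal_cos, ← Complex.ofReal_sin]
  apply Complex.ext <;> simp [-Complex.ofReal_cos, -Complex.ofReal_sin]

theorem unity_pow_two_pow {L e : ℕ} (he : e ≤ L) :
    unity (2 ^ L) 1 ^ 2 ^ e = unity (2 ^ (L - e)) 1 := by
  rw [← unity_nat, unity, unity]
  congr 2
  obtain ⟨k, rfl⟩ := Nat.exists_eq_add_of_le he
  rw [Nat.add_sub_cancel_left]
  push_cast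
  rw [pow_add]
  field_simp

/-- Near 0 the square root is only Hölder continuous with exponent 1/2, so taking the sine from the
cosine may lose half of the digits. For this reason the cosine is computed in units of 1/D² rather
than 1/D. -/
theorem abs_sqrt_sub_sqrt_le {s t u : ℝ} (hs : 0 ≤ s) (ht : 0 ≤ t) (h : |s - t| ≤ u ^ 2)
    (hu : 0 ≤ u) : |√s - √t| ≤ u := by
  have h' := abs_le.1 h
  rw [abs_le]
  constructor
  · have : √t ≤ √s + u := Real.sqrt_le_iff.2 ⟨by positivity, by
      nlinarith [Real.sq_sqrt hs, mul_nonneg (Real.sqrt_nonneg s) hu]⟩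
    linarith
  · have : √s ≤ √t + u := Real.sqrt_le_iff.2 ⟨by positivity, by
      nlinarith [Real.sq_sqrt ht, mul_nonneg (Real.sqrt_nonneg t) hu]⟩
    linarith

theorem rootZero_close {D L : ℕ} (hD : 0 < D) (hL : 1 ≤ L) :
    ‖zval D (rootZero D L) - unity (2 ^ L) 1‖ ≤ 8 / D := by
  have hD' : (0 : ℝ) < D := by exact_mod_cast hD
  have hD1 : (1 : ℝ) ≤ D := by exact_mod_cast hD
  have hE : 0 < D * D := by positivity
  have hclose := cosSeq_close hE (L - 1)
  have hXle := cosSeq_le (D * D) (L - 1)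
  set X := cosSeq (D * D) (L - 1) with hX
  have hcos : Real.cos (Real.pi / 2 ^ L) = Real.sqrtTwoAddSeries 0 (L - 1) / 2 := by
    rw [← Real.cos_pi_over_two_pow, Nat.sub_add_cancel hL]
  set θ := Real.pi / 2 ^ L with hθ
  have hθ0 : 0 ≤ θ := by positivity
  have hθ1 : θ ≤ Real.pi := div_le_self Real.pi_pos.le (one_le_pow₀ (by norm_num))
  have hsin : Real.sin θ = √(1 - Real.cos θ ^ 2) := by
    rw [← Real.abs_sin_eq_sqrt_one_sub_cos_sq,
      abs_of_nonneg (Real.sin_nonneg_of_nonneg_of_le_pi hθ0 hθ1)]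
  set x : ℝ := (X : ℝ) / (2 * (D * D)) with hx
  have hx0 : 0 ≤ x := by positivity
  have hx1 : x ≤ 1 := by
    rw [hx, div_le_one (by positivity)]
    exact_mod_cast hXle
  have hxc : |x - Real.cos θ| ≤ 1 / (D * D) := by
    rw [hcos, hx, show (X : ℝ) / (2 * (D * D)) - Real.sqrtTwoAddSeries 0 (L - 1) / 2 =
      ((X : ℝ) / ((D * D : ℕ) : ℝ) - Real.sqrtTwoAddSeries 0 (L - 1)) / 2 by
        push_cast; field_simp, abs_div, abs_two]
    push_cast at hclose ⊢
    calc _ ≤ 2 / ((D : ℝ) * D) / 2 := by gcongr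
      _ = _ := by ring
  have hEE : 1 / ((D : ℝ) * D) ≤ 1 / D := by
    gcongr
    nlinarith
  have h2D : 0 < 2 * D := by omega
  -- real part
  have hre : |(zval D (rootZero D L)).re - Real.cos θ| ≤ 2 / D := by
    have hb := natDiv_bounds X h2D
    have e : (zval D (rootZero D L)).re = ((X / (2 * D) : ℕ) : ℝ) / D := by
      simp only [zval, rootZero, ← hX]; push_cast; ring
    have h1 : |((X / (2 * D) : ℕ) : ℝ) / D - x| ≤ 1 / D := by
      rw [show ((X / (2 * D) : ℕ) : ℝ) / D - x =
        (((X / (2 * D) : ℕ) : ℝ) - (X : ℝ) / ((2 * D : ℕ) : ℝ)) / D by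
          rw [hx]; push_cast; field_simp, abs_div, abs_of_pos hD']
      gcongr
      rw [abs_le]; constructor <;> linarith
    rw [e]
    have h2 := abs_add_le (((X / (2 * D) : ℕ) : ℝ) / D - x) (x - Real.cos θ)
    rw [sub_add_sub_cancel] at h2
    calc _ ≤ 1 / (D : ℝ) + 1 / D := by linarith
      _ = _ := by ring
  -- imaginary part
  have him : |(zval D (rootZero D L)).im - Real.sin θ| ≤ 4 / D := by
    set Y := Nat.sqrt (4 * (D * D) * (D * D) - X * X) with hY
    have hsub : X * X ≤ 4 * (D * D) * (D * D) := by nlinarith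
    have hbY := natSqrt_bounds (4 * (D * D) * (D * D) - X * X)
    have eY : √((4 * (D * D) * (D * D) - X * X : ℕ) : ℝ) = 2 * (D * D) * √(1 - x ^ 2) := by
      have : ((4 * (D * D) * (D * D) - X * X : ℕ) : ℝ) = (2 * (D * D)) ^ 2 * (1 - x ^ 2) := by
        rw [Nat.cast_sub hsub, hx]; push_cast; field_simp; ring
      rw [this, Real.sqrt_mul (by positivity), Real.sqrt_sq (by positivity)]
    rw [← hY, eY] at hbY
    have hb := natDiv_bounds Y h2D
    have e : (zval D (rootZero D L)).im = ((Y / (2 * D) : ℕ) : ℝ) / D := by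
      simp only [zval, rootZero, ← hX, ← hY]; push_cast; ring
    have h1 : |((Y / (2 * D) : ℕ) : ℝ) / D - Y / (2 * (D * D))| ≤ 1 / D := by
      rw [show ((Y / (2 * D) : ℕ) : ℝ) / D - Y / (2 * (D * D)) =
        (((Y / (2 * D) : ℕ) : ℝ) - (Y : ℝ) / ((2 * D : ℕ) : ℝ)) / D by
          push_cast; field_simp, abs_div, abs_of_pos hD']
      gcongr
      rw [abs_le]; constructor <;> linarith
    have h2 : |(Y : ℝ) / (2 * (D * D)) - √(1 - x ^ 2)| ≤ 1 / D := by
      rw [show (Y : ℝ) / (2 * (D * D)) - √(1 - x ^ 2) =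
        ((Y : ℝ) - 2 * (D * D) * √(1 - x ^ 2)) / (2 * (D * D)) by field_simp, abs_div,
        abs_of_pos (show (0 : ℝ) < 2 * (D * D) by positivity)]
      refine (div_le_div₀ zero_le_one ?_ (by positivity) ?_).trans hEE
      · rw [abs_le]; constructor <;> linarith
      · nlinarith
    -- The error of the cosine is 1/D², hence that of 1 - x² is at most 4/D² = (2/D)².
    have h3 : |√(1 - x ^ 2) - Real.sin θ| ≤ 2 / D := by
      rw [hsin]
      have hc1 := Real.abs_cos_le_one θ
      have hcsq : Real.cos θ ^ 2 ≤ 1 := Real.cos_sq_le_one θ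
      have hdiff : |(1 - x ^ 2) - (1 - Real.cos θ ^ 2)| ≤ 4 / ((D : ℝ) * D) := by
        rw [show (1 - x ^ 2) - (1 - Real.cos θ ^ 2) = -((x - Real.cos θ) * (x + Real.cos θ)) by ring,
          abs_neg, abs_mul]
        have : |x + Real.cos θ| ≤ 4 := by
          refine (abs_add_le _ _).trans ?_
          rw [abs_of_nonneg hx0]; linarith
        calc _ ≤ 1 / ((D : ℝ) * D) * 4 := mul_le_mul hxc this (abs_nonneg _) (by positivity)
          _ = _ := by ring
      refine abs_sqrt_sub_sqrt_le (by nlinarith) (by linarith) ?_ (by positivity)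
      refine hdiff.trans (le_of_eq ?_)
      field_simp; norm_num
    rw [e]
    have h4 := abs_add_le (((Y / (2 * D) : ℕ) : ℝ) / D - (Y : ℝ) / (2 * (D * D)))
      ((Y : ℝ) / (2 * (D * D)) - √(1 - x ^ 2))
    rw [sub_add_sub_cancel] at h4
    have h5 := abs_add_le (((Y / (2 * D) : ℕ) : ℝ) / D - √(1 - x ^ 2))
      (√(1 - x ^ 2) - Real.sin θ)
    rw [sub_add_sub_cancel] at h5
    calc _ ≤ 1 / (D : ℝ) + 1 / D + 2 / D := by linarith
      _ = _ := by ring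
  rw [unity_eq, show (8 : ℝ) / D = 2 * (4 / D) by ring]
  refine norm_le_two_mul ?_ ?_
  · rw [Complex.sub_re]
    refine hre.trans ?_
    gcongr
    norm_num
  · rw [Complex.sub_im]; exact him

/-! ### Accuracy of the butterflies -/

section butterflies

variable {D : ℕ}

/-- Common form of all fixed-point products: the exact numerators represent D² times the result, and
each truncation loses less than 1. In a difference of two truncated numbers the losses do not add,
since both have the same sign. -/
theorem norm_val_div_sub_le (hD : 0 < D) {p q r s : ℕ} {W : ℂ}
    (h1 : (p : ℝ) - q = D * (D * W.re)) (h2 : (r : ℝ) - s = D * (D * W.im)) :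
    ‖Quad.val D ⟨p / D, q / D, r / D, s / D⟩ - W‖ ≤ 2 / D := by
  have hD' : (0 : ℝ) < D := by exact_mod_cast hD
  have key : ∀ {p q : ℕ} {w : ℝ}, (p : ℝ) - q = D * (D * w) →
      |(((p / D : ℕ) : ℝ) - ((q / D : ℕ) : ℝ)) / D - w| ≤ 1 / D := by
    intro p q w h
    have hp := natDiv_bounds p hD
    have hq := natDiv_bounds q hD
    have e : (p : ℝ) / D - q / D = D * w := by
      rw [← sub_div, h, mul_div_cancel_left₀ _ hD'.ne']
    rw [show (((p / D : ℕ) : ℝ) - ((q / D : ℕ) : ℝ)) / D - w =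
      (((p / D : ℕ) : ℝ) - ((q / D : ℕ) : ℝ) - D * w) / D by field_simp, abs_div, abs_of_pos hD']
    gcongr
    rw [abs_le]; constructor <;> linarith
  rw [show 2 / (D : ℝ) = 2 * (1 / D) by ring]
  exact norm_le_two_mul (key h1) (key h2)

theorem val_eq (hD : 0 < D) (u : Quad) :
    (u.a : ℝ) - u.b = D * (u.val D).re ∧ (u.c : ℝ) - u.d = D * (u.val D).im := by
  have : (D : ℝ) ≠ 0 := by exact_mod_cast hD.ne'
  simp only [Quad.val]
  constructor <;> field_simp

/-- Additions are exact: representing a number as a difference of two registers makes sums and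
differences free of rounding and of signs. The price is that the registers grow even when the value
does not. -/
theorem val_fwdLo (z : ℕ × ℕ) (u v : Quad) : (fwdLo D z u v).val D = u.val D + v.val D := by
  apply Complex.ext <;> simp [Quad.val, fwdLo] <;> ring

theorem val_fwdHi_close (hD : 0 < D) (z : ℕ × ℕ) (u v : Quad) :
    ‖(fwdHi D z u v).val D - (u.val D - v.val D) * zval D z‖ ≤ 2 / D := by
  obtain ⟨u1, u2⟩ := val_eq hD u
  obtain ⟨v1, v2⟩ := val_eq hD v
  have z1 := fst_eq_zval hD z
  have z2 := snd_eq_zval hD z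
  refine norm_val_div_sub_le hD ?_ ?_
  · push_cast
    rw [z1, z2, Complex.mul_re, Complex.sub_re, Complex.sub_im]
    linear_combination (D * (zval D z).re) * (u1 - v1) - (D * (zval D z).im) * (u2 - v2)
  · push_cast
    rw [z1, z2, Complex.mul_im, Complex.sub_re, Complex.sub_im]
    linear_combination (D * (zval D z).im) * (u1 - v1) + (D * (zval D z).re) * (u2 - v2)

theorem val_twist_close (hD : 0 < D) (z : ℕ × ℕ) (v : Quad) :
    ‖(twist D z v).val D - (starRingEnd ℂ) (zval D z) * v.val D‖ ≤ 2 / D := by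
  obtain ⟨v1, v2⟩ := val_eq hD v
  have z1 := fst_eq_zval hD z
  have z2 := snd_eq_zval hD z
  refine norm_val_div_sub_le hD ?_ ?_
  · push_cast
    rw [z1, z2, Complex.mul_re, Complex.conj_re, Complex.conj_im]
    linear_combination (D * (zval D z).re) * v1 + (D * (zval D z).im) * v2
  · push_cast
    rw [z1, z2, Complex.mul_im, Complex.conj_re, Complex.conj_im]
    linear_combination (D * (zval D z).re) * v2 - (D * (zval D z).im) * v1

theorem val_invLo (z : ℕ × ℕ) (u v : Quad) :
    (invLo D z u v).val D = u.val D + (twist D z v).val D := by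
  apply Complex.ext <;> simp only [Quad.val, invLo, Complex.add_re, Complex.add_im] <;>
    push_cast <;> ring

theorem val_invHi (z : ℕ × ℕ) (u v : Quad) :
    (invHi D z u v).val D = u.val D - (twist D z v).val D := by
  apply Complex.ext <;> simp only [Quad.val, invHi, Complex.sub_re, Complex.sub_im] <;>
    push_cast <;> ring

theorem val_quadMul_close (hD : 0 < D) (u v : Quad) :
    ‖(quadMul D u v).val D - u.val D * v.val D‖ ≤ 2 / D := by
  obtain ⟨u1, u2⟩ := val_eq hD u
  obtain ⟨v1, v2⟩ := val_eq hD v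
  refine norm_val_div_sub_le hD ?_ ?_
  · push_cast
    rw [Complex.mul_re]
    linear_combination ((v.a : ℝ) - v.b) * u1 + (D * (u.val D).re) * v1 -
      ((v.c : ℝ) - v.d) * u2 - (D * (u.val D).im) * v2
  · push_cast
    rw [Complex.mul_im]
    linear_combination ((v.c : ℝ) - v.d) * u1 + (D * (u.val D).re) * v2 +
      ((v.a : ℝ) - v.b) * u2 + (D * (u.val D).im) * v1

/-! ### Sizes of the stored numbers -/

/-- All fixed-point products by roots are sums of four products in which one factor is at most 4D.
-/
theorem sum_mul_div_le (hD : 0 < D) {K α β γ δ a b c d : ℕ} (hα : α ≤ K) (hβ : β ≤ K) (hγ : γ ≤ K)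
    (hδ : δ ≤ K) (ha : a ≤ 4 * D) (hb : b ≤ 4 * D) (hc : c ≤ 4 * D) (hd : d ≤ 4 * D) :
    (α * a + β * b + γ * c + δ * d) / D ≤ 16 * K := by
  have h1 := Nat.mul_le_mul hα ha
  have h2 := Nat.mul_le_mul hβ hb
  have h3 := Nat.mul_le_mul hγ hc
  have h4 := Nat.mul_le_mul hδ hd
  rw [Nat.div_le_iff_le_mul hD]
  have e : 16 * K * D = K * (4 * D) + K * (4 * D) + K * (4 * D) + K * (4 * D) := by ring
  omega

variable {z : ℕ × ℕ} {u v : Quad} {M : ℕ}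

/-- The factor 32 is generous for a sum; it is chosen so that both outputs of a butterfly, forward
and inverse, obey the same bound. -/
theorem fwdLo_le (hu : u.Le M) (hv : v.Le M) : (fwdLo D z u v).Le (32 * M) := by
  obtain ⟨u1, u2, u3, u4⟩ := hu
  obtain ⟨v1, v2, v3, v4⟩ := hv
  refine ⟨?_, ?_, ?_, ?_⟩ <;> simp only [fwdLo] <;> omega

theorem fwdHi_le (hD : 0 < D) (hz : z.1 ≤ 4 * D ∧ z.2 ≤ 4 * D) (hu : u.Le M) (hv : v.Le M) :
    (fwdHi D z u v).Le (32 * M) := by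
  obtain ⟨u1, u2, u3, u4⟩ := hu
  obtain ⟨v1, v2, v3, v4⟩ := hv
  obtain ⟨z1, z2⟩ := hz
  rw [show 32 * M = 16 * (2 * M) by ring]
  refine ⟨?_, ?_, ?_, ?_⟩ <;> refine sum_mul_div_le hD ?_ ?_ ?_ ?_ ?_ ?_ ?_ ?_ <;> omega

theorem twist_le (hD : 0 < D) (hz : z.1 ≤ 4 * D ∧ z.2 ≤ 4 * D) (hv : v.Le M) :
    (twist D z v).Le (16 * M) := by
  obtain ⟨v1, v2, v3, v4⟩ := hv
  obtain ⟨z1, z2⟩ := hz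
  refine ⟨?_, ?_, ?_, ?_⟩ <;> refine sum_mul_div_le hD ?_ ?_ ?_ ?_ ?_ ?_ ?_ ?_ <;> omega

theorem invLo_le (hD : 0 < D) (hz : z.1 ≤ 4 * D ∧ z.2 ≤ 4 * D) (hu : u.Le M) (hv : v.Le M) :
    (invLo D z u v).Le (32 * M) := by
  obtain ⟨u1, u2, u3, u4⟩ := hu
  obtain ⟨v1, v2, v3, v4⟩ := twist_le hD hz hv
  refine ⟨?_, ?_, ?_, ?_⟩ <;> simp only [invLo] <;> omega

theorem invHi_le (hD : 0 < D) (hz : z.1 ≤ 4 * D ∧ z.2 ≤ 4 * D) (hu : u.Le M) (hv : v.Le M) :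
    (invHi D z u v).Le (32 * M) := by
  obtain ⟨u1, u2, u3, u4⟩ := hu
  obtain ⟨v1, v2, v3, v4⟩ := twist_le hD hz hv
  refine ⟨?_, ?_, ?_, ?_⟩ <;> simp only [invHi] <;> omega

theorem quadMul_le (hD : 0 < D) {M' : ℕ} (hM' : 4 * (M * M) ≤ M' * D) (hu : u.Le M) (hv : v.Le M) :
    (quadMul D u v).Le M' := by
  obtain ⟨u1, u2, u3, u4⟩ := hu
  obtain ⟨v1, v2, v3, v4⟩ := hv
  have key : ∀ {α β γ δ a b c d : ℕ}, α ≤ M → β ≤ M → γ ≤ M → δ ≤ M → a ≤ M → b ≤ M → c ≤ M →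
      d ≤ M → (α * a + β * b + γ * c + δ * d) / D ≤ M' := by
    intro α β γ δ a b c d hα hβ hγ hδ ha hb hc hd
    have h1 := Nat.mul_le_mul hα ha
    have h2 := Nat.mul_le_mul hβ hb
    have h3 := Nat.mul_le_mul hγ hc
    have h4 := Nat.mul_le_mul hδ hd
    rw [Nat.div_le_iff_le_mul hD]
    omega
  refine ⟨?_, ?_, ?_, ?_⟩ <;> refine key ?_ ?_ ?_ ?_ ?_ ?_ ?_ ?_ <;> assumption

theorem level_le {lo hi : ℕ × ℕ → Quad → Quad → Quad} {h M' : ℕ} (hh : 0 < h) {ζ : ℕ → ℕ × ℕ}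
    (hlo : ∀ j < h, ∀ u v : Quad, u.Le M → v.Le M → (lo (ζ j) u v).Le M')
    (hhi : ∀ j < h, ∀ u v : Quad, u.Le M → v.Le M → (hi (ζ j) u v).Le M')
    {A : ℕ → Quad} (hA : ∀ i, (A i).Le M) (i : ℕ) : (level lo hi h ζ A i).Le M' := by
  rw [level]
  split_ifs
  · exact hlo _ (Nat.mod_lt _ hh) _ _ (hA _) (hA _)
  · exact hhi _ (Nat.mod_lt _ hh) _ _ (hA _) (hA _)

end butterflies

/-! ### The roots of unity of a run -/

namespace Setting

variable (P : Setting)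

/-- The parameters of the execution of the algorithm. -/
def params : Params := ⟨P.S, P.L, 16 * P.S, 9 * P.S⟩

theorem four_le_pow : (4 : ℝ) ≤ 2 ^ P.S := by
  calc (4 : ℝ) = 2 ^ 2 := by norm_num
    _ ≤ 2 ^ P.S := pow_le_pow_right₀ (by norm_num) P.two_le_S

theorem cast_D : (P.D : ℝ) = (2 ^ P.S) ^ 16 := by
  simp only [D, ← pow_mul]; push_cast; rw [mul_comm]

theorem err_mul : P.params.err * (2 ^ P.S) ^ 9 = 1 := by
  rw [Params.err, params, ← pow_mul, mul_comm P.S 9, ← mul_pow]; norm_num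

/-- The margin between the fixed-point unit V^(-16) and the admitted error V^(-9) is a factor V^7,
to be spent on the errors of the roots of unity. -/
theorem err_eq : P.params.err = (2 ^ P.S) ^ 7 / P.D := by
  have h1 := P.err_mul
  have h2 : (0 : ℝ) < 2 ^ P.S := by positivity
  rw [P.cast_D, eq_div_iff (by positivity)]
  calc _ = P.params.err * (2 ^ P.S) ^ 9 * (2 ^ P.S) ^ 7 := by ring
    _ = _ := by rw [h1, one_mul]

theorem two_div_D_le : 2 / (P.D : ℝ) ≤ P.params.err := by
  have hD : (0 : ℝ) < P.D := by exact_mod_cast P.D_pos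
  rw [P.err_eq]
  gcongr
  have h4 := P.four_le_pow
  calc (2 : ℝ) ≤ (2 ^ P.S) ^ 1 := by linarith
    _ ≤ (2 ^ P.S) ^ 7 := pow_le_pow_right₀ (by linarith) (by norm_num)

theorem err_le_quarter : P.params.err ≤ 1 / 4 := by
  have h4 := P.four_le_pow
  have h1 := P.err_mul
  have h0 := Params.err_pos (P := P.params)
  have h9 : (4 : ℝ) ≤ (2 ^ P.S) ^ 9 := by
    calc (4 : ℝ) ≤ (2 ^ P.S) ^ 1 := by linarith
      _ ≤ (2 ^ P.S) ^ 9 := pow_le_pow_right₀ (by linarith) (by norm_num)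
  nlinarith

theorem root_small {e : ℕ} (he : e ≤ P.L) : (8 : ℝ) * 4 ^ e / P.D ≤ 8 * (2 ^ P.S) ^ 2 / P.D := by
  have hD : (0 : ℝ) < P.D := by exact_mod_cast P.D_pos
  gcongr
  calc (4 : ℝ) ^ e ≤ 4 ^ P.S := pow_le_pow_right₀ (by norm_num) (he.trans P.L_le)
    _ = _ := by rw [← pow_mul, mul_comm, pow_mul]; norm_num

theorem root_small' : (8 : ℝ) * (2 ^ P.S) ^ 2 / P.D ≤ 1 / 4 := by
  have hD : (0 : ℝ) < P.D := by exact_mod_cast P.D_pos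
  refine le_trans ?_ P.err_le_quarter
  rw [P.err_eq]
  gcongr
  have h4 := P.four_le_pow
  calc (8 : ℝ) * (2 ^ P.S) ^ 2 ≤ (2 ^ P.S) ^ 2 * (2 ^ P.S) ^ 2 := by gcongr; nlinarith
    _ = (2 ^ P.S) ^ 4 := by ring
    _ ≤ (2 ^ P.S) ^ 7 := pow_le_pow_right₀ (by linarith) (by norm_num)

theorem square_close {e : ℕ} (he : e ≤ P.L) :
    ‖zval P.D (zsq P.D (rootZero P.D P.L) e) - unity (2 ^ (P.L - e)) 1‖ ≤
      8 * (2 ^ P.S) ^ 2 / P.D := by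
  rw [← unity_pow_two_pow he]
  exact (zsq_spec P.D_pos (norm_unity _ _)
    (rootZero_close P.D_pos (by have := P.f_lt; omega))
    ((P.root_small le_rfl).trans P.root_small') he).trans (P.root_small he)

/-- The error of the roots of unity of a level. -/
theorem root_error_le {h : ℕ} (hh : h ≤ P.N) :
    h * (2 * (8 * (2 ^ P.S) ^ 2 / P.D) + 2 / P.D) ≤ P.params.err := by
  have hD : (0 : ℝ) < P.D := by exact_mod_cast P.D_pos
  have h4 := P.four_le_pow
  have hN : (h : ℝ) ≤ 2 ^ P.S := by exact_mod_cast hh.trans P.N_le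
  rw [P.err_eq, show (h : ℝ) * (2 * (8 * (2 ^ P.S) ^ 2 / P.D) + 2 / P.D) =
    h * (16 * (2 ^ P.S) ^ 2 + 2) / P.D by ring]
  gcongr
  set V : ℝ := 2 ^ P.S
  calc (h : ℝ) * (16 * V ^ 2 + 2) ≤ V * (V ^ 4 + V ^ 2) := by
        gcongr
        · calc 16 * V ^ 2 ≤ V ^ 2 * V ^ 2 := by gcongr; nlinarith
            _ = V ^ 4 := by ring
        · nlinarith
    _ ≤ V * (V ^ 4 * V ^ 2) := by
        gcongr
        have : 4 ≤ V ^ 2 := by nlinarith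
        have : 4 ≤ V ^ 4 := by nlinarith
        nlinarith
    _ = V ^ 7 := by ring

/-- The squared roots are accurate to 8V²/D and at most N ≤ V factors are multiplied, which gives an
error of order V³/D, well within V^7/D. -/
theorem power_close {e : ℕ} (he : e ≤ P.L) {j : ℕ} (hj : j ≤ 2 ^ (P.L - e)) :
    ‖zval P.D (zpow P.D (zsq P.D (rootZero P.D P.L) e) j) - unity (2 ^ (P.L - e)) j‖ ≤
      P.params.err := by
  have hD : (0 : ℝ) < P.D := by exact_mod_cast P.D_pos
  have hle : 2 ^ (P.L - e) ≤ P.N := Nat.pow_le_pow_right (by norm_num) (by omega)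
  rw [unity_nat]
  refine (zpow_spec P.D_pos (norm_unity _ _) (P.square_close he) P.root_small'
    ((P.root_error_le hle).trans P.err_le_quarter) hj).trans ?_
  exact P.root_error_le (hj.trans hle)

theorem norm_square_le {e : ℕ} (he : e ≤ P.L) :
    ‖zval P.D (zsq P.D (rootZero P.D P.L) e)‖ ≤ 5 / 4 :=
  norm_zval_le_of_close (norm_unity _ _) ((P.square_close he).trans P.root_small')

theorem norm_power_le {e : ℕ} (he : e ≤ P.L) {j : ℕ} (hj : j ≤ 2 ^ (P.L - e)) :
    ‖zval P.D (zpow P.D (zsq P.D (rootZero P.D P.L) e) j)‖ ≤ 5 / 4 :=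
  norm_zval_le_of_close (norm_unity _ _) ((P.power_close he hj).trans P.err_le_quarter)

theorem power_le {e : ℕ} (he : e ≤ P.L) {j : ℕ} (hj : j ≤ 2 ^ (P.L - e)) :
    (zpow P.D (zsq P.D (rootZero P.D P.L) e) j).1 ≤ 4 * P.D ∧
      (zpow P.D (zsq P.D (rootZero P.D P.L) e) j).2 ≤ 4 * P.D :=
  le_four_mul_of_norm_zval_le P.D_pos (P.norm_power_le he hj)

theorem squaresOK : SquaresOK P (rootZero P.D P.L) := by
  have hS := P.two_le_S
  have h4 : 4 * P.D < 2 ^ (19 * P.S) := by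
    rw [D, show (4 : ℕ) = 2 ^ 2 by norm_num, ← pow_add]
    exact Nat.pow_lt_pow_right (by norm_num) (by omega)
  refine ⟨fun i hi => ?_, fun i hi => ?_, fun i _ hi => ⟨fun j hj => ?_, fun j hj => ?_⟩⟩
  · exact (zmul_spec P.D_pos (P.norm_square_le hi.le) (P.norm_square_le hi.le)).1
  · have := le_four_mul_of_norm_zval_le P.D_pos (P.norm_square_le hi)
    omega
  · exact (zmul_spec P.D_pos (P.norm_power_le hi hj.le) (P.norm_square_le hi)).1
  · have := P.power_le hi hj
    omega

theorem approxRoot {e : ℕ} (he : e ≤ P.L) {j : ℕ} (hj : j ≤ 2 ^ (P.L - e)) :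
    P.params.ApproxRoot (zval P.D (zpow P.D (zsq P.D (rootZero P.D P.L) e) j)) j
      (2 * 2 ^ (P.L - e)) := by
  refine ⟨⟨((zpow P.D (zsq P.D (rootZero P.D P.L) e) j).1 : ℤ) - 2 * P.D,
    ((zpow P.D (zsq P.D (rootZero P.D P.L) e) j).2 : ℤ) - 2 * P.D, ?_⟩, P.power_close he hj⟩
  simp [zval, params, D]

/-- The inverse transform needs the roots with negative exponent. Conjugation provides them with the
same error, so no further roots are computed. -/
theorem approxRoot_conj {e : ℕ} (he : e ≤ P.L) {j : ℕ} (hj : j ≤ 2 ^ (P.L - e)) :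
    P.params.ApproxRoot
      ((starRingEnd ℂ) (zval P.D (zpow P.D (zsq P.D (rootZero P.D P.L) e) j))) (-(j : ℤ))
      (2 * 2 ^ (P.L - e)) := by
  refine ⟨⟨((zpow P.D (zsq P.D (rootZero P.D P.L) e) j).1 : ℤ) - 2 * P.D,
    -(((zpow P.D (zsq P.D (rootZero P.D P.L) e) j).2 : ℤ) - 2 * P.D), ?_⟩, ?_⟩
  · apply Complex.ext
    · simp [zval, params, D]
    · simp [zval, params, D]; ring
  · change ‖_ - unity (2 ^ (P.L - e)) (-(j : ℤ))‖ ≤ _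
    rw [unity_neg, ← map_sub, Complex.norm_conj]
    exact P.power_close he hj

/-! ### Levels -/

theorem level_fwd_spec {e : ℕ} (he : e ≤ P.L) (A : ℕ → Quad) (b : ℕ) {j : ℕ}
    (hj : j < 2 ^ (P.L - e)) {h : ℕ} (hh : h = 2 ^ (P.L - e)) {A' : ℕ → Quad}
    (hA' : A' = level (fwdLo P.D) (fwdHi P.D) h (zpow P.D (zsq P.D (rootZero P.D P.L) e)) A) :
    ∃ ζ : ℂ, P.params.ApproxRoot ζ j (2 * h) ∧
      ‖(A' (2 * h * b + j)).val P.D -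
        ((A (2 * h * b + j)).val P.D + (A (2 * h * b + h + j)).val P.D)‖ ≤ P.params.err ∧
      ‖(A' (2 * h * b + h + j)).val P.D -
        ((A (2 * h * b + j)).val P.D - (A (2 * h * b + h + j)).val P.D) * ζ‖ ≤ P.params.err := by
  rw [← hh] at hj
  refine ⟨_, by rw [hh]; exact P.approxRoot he (by rw [← hh]; exact hj.le), ?_, ?_⟩
  · rw [hA', level, upper_mod_two hj, if_pos hj, val_fwdLo,
      add_right_comm (2 * h * b) j h, sub_self,
      norm_zero]
    exact Params.err_pos.le
  · rw [hA', level, lower_mod_two hj, if_neg (by omega), lower_mod hj,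
      show 2 * h * b + h + j - h = 2 * h * b + j by omega]
    exact (val_fwdHi_close P.D_pos _ _ _).trans P.two_div_D_le

theorem level_inv_spec {e : ℕ} (he : e ≤ P.L) (A : ℕ → Quad) (b : ℕ) {j : ℕ}
    (hj : j < 2 ^ (P.L - e)) {h : ℕ} (hh : h = 2 ^ (P.L - e)) {A' : ℕ → Quad}
    (hA' : A' = level (invLo P.D) (invHi P.D) h (zpow P.D (zsq P.D (rootZero P.D P.L) e)) A) :
    ∃ ζ : ℂ, P.params.ApproxRoot ζ (-(j : ℤ)) (2 * h) ∧
      ‖(A' (2 * h * b + j)).val P.D -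
        ((A (2 * h * b + j)).val P.D + ζ * (A (2 * h * b + h + j)).val P.D)‖ ≤ P.params.err ∧
      ‖(A' (2 * h * b + h + j)).val P.D -
        ((A (2 * h * b + j)).val P.D - ζ * (A (2 * h * b + h + j)).val P.D)‖ ≤ P.params.err := by
  rw [← hh] at hj
  refine ⟨_, by rw [hh]; exact P.approxRoot_conj he (by rw [← hh]; exact hj.le), ?_, ?_⟩
  · rw [hA', level, upper_mod_two hj, if_pos hj, upper_mod hj, val_invLo,
      add_right_comm (2 * h * b) j h, add_sub_add_left_eq_sub]
    exact (val_twist_close P.D_pos _ _).trans P.two_div_D_le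
  · rw [hA', level, lower_mod_two hj, if_neg (by omega), lower_mod hj,
      show 2 * h * b + h + j - h = 2 * h * b + j by omega, val_invHi, sub_sub_sub_cancel_left,
      norm_sub_rev]
    exact (val_twist_close P.D_pos _ _).trans P.two_div_D_le

variable (A : ℕ → Quad)

/-- Block b of factor number k (0 for x, 1 for y) is block 2^s k + b of the joint vector, because a
half contains 2^s blocks at this level. -/
theorem forwardLevel {s : ℕ} (hs : s < P.L) (k : ℕ) :
    P.params.ForwardLevel (2 ^ (P.params.levels - 1 - s))
      (fun i => (fwdArr P (rootZero P.D P.L) A s (P.N * k + i)).val P.D)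
      (fun i => (fwdArr P (rootZero P.D P.L) A (s + 1) (P.N * k + i)).val P.D) := by
  intro b j _ hj
  have e : P.params.levels - 1 - s = P.L - (s + 1) := by
    show P.L - 1 - s = _
    omega
  rw [e] at hj ⊢
  have hN : P.N = 2 * 2 ^ (P.L - (s + 1)) * 2 ^ s := by
    rw [← pow_succ', ← pow_add, N]; congr 1; omega
  obtain ⟨ζ, h1, h2, h3⟩ := P.level_fwd_spec (e := s + 1) hs (fwdArr P (rootZero P.D P.L) A s)
    (2 ^ s * k + b) hj rfl (A' := fwdArr P (rootZero P.D P.L) A (s + 1)) rfl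
  have e1 : 2 * 2 ^ (P.L - (s + 1)) * (2 ^ s * k + b) =
      P.N * k + 2 * 2 ^ (P.L - (s + 1)) * b := by rw [hN]; ring
  rw [e1] at h2 h3
  refine ⟨ζ, h1, ?_, ?_⟩
  · simpa only [add_assoc] using h2
  · simpa only [add_assoc] using h3

theorem inverseLevel {s : ℕ} (hs : s < P.L) :
    P.params.InverseLevel (2 ^ s)
      (fun i => (invArr P (rootZero P.D P.L) A s i).val P.D)
      (fun i => (invArr P (rootZero P.D P.L) A (s + 1) i).val P.D) := by
  intro b j _ hj
  have e : s = P.L - (P.L - s) := by omega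
  exact P.level_inv_spec (e := P.L - s) (by omega) _ b (by rwa [← e])
    (congrArg (2 ^ ·) e) rfl

theorem fwdArr_le {M : ℕ} (hA : ∀ i, (A i).Le M) {s : ℕ} (hs : s ≤ P.L) :
    ∀ i, (fwdArr P (rootZero P.D P.L) A s i).Le (32 ^ s * M) := by
  induction s with
  | zero => simpa [fwdArr] using hA
  | succ s ih =>
    intro i
    rw [fwdArr, pow_succ', mul_assoc]
    exact level_le (by positivity) (fun j _ u v hu hv => fwdLo_le hu hv)
      (fun j hj u v hu hv => fwdHi_le P.D_pos (P.power_le hs hj.le) hu hv) (ih (by omega)) i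

theorem invArr_le {M : ℕ} (hA : ∀ i, (A i).Le M) {s : ℕ} (hs : s ≤ P.L) :
    ∀ i, (invArr P (rootZero P.D P.L) A s i).Le (32 ^ s * M) := by
  induction s with
  | zero => simpa [invArr] using hA
  | succ s ih =>
    intro i
    have e : s = P.L - (P.L - s) := by omega
    rw [invArr, pow_succ', mul_assoc]
    exact level_le (by positivity)
      (fun j hj u v hu hv => invLo_le P.D_pos
        (P.power_le (by omega) (by rw [← e]; exact hj.le)) hu hv)
      (fun j hj u v hu hv => invHi_le P.D_pos
        (P.power_le (by omega) (by rw [← e]; exact hj.le)) hu hv) (ih (by omega)) i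

end Setting

/-! ### Correctness of a run -/

namespace Setting

variable (P : Setting)

theorem initArray_le (x y q : ℕ) : (initArray P x y q).Le (2 ^ (17 * P.S)) := by
  have h : ∀ v : ℕ, v % 2 ^ P.S * P.D ≤ 2 ^ (17 * P.S) := fun v => by
    calc v % 2 ^ P.S * P.D ≤ 2 ^ P.S * 2 ^ (16 * P.S) :=
          Nat.mul_le_mul_right _ (Nat.mod_lt _ (by positivity)).le
      _ = 2 ^ (17 * P.S) := by rw [← pow_add]; congr 1; ring
  refine ⟨?_, Nat.zero_le _, Nat.zero_le _, Nat.zero_le _⟩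
  simp only [initArray]
  split_ifs <;> exact h _

theorem val_natCast_mul (v : ℕ) : (⟨v * P.D, 0, 0, 0⟩ : Quad).val P.D = (v : ℂ) := by
  have : (P.D : ℝ) ≠ 0 := by exact_mod_cast P.D_pos.ne'
  apply Complex.ext <;> simp [Quad.val, this]

theorem pow_32 (s k : ℕ) : 32 ^ s * 2 ^ k = 2 ^ (5 * s + k) := by
  rw [show (32 : ℕ) = 2 ^ 5 by norm_num, ← pow_mul, ← pow_add]

/-- The registers hold 22S bits before the multiplication; a sum of four products divided by D has
at most 44S + 2 - 16S ≤ 29S bits. -/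
theorem prodArr_le {A : ℕ → Quad} (hA : ∀ i, (A i).Le (2 ^ (22 * P.S))) (i : ℕ) :
    (prodArr P A i).Le (2 ^ (29 * P.S)) := by
  refine quadMul_le P.D_pos ?_ (hA _) (hA _)
  have := P.two_le_S
  rw [← pow_add, show (4 : ℕ) = 2 ^ 2 by norm_num, ← pow_add, D, ← pow_add]
  exact Nat.pow_le_pow_right (by norm_num) (by omega)

theorem _root_.DepthCostRAM.Quad.Le.mono {q : Quad} {M M' : ℕ} (h : q.Le M) (hM : M ≤ M') : q.Le M' :=
  ⟨h.1.trans hM, h.2.1.trans hM, h.2.2.1.trans hM, h.2.2.2.trans hM⟩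

/-- Rounding of a stored number that is close to a multiple of the number of points. -/
theorem round_spec {q : Quad} {c : ℕ} (hL : 1 ≤ P.L)
    (hq : ‖q.val P.D - P.N * (c : ℂ)‖ ≤ P.N * (17 / 64)) :
    q.b ≤ q.a + P.D * P.N / 2 ∧ P.round q = c ∧ |(c : ℝ) - (q.val P.D).re / P.N| ≤ 1 / 2 := by
  have hD : (0 : ℝ) < P.D := by exact_mod_cast P.D_pos
  have hN : (0 : ℝ) < P.N := by exact_mod_cast P.N_pos
  have h1 := (Complex.abs_re_le_norm _).trans hq
  have e1 : (q.val P.D - P.N * (c : ℂ)).re = (q.val P.D).re - P.N * c := by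
    rw [Complex.sub_re, ← Nat.cast_mul, Complex.natCast_re]; push_cast; ring
  rw [e1] at h1
  set r := (q.val P.D).re with hr
  have hab : (q.a : ℝ) - q.b = P.D * r := (val_eq P.D_pos q).1
  have hhalf : ((P.D * P.N / 2 : ℕ) : ℝ) = P.D * P.N / 2 := by
    have h2 : 2 ∣ P.D * P.N := Dvd.dvd.mul_left (dvd_pow_self 2 (by omega)) _
    rw [Nat.cast_div h2 (by norm_num)]; push_cast; ring
  have hr' : |r / P.N - c| ≤ 17 / 64 := by
    rw [show r / P.N - c = (r - P.N * c) / P.N by field_simp, abs_div, abs_of_pos hN,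
      div_le_iff₀ hN]
    linarith
  have h2 := abs_le.1 hr'
  set t := r / P.N with ht
  have hrt : r = P.N * t := by rw [ht]; field_simp
  have hc0 : (0 : ℝ) ≤ c := Nat.cast_nonneg c
  have hDN : (0 : ℝ) < P.D * P.N := by positivity
  have hle : q.b ≤ q.a + P.D * P.N / 2 := by
    have : (q.b : ℝ) ≤ q.a + ((P.D * P.N / 2 : ℕ) : ℝ) := by
      rw [hhalf]
      have : (P.D : ℝ) * r = P.D * P.N * t := by rw [hrt]; ring
      nlinarith
    exact_mod_cast this
  have hb := natDiv_bounds (q.a + P.D * P.N / 2 - q.b) (Nat.mul_pos P.D_pos P.N_pos)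
  -- Before truncation the machine's quotient is exactly t + 1/2, where t is within 17/64 of c; its
  -- integer part is therefore c.
  have e2 : ((q.a + P.D * P.N / 2 - q.b : ℕ) : ℝ) / ((P.D * P.N : ℕ) : ℝ) = t + 1 / 2 := by
    rw [Nat.cast_sub hle]
    push_cast
    rw [hhalf, show (q.a : ℝ) + P.D * P.N / 2 - q.b = P.D * P.N * (t + 1 / 2) by
      have : (P.D : ℝ) * r = P.D * P.N * t := by rw [hrt]; ring
      linarith]
    field_simp
  rw [e2] at hb
  have hround : P.round q = c := by
    change _ ≤ ((P.round q : ℕ) : ℝ) ∧ ((P.round q : ℕ) : ℝ) ≤ _ at hb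
    have l1 : P.round q < c + 1 := by
      have : ((P.round q : ℕ) : ℝ) < c + 1 := by linarith
      exact_mod_cast this
    have l2 : c < P.round q + 1 := by
      have : (c : ℝ) < (P.round q : ℕ) + 1 := by linarith
      exact_mod_cast this
    omega
  refine ⟨hle, hround, ?_⟩
  rw [abs_le]; constructor <;> linarith

variable {P}

theorem Computed.le_mul {d : ℕ} (hP : P.Computed d) : P.n / 2 ≤ d * P.S := by
  have hS := P.two_le_S
  have h1 := hP.pieces_eq
  have h2 : P.n / 2 + P.S - 1 < (d + 1) * P.S := by
    rw [← Nat.div_lt_iff_lt_mul (by omega), ← h1]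
    omega
  rw [add_mul, one_mul] at h2
  omega

theorem Computed.two_mul_le {d : ℕ} (hP : P.Computed d) : 2 * d ≤ P.N := by
  rw [N, hP.levels_eq]; exact Nat.le_pow_clog (by norm_num) _

/-- Both forward transforms share the same times, as they live in the two halves of one vector. The
rounded coefficients are identified with those of the product polynomial, whose value at 2^S is xy.
-/
theorem multiplier_spec {d : ℕ} (hP : P.Computed d) (hLS : P.L < P.S) {m x y : ℕ}
    (hn : P.n = 2 * m) (hm : 1 ≤ m) (hx : x < 2 ^ m) (hy : y < 2 ^ m) :
    ∃ T, multiplier.CarriesOutSSC P.params m x y T ∧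
      multiplier.HaltsWith (2 * m) (inputOf m x y) T (bits (2 * m) (x * y)) ∧
      multiplier.cost (2 * m) (inputOf m x y) T ≤ P.totalCost := by
  have hS := P.two_le_S
  have hL : 1 ≤ P.L := by have := P.f_lt; omega
  have hdN := hP.two_mul_le
  have hmd : m ≤ P.S * d := by
    have := hP.le_mul
    rw [hn, Nat.mul_div_cancel_left _ (by norm_num)] at this
    rwa [mul_comm]
  have hx' : x < 2 ^ (P.S * d) := hx.trans_le (Nat.pow_le_pow_right (by norm_num) hmd)
  have hy' : y < 2 ^ (P.S * d) := hy.trans_le (Nat.pow_le_pow_right (by norm_num) hmd)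
  set w₀ := rootZero P.D P.L with hw₀
  set A := fwdArr P w₀ (initArray P x y) with hA
  set H := invArr P w₀ (prodArr P (A P.L)) with hH
  -- the execution of the algorithm
  let F' : ℕ → ℕ → ℂ := fun s i => (A s (P.N * 0 + i)).val P.D
  let G' : ℕ → ℕ → ℂ := fun s i => (A s (P.N * 1 + i)).val P.D
  let H' : ℕ → ℕ → ℂ := fun s i => (H s i).val P.D
  have pieces_x : ∀ i < P.params.points,
      F' 0 i = ((x / 2 ^ (P.params.pieceLen * i) % 2 ^ P.params.pieceLen : ℕ) : ℂ) := by
    intro i hi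
    have hi' : i < P.N := hi
    simp only [F', hA, fwdArr, initArray, mul_zero, zero_add, if_pos hi']
    exact P.val_natCast_mul _
  have pieces_y : ∀ i < P.params.points,
      G' 0 i = ((y / 2 ^ (P.params.pieceLen * i) % 2 ^ P.params.pieceLen : ℕ) : ℂ) := by
    intro i _
    have hi' : ¬ P.N + i < P.N := by omega
    simp only [G', hA, fwdArr, initArray, mul_one, if_neg hi', Nat.add_sub_cancel_left]
    exact P.val_natCast_mul _
  have fft_x : ∀ s < P.params.levels,
      P.params.ForwardLevel (2 ^ (P.params.levels - 1 - s)) (F' s) (F' (s + 1)) :=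
    fun s hs => P.forwardLevel _ hs 0
  have fft_y : ∀ s < P.params.levels,
      P.params.ForwardLevel (2 ^ (P.params.levels - 1 - s)) (G' s) (G' (s + 1)) :=
    fun s hs => P.forwardLevel _ hs 1
  have mul_values : ∀ i < P.params.points,
      ‖H' 0 i - F' P.params.levels i * G' P.params.levels i‖ ≤ P.params.err := by
    intro i _
    refine le_trans ?_ P.two_div_D_le
    have := val_quadMul_close P.D_pos (A P.L i) (A P.L (P.N + i))
    simpa only [H', hH, invArr, prodArr, F', G', mul_zero, zero_add, mul_one,
      show P.params.levels = P.L from rfl] using this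
  have inverse_fft : ∀ s < P.params.levels,
      P.params.InverseLevel (2 ^ s) (H' s) (H' (s + 1)) := fun s hs => P.inverseLevel _ hs
  have hclose : ∀ i < P.N, ‖(H P.L i).val P.D - P.N * (prodCoeff P.S d x y i : ℂ)‖ ≤
      P.N * (17 / 64) := fun i hi =>
    norm_sub_prodCoeff_le (P := P.params) (F := F') (G := G') (H := H') hS P.L_le rfl
      hP.pieces_pos hdN hx' hy' pieces_x pieces_y fft_x fft_y mul_values inverse_fft hi
  have hround := fun i hi => P.round_spec hL (hclose i hi)
  set z := prodCoeff P.S d x y with hz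
  have hval : valueOf P.S z P.N = x * y := valueOf_prodCoeff hP.pieces_pos hdN hx' hy'
  -- sizes
  have hA_le : ∀ s ≤ P.L, ∀ i, (A s i).Le (2 ^ (22 * P.S)) := fun s hs i =>
    Quad.Le.mono (P.fwdArr_le _ (P.initArray_le x y) hs i) (by
      rw [pow_32]; exact Nat.pow_le_pow_right (by norm_num) (by omega))
  -- Five bits per level on top of 29S give 29S + 5L ≤ 34S - 5. The strict inequality L < S is what
  -- keeps this below the limit of 34S bits.
  have hH_le : ∀ s ≤ P.L, ∀ i, (H s i).Le (2 ^ (34 * P.S - 5)) := fun s hs i =>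
    Quad.Le.mono (P.invArr_le _ (P.prodArr_le (hA_le _ le_rfl)) hs i) (by
      rw [pow_32]; exact Nat.pow_le_pow_right (by norm_num) (by omega))
  have hlast : (P.n - 1) / P.S < P.N := by
    rw [Nat.div_lt_iff_lt_mul (by omega), hn]
    calc 2 * m - 1 < 2 * (P.S * d) := by omega
      _ = 2 * d * P.S := by ring
      _ ≤ P.N * P.S := Nat.mul_le_mul_right _ hdN
  obtain ⟨tF, tH, tz, T, monoF, monoH, hFH, hHz, hzT, cF, cH, cz, halts, hcost⟩ :=
    multiplier_run P hP hn hx hy hm hdN hw₀ P.squaresOK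
      (M := 2 ^ (34 * P.S - 5)) (Nat.pow_lt_pow_right (by norm_num) (by omega)) hA hH
      (fun s hs i _ => Quad.Le.mono (hA_le s hs i) (Nat.pow_le_pow_right (by norm_num) (by omega)))
      (fun s hs i _ => hH_le s hs i) (fun q hq => (hround q hq).1)
      (fun q hq => (hround q hq).2.1.symm)
      (fun q hq => prodCoeff_lt hx' hy' hq P.N_le) hlast
  have hDcast : (P.D : ℝ) = 2 ^ P.params.fracBits := by simp [D, params]
  have stores : ∀ (mem : ℕ → ℕ) (base : ℕ) (v : ℕ → Quad),
      (∀ i < P.N, quad mem (base + 4 * i) = v i) →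
      StoresComplex P.params mem (fun i => (v i).val P.D) := by
    intro mem base v hv
    refine ⟨base, fun i hi => ?_⟩
    rw [← hDcast]
    change (v i).val P.D = _
    rw [← hv i hi]
    rfl
  rw [hn] at cF cH cz halts hcost
  refine ⟨T, ⟨⟨F', G', H', z⟩, ⟨pieces_x, pieces_y, fft_x, fft_y, mul_values, inverse_fft,
    fun i hi => (hround i hi).2.2⟩, tF, tF, tH, tz, monoF, monoF, monoH, hFH, hFH, hHz, hzT,
    ?_, ?_, ?_, ?_, halts⟩, by rwa [hval] at halts, hcost⟩
  · intro s hs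
    obtain ⟨σ, h1, h2⟩ := cF s hs
    refine ⟨σ, h1, stores σ.mem P.base (fun i => A s (P.N * 0 + i)) fun i hi => ?_⟩
    rw [h2 i (by omega), mul_zero, zero_add]
  · intro s hs
    obtain ⟨σ, h1, h2⟩ := cF s hs
    refine ⟨σ, h1, stores σ.mem (P.base + 4 * P.N) (fun i => A s (P.N * 1 + i)) fun i hi => ?_⟩
    rw [mul_one, ← h2 (P.N + i) (by omega)]
    congr 1; ring
  · intro s hs
    obtain ⟨σ, h1, h2⟩ := cH s hs
    exact ⟨σ, h1, stores σ.mem P.base (H s) h2⟩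
  · obtain ⟨σ, h1, h2⟩ := cz
    exact ⟨σ, h1, P.base + 4 * P.N, fun i hi => (h2 i hi).symm⟩

end Setting

/-! ### The parameters for a given length of the factors -/

theorem two_le_size {m : ℕ} (hm : 1 ≤ m) : 2 ≤ Nat.size (2 * m) :=
  Nat.lt_size.2 (by omega)

theorem pieces_pos {m S : ℕ} (hm : 1 ≤ m) (hS : 2 ≤ S) : 0 < (m + S - 1) / S :=
  Nat.div_pos (by omega) (by omega)

/-- Since S ≥ 2, cutting into pieces at least halves the length up to rounding. This gives L ≤ S -
1, both for the register sizes and for bounding the number of levels. -/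
theorem two_mul_pieces_le {m : ℕ} (hm : 1 ≤ m) :
    2 * ((m + Nat.size (2 * m) - 1) / Nat.size (2 * m)) ≤ 2 ^ (Nat.size (2 * m) - 1) := by
  have hS := two_le_size hm
  set S := Nat.size (2 * m)
  have h1 : 2 * m < 2 ^ S := Nat.lt_size_self _
  have h2 : 2 ^ S = 2 * 2 ^ (S - 1) := by rw [← pow_succ', Nat.sub_add_cancel (by omega)]
  have h3 : (m + S - 1) / S * S ≤ m + S - 1 := Nat.div_mul_le_self _ _
  have h4 := pieces_pos hm hS
  set d := (m + S - 1) / S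
  have h5 : (d - 1) * 2 ≤ (d - 1) * S := Nat.mul_le_mul_left _ hS
  have h6 : d * S = (d - 1) * S + S := by
    conv_lhs => rw [show d = d - 1 + 1 by omega, add_mul, one_mul]
  omega

/-- The setting for factors of `m` bits. -/
def settingOf (m : ℕ) (hm : 1 ≤ m) : Setting where
  n := 2 * m
  S := Nat.size (2 * m)
  L := Nat.clog 2 (2 * ((m + Nat.size (2 * m) - 1) / Nat.size (2 * m)))
  f := min (Nat.clog 2 (Nat.size (2 * m)))
    (Nat.clog 2 (2 * ((m + Nat.size (2 * m) - 1) / Nat.size (2 * m))) - 1)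
  two_le_S := two_le_size hm
  n_lt := Nat.lt_size_self _
  f_lt := by
    have h := pieces_pos hm (two_le_size hm)
    have : 0 < Nat.clog 2 (2 * ((m + Nat.size (2 * m) - 1) / Nat.size (2 * m))) :=
      Nat.clog_pos (by norm_num) (by omega)
    omega
  L_le := (Nat.clog_le_of_le_pow (two_mul_pieces_le hm)).trans (Nat.sub_le _ _)
  chunk_lt := by
    have hS := two_le_size hm
    have h1 := Nat.pow_pred_clog_lt_self (b := 2) (by norm_num) (x := Nat.size (2 * m)) (by omega)
    have h2 : 0 < Nat.clog 2 (Nat.size (2 * m)) := Nat.clog_pos (by norm_num) hS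
    calc 2 ^ min _ _ ≤ 2 ^ Nat.clog 2 (Nat.size (2 * m)) :=
          Nat.pow_le_pow_right (by norm_num) (min_le_left _ _)
      _ = 2 * 2 ^ (Nat.clog 2 (Nat.size (2 * m)) - 1) := by
          rw [← pow_succ', Nat.sub_add_cancel h2]
      _ < 2 * Nat.size (2 * m) := by
          rw [Nat.pred_eq_sub_one] at h1
          omega

section setting

variable {m : ℕ} (hm : 1 ≤ m)

theorem settingOf_computed :
    (settingOf m hm).Computed ((m + Nat.size (2 * m) - 1) / Nat.size (2 * m)) where
  size_eq := rfl
  pieces_eq := by simp [settingOf]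
  pieces_pos := pieces_pos hm (two_le_size hm)
  levels_eq := rfl
  chunk_eq := rfl

theorem settingOf_L_lt : (settingOf m hm).L < (settingOf m hm).S := by
  have h1 : (settingOf m hm).L ≤ Nat.size (2 * m) - 1 :=
    Nat.clog_le_of_le_pow (two_mul_pieces_le hm)
  have h2 := two_le_size hm
  exact lt_of_le_of_lt h1 (by show _ < Nat.size (2 * m); omega)

theorem settingOf_N_lt :
    (settingOf m hm).N < 4 * ((m + Nat.size (2 * m) - 1) / Nat.size (2 * m)) := by
  have h0 := pieces_pos hm (two_le_size hm)
  have h1 := Nat.pow_pred_clog_lt_self (b := 2) (by norm_num)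
    (x := 2 * ((m + Nat.size (2 * m) - 1) / Nat.size (2 * m))) (by omega)
  have h2 : 0 < Nat.clog 2 (2 * ((m + Nat.size (2 * m) - 1) / Nat.size (2 * m))) :=
    Nat.clog_pos (by norm_num) (by omega)
  show 2 ^ Nat.clog 2 (2 * ((m + Nat.size (2 * m) - 1) / Nat.size (2 * m))) < _
  rw [Nat.pred_eq_sub_one] at h1
  have h3 : 2 ^ Nat.clog 2 (2 * ((m + Nat.size (2 * m) - 1) / Nat.size (2 * m))) =
      2 * 2 ^ (Nat.clog 2 (2 * ((m + Nat.size (2 * m) - 1) / Nat.size (2 * m))) - 1) := by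
    rw [← pow_succ', Nat.sub_add_cancel h2]
  omega

theorem settingOf_admissible : (settingOf m hm).params.Admissible 16 m := by
  have hS := two_le_size hm
  have hc : m ⌈/⌉ (settingOf m hm).params.pieceLen =
      (m + Nat.size (2 * m) - 1) / Nat.size (2 * m) := Nat.ceilDiv_eq_add_pred_div _ _
  refine ⟨?_, ?_, ?_, ?_, ?_, ?_, ?_⟩
  · show Nat.size (2 * m) ≤ 16 * Nat.size (2 * m)
    omega
  · show Nat.size (2 * m) ≤ 16 * Nat.size (2 * m)
    omega
  · rw [hc]; exact (settingOf_computed hm).two_mul_le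
  · rw [hc]; exact settingOf_N_lt hm
  · show Nat.size (2 * m) ≤ 9 * Nat.size (2 * m)
    omega
  · show 9 * Nat.size (2 * m) ≤ 16 * Nat.size (2 * m)
    omega
  · show 16 * Nat.size (2 * m) ≤ 16 * Nat.size (2 * m)
    omega

end setting

/-! ### The cost -/

theorem sq_le_two_mul_two_pow (S : ℕ) : S * S ≤ 2 * 2 ^ S := by
  induction S with
  | zero => simp
  | succ S ih =>
    rcases Nat.lt_or_ge S 3 with h | h
    · interval_cases S <;> norm_num
    · rw [pow_succ]; nlinarith

namespace Setting

variable {P : Setting} {d : ℕ}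

theorem Computed.pow_le (hP : P.Computed d) : 2 ^ (P.S - 1) ≤ P.n :=
  Nat.lt_size.1 (by rw [← hP.size_eq]; have := P.two_le_S; omega)

theorem Computed.S_le (hP : P.Computed d) : P.S ≤ P.n := by
  have h1 := hP.pow_le
  have h2 : P.S - 1 < 2 ^ (P.S - 1) := Nat.lt_two_pow_self
  omega

/-- With this the quadratic cost of computing the first root of unity is linear in n. -/
theorem Computed.S_mul_S_le (hP : P.Computed d) : P.S * P.S ≤ 4 * P.n := by
  have h1 := hP.pow_le
  have h2 := sq_le_two_mul_two_pow P.S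
  have h3 : 2 ^ P.S = 2 * 2 ^ (P.S - 1) := by
    rw [← pow_succ', Nat.sub_add_cancel (by have := P.two_le_S; omega)]
  omega

/-- The central count: N is below four times the number of pieces, and the pieces have total length
of about n/2. -/
theorem Computed.N_mul_S_le (hP : P.Computed d) (hN : P.N < 4 * d) : P.N * P.S ≤ 6 * P.n := by
  have h1 : d * P.S ≤ P.n / 2 + P.S - 1 := by
    conv_lhs => rw [hP.pieces_eq]
    exact Nat.div_mul_le_self _ _
  have h2 : P.N * P.S ≤ 4 * d * P.S := Nat.mul_le_mul_right _ hN.le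
  have h3 := hP.S_le
  rw [mul_assoc] at h2
  omega

theorem near_le (P : Setting) : P.near ≤ P.f + 8 := by
  refine Nat.clog_le_of_le_pow ?_
  have : 1 ≤ 2 ^ P.f := Nat.one_le_two_pow
  rw [base, B, pow_add]
  omega

/-- The near area has O(S) registers, so its addresses have O(log log n) bits. -/
theorem Computed.near_le_wordCost (hP : P.Computed d) : P.near ≤ 10 * wordCost P.n := by
  have h1 := P.near_le
  have h2 : P.f ≤ Nat.clog 2 P.S := by rw [hP.chunk_eq]; exact min_le_left _ _
  have hn : 2 ≤ P.n := P.two_le_S.trans hP.S_le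
  have h3 : P.S ≤ 2 * Nat.clog 2 P.n := by
    have h4 : 0 < Nat.clog 2 P.n := Nat.clog_pos (by norm_num) hn
    have h5 : P.S ≤ Nat.clog 2 P.n + 1 := by
      rw [hP.size_eq, Nat.size_le]
      have := Nat.le_pow_clog (b := 2) (by norm_num) P.n
      rw [pow_succ]
      omega
    omega
  have h6 : Nat.clog 2 P.S ≤ Nat.clog 2 (Nat.clog 2 P.n) + 1 := by
    refine Nat.clog_le_of_le_pow (h3.trans ?_)
    rw [pow_succ']
    exact Nat.mul_le_mul_left _ (Nat.le_pow_clog (by norm_num) _)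
  have h7 : Nat.clog 2 (Nat.clog 2 P.n) ≤ wordCost P.n := le_max_right _ _
  have h8 := wordCost_pos P.n
  omega

/-- Either B ≥ S, so that the long copies of a level cost O(N) in total, or the chunk size was
limited by N and there are just two chunks. -/
theorem Computed.chunks_mul_S_le (hP : P.Computed d) : P.N / P.B * P.S ≤ P.N + 2 * P.S := by
  rcases Nat.le_total (Nat.clog 2 P.S) (P.L - 1) with h | h
  · have hB : P.S ≤ P.B := by
      rw [B, hP.chunk_eq, min_eq_left h]; exact Nat.le_pow_clog (by norm_num) _
    calc P.N / P.B * P.S ≤ P.N / P.B * P.B := Nat.mul_le_mul_left _ hB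
      _ ≤ P.N := Nat.div_mul_le_self _ _
      _ ≤ _ := Nat.le_add_right _ _
  · have hN : P.N = 2 * P.B := by
      rw [N, B, hP.chunk_eq, min_eq_right h, ← pow_succ', Nat.sub_add_cancel]
      have := P.f_lt; omega
    rw [hN, Nat.mul_div_cancel _ P.B_pos]
    omega

/-- A level costs O((N + S) log log n): the butterflies and chunk overhead give the first part, the
squarings that produce its root give the second. -/
theorem Computed.levelCost_le (hP : P.Computed d) :
    P.levelCost ≤ wordCost P.n * (3100 * P.S + 2000 + 12200 * P.N) := by
  have hW := wordCost_pos P.n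
  set W := wordCost P.n with hWdef
  have h1 := hP.near_le_wordCost
  rw [← hWdef] at h1
  have h2 := hP.chunks_mul_S_le
  have h3 : P.N / P.B * P.B ≤ P.N := Nat.div_mul_le_self _ _
  have h4 : P.N / P.B ≤ P.N := Nat.div_le_self _ _
  have e : P.levelCost = P.L * (3000 * W) + 2000 * W + (P.N / P.B * P.B * (10016 * W + 4 * P.near) +
      P.N / P.B * (2016 * W) + 32 * (P.N / P.B * P.S)) := by
    rw [levelCost, far, ← hWdef]; ring
  have i1 : P.L * (3000 * W) ≤ P.S * (3000 * W) := Nat.mul_le_mul_right _ P.L_le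
  have i2 : P.N / P.B * P.B * (10016 * W + 4 * P.near) ≤ P.N * (10056 * W) :=
    Nat.mul_le_mul h3 (by omega)
  have i3 : P.N / P.B * (2016 * W) ≤ P.N * (2016 * W) := Nat.mul_le_mul_right _ h4
  have i4 : 32 * (P.N / P.B * P.S) ≤ 32 * (P.N + 2 * P.S) * W :=
    (Nat.mul_le_mul_left _ h2).trans (Nat.le_mul_of_pos_right _ hW)
  rw [e]
  nlinarith [Nat.zero_le (P.N * W), Nat.zero_le (P.S * W)]

/-- The 2L ≤ 2S levels contribute O((N S + S²) log log n), and both N S and S² are O(n). -/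
theorem Computed.totalCost_le (hP : P.Computed d) (hN : P.N < 4 * d) :
    P.totalCost ≤ 1000000 * (P.n * wordCost P.n) := by
  have hW := wordCost_pos P.n
  have hlev := hP.levelCost_le
  have hSn := hP.S_le
  have hSS := hP.S_mul_S_le
  have hNS := hP.N_mul_S_le hN
  have hS2 := P.two_le_S
  have hNle : P.N ≤ P.N * P.S := Nat.le_mul_of_pos_right _ (by omega)
  have hnpos : 1 ≤ P.n := by omega
  set W := wordCost P.n with hWdef
  have i1 : P.S * (10000 * W) ≤ 10000 * (P.n * W) := by
    have := Nat.mul_le_mul_right W hSn; nlinarith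
  have i2 : 100 * P.S * P.S * (1000 * W) ≤ 400000 * (P.n * W) := by
    have := Nat.mul_le_mul_right W hSS; nlinarith
  have i3 : P.N * (20000 * W + 10 * P.far) ≤ 121000 * (P.n * W) := by
    have h1 := Nat.mul_le_mul_right W (hNle.trans hNS)
    have h2 := Nat.mul_le_mul_right W hNS
    have h3 : P.N * P.S ≤ P.N * P.S * W := Nat.le_mul_of_pos_right _ hW
    have h4 : P.N * (20000 * W + 10 * P.far) = 20000 * (P.N * W) + 80 * (P.N * P.S) := by
      rw [far]; ring
    rw [h4]
    nlinarith
  have i4 : P.far ≤ 8 * (P.n * W) := by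
    have h1 : P.n ≤ P.n * W := Nat.le_mul_of_pos_right _ hW
    unfold far; omega
  have i5 : 20000 * W ≤ 20000 * (P.n * W) := by
    have h1 : W ≤ P.n * W := Nat.le_mul_of_pos_left _ hnpos
    omega
  have i6 : 2 * (P.L * (P.levelCost + 1016 * W)) ≤ 200000 * (P.n * W) := by
    have h1 : P.L * (P.levelCost + 1016 * W) ≤
        P.S * (W * (3100 * P.S + 2000 + 12200 * P.N) + 1016 * W) :=
      Nat.mul_le_mul P.L_le (by omega)
    have h2 : P.S * (W * (3100 * P.S + 2000 + 12200 * P.N) + 1016 * W) =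
        (3100 * (P.S * P.S) + 3016 * P.S + 12200 * (P.N * P.S)) * W := by ring
    have h3 : (3100 * (P.S * P.S) + 3016 * P.S + 12200 * (P.N * P.S)) * W ≤ 100000 * P.n * W :=
      Nat.mul_le_mul_right _ (by omega)
    rw [h2] at h1
    have h4 := h1.trans h3
    rw [mul_assoc] at h4
    omega
  unfold totalCost
  rw [← hWdef]
  omega

end Setting

theorem clog_le_log {k : ℕ} (hk : 2 ≤ k) : (Nat.clog 2 k : ℝ) ≤ 2 * Real.log k + 1 := by
  have h1 := Nat.pow_pred_clog_lt_self (b := 2) (by norm_num) (x := k) (by omega)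
  have h2 : 0 < Nat.clog 2 k := Nat.clog_pos (by norm_num) hk
  rw [Nat.pred_eq_sub_one] at h1
  have h3 : ((2 : ℝ) ^ (Nat.clog 2 k - 1)) ≤ k := by exact_mod_cast h1.le
  have h4 := Real.log_le_log (by positivity) h3
  rw [Real.log_pow, Nat.cast_sub h2] at h4
  have h5 := Real.log_two_gt_d9
  have h6 : (0 : ℝ) ≤ Nat.clog 2 k - 1 := by
    have : (1 : ℝ) ≤ Nat.clog 2 k := by exact_mod_cast h2
    linarith
  push_cast at h4
  nlinarith

/-- For n ≥ 4 the iterated natural logarithm is at least 1/4, so additive constants can be absorbed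
into the factor. For n = 2 it is negative, and no such bound could hold. -/
theorem wordCost_le_log_log {n : ℕ} (hn : 4 ≤ n) :
    (wordCost n : ℝ) ≤ 30 * Real.log (Real.log n) := by
  have hn' : (4 : ℝ) ≤ n := by exact_mod_cast hn
  set ℓ := Real.log n with hℓ
  have hℓ1 : 1.38 ≤ ℓ := by
    have h1 := Real.log_le_log (by norm_num) hn'
    rw [show (4 : ℝ) = 2 ^ 2 by norm_num, Real.log_pow] at h1
    have h2 := Real.log_two_gt_d9
    push_cast at h1
    linarith
  have hloglog : 1 / 4 ≤ Real.log ℓ := by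
    have h1 := Real.one_sub_inv_le_log_of_pos (show 0 < ℓ by linarith)
    have h2 : ℓ⁻¹ ≤ (1.38)⁻¹ := inv_anti₀ (by norm_num) hℓ1
    norm_num at h2
    linarith
  have hk := clog_le_log (k := n) (by omega)
  rw [← hℓ] at hk
  set k := Nat.clog 2 n with hkdef
  have hk2 : 2 ≤ k := by
    by_contra h
    have h1 := Nat.le_pow_clog (b := 2) (by norm_num) n
    have h2 : 2 ^ Nat.clog 2 n ≤ 2 ^ 1 := Nat.pow_le_pow_right (by norm_num) (by omega)
    omega
  have hk' := clog_le_log hk2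
  have h3 : Real.log k ≤ Real.log (3 * ℓ) :=
    Real.log_le_log (by exact_mod_cast (by omega : 0 < k)) (by linarith)
  rw [Real.log_mul (by norm_num) (by linarith)] at h3
  have h4 : Real.log 3 ≤ 2 := by
    have := Real.log_le_sub_one_of_pos (show (0 : ℝ) < 3 by norm_num)
    linarith
  have h5 : (wordCost n : ℝ) ≤ 1 + Nat.clog 2 k := by
    have : wordCost n ≤ 1 + Nat.clog 2 k := by
      have : wordCost n = max 1 (Nat.clog 2 k) := rfl
      omega
    exact_mod_cast this
  linarith

end DepthCostRAM

/-- SS-C can be carried out on the log-RAM with Depth-Cost so that it multiplies integers correctly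
in time `O(n log log n)`, where `n = 2 * m` is the length of the input (two factors of `m` bits). -/
theorem theorem3 :
    ∃ (M : DepthCostRAM.Machine) (c : ℕ) (C : ℝ), ∀ m : ℕ, 1 ≤ m →
      ∃ P : DepthCostRAM.Params, P.Admissible c m ∧
        ∀ x y : ℕ, x < 2 ^ m → y < 2 ^ m →
          ∃ T : ℕ,
            M.CarriesOutSSC P m x y T ∧
            M.HaltsWith (2 * m) (DepthCostRAM.inputOf m x y) T
              (DepthCostRAM.bits (2 * m) (x * y)) ∧
            (2 ≤ m →
              (M.cost (2 * m) (DepthCostRAM.inputOf m x y) T : ℝ) ≤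
                C * (((2 * m : ℕ) : ℝ) * Real.log (Real.log ((2 * m : ℕ) : ℝ)))) := by
  -- The constant 16 comes from the 16S fractional bits; the other is 10⁶ from `totalCost_le` times
  -- 30 from `wordCost_le_log_log`.
  refine ⟨DepthCostRAM.multiplier, 16, 30000000, fun m hm =>
    ⟨(DepthCostRAM.settingOf m hm).params, DepthCostRAM.settingOf_admissible hm,
      fun x y hx hy => ?_⟩⟩
  have hP := DepthCostRAM.settingOf_computed hm
  obtain ⟨T, h1, h2, h3⟩ := DepthCostRAM.Setting.multiplier_spec hP
    (DepthCostRAM.settingOf_L_lt hm) rfl hm hx hy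
  refine ⟨T, h1, h2, fun hm2 => ?_⟩
  have h4 := h3.trans (hP.totalCost_le (DepthCostRAM.settingOf_N_lt hm))
  change _ ≤ 1000000 * (2 * m * DepthCostRAM.wordCost (2 * m)) at h4
  have h5 : (DepthCostRAM.multiplier.cost (2 * m) (DepthCostRAM.inputOf m x y) T : ℝ) ≤
      1000000 * (((2 * m : ℕ) : ℝ) * DepthCostRAM.wordCost (2 * m)) := by exact_mod_cast h4
  have h6 := DepthCostRAM.wordCost_le_log_log (n := 2 * m) (by omega)
  calc _ ≤ _ := h5
    _ ≤ 1000000 * (((2 * m : ℕ) : ℝ) *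
        (30 * Real.log (Real.log ((2 * m : ℕ) : ℝ)))) := by gcongr
    _ = _ := by ring
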